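/- **Setting.** Let $X=(M,j)$ be a complex manifold (Hausdorff, second countable, finite-dimensional) and $L\to X$ a holomorphic line bundle. For a real (or complex) line bundle $P\to N$ over a smooth manifold, $DP$ is the gauge algebroid (its sections are the $\mathbb R$- (or $\mathbb C$-) linear operators $\Delta$ on $\Gamma(P)$ with $\Delta(fp)=\xi(f)p+f\Delta p$ for a (complex) vector field $\xi$, the symbol of $\Delta$), $J^1P$ is the first jet bundle, so that $DP=\mathrm{Hom}(J^1P,P)$, with prolongation $j^1:\Gamma(P)\to\Gamma(J^1P)$, and a (complex) bi-derivation $B$ of $P$ is a skew-symmetric bracket on $\Gamma(P)$ that is a derivation in each entry. It corresponds to a $P$-valued skew form on $J^1P$ with $B(j^1p,j^1q)=B(p,q)$ and to $B^\sharp:J^1P\to DP$, $B^\sharp(\rho)(\sigma)=B(\rho,\sigma)$. For $\Delta\in\Gamma(DP)$, $\mathcal L_\Delta\rho$ is the Lie derivative, $(\mathcal L_\Delta \rho)(\Theta)=\Delta(\rho(\Theta))-\rho([\Delta,\Theta])$. Write $[-,-]^{SJ}$ for the Schouten–Jacobi bracket of multi-derivations; $[J,J]^{SJ}=0$ is the Jacobi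 identity, and $[\Delta,J]^{SJ}(\lambda,\mu)=\Delta J(\lambda,\mu)-J(\Delta\lambda,\mu)-J(\lambda,\Delta\mu)$. * A complex bi-derivation $J$ of $L\to M$ is *of type $(2,0)$* if it vanishes whenever one argument is the jet at $x$ of a section vanishing at $x$ with differential of type $(0,1)$. $(L,J)$ is *holomorphic Jacobi* if $J$ is of type $(2,0)$, $\overline\partial{}^{DL}J=0$ (that is, for each $(0,1)$ vector field $\xi$ the restriction of $[\overline\partial_\xi,J]^{SJ}$ to the jets annihilated by $\overline\partial$ is zero) and $[J,J]^{SJ}=0$. * $J$ *comes from a complex contact structure* if there is a surjective holomorphic $L$-valued form $\theta:T^{1,0}X\to L$ whose Frobenius form $(\xi,\zeta)\mapsto\theta[\xi,\zeta]$ on $\ker\theta$ is everywhere nondegenerate, and $J(\lambda,\mu)=\theta[\xi_\lambda,\xi_\mu]$, where $\xi_\lambda\in\Gamma(T^{1,0}X)$ is the contact vector field ($\theta[\xi_\lambda,\ker\theta]=0$) with $\theta\xi_\lambda=\lambda$. That a real bi-derivation *comes from a contact structure* is defined in the same way, with the whole tangent bundle in place of $T^{1,0}X$. * For a real line bundle,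 a bi-derivation $B$ and an endomorphism $\phi:DP\to DP$ with adjoint $\phi^\dagger:J^1P\to J^1P$: if $B^\sharp\phi^\dagger=\phi B^\sharp$, $B_\phi$ is the bi-derivation $B(\phi^\dagger-,-)$. (A statement $B'=B_\phi$ includes that $B_\phi$ is defined.) $(B,\phi)$ is *Jacobi–Nijenhuis* if $B$ satisfies the Jacobi identity, $B^\sharp\phi^\dagger=\phi B^\sharp$, $\phi^\dagger[\rho,\sigma]_B=[\phi^\dagger\rho,\sigma]_B+[\rho,\phi^\dagger\sigma]_B-[\rho,\sigma]_{B_\phi}$ with $[\rho,\sigma]_B=\mathcal L_{B^\sharp\rho}\sigma-\mathcal L_{B^\sharp\sigma}\rho-j^1B(\rho,\sigma)$, and the Nijenhuis torsion of $\phi$ vanishes. * On $\mathbb DP=DP\oplus J^1P$ put $\langle\!\langle(\Delta,\rho),(\Theta,\sigma)\rangle\!\rangle=\sigma(\Delta)+\rho(\Theta)$ and $[\![(\Delta,\rho),(\Theta,\sigma)]\!]=([\Delta,\Theta],\mathcal L_\Delta\sigma-\mathcal L_\Theta\rho+j^1\rho(\Theta))$. An endomorphism $\mathcal I$ of $\mathbb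 DP$ is a *generalized contact structure* if $\mathcal I^2=-1$, $\mathcal I$ is skew for $\langle\!\langle-,-\rangle\!\rangle$, and $[\![\mathcal I\alpha,\mathcal I\beta]\!]-[\![\alpha,\beta]\!]-\mathcal I[\![\mathcal I\alpha,\beta]\!]-\mathcal I[\![\alpha,\mathcal I\beta]\!]=0$. **Construction.** Let $\widetilde M=L^*\smallsetminus0$ be the slit complex dual with its complex structure $\widetilde j$, $\widehat M=\mathbb{RP}(L^*)$ (a circle bundle over $M$), and $\ell\to\widehat M$ the real dual of the tautological real line bundle. Sections $\lambda$ of $L$ (resp. $s$ of $\ell$) correspond to complex-valued (resp. real-valued) homogeneous functions $\widetilde\lambda$ (resp. $\widetilde s$) on $\widetilde M$, and a section $\Delta$ of $D_{\mathbb R}\ell$ corresponds to the vector field $V_\Delta$ on $\widetilde M$ with $V_\Delta(\widetilde s)=\widetilde{\Delta s}$. Let $\widehat j: D_{\mathbb R}\ell\to D_{\mathbb R}\ell$ be the endomorphism with $V_{\widehat j\Delta}=\widetilde jV_\Delta$. For a complex bi-derivation $J$ of $L\to M$, a *lift* of $J$ is a complex bi-vector $\Pi=\pi'+i\pi$ on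 $\widetilde M$ ($\pi,\pi'$ real) such that $\Pi(d\widetilde\lambda,d\widetilde\mu)=\widetilde{J(\lambda,\mu)}$ for all $\lambda,\mu\in\Gamma(L)$; if $J$ is of type $(2,0)$, the lift is in addition required to be of type $(2,0)$. The bi-derivations $\widehat J,\widehat J'$ of $\ell$ *induced* by $J$ (and by the lift $\Pi$) are those with $\widetilde{\widehat J(s,t)}=\pi(d\widetilde s,d\widetilde t)$ and $\widetilde{\widehat J'(s,t)}=\pi'(d\widetilde s,d\widetilde t)$ for all $s,t\in\Gamma(\ell)$. **Theorem.** The endomorphism $\widehat j$ exists and is unique, and for $J$ of type $(2,0)$ the induced pair $(\widehat J,\widehat J')$ exists and is unique. Let $J$ be any complex bi-derivation of $L\to M$ and $\widehat J,\widehat J'$ bi-derivations of $\ell$ induced by $J$. Then the following conditions are equivalent: 1. $(L,J)$ is a holomorphic Jacobi structure on $X$; 2. $(\widehat J,\widehat j)$ is a Jacobi–Nijenhuis structure on $\ell\to\widehat M$, and $\widehat J'=\widehat J_{\widehat j}$; 3. $\begin{pmatrix}\widehat j&\widehat J^\sharp\\0&-\widehat j^\dagger\end{pmatrix}$ is a generalized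 contact structure on $\ell\to\widehat M$, and $\widehat J'=\widehat J_{\widehat j}$. Additionally, if $J$ is of type $(2,0)$, then $\widehat J$ comes from a contact structure if and only if $J$ comes from a complex contact structure; in this case $\widehat J'$ comes from a contact structure as well. -/

import Mathlib

open scoped Manifold ContDiff Bundle LinearAlgebra.Projectivization

noncomputable section

namespace HJ

/-! ### Derivations, jets and bi-derivations of a module of sections -/

section Algebra

variable (K A P : Type*) [Field K] [CommRing A] [Algebra K A] [AddCommGroup P] [Module K P]
  [Module A P] [IsScalarTower K A P]

variable {K A P} in
/-- `ξ` is the symbol of the operator `Δ`. -/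
def IsSymbol (Δ : P →ₗ[K] P) (ξ : Derivation K A A) : Prop :=
  ∀ (a : A) (p : P), Δ (a • p) = ξ a • p + a • Δ p

/-- Sections of the gauge algebroid: the derivations of the `A`-module `P`. -/
def Gauge : Submodule A (P →ₗ[K] P) where
  carrier := {Δ | ∃ ξ : Derivation K A A, IsSymbol Δ ξ}
  zero_mem' := ⟨0, fun a p => by simp⟩
  add_mem' := by
    rintro Δ Θ ⟨ξ, hξ⟩ ⟨ζ, hζ⟩
    refine ⟨ξ + ζ, fun a p => ?_⟩
    simp only [LinearMap.add_apply, hξ a p, hζ a p, Derivation.add_apply, add_smul, smul_add]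
    abel
  smul_mem' := by
    rintro b Δ ⟨ξ, hξ⟩
    refine ⟨b • ξ, fun a p => ?_⟩
    simp only [LinearMap.smul_apply, hξ a p, Derivation.smul_apply, smul_add, smul_eq_mul, mul_smul]
    rw [smul_comm b a]

variable {K A P}

/-- The commutator of two derivations. -/
def gcomm (Δ Θ : Gauge K A P) : Gauge K A P :=
  ⟨Δ.1 ∘ₗ Θ.1 - Θ.1 ∘ₗ Δ.1, by
    obtain ⟨Δ, ξ, hξ⟩ := Δ
    obtain ⟨Θ, ζ, hζ⟩ := Θ
    refine ⟨⁅ξ, ζ⁆, fun a p => ?_⟩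
    have h1 := hξ; have h2 := hζ
    simp only [IsSymbol] at h1 h2
    simp only [LinearMap.sub_apply, LinearMap.comp_apply, h1, h2, map_add,
      Derivation.commutator_apply, sub_smul, smul_sub]
    abel⟩

variable (K A P) in
/-- A bi-derivation: a skew-symmetric `K`-bilinear bracket on `P` which is a derivation
in each entry. -/
structure BiDer where
  /-- The derivation `{p, -}`. -/
  br : P →ₗ[K] Gauge K A P
  skew : ∀ p, (br p).1 p = 0

/-- The bracket `{p, q}`. -/
def BiDer.bracket (B : BiDer K A P) (p q : P) : P := (B.br p).1 q

theorem BiDer.bracket_skew (B : BiDer K A P) (p q : P) : B.bracket p q = - B.bracket q p := by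
  have h := B.skew (p + q)
  have h1 := B.skew p
  have h2 := B.skew q
  simp only [map_add, Submodule.coe_add, LinearMap.add_apply, h1, h2] at h
  simp only [BiDer.bracket]
  rw [eq_neg_iff_add_eq_zero]
  simpa [add_comm] using h

/-- The Jacobi identity. -/
def BiDer.IsJacobi (B : BiDer K A P) : Prop :=
  ∀ p q r, B.bracket p (B.bracket q r) + B.bracket q (B.bracket r p)
    + B.bracket r (B.bracket p q) = 0

variable (K A P) in
/-- Sections of the first jet bundle of a line bundle, as the dual (with values in the
line bundle) of the gauge algebroid. The duality pairing is evaluation. -/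
abbrev Jet := Gauge K A P →ₗ[A] P

/-- The first jet prolongation of a section. -/
def j1 : P →ₗ[K] Jet K A P where
  toFun p := { toFun := fun Δ => Δ.1 p, map_add' := fun _ _ => rfl, map_smul' := fun _ _ => rfl }
  map_add' p q := by ext Δ; simp
  map_smul' c p := by ext Δ; simp

/-- The Lie derivative of a section of the jet bundle along a derivation. -/
def lieDer (Δ : Gauge K A P) (ρ : Jet K A P) : Jet K A P where
  toFun := fun Θ => Δ.1 (ρ Θ) - ρ (gcomm Δ Θ)
  map_add' Θ Θ' := by
    have : gcomm Δ (Θ + Θ') = gcomm Δ Θ + gcomm Δ Θ' := by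
      ext p; simp [gcomm]; abel
    rw [this]; simp only [map_add]; abel
  map_smul' a Θ := by
    obtain ⟨Δ, ξ, hξ⟩ := Δ
    have : gcomm ⟨Δ, ξ, hξ⟩ (a • Θ) = ξ a • Θ + a • gcomm ⟨Δ, ξ, hξ⟩ Θ := by
      ext p
      have := hξ a (Θ.1 p)
      simp [gcomm, this, smul_sub]; abel
    rw [this]
    have h2 := hξ a (ρ Θ)
    simp only [map_smul, map_add, h2, RingHom.id_apply, smul_sub]
    abel

theorem lieDer_j1 (Δ : Gauge K A P) (p : P) : lieDer Δ (j1 p) = j1 (Δ.1 p) := by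
  ext Θ
  simp [lieDer, j1, gcomm]

theorem lieDer_smul (Δ : Gauge K A P) (ξ : Derivation K A A) (h : IsSymbol Δ.1 ξ) (a : A)
    (ρ : Jet K A P) : lieDer Δ (a • ρ) = ξ a • ρ + a • lieDer Δ ρ := by
  ext Θ
  have := h a (ρ Θ)
  simp [lieDer, this, smul_sub]; abel

/-- The endomorphisms of the module `P` are the multiplications by elements of `A`, as is the case
for the sections of a line bundle. -/
class IsLineModule (A P : Type*) [CommRing A] [AddCommGroup P] [Module A P] : Prop where
  faithful : ∀ a : A, (∀ p : P, a • p = 0) → a = 0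
  endo : ∀ T : P →ₗ[A] P, ∃ a : A, ∀ p, T p = a • p

variable [IsLineModule A P]

theorem sharp_mem (B : BiDer K A P) (ρ : Jet K A P) :
    (-(ρ.restrictScalars K ∘ₗ B.br) : P →ₗ[K] P) ∈ Gauge K A P := by
  classical
  choose R hR using fun p => (B.br p).2
  simp only [IsSymbol] at hR
  have hsk : ∀ p q, (B.br p).1 q = - (B.br q).1 p := B.bracket_skew
  -- the derivation `q ↦ R q a • p`
  have hD : ∀ (a : A) (p : P), ∃ D : Gauge K A P, ∀ q, D.1 q = R q a • p := by
    intro a p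
    have hval : ∀ q, R q a • p = (B.br q).1 (a • p) - a • (B.br q).1 p := by
      intro q; rw [hR]; abel
    refine ⟨⟨{ toFun := fun q => R q a • p, map_add' := ?_, map_smul' := ?_ },
      a • R p - R (a • p), ?_⟩, fun q => rfl⟩
    · intro q q'
      rw [hval, hval, hval]; simp only [map_add, Submodule.coe_add, LinearMap.add_apply, smul_add]
      abel
    · intro c q
      rw [hval, hval]; simp [smul_sub]
      rw [smul_comm a c]
    · intro b q
      change R (b • q) a • p = _ + b • (R q a • p)
      have e1 := hval (b • q)
      rw [hsk (b • q) (a • p), hsk (b • q) p, hR (a • p) b q, hR p b q,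
        hsk (a • p) q, hsk p q, hR q a p] at e1
      rw [e1]
      simp only [Derivation.sub_apply, Derivation.smul_apply, sub_smul, smul_add, smul_neg,
        smul_eq_mul, mul_smul, neg_add, neg_neg]
      rw [smul_comm b a]
      abel
  choose D hDv using hD
  have hDlin : ∀ (a b : A) (p : P), D a (b • p) = b • D a p := by
    intro a b p; ext q; simp [hDv, smul_comm b]
  have hDadd : ∀ a p p', D a (p + p') = D a p + D a p' := by
    intro a p p'; ext q; simp [hDv]
  have hT : ∀ a, ∃ c : A, ∀ p : P, ρ (D a p) = c • p := fun a =>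
    IsLineModule.endo (A := A) (P := P)
                      { toFun := fun p => ρ (D a p)
                        map_add' := fun p p' => by rw [hDadd, map_add]
                        map_smul' := fun b p => by rw [hDlin, map_smul]; rfl }
  choose c hc using hT
  have inj : ∀ a b : A, (∀ p : P, a • p = b • p) → a = b := by
    intro a b h
    refine sub_eq_zero.1 (IsLineModule.faithful (P := P) _ fun p => ?_)
    rw [sub_smul, h, sub_self]
  let cl : A →ₗ[K] A :=
    { toFun := c
      map_add' := fun a b => inj _ _ fun p => by
        rw [add_smul, ← hc, ← hc, ← hc, ← map_add]; congr 1; ext q; simp [hDv, add_smul]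
      map_smul' := fun k a => inj _ _ fun p => by
        rw [RingHom.id_apply, smul_assoc, ← hc, ← hc, ← algebraMap_smul A k (ρ _), ← map_smul]
        congr 1; ext q; simp [hDv] }
  let ξ : Derivation K A A := Derivation.mk' cl fun a b => inj _ _ fun p => by
    change c (a * b) • p = (a • c b + b • c a) • p
    rw [add_smul, smul_assoc, smul_assoc, ← hc, ← hc, ← hc, ← map_smul, ← map_smul, ← map_add]
    congr 1; ext q; simp [hDv, add_smul, mul_smul]
  refine ⟨ξ, fun a p => ?_⟩
  change -(ρ (B.br (a • p))) = c a • p + a • -(ρ (B.br p))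
  have : B.br (a • p) = a • B.br p - D a p := by
    ext q
    have h1 := hsk (a • p) q
    rw [hR q a p] at h1
    simp [h1, hDv, hsk p q]; abel
  rw [this, map_sub, map_smul, hc, smul_neg]; abel

/-- The morphism `J^♯` from jets to derivations associated with a bi-derivation. -/
def BiDer.sharp (B : BiDer K A P) : Jet K A P →ₗ[A] Gauge K A P where
  toFun ρ := ⟨-(ρ.restrictScalars K ∘ₗ B.br), sharp_mem B ρ⟩
  map_add' ρ σ := by ext p; simp; abel
  map_smul' a ρ := by ext p; simp

theorem BiDer.sharp_j1 (B : BiDer K A P) (p : P) : B.sharp (j1 p) = B.br p := by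
  ext q
  have := B.bracket_skew p q
  simp only [BiDer.bracket] at this
  simp [BiDer.sharp, j1, this]

/-- The skew-symmetric form `J` on jets associated with a bi-derivation. -/
def BiDer.form (B : BiDer K A P) (ρ σ : Jet K A P) : P := σ (B.sharp ρ)

theorem BiDer.form_j1 (B : BiDer K A P) (p q : P) : B.form (j1 p) (j1 q) = B.bracket p q := by
  rw [BiDer.form, B.sharp_j1]; rfl

/-- The bracket `[-,-]_J` on sections of the jet bundle. -/
def BiDer.jetBracket (B : BiDer K A P) (ρ σ : Jet K A P) : Jet K A P :=
  lieDer (B.sharp ρ) σ - lieDer (B.sharp σ) ρ - j1 (B.form ρ σ)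

/-- The adjoint `φ^†` of an endomorphism `φ` of the gauge algebroid. -/
def adj (φ : Gauge K A P →ₗ[A] Gauge K A P) : Jet K A P →ₗ[A] Jet K A P where
  toFun ρ := ρ ∘ₗ φ
  map_add' _ _ := rfl
  map_smul' _ _ := rfl

end Algebra

/-! ### Jacobi Nijenhuis and generalized contact structures -/

section Real

variable {A P : Type*} [CommRing A] [Algebra ℝ A] [AddCommGroup P] [Module ℝ P]
  [Module A P] [IsScalarTower ℝ A P] [IsLineModule A P]

/-- The condition `J^♯ ∘ φ^† = φ ∘ J^♯`. -/
def SharpComm (B : BiDer ℝ A P) (φ : Gauge ℝ A P →ₗ[A] Gauge ℝ A P) : Prop :=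
  B.sharp ∘ₗ adj φ = φ ∘ₗ B.sharp

/-- The bi-derivation `{-,-}_φ`, corresponding to the form `J(φ^† -, -)`. -/
def BiDer.deform (B : BiDer ℝ A P) (φ : Gauge ℝ A P →ₗ[A] Gauge ℝ A P) (h : SharpComm B φ) :
    BiDer ℝ A P where
  br := (B.sharp ∘ₗ adj φ).restrictScalars ℝ ∘ₗ j1
  skew p := by
    have h1 : (B.sharp (adj φ (j1 p))).1 p = -(φ (B.br p)).1 p := rfl
    have h2 : B.sharp (adj φ (j1 p)) = φ (B.br p) := by
      have := LinearMap.congr_fun h (j1 p)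
      simpa [B.sharp_j1] using this
    have h3 : (B.sharp (adj φ (j1 p))).1 p = -(B.sharp (adj φ (j1 p))).1 p := by
      conv_rhs => rw [h2]
      exact h1
    have h4 : (2 : ℝ) • (B.sharp (adj φ (j1 p))).1 p = 0 := by
      rw [two_smul]; exact eq_neg_iff_add_eq_zero.1 h3
    exact (smul_eq_zero.1 h4).resolve_left two_ne_zero

theorem BiDer.deform_form (B : BiDer ℝ A P) (φ : Gauge ℝ A P →ₗ[A] Gauge ℝ A P)
    (h : SharpComm B φ) (ρ σ : Jet ℝ A P) : (B.deform φ h).form ρ σ = B.form (adj φ ρ) σ := by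
  have : (B.deform φ h).sharp ρ = B.sharp (adj φ ρ) := by
    ext p
    have h2 : B.sharp (adj φ (j1 p)) = φ (B.br p) := by
      have := LinearMap.congr_fun h (j1 p)
      simpa [B.sharp_j1] using this
    change -(ρ (B.sharp (adj φ (j1 p)))) = -(ρ (φ (B.br p)))
    rw [h2]
  rw [BiDer.form, BiDer.form, this]

/-- `φ` is compatible with the bi-derivation `B`. -/
def Compatible (B : BiDer ℝ A P) (φ : Gauge ℝ A P →ₗ[A] Gauge ℝ A P) : Prop :=
  ∃ h : SharpComm B φ, ∀ ρ σ, adj φ (B.jetBracket ρ σ) =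
    B.jetBracket (adj φ ρ) σ + B.jetBracket ρ (adj φ σ) - (B.deform φ h).jetBracket ρ σ

/-- The Nijenhuis torsion of an endomorphism of the gauge algebroid. -/
def torsion (φ : Gauge ℝ A P →ₗ[A] Gauge ℝ A P) (Δ Θ : Gauge ℝ A P) : Gauge ℝ A P :=
  gcomm (φ Δ) (φ Θ) + φ (φ (gcomm Δ Θ)) - φ (gcomm (φ Δ) Θ) - φ (gcomm Δ (φ Θ))

/-- Jacobi Nijenhuis structures. -/
structure IsJacobiNijenhuis (B : BiDer ℝ A P) (φ : Gauge ℝ A P →ₗ[A] Gauge ℝ A P) : Prop where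
  jacobi : B.IsJacobi
  compatible : Compatible B φ
  torsion_eq_zero : ∀ Δ Θ, torsion φ Δ Θ = 0

variable (A P) in
/-- Sections of the omni-Lie algebroid. -/
abbrev Omni := Gauge ℝ A P × Jet ℝ A P

/-- The `P`-valued symmetric bilinear form on the omni-Lie algebroid. -/
def omniPairing (α β : Omni A P) : P := β.2 α.1 + α.2 β.1

/-- The Dorfman-Jacobi bracket. -/
def dorfman (α β : Omni A P) : Omni A P :=
  (gcomm α.1 β.1, lieDer α.1 β.2 - lieDer β.1 α.2 + j1 (α.2 β.1))

/-- Generalized contact structures. -/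
structure IsGeneralizedContact (I : Omni A P →ₗ[A] Omni A P) : Prop where
  almost_complex : ∀ α, I (I α) = -α
  skew : ∀ α β, omniPairing (I α) β + omniPairing α (I β) = 0
  integrable : ∀ α β, dorfman (I α) (I β) - dorfman α β - I (dorfman (I α) β)
    - I (dorfman α (I β)) = 0

/-- The endomorphism of the omni-Lie algebroid with block matrix `(φ, J^♯; 0, -φ^†)`. -/
def blockEnd (φ : Gauge ℝ A P →ₗ[A] Gauge ℝ A P) (B : BiDer ℝ A P) : Omni A P →ₗ[A] Omni A P where
  toFun α := (φ α.1 + B.sharp α.2, -adj φ α.2)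
  map_add' α β := by ext1 <;> simp <;> abel
  map_smul' a α := by ext1 <;> simp

end Real

section Geometry

open Bundle TopologicalSpace

section Defs

variable (E : Type*) [NormedAddCommGroup E] [NormedSpace ℂ E]
  {X : Type*} [TopologicalSpace X] [ChartedSpace E X]
  (L : X → Type*) [∀ x, AddCommGroup (L x)] [∀ x, Module ℂ (L x)] [∀ x, TopologicalSpace (L x)]
  [TopologicalSpace (TotalSpace ℂ L)] [FiberBundle ℂ L] [VectorBundle ℂ ℂ L]

/-- The fibers of the complex dual bundle of `L`. -/
abbrev CDual (x : X) : Type _ := L x →L[ℂ] Trivial X ℂ x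

/-- The total space of the complex dual bundle of `L`. -/
abbrev DualTot : Type _ := TotalSpace (ℂ →L[ℂ] ℂ) (CDual L)

theorem isOpen_slit : IsOpen {v : DualTot L | v.2 ≠ 0} := by
  rw [isOpen_iff_mem_nhds]
  intro v hv
  let e := trivializationAt (ℂ →L[ℂ] ℂ) (CDual L) v.1
  have he : v ∈ e.source := e.mem_source.2 (mem_baseSet_trivializationAt _ _ _)
  have key : ∀ u ∈ e.source, (e u).2 ≠ 0 ↔ u.2 ≠ 0 := by
    intro u hu
    have hu' : u.1 ∈ e.baseSet := e.mem_source.1 hu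
    rw [show (e u).2 = e.continuousLinearEquivAt ℂ u.1 hu' u.2 from rfl]
    exact (e.continuousLinearEquivAt ℂ u.1 hu').map_ne_zero_iff
  have hcont : ContinuousAt (fun u => (e u).2) v :=
    continuous_snd.continuousAt.comp (e.continuousAt he)
  filter_upwards [e.open_source.mem_nhds he, hcont.eventually_ne ((key v he).2 hv)] with u h1 h2
  exact (key u h1).1 h2

/-- The slit complex dual `L* ∖ 0`, an open submanifold of the total space of the dual bundle. -/
def slitDual : Opens (DualTot L) := ⟨{v | v.2 ≠ 0}, isOpen_slit L⟩

/-- The real projective bundle `ℝℙ(L*)`. -/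
def Hat : Type _ := Σ x : X, ℙ ℝ (CDual L x)

/-- The fibers of the real dual `ℓ` of the real tautological line bundle over `ℝℙ(L*)`. -/
abbrev TautDual (p : Hat L) : Type _ := Module.Dual ℝ p.2.submodule

variable {L} in
/-- The projection `L* ∖ 0 → ℝℙ(L*)`. -/
def toHat (v : slitDual L) : Hat L := ⟨v.1.1, Projectivization.mk ℝ v.1.2 v.2⟩

/-- The model with corners of the real manifold underlying the total space of `L*`. -/
abbrev tildeModel : ModelWithCorners ℝ (E × (ℂ →L[ℂ] ℂ)) (ModelProd E (ℂ →L[ℂ] ℂ)) :=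
  (𝓘(ℝ, E)).prod 𝓘(ℝ, ℂ →L[ℂ] ℂ)

/-- The algebra of smooth real functions on `ℝℙ(L*)`: those with smooth pull-back along the
surjective submersion `L* ∖ 0 → ℝℙ(L*)`. -/
def hatFun : Subalgebra ℝ (Hat L → ℝ) where
  carrier := {f | ContMDiff (tildeModel E) 𝓘(ℝ, ℝ) ∞ (fun v : slitDual L => f (toHat v))}
  add_mem' hf hg := ContMDiff.add hf hg
  mul_mem' hf hg := ContMDiff.mul hf hg
  algebraMap_mem' _ := contMDiff_const

/-- Smooth real functions on `ℝℙ(L*)`. -/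
def HatFun : Type _ := hatFun E L

instance : CommRing (HatFun E L) := inferInstanceAs (CommRing (hatFun E L))
instance : Algebra ℝ (HatFun E L) := inferInstanceAs (Algebra ℝ (hatFun E L))

variable {L} in
/-- The homogeneous function on `L* ∖ 0` corresponding to a section of `ℓ`. -/
def tildeFun (s : ∀ p : Hat L, TautDual L p) (v : slitDual L) : ℝ :=
  s (toHat v) ⟨v.1.2, Submodule.mem_span_singleton_self (R := ℝ) v.1.2⟩

/-- The space of smooth sections of `ℓ`: those with smooth homogeneous function. -/
def hatSec : Submodule ℝ (∀ p : Hat L, TautDual L p) where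
  carrier := {s | ContMDiff (tildeModel E) 𝓘(ℝ, ℝ) ∞ (tildeFun s)}
  zero_mem' :=
    (contMDiff_const : ContMDiff (tildeModel E) 𝓘(ℝ, ℝ) ∞ fun _ : slitDual L => (0 : ℝ))
  add_mem' {s t} hs ht := by
    have hs' : ContMDiff (tildeModel E) 𝓘(ℝ, ℝ) ∞ (tildeFun s) := hs
    have ht' : ContMDiff (tildeModel E) 𝓘(ℝ, ℝ) ∞ (tildeFun t) := ht
    exact hs'.add ht'
  smul_mem' c s hs := by
    have hs' : ContMDiff (tildeModel E) 𝓘(ℝ, ℝ) ∞ (tildeFun s) := hs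
    exact (contMDiff_const (c := c)).mul hs'

/-- Smooth sections of `ℓ`. -/
def HatSec : Type _ := hatSec E L

instance : AddCommGroup (HatSec E L) := inferInstanceAs (AddCommGroup (hatSec E L))
instance : Module ℝ (HatSec E L) := inferInstanceAs (Module ℝ (hatSec E L))

instance : SMul (HatFun E L) (HatSec E L) where
  smul f s := ⟨fun p => f.1 p • s.1 p, by
    have h1 : ContMDiff (tildeModel E) 𝓘(ℝ, ℝ) ∞ (fun v : slitDual L => f.1 (toHat v)) := f.2
    have h2 : ContMDiff (tildeModel E) 𝓘(ℝ, ℝ) ∞ (tildeFun s.1) := s.2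
    exact h1.mul h2⟩

variable {E L} in
theorem HatSec.ext {s t : HatSec E L} (h : ∀ p, s.1 p = t.1 p) : s = t := Subtype.ext (funext h)

instance : Module (HatFun E L) (HatSec E L) where
  one_smul s := HatSec.ext fun p => one_smul ℝ (s.1 p)
  mul_smul f g s := HatSec.ext fun p => mul_smul (f.1 p) (g.1 p) (s.1 p)
  smul_zero f := HatSec.ext fun p => smul_zero (f.1 p)
  smul_add f s t := HatSec.ext fun p => smul_add (f.1 p) (s.1 p) (t.1 p)
  add_smul f g s := HatSec.ext fun p => add_smul (f.1 p) (g.1 p) (s.1 p)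
  zero_smul s := HatSec.ext fun p => zero_smul ℝ (s.1 p)

instance : IsScalarTower ℝ (HatFun E L) (HatSec E L) where
  smul_assoc c f s := HatSec.ext fun p => smul_assoc c (f.1 p) (s.1 p)

variable {E L} in
/-- The homogeneous function on `L* ∖ 0` corresponding to a smooth section of `ℓ`. -/
def tilde (s : HatSec E L) : slitDual L → ℝ := tildeFun s.1

theorem contMDiffAt_mul_complex {f g : X → ℂ} {x : X}
    (hf : ContMDiffAt 𝓘(ℝ, E) 𝓘(ℝ, ℂ) ∞ f x) (hg : ContMDiffAt 𝓘(ℝ, E) 𝓘(ℝ, ℂ) ∞ g x) :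
    ContMDiffAt 𝓘(ℝ, E) 𝓘(ℝ, ℂ) ∞ (fun x => f x * g x) x :=
  (contDiff_mul (𝕜 := ℝ) (𝔸 := ℂ)).contDiffAt.comp_contMDiffAt (hf.prodMk_space hg)

variable (X) in
/-- The algebra of smooth complex functions on the real manifold underlying `X`. -/
def smoothFun : Subalgebra ℂ (X → ℂ) where
  carrier := {f | ContMDiff 𝓘(ℝ, E) 𝓘(ℝ, ℂ) ∞ f}
  add_mem' hf hg := ContMDiff.add hf hg
  mul_mem' hf hg := fun x => contMDiffAt_mul_complex E (hf x) (hg x)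
  algebraMap_mem' _ := contMDiff_const

variable (X) in
/-- Smooth complex functions on the real manifold underlying `X`. -/
def CFun : Type _ := smoothFun E X

instance : CommRing (CFun E X) := inferInstanceAs (CommRing (smoothFun E X))
instance : Algebra ℂ (CFun E X) := inferInstanceAs (Algebra ℂ (smoothFun E X))

variable {L} in
/-- The local representation of a section in the preferred trivialization at `x₀`. -/
def localRep (s : ∀ x, L x) (x₀ x : X) : ℂ := (trivializationAt ℂ L x₀ ⟨x, s x⟩).2

variable {L} in
theorem localRep_lin (s t : ∀ x, L x) (f g : X → ℂ) (x₀ : X) :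
    localRep (fun x => f x • s x + g x • t x) x₀ =ᶠ[nhds x₀]
      fun x => f x * localRep s x₀ x + g x * localRep t x₀ x := by
  filter_upwards [(trivializationAt ℂ L x₀).open_baseSet.mem_nhds
    (mem_baseSet_trivializationAt ℂ L x₀)] with x hx
  let l := (trivializationAt ℂ L x₀).continuousLinearEquivAt ℂ x hx
  change l (f x • s x + g x • t x) = f x * l (s x) + g x * l (t x)
  simp

/-- Smooth sections. -/
def IsSmoothSec (s : ∀ x, L x) : Prop :=
  ContMDiff 𝓘(ℝ, E) ((𝓘(ℝ, E)).prod 𝓘(ℝ, ℂ)) ∞ (fun x => TotalSpace.mk' ℂ x (s x))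

variable {L} in
theorem isSmoothSec_lin {s t : ∀ x, L x} (hs : IsSmoothSec E L s) (ht : IsSmoothSec E L t)
    {f g : X → ℂ} (hf : ContMDiff 𝓘(ℝ, E) 𝓘(ℝ, ℂ) ∞ f) (hg : ContMDiff 𝓘(ℝ, E) 𝓘(ℝ, ℂ) ∞ g) :
    IsSmoothSec E L (fun x => f x • s x + g x • t x) := by
  intro x₀
  rw [contMDiffAt_section]
  have h1 := (contMDiffAt_section _).1 (hs x₀)
  have h2 := (contMDiffAt_section _).1 (ht x₀)
  have h3 := (contMDiffAt_mul_complex E (hf x₀) h1).add (contMDiffAt_mul_complex E (hg x₀) h2)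
  exact h3.congr_of_eventuallyEq (localRep_lin s t f g x₀)

/-- The space of smooth sections of `L`. -/
def smoothSec : Submodule ℂ (∀ x, L x) where
  carrier := {s | IsSmoothSec E L s}
  zero_mem' := by
    intro x₀
    rw [contMDiffAt_section]
    refine (contMDiffAt_const (c := (0 : ℂ))).congr_of_eventuallyEq ?_
    filter_upwards [localRep_lin (L := L) 0 0 0 0 x₀] with x hx
    simpa [localRep] using hx
  add_mem' {s t} hs ht := by
    have h := isSmoothSec_lin E hs ht (contMDiff_const (c := (1 : ℂ))) (contMDiff_const (c := (1 : ℂ)))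
    simp only [one_smul] at h
    exact h
  smul_mem' c s hs := by
    have h := isSmoothSec_lin E hs hs (contMDiff_const (c := c)) (contMDiff_const (c := (0 : ℂ)))
    simp only [zero_smul, add_zero] at h
    exact h

/-- Smooth sections of the complex line bundle `L`. -/
def CSec : Type _ := smoothSec E L

instance : AddCommGroup (CSec E L) := inferInstanceAs (AddCommGroup (smoothSec E L))
instance : Module ℂ (CSec E L) := inferInstanceAs (Module ℂ (smoothSec E L))

instance : SMul (CFun E X) (CSec E L) where
  smul f s := ⟨fun x => f.1 x • s.1 x, by
    have h := isSmoothSec_lin E s.2 s.2 f.2 (contMDiff_const (c := (0 : ℂ)))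
    simp only [zero_smul, add_zero] at h
    exact h⟩

variable {E L} in
theorem CSec.ext {s t : CSec E L} (h : ∀ x, s.1 x = t.1 x) : s = t := Subtype.ext (funext h)

instance : Module (CFun E X) (CSec E L) where
  one_smul s := CSec.ext fun x => one_smul ℂ (s.1 x)
  mul_smul f g s := CSec.ext fun x => mul_smul (f.1 x) (g.1 x) (s.1 x)
  smul_zero f := CSec.ext fun x => smul_zero (f.1 x)
  smul_add f s t := CSec.ext fun x => smul_add (f.1 x) (s.1 x) (t.1 x)
  add_smul f g s := CSec.ext fun x => add_smul (f.1 x) (g.1 x) (s.1 x)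
  zero_smul s := CSec.ext fun x => zero_smul ℂ (s.1 x)

instance : IsScalarTower ℂ (CFun E X) (CSec E L) where
  smul_assoc c f s := CSec.ext fun x => smul_assoc c (f.1 x) (s.1 x)

end Defs
end Geometry

section Line

open Bundle TopologicalSpace

variable {E : Type*} [NormedAddCommGroup E] [NormedSpace ℂ E]

theorem isManifold_real {X : Type*} [TopologicalSpace X] [ChartedSpace E X]
    [IsManifold 𝓘(ℂ, E) ω X] : IsManifold 𝓘(ℝ, E) ∞ X := by
  refine isManifold_of_contDiffOn _ _ _ fun e e' he he' => ?_
  have h := HasGroupoid.compatible (G := contDiffGroupoid ω 𝓘(ℂ, E)) he he'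
  have h1 : ContDiffOn ℂ ω (𝓘(ℂ, E) ∘ (e.symm ≫ₕ e') ∘ 𝓘(ℂ, E).symm)
      (𝓘(ℂ, E).symm ⁻¹' (e.symm ≫ₕ e').source ∩ Set.range 𝓘(ℂ, E)) :=
    (mem_groupoid_of_pregroupoid.1 h).1
  exact (h1.restrict_scalars ℝ).of_le le_top

theorem contMDiffAt_real {F G : Type*} [NormedAddCommGroup F] [NormedSpace ℂ F]
    [NormedAddCommGroup G] [NormedSpace ℂ G]
    {M : Type*} [TopologicalSpace M] [ChartedSpace (ModelProd E F) M] {f : M → G} {x : M}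
    (h : ContMDiffAt ((𝓘(ℂ, E)).prod 𝓘(ℂ, F)) 𝓘(ℂ, G) ω f x) :
    ContMDiffAt ((𝓘(ℝ, E)).prod 𝓘(ℝ, F)) 𝓘(ℝ, G) ∞ f x := by
  rw [contMDiffAt_iff] at h ⊢
  exact ⟨h.1, (h.2.restrict_scalars ℝ).of_le le_top⟩

variable {X : Type*} [TopologicalSpace X] [ChartedSpace E X]
  {L : X → Type*} [∀ x, AddCommGroup (L x)] [∀ x, Module ℂ (L x)] [∀ x, TopologicalSpace (L x)]
  [TopologicalSpace (TotalSpace ℂ L)] [FiberBundle ℂ L] [VectorBundle ℂ ℂ L]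

theorem tilde_inj {s t : HatSec E L} (h : ∀ v, tilde s v = tilde t v) : s = t := by
  refine HatSec.ext fun p => ?_
  obtain ⟨x, q⟩ := p
  induction q with
  | h φ hφ =>
    refine LinearMap.ext fun ⟨u, hu⟩ => ?_
    obtain ⟨c, rfl⟩ := Submodule.mem_span_singleton.1 hu
    have h1 : s.1 ⟨x, Projectivization.mk ℝ φ hφ⟩ ⟨φ, Submodule.mem_span_singleton_self φ⟩ =
        t.1 ⟨x, Projectivization.mk ℝ φ hφ⟩ ⟨φ, Submodule.mem_span_singleton_self φ⟩ :=
      h ⟨⟨x, φ⟩, hφ⟩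
    have h2 : (⟨c • φ, hu⟩ : (Projectivization.mk ℝ φ hφ).submodule) =
        c • ⟨φ, Submodule.mem_span_singleton_self φ⟩ := rfl
    rw [h2, map_smul, map_smul, h1]

/-- The representative of a point of `ℝℙ(L*)`. -/
def hatRep (p : Hat L) : slitDual L := ⟨⟨p.1, p.2.rep⟩, p.2.rep_nonzero⟩

theorem toHat_hatRep (p : Hat L) : toHat (hatRep p) = p := by
  obtain ⟨x, q⟩ := p
  exact Sigma.ext rfl (heq_of_eq (Projectivization.mk_rep q))

theorem hatRep_toHat (v : slitDual L) : ∃ c : ℝ, c ≠ 0 ∧ (hatRep (toHat v)).1.1 = v.1.1 ∧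
    ∃ h : c • v.1.2 ≠ 0, hatRep (toHat v) = ⟨⟨v.1.1, c • v.1.2⟩, h⟩ := by
  obtain ⟨a, ha⟩ := Projectivization.exists_smul_eq_mk_rep ℝ v.1.2 v.2
  have h : (a : ℝ) • v.1.2 ≠ 0 := by
    intro h0
    exact Projectivization.rep_nonzero (Projectivization.mk ℝ v.1.2 v.2) (ha ▸ h0)
  refine ⟨a, a.ne_zero, rfl, h, ?_⟩
  refine Subtype.ext ?_
  change (⟨v.1.1, (Projectivization.mk ℝ v.1.2 v.2).rep⟩ : DualTot L) = ⟨v.1.1, (a : ℝ) • v.1.2⟩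
  rw [← ha]; rfl

/-- A homogeneous function of degree zero descends. -/
theorem exists_hatFun (F : slitDual L → ℝ)
    (hF : ContMDiff (tildeModel E) 𝓘(ℝ, ℝ) ∞ F)
    (hom : ∀ (v : slitDual L) (c : ℝ) (h : c • v.1.2 ≠ 0), F ⟨⟨v.1.1, c • v.1.2⟩, h⟩ = F v) :
    ∃ f : HatFun E L, ∀ v, f.1 (toHat v) = F v := by
  have key : ∀ v, F (hatRep (toHat v)) = F v := by
    intro v
    obtain ⟨c, -, -, h, e⟩ := hatRep_toHat v
    rw [e, hom]
  exact ⟨⟨fun p => F (hatRep p), by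
    change ContMDiff (tildeModel E) 𝓘(ℝ, ℝ) ∞ (fun v : slitDual L => F (hatRep (toHat v)))
    simp only [key]; exact hF⟩, key⟩

/-- A homogeneous function of degree one is a section of `ℓ`. -/
theorem exists_hatSec (F : slitDual L → ℝ)
    (hF : ContMDiff (tildeModel E) 𝓘(ℝ, ℝ) ∞ F)
    (hom : ∀ (v : slitDual L) (c : ℝ) (h : c • v.1.2 ≠ 0), F ⟨⟨v.1.1, c • v.1.2⟩, h⟩ = c * F v) :
    ∃ s : HatSec E L, ∀ v, tilde s v = F v := by
  have ex : ∀ p : Hat L, ∃ l : TautDual L p, ∀ v : slitDual L, ∀ h : toHat v = p,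
      ∀ u : p.2.submodule, HEq u.1 v.1.2 → l u = F v := by
    rintro ⟨x, q⟩
    induction q with
    | h φ hφ =>
      let r : ℝ ∙ φ ≃ₗ[ℝ] ℝ := (LinearEquiv.toSpanNonzeroSingleton ℝ (CDual L x) φ hφ).symm
      refine ⟨(F ⟨⟨x, φ⟩, hφ⟩) • (r : (ℝ ∙ φ) →ₗ[ℝ] ℝ), ?_⟩
      rintro ⟨⟨y, ψ⟩, hψ⟩ h ⟨u, hu⟩ huv
      have hxy : y = x := congrArg Sigma.fst h
      subst hxy
      obtain rfl : u = ψ := eq_of_heq huv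
      obtain ⟨c, rfl⟩ := Submodule.mem_span_singleton.1 hu
      have : r ⟨c • φ, hu⟩ = c := by
        rw [LinearEquiv.symm_apply_eq]
        rfl
      change F ⟨⟨y, φ⟩, hφ⟩ * r ⟨c • φ, hu⟩ = _
      rw [this, mul_comm]
      exact (hom ⟨⟨y, φ⟩, hφ⟩ c hψ).symm
  choose l hl using ex
  have key : ∀ v, tildeFun l v = F v := fun v => hl _ v rfl _ HEq.rfl
  exact ⟨⟨l, by
    change ContMDiff (tildeModel E) 𝓘(ℝ, ℝ) ∞ (tildeFun l)
    rw [funext key]; exact hF⟩, key⟩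

theorem smul_ne {v : slitDual L} {c : ℝ} (h : c • v.1.2 ≠ 0) : c ≠ 0 := by
  rintro rfl
  exact h (ContinuousLinearMap.ext fun u => zero_smul ℝ (v.1.2 u))

theorem tilde_hom (t : HatSec E L) (v : slitDual L) (c : ℝ) (h : c • v.1.2 ≠ 0) :
    tilde t ⟨⟨v.1.1, c • v.1.2⟩, h⟩ = c * tilde t v := by
  obtain ⟨⟨x, φ⟩, hφ⟩ := v
  have hq : Projectivization.mk ℝ (c • φ) h = Projectivization.mk ℝ φ hφ :=
    (Projectivization.mk_eq_mk_iff' ℝ _ _ _ _).2 ⟨c, rfl⟩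
  have gen : ∀ (q q' : ℙ ℝ (CDual L x)) (e : q = q') (u : CDual L x) (h1 : u ∈ q.submodule)
      (h2 : u ∈ q'.submodule), t.1 ⟨x, q⟩ ⟨u, h1⟩ = t.1 ⟨x, q'⟩ ⟨u, h2⟩ := by
    rintro q _ rfl u h1 h2; rfl
  have h2 : c • φ ∈ (Projectivization.mk ℝ φ hφ).submodule :=
    Submodule.smul_mem _ c (Submodule.mem_span_singleton_self φ)
  refine (gen _ _ hq (c • φ) (Submodule.mem_span_singleton_self _) h2).trans ?_
  exact (t.1 ⟨x, Projectivization.mk ℝ φ hφ⟩).map_smul c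
    ⟨φ, Submodule.mem_span_singleton_self φ⟩

variable [FiniteDimensional ℂ E] [T2Space X] [IsManifold 𝓘(ℂ, E) ω X]
  [ContMDiffVectorBundle ω ℂ L 𝓘(ℂ, E)]

theorem exists_coord (x₀ : X) : ∃ (χ : X → ℝ) (W : slitDual L → ℂ), ContMDiff 𝓘(ℝ, E) 𝓘(ℝ, ℝ) ∞ χ ∧
    χ x₀ = 1 ∧ (∀ v : slitDual L, (v.1.1 ∈ tsupport χ →
      W v ≠ 0 ∧ ContMDiffAt (tildeModel E) 𝓘(ℝ, ℂ) ∞ W v ∧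
      ∀ (c : ℝ) (h : c • v.1.2 ≠ 0), W ⟨⟨v.1.1, c • v.1.2⟩, h⟩ = c * W v)) := by
  have : IsManifold 𝓘(ℝ, E) ∞ X := isManifold_real
  let e := trivializationAt (ℂ →L[ℂ] ℂ) (CDual L) x₀
  have hb : e.baseSet ∈ nhds x₀ := e.open_baseSet.mem_nhds (mem_baseSet_trivializationAt _ _ _)
  obtain ⟨f, -, hf⟩ := (SmoothBumpFunction.nhds_basis_tsupport (I := 𝓘(ℝ, E)) x₀).mem_iff.1 hb
  refine ⟨f, fun v => (e v.1).2 1, f.contMDiff, f.eq_one, fun v hv => ?_⟩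
  have hvb : v.1.1 ∈ e.baseSet := hf hv
  let l := e.continuousLinearEquivAt ℂ v.1.1 hvb
  have hl : ∀ φ : CDual L v.1.1, (e ⟨v.1.1, φ⟩).2 = l φ := fun φ => rfl
  refine ⟨?_, ?_, ?_⟩
  · intro h0
    have h1 : l v.1.2 = 0 := by
      ext; exact h0
    exact v.2 ((l.map_eq_zero_iff).1 h1)
  · have h1 : ContMDiffAt ((𝓘(ℂ, E)).prod 𝓘(ℂ, ℂ →L[ℂ] ℂ)) 𝓘(ℂ, ℂ →L[ℂ] ℂ) ω
        (fun u : DualTot L => (e u).2) v.1 := by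
      have h2 := (e.contMDiffOn (n := ω) (IB := 𝓘(ℂ, E))).contMDiffAt
        (e.open_source.mem_nhds (e.mem_source.2 hvb))
      exact contMDiffAt_snd.comp _ h2
    have h2 := contMDiffAt_real h1
    have h3 : ContMDiffAt (tildeModel E) 𝓘(ℝ, ℂ →L[ℂ] ℂ) ∞ (fun u : slitDual L => (e u.1).2) v :=
      h2.comp v (contMDiff_subtype_val v)
    let ev : (ℂ →L[ℂ] ℂ) →L[ℝ] ℂ :=
      (ContinuousLinearMap.apply ℂ ℂ (1 : ℂ)).restrictScalars ℝ
    exact ev.contDiff.contDiffAt.comp_contMDiffAt h3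
  · intro c h
    have : (e ⟨v.1.1, c • v.1.2⟩).2 = (c : ℂ) • (e v.1).2 := by
      rw [hl, show (e v.1).2 = l v.1.2 from rfl, ← map_smul]
      congr 1
    change (e ⟨v.1.1, c • v.1.2⟩).2 1 = c * (e v.1).2 1
    rw [this]; rfl

theorem exists_local (v₀ : slitDual L) : ∃ (s : HatSec E L) (G : slitDual L → ℝ),
    ContMDiff (tildeModel E) 𝓘(ℝ, ℝ) ∞ G ∧
    (∀ (v : slitDual L) (c : ℝ) (h : c • v.1.2 ≠ 0), G ⟨⟨v.1.1, c • v.1.2⟩, h⟩ = c⁻¹ * G v) ∧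
    tilde s v₀ ≠ 0 ∧ G v₀ ≠ 0 := by
  obtain ⟨χ, W, hχ, hχ0, hW⟩ := exists_coord (E := E) (L := L) v₀.1.1
  have hχt : ContMDiff (tildeModel E) 𝓘(ℝ, ℝ) ∞ (fun v : slitDual L => χ v.1.1) := by
    have h1 : ContMDiff (tildeModel E) 𝓘(ℝ, E) ∞ (fun v : slitDual L => v.1.1) :=
      (contMDiff_proj (CDual L)).comp contMDiff_subtype_val
    exact hχ.comp h1
  have hcont : Continuous (fun v : slitDual L => v.1.1) :=
    (FiberBundle.continuous_proj (ℂ →L[ℂ] ℂ) (CDual L)).comp continuous_subtype_val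
  -- products with `χ` are smooth
  have smooth : ∀ g : ℂ → ℝ, ContDiffOn ℝ ∞ g {0}ᶜ →
      ContMDiff (tildeModel E) 𝓘(ℝ, ℝ) ∞ (fun v : slitDual L => χ v.1.1 * g (W v)) := by
    intro g hg v
    by_cases hv : v.1.1 ∈ tsupport χ
    · obtain ⟨h0, h1, -⟩ := hW v hv
      have h2 : ContDiffAt ℝ ∞ g (W v) := hg.contDiffAt (isOpen_compl_singleton.mem_nhds h0)
      exact (hχt v).mul (h2.comp_contMDiffAt h1)
    · have : ∀ᶠ u : slitDual L in nhds v, χ u.1.1 = 0 := by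
        have h1 : (tsupport χ)ᶜ ∈ nhds v.1.1 := (isClosed_tsupport χ).isOpen_compl.mem_nhds hv
        filter_upwards [hcont.continuousAt.preimage_mem_nhds h1] with u hu
        exact image_eq_zero_of_notMem_tsupport hu
      refine (contMDiffAt_const (c := (0 : ℝ))).congr_of_eventuallyEq ?_
      filter_upwards [this] with u hu
      rw [hu, zero_mul]
  have hx0 : v₀.1.1 ∈ tsupport χ := subset_tsupport χ (by simp [hχ0])
  obtain ⟨hw0, -, -⟩ := hW v₀ hx0
  set b : ℂ := starRingEnd ℂ (W v₀) with hbdef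
  have hre : (b * W v₀).re ≠ 0 := by
    have : (b * W v₀) = (Complex.normSq (W v₀) : ℂ) := by
      rw [hbdef, mul_comm, Complex.mul_conj]
    rw [this, Complex.ofReal_re]
    exact (Complex.normSq_pos.2 hw0).ne'
  have hlin : ContDiff ℝ ∞ (fun z : ℂ => (b * z).re) :=
    Complex.reCLM.contDiff.comp (contDiff_const.mul contDiff_id)
  have hns : ContDiff ℝ ∞ (fun z : ℂ => Complex.normSq z) := by
    have : (fun z : ℂ => Complex.normSq z) = fun z => z.re * z.re + z.im * z.im := by
      ext z; exact Complex.normSq_apply z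
    rw [this]
    exact (Complex.reCLM.contDiff.mul Complex.reCLM.contDiff).add
      (Complex.imCLM.contDiff.mul Complex.imCLM.contDiff)
  have hom : ∀ (v : slitDual L) (c : ℝ) (h : c • v.1.2 ≠ 0) (g : ℂ → ℝ) (m : ℝ),
      (∀ z, g (c * z) = m * g z) →
      χ v.1.1 * g (W ⟨⟨v.1.1, c • v.1.2⟩, h⟩) = m * (χ v.1.1 * g (W v)) := by
    intro v c h g m hg
    by_cases hv : v.1.1 ∈ tsupport χ
    · rw [(hW v hv).2.2 c h, hg]; ring
    · rw [image_eq_zero_of_notMem_tsupport hv]; ring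
  have hlinc : ∀ (c : ℝ) (z : ℂ), (b * (c * z)).re = c * (b * z).re := by
    intro c z
    rw [show b * (c * z) = c * (b * z) by ring, Complex.re_ofReal_mul]
  obtain ⟨s, hs⟩ := exists_hatSec (E := E) (fun v : slitDual L => χ v.1.1 * (b * W v).re)
    (smooth _ hlin.contDiffOn) (fun v c h => hom v c h (fun z => (b * z).re) c (hlinc c))
  refine ⟨s, fun v => χ v.1.1 * ((b * W v).re / Complex.normSq (W v)),
    smooth (fun z => (b * z).re / Complex.normSq z) ?_, ?_, ?_, ?_⟩
  · exact hlin.contDiffOn.div hns.contDiffOn fun z hz => (Complex.normSq_pos.2 hz).ne'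
  · intro v c h
    have hc : c ≠ 0 := smul_ne h
    refine hom v c h (fun z => (b * z).re / Complex.normSq z) c⁻¹ fun z => ?_
    simp only [hlinc, Complex.normSq_mul, Complex.normSq_ofReal]
    field_simp
  · rw [hs, hχ0, one_mul]; exact hre
  · change χ v₀.1.1 * _ ≠ 0
    rw [hχ0, one_mul]
    exact div_ne_zero hre (Complex.normSq_pos.2 hw0).ne'

instance : IsLineModule (HatFun E L) (HatSec E L) where
  faithful a ha := by
    refine Subtype.ext (funext fun p => ?_)
    obtain ⟨s, -, -, -, hs, -⟩ := exists_local (E := E) (hatRep p)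
    have h : a.1 (toHat (hatRep p)) * tilde s (hatRep p) = 0 :=
      congrArg (fun t : HatSec E L => tilde t (hatRep p)) (ha s)
    rw [toHat_hatRep] at h
    exact (mul_eq_zero.1 h).resolve_right hs
  endo T := by
    have tsm : ∀ (f : HatFun E L) (s : HatSec E L) v, tilde (f • s) v = f.1 (toHat v) * tilde s v :=
      fun _ _ _ => rfl
    choose s G hG hGh hs hG0 using fun v₀ : slitDual L => exists_local (E := E) v₀
    have hsm : ∀ t : HatSec E L, ContMDiff (tildeModel E) 𝓘(ℝ, ℝ) ∞ (tilde t) := fun t => t.2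
    have hth : ∀ (t : HatSec E L) (v : slitDual L) (c : ℝ) (h : c • v.1.2 ≠ 0),
        tilde t ⟨⟨v.1.1, c • v.1.2⟩, h⟩ = c * tilde t v := tilde_hom
    have key : ∀ (v₀ v : slitDual L) (t : HatSec E L), G v₀ v ≠ 0 →
        tilde (s v₀) v * tilde (T t) v = tilde t v * tilde (T (s v₀)) v := by
      intro v₀ v t hv
      have ex : ∀ t : HatSec E L, ∃ f : HatFun E L, ∀ v, f.1 (toHat v) = tilde t v * G v₀ v := by
        intro t
        refine exists_hatFun _ ((hsm t).mul (hG v₀)) fun v c h => ?_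
        have hc : c ≠ 0 := smul_ne h
        change tilde t _ * G v₀ _ = tilde t _ * G v₀ _
        rw [hth, hGh]; field_simp
      obtain ⟨f, hf⟩ := ex t
      obtain ⟨g, hg⟩ := ex (s v₀)
      have h1 : g • t = f • s v₀ := tilde_inj fun v => by
        rw [tsm, tsm, hf, hg]; ring
      have h2 : g • T t = f • T (s v₀) := by rw [← map_smul, ← map_smul, h1]
      have h3 := congrArg (fun t : HatSec E L => tilde t v) h2
      simp only [tsm, hf, hg] at h3
      refine mul_right_cancel₀ hv ?_
      linear_combination h3
    let c : slitDual L → ℝ := fun v => tilde (T (s v)) v / tilde (s v) v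
    have hc : ∀ t v, tilde (T t) v = c v * tilde t v := by
      intro t v
      have := key v v t (hG0 v)
      simp only [c]
      field_simp [hs v]
      linear_combination this
    have hcs : ContMDiff (tildeModel E) 𝓘(ℝ, ℝ) ∞ c := by
      intro v
      have hne : ∀ᶠ u in nhds v, tilde (s v) u ≠ 0 :=
        (hsm (s v)).continuous.continuousAt.eventually_ne (hs v)
      have h1 : ContMDiffAt (tildeModel E) 𝓘(ℝ, ℝ) ∞
          (fun u => tilde (T (s v)) u / tilde (s v) u) v :=
        (hsm (T (s v)) v).div₀ (hsm (s v) v) (hs v)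
      refine h1.congr_of_eventuallyEq ?_
      filter_upwards [hne] with u hu
      rw [hc (s v) u]; field_simp
    obtain ⟨a, ha⟩ := exists_hatFun (E := E) c hcs fun v r h => by
      have hr : r ≠ 0 := smul_ne h
      have h1 := hc (s v) v
      have h2 := hc (s v) ⟨⟨v.1.1, r • v.1.2⟩, h⟩
      rw [hth, hth, h1] at h2
      have h3 := hs v
      have h4 : (r * tilde (s v) v) * (c v - c ⟨⟨v.1.1, r • v.1.2⟩, h⟩) = 0 := by
        linear_combination h2
      have := (mul_eq_zero.1 h4).resolve_left (mul_ne_zero hr h3)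
      linarith
    exact ⟨a, fun t => tilde_inj fun v => by rw [tsm, ha, hc]⟩

end Line

/-! ### Schouten-Jacobi brackets -/

section Schouten

variable {K A P : Type*} [Field K] [CommRing A] [Algebra K A] [AddCommGroup P] [Module K P]
  [Module A P] [IsScalarTower K A P]

/-- The composition `B ∘ B` of a bi-derivation with itself (a sum over `(2,1)`-unshuffles). -/
def BiDer.gerst (B : BiDer K A P) (p q r : P) : P :=
  B.bracket (B.bracket p q) r - B.bracket (B.bracket p r) q + B.bracket (B.bracket q r) p

/-- The Schouten-Jacobi bracket `[B, B]` of a bi-derivation with itself. -/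
def BiDer.schoutenSelf (B : BiDer K A P) (p q r : P) : P := -B.gerst p q r - B.gerst p q r

/-- The Schouten-Jacobi bracket `[Δ, B]` of a derivation and a bi-derivation. -/
def BiDer.schoutenGauge (Δ : Gauge K A P) (B : BiDer K A P) (p q : P) : P :=
  Δ.1 (B.bracket p q) - (B.bracket (Δ.1 p) q - B.bracket (Δ.1 q) p)

end Schouten

/-! ### Holomorphic Jacobi structures -/

section Holomorphic

open Bundle

variable {E : Type*} [NormedAddCommGroup E] [NormedSpace ℂ E]
  {X : Type*} [TopologicalSpace X] [ChartedSpace E X]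
  {L : X → Type*} [∀ x, AddCommGroup (L x)] [∀ x, Module ℂ (L x)] [∀ x, TopologicalSpace (L x)]
  [TopologicalSpace (TotalSpace ℂ L)] [FiberBundle ℂ L] [VectorBundle ℂ ℂ L]

/-- The (real) differential of a smooth complex function. -/
def dfun (f : CFun E X) (x : X) : E →L[ℝ] ℂ := mfderiv 𝓘(ℝ, E) 𝓘(ℝ, ℂ) f.1 x

/-- The (real) differential at `x` of a section in the preferred trivialization at `x`. -/
def dloc (s : CSec E L) (x : X) : E →L[ℝ] ℂ := mfderiv 𝓘(ℝ, E) 𝓘(ℝ, ℂ) (localRep s.1 x) x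

/-- `∂̄ s` at the point `x`, evaluated on the `(0,1)`-part of the tangent vector `v`. The preferred
trivialization may be used when the transition functions of `L` are holomorphic. -/
def dbar (s : CSec E L) (x : X) (v : E) : L x :=
  (trivializationAt ℂ L x).symm x
    ((1 / 2 : ℂ) * (dloc s x v + Complex.I * dloc s x (Complex.I • v)))

/-- `Δ` is the derivation `∂̄_ξ` of `L`, where `ξ` is the `(0,1)`-part of the vector field `V`. -/
def IsDbar (Δ : Gauge ℂ (CFun E X) (CSec E L)) (V : X → E) : Prop :=
  ∀ s x, (Δ.1 s).1 x = dbar s x (V x)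

/-- The bi-derivation `J` is of type `(2,0)`: it vanishes when one argument is the `1`-jet of a
section `s` at a point where `s` vanishes and has differential of type `(0,1)`. -/
def Is20 (J : BiDer ℂ (CFun E X) (CSec E L)) : Prop :=
  ∀ (s t : CSec E L) (x : X), s.1 x = 0 →
    (∀ v, dloc s x (Complex.I • v) = -(Complex.I * dloc s x v)) → (J.bracket s t).1 x = 0

/-- The condition `∂̄ J = 0`: for every `(0,1)` vector field `ξ`, the `(2,0)`-part of the
Schouten-Jacobi bracket `[∂̄_ξ, J]` vanishes, i.e. this bracket vanishes on the `1`-jets which are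
annihilated by `∂̄`. -/
def DbarClosed (J : BiDer ℂ (CFun E X) (CSec E L)) : Prop :=
  ∀ (Δ : Gauge ℂ (CFun E X) (CSec E L)) (V : X → E), IsDbar Δ V →
    ∀ (s t : CSec E L) (x : X), (∀ v, dbar s x v = 0) → (∀ v, dbar t x v = 0) →
      (J.schoutenGauge Δ s t).1 x = 0

/-- Holomorphic Jacobi bi-derivations. -/
structure IsHolomorphicJacobi (J : BiDer ℂ (CFun E X) (CSec E L)) : Prop where
  type20 : Is20 J
  dbar_closed : DbarClosed J
  jacobi : ∀ s t u, J.schoutenSelf s t u = 0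

variable (E X) in
/-- Complex vector fields on the real manifold underlying `X`. -/
abbrev CVec := Derivation ℂ (CFun E X) (CFun E X)

variable (E X) in
/-- Complex vector fields of type `(1,0)`. -/
def T10 : Set (CVec E X) :=
  {ξ | ∀ f x, (∀ v, dfun f x (Complex.I • v) = -(Complex.I * dfun f x v)) → (ξ f).1 x = 0}

variable (E X) in
/-- Complex vector fields of type `(0,1)`. -/
def T01 : Set (CVec E X) :=
  {ξ | ∀ f x, (∀ v, dfun f x (Complex.I • v) = Complex.I * dfun f x v) → (ξ f).1 x = 0}

end Holomorphic

/-! ### Contact structures -/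

section Contact

variable {K A P : Type*} [Field K] [CommRing A] [Algebra K A] [AddCommGroup P] [Module K P]
  [Module A P]

/-- The vector field `ξ` in `T` is a contact vector field of the distribution `T ∩ ker θ`. -/
def IsContactField (T : Set (Derivation K A A)) (θ : Derivation K A A →ₗ[A] P)
    (ξ : Derivation K A A) : Prop :=
  ξ ∈ T ∧ ∀ ζ ∈ T, θ ζ = 0 → θ ⁅ξ, ζ⁆ = 0

/-- The line bundle valued `1`-form `θ` is a contact form along the (real, or complex) tangent
bundle `T`: it is surjective and the Frobenius map `(ξ, ζ) ↦ θ[ξ, ζ]` on its kernel is everywhere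
nondegenerate. Here `zA m a`, `zP m p` mean that `a`, `p` vanish at the point `m`. -/
structure IsContactForm {M : Type*} (zA : M → A → Prop) (zP : M → P → Prop)
    (T : Set (Derivation K A A)) (θ : Derivation K A A →ₗ[A] P) : Prop where
  surj : ∀ p, ∃ ξ ∈ T, θ ξ = p
  nondeg : ∀ m, ∀ ξ ∈ T, θ ξ = 0 → (∀ ζ ∈ T, θ ζ = 0 → zP m (θ ⁅ξ, ζ⁆)) → ∀ a, zA m (ξ a)

/-- The bi-derivation `B` is the Jacobi bracket induced by `θ`: `{p, q} = θ[ξ, ζ]` where `ξ`, `ζ`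
are the contact vector fields with `θ ξ = p` and `θ ζ = q`. -/
def BiDer.InducedBy [IsScalarTower K A P] (B : BiDer K A P) (T : Set (Derivation K A A))
    (θ : Derivation K A A →ₗ[A] P) : Prop :=
  ∀ p q, ∃ ξ ζ, IsContactField T θ ξ ∧ IsContactField T θ ζ ∧ θ ξ = p ∧ θ ζ = q ∧
    B.bracket p q = θ ⁅ξ, ζ⁆

end Contact

/-! ### The bi-derivations and the endomorphism induced on `ℝℙ(L*)` -/

section Induced

open Bundle

variable {E : Type*} [NormedAddCommGroup E] [NormedSpace ℂ E]
  {X : Type*} [TopologicalSpace X] [ChartedSpace E X]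
  {L : X → Type*} [∀ x, AddCommGroup (L x)] [∀ x, Module ℂ (L x)] [∀ x, TopologicalSpace (L x)]
  [TopologicalSpace (TotalSpace ℂ L)] [FiberBundle ℂ L] [VectorBundle ℂ ℂ L]

/-- The bi-derivation `B` of `ℓ` comes from a contact structure on `ℝℙ(L*)`. -/
def FromContact (B : BiDer ℝ (HatFun E L) (HatSec E L)) : Prop :=
  ∃ θ : Derivation ℝ (HatFun E L) (HatFun E L) →ₗ[HatFun E L] HatSec E L,
    IsContactForm (fun (p : Hat L) (f : HatFun E L) => f.1 p = 0)
      (fun (p : Hat L) (s : HatSec E L) => s.1 p = 0) Set.univ θ ∧ B.InducedBy Set.univ θ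

/-- The bi-derivation `J` of `L` comes from a complex contact structure on `X`: a holomorphic
`L`-valued `(1,0)`-form which is a contact form on `T^{1,0} X`. -/
def FromComplexContact (J : BiDer ℂ (CFun E X) (CSec E L)) : Prop :=
  ∃ θ : CVec E X →ₗ[CFun E X] CSec E L,
    (∀ ξ ∈ T01 E X, θ ξ = 0) ∧
    (∀ (Δ : Gauge ℂ (CFun E X) (CSec E L)) (V : X → E) (ξ : CVec E X), IsDbar Δ V →
      IsSymbol Δ.1 ξ → ∀ ζ ∈ T10 E X, Δ.1 (θ ζ) = θ ⁅ξ, ζ⁆) ∧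
    IsContactForm (fun (x : X) (f : CFun E X) => f.1 x = 0)
      (fun (x : X) (s : CSec E L) => s.1 x = 0) (T10 E X) θ ∧ J.InducedBy (T10 E X) θ

variable (E) in
/-- The model space of the tangent spaces of `L* ∖ 0`. Its complex structure is the complex
structure of `L* ∖ 0`. -/
abbrev TildeT : Type _ := E × (ℂ →L[ℂ] ℂ)

/-- The differential of the homogeneous function corresponding to a section of `ℓ`. -/
def dTilde (s : HatSec E L) (v : slitDual L) : TildeT E →L[ℝ] ℝ :=
  mfderiv (tildeModel E) 𝓘(ℝ, ℝ) (tilde s) v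

/-- The homogeneous complex function on `L* ∖ 0` corresponding to a section of `L`. -/
def cTilde (s : CSec E L) (v : slitDual L) : ℂ := v.1.2 (s.1 v.1.1)

/-- The differential of the homogeneous function corresponding to a section of `L`. -/
def dcTilde (s : CSec E L) (v : slitDual L) : TildeT E →L[ℝ] ℂ :=
  mfderiv (tildeModel E) 𝓘(ℝ, ℂ) (cTilde s) v

/-- `φ` is the endomorphism of the gauge algebroid of `ℓ` corresponding to the complex structure of
`L* ∖ 0`: if `V` is the vector field on `L* ∖ 0` corresponding to `Δ`, then the vector field `iV`
corresponds to `φ Δ`. -/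
def IsHatEnd (φ : Gauge ℝ (HatFun E L) (HatSec E L) →ₗ[HatFun E L]
    Gauge ℝ (HatFun E L) (HatSec E L)) : Prop :=
  ∀ Δ, ∃ V : slitDual L → TildeT E,
    (∀ s v, dTilde s v (V v) = tilde (Δ.1 s) v) ∧
    (∀ s v, dTilde s v (Complex.I • V v) = tilde ((φ Δ).1 s) v)

/-- The complexification of a real covector. -/
def complexify (α : TildeT E →L[ℝ] ℝ) : TildeT E →L[ℝ] ℂ := Complex.ofRealCLM ∘L α

/-- A complex covector of type `(0,1)`. -/
def Is01 (α : TildeT E →L[ℝ] ℂ) : Prop := ∀ u, α (Complex.I • u) = -(Complex.I * α u)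

/-- Complex bi-vectors on `L* ∖ 0`, as alternating forms on complex covectors. -/
structure CBivector (E : Type*) [NormedAddCommGroup E] [NormedSpace ℂ E]
    {X : Type*} [TopologicalSpace X] [ChartedSpace E X]
    (L : X → Type*) [∀ x, AddCommGroup (L x)] [∀ x, Module ℂ (L x)] [∀ x, TopologicalSpace (L x)]
    [TopologicalSpace (TotalSpace ℂ L)] [FiberBundle ℂ L] [VectorBundle ℂ ℂ L] where
  /-- The bi-vector at a point. -/
  form : slitDual L → (TildeT E →L[ℝ] ℂ) →ₗ[ℂ] (TildeT E →L[ℝ] ℂ) →ₗ[ℂ] ℂ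
  alt : ∀ v α, form v α α = 0

/-- The complex bi-vector `Q` lifts the bi-derivation `J`. -/
def CBivector.Lifts (Q : CBivector E L) (J : BiDer ℂ (CFun E X) (CSec E L)) : Prop :=
  ∀ s t v, Q.form v (dcTilde s v) (dcTilde t v) = cTilde (J.bracket s t) v

/-- The complex bi-vector `Q` is of type `(2,0)`. -/
def CBivector.Is20 (Q : CBivector E L) : Prop :=
  ∀ v α β, Is01 α → Q.form v α β = 0

/-- `(B', B)` is a pair of bi-derivations of `ℓ` induced by the complex bi-derivation `J` of `L`:
they correspond to the real and to the imaginary part of a complex bi-vector `Q` on `L* ∖ 0` which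
lifts `J`, and which is of type `(2,0)` if so is `J`. -/
def IsHatPair (J : BiDer ℂ (CFun E X) (CSec E L)) (B' B : BiDer ℝ (HatFun E L) (HatSec E L)) :
    Prop :=
  ∃ Q : CBivector E L, Q.Lifts J ∧ (Is20 J → Q.Is20) ∧
    (∀ s t v, tilde (B'.bracket s t) v =
      (Q.form v (complexify (dTilde s v)) (complexify (dTilde t v))).re) ∧
    (∀ s t v, tilde (B.bracket s t) v =
      (Q.form v (complexify (dTilde s v)) (complexify (dTilde t v))).im)

end Induced

/-- `B' = B_φ`. -/
def IsDeform {A P : Type*} [CommRing A] [Algebra ℝ A] [AddCommGroup P] [Module ℝ P]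
    [Module A P] [IsScalarTower ℝ A P] [IsLineModule A P] (B' B : BiDer ℝ A P)
    (φ : Gauge ℝ A P →ₗ[A] Gauge ℝ A P) : Prop :=
  ∃ h : SharpComm B φ, B' = B.deform φ h


end HJ

end

/-! A section `s` of `L` yields the homogeneous real function `Re s̃` on `L* ∖ 0`, that is, the
section `re s` of `ℓ`. Every real covector at a point is the real part of a complex linear one,
hence the differential of `Re s̃` for some `s` that is holomorphic near the base point
(`exists_dTilde_re`). By Euler's identity the differential of a homogeneous function is the whole
1-jet of the section. Derivations, bi-derivations and tensors on jets of `ℓ` are therefore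
determined by what they do to `re s` with `s` holomorphic (`hat_gauge_ext`, `biDer_ext`, `jet_ext`).

On such sections everything is explicit. The complex structure acts by `(ĵ Δ)(re s) = Δ(re (i s))`.
A bi-vector of type `(2,0)` does not see the antiholomorphic half of `d Re s̃ = (ds̃ + conj ds̃) /
2`, so that `Ĵ'(re s, re t) = re (J(s, t) / 4)` and `Ĵ(re s, re t) = re (-i J(s, t) / 4)`; this is
`Induces` with two constants. The first formula gives `ĵ² = -1` and vanishing torsion; both together
give `Ĵ^♯ ĵ^† = ĵ Ĵ^♯` and `Ĵ' = Ĵ_ĵ`, by complex bilinearity of `J`. Conversely `Ĵ' = Ĵ_ĵ` relates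
the real and imaginary parts of the lift in a way that forces type `(2,0)` (`CBivector.is20_of`).

For `J` of type `(2,0)`, the condition `∂̄ J = 0` says that `J` preserves local holomorphic
sections. The remaining compatibility condition between `Ĵ` and `ĵ` is tensorial, and on `re s`, `re
t` its defect measures the failure of `ĵ` to act as `i` on `J(s, t)`, that is, the failure of `J(s,
t)` to be holomorphic (`Induces.compatDefect`, `IsHatEnd.holAt`). The Jacobiators correspond up to
the square of the constant. This proves that conditions 1 and 2 are equivalent. The equivalence of 2
and 3 is algebra: once `φ² = -1` and the torsion vanishes, the components of the integrability of
the block endomorphism are the Jacobi identity and the compatibility condition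
(`isGeneralizedContact_iff`).

For the last claim, a bracket comes from a contact structure exactly when it satisfies the Jacobi
identity and is nondegenerate on jets. This is proved once, in an abstract `ContactModel`, and used
for `ℓ` and for `T^{1,0} X`; in the complex case holomorphy of `θ` corresponds to `J` preserving
holomorphic sections. Nondegeneracy passes between `J` and `Ĵ`. Starting from a contact structure on
`ℓ`, the only thing not yet available is that `J` preserves holomorphic sections, and it follows
from a signed sum of four Jacobi identities (`Induces.preservesHol_of_nondeg`). Since `Ĵ` and `Ĵ'`
are induced by nonzero multiples of the same `J`, both are contact at the same time. -/

set_option linter.unusedSectionVars false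

noncomputable section

namespace HJ

/-! ### Hadamard's lemma -/

section Hadamard

open MeasureTheory intervalIntegral Set Filter

universe u w

theorem segment_mem {V : Type*} [NormedAddCommGroup V] [NormedSpace ℝ V] {C : Set V} {p₀ : V} (hs : StarConvex ℝ p₀ C) {p : V} (hp : p ∈ C) {t : ℝ}
    (ht : t ∈ Icc (0 : ℝ) 1) : p₀ + t • (p - p₀) ∈ C := by
  have := hs hp (sub_nonneg.2 ht.2) ht.1 (by ring)
  convert this using 1
  module

variable {V : Type u} [NormedAddCommGroup V] [NormedSpace ℝ V] [FiniteDimensional ℝ V]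

/-- Differentiation under the integral sign, with one more factor `t` from the chain rule. The
weight `t ^ k` makes this family of integrals stable under differentiation, as the induction on the
order of smoothness requires. -/
theorem hasFDerivAt_integral_segment {G : Type w} [NormedAddCommGroup G] [NormedSpace ℝ G]
    {C : Set V} (hC : IsOpen C) {p₀ : V} (hs : StarConvex ℝ p₀ C) {F : V → G}
    (hF : ContDiffOn ℝ ∞ F C) (k : ℕ) {p : V} (hp : p ∈ C) :
    HasFDerivAt (fun p => ∫ t in (0 : ℝ)..1, t ^ k • F (p₀ + t • (p - p₀)))
      (∫ t in (0 : ℝ)..1, t ^ (k + 1) • fderiv ℝ F (p₀ + t • (p - p₀))) p := by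
  obtain ⟨r, hr, hrC⟩ := Metric.nhds_basis_closedBall.mem_iff.1 (hC.mem_nhds hp)
  have hF0 : ContinuousOn F C := hF.continuousOn
  have hF1 : ContinuousOn (fderiv ℝ F) C :=
    ((contDiffOn_infty_iff_fderiv_of_isOpen hC).1 hF).2.continuousOn
  have hd : DifferentiableOn ℝ F C := ((contDiffOn_infty_iff_fderiv_of_isOpen hC).1 hF).1
  have hseg : Continuous fun q : ℝ × V => p₀ + q.1 • (q.2 - p₀) := by fun_prop
  have hmaps : MapsTo (fun q : ℝ × V => p₀ + q.1 • (q.2 - p₀))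
      (Icc (0 : ℝ) 1 ×ˢ Metric.closedBall p r) C := fun q hq => segment_mem hs (hrC hq.2) hq.1
  have hc1 : ContinuousOn (fun q : ℝ × V => q.1 ^ (k + 1) • fderiv ℝ F (p₀ + q.1 • (q.2 - p₀)))
      (Icc (0 : ℝ) 1 ×ˢ Metric.closedBall p r) :=
    (by fun_prop : Continuous fun q : ℝ × V => q.1 ^ (k + 1)).continuousOn.smul
      (hF1.comp hseg.continuousOn hmaps)
  have hc0 : ContinuousOn (fun q : ℝ × V => q.1 ^ k • F (p₀ + q.1 • (q.2 - p₀)))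
      (Icc (0 : ℝ) 1 ×ˢ Metric.closedBall p r) :=
    (by fun_prop : Continuous fun q : ℝ × V => q.1 ^ k).continuousOn.smul
      (hF0.comp hseg.continuousOn hmaps)
  obtain ⟨M, hM⟩ := (isCompact_Icc.prod (isCompact_closedBall p r)).exists_bound_of_continuousOn hc1
  have hslice1 : ∀ q ∈ Metric.closedBall p r, ContinuousOn
      (fun t : ℝ => t ^ (k + 1) • fderiv ℝ F (p₀ + t • (q - p₀))) (Icc (0 : ℝ) 1) := fun q hq =>
    hc1.comp (f := fun t : ℝ => (t, q)) (by fun_prop) fun t ht => ⟨ht, hq⟩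
  have hslice0 : ∀ q ∈ Metric.closedBall p r,
      ContinuousOn (fun t : ℝ => t ^ k • F (p₀ + t • (q - p₀))) (Icc (0 : ℝ) 1) := fun q hq =>
    hc0.comp (f := fun t : ℝ => (t, q)) (by fun_prop) fun t ht => ⟨ht, hq⟩
  have hI : Set.uIoc (0 : ℝ) 1 ⊆ Icc (0 : ℝ) 1 := by
    rw [uIoc_of_le zero_le_one]; exact Ioc_subset_Icc_self
  have hmeas : MeasurableSet (Set.uIoc (0 : ℝ) 1) := measurableSet_uIoc
  refine hasFDerivAt_integral_of_dominated_of_fderiv_le (𝕜 := ℝ) (bound := fun _ => M)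
    (F' := fun q t => t ^ (k + 1) • fderiv ℝ F (p₀ + t • (q - p₀)))
    (Metric.closedBall_mem_nhds p hr) ?_ ?_ ?_ ?_ ?_ ?_
  · filter_upwards [Metric.closedBall_mem_nhds p hr] with q hq
    exact ((hslice0 q hq).mono hI).aestronglyMeasurable hmeas
  · refine ContinuousOn.intervalIntegrable ?_
    rw [uIcc_of_le zero_le_one]
    exact hslice0 p (Metric.mem_closedBall_self hr.le)
  · exact ((hslice1 p (Metric.mem_closedBall_self hr.le)).mono hI).aestronglyMeasurable hmeas
  · exact Eventually.of_forall fun t ht q hq => hM (t, q) ⟨hI ht, hq⟩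
  · exact intervalIntegrable_const
  · refine Eventually.of_forall fun t ht q hq => ?_
    have hm : p₀ + t • (q - p₀) ∈ C := segment_mem hs (hrC hq) (hI ht)
    have h1 := (hd.differentiableAt (hC.mem_nhds hm)).hasFDerivAt
    have h2 : HasFDerivAt (fun q : V => p₀ + t • (q - p₀)) (t • ContinuousLinearMap.id ℝ V) q :=
      (((hasFDerivAt_id q).sub_const p₀).const_smul t).const_add p₀
    have h3 := (h1.comp q h2).const_smul (t ^ k)
    refine h3.congr_fderiv ?_
    ext u
    simp [pow_succ, mul_smul]

/-- The induction runs over all codomains and weights at once, because a derivative replaces `G` by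
`V →L[ℝ] G` and `k` by `k + 1`. The universe `max u w` is not changed by this replacement. -/
theorem contDiffOn_integral_segment {C : Set V} (hC : IsOpen C) {p₀ : V} (hs : StarConvex ℝ p₀ C)
    (n : ℕ) : ∀ {G : Type (max u w)} [NormedAddCommGroup G] [NormedSpace ℝ G] {F : V → G},
      ContDiffOn ℝ ∞ F C → ∀ k : ℕ,
      ContDiffOn ℝ n (fun p => ∫ t in (0 : ℝ)..1, t ^ k • F (p₀ + t • (p - p₀))) C := by
  induction n with
  | zero =>
    intro G _ _ F hF k
    rw [Nat.cast_zero, contDiffOn_zero]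
    exact fun p hp => (hasFDerivAt_integral_segment hC hs hF k hp).continuousAt.continuousWithinAt
  | succ n ih =>
    intro G _ _ F hF k
    rw [Nat.cast_succ, contDiffOn_succ_iff_fderiv_of_isOpen hC]
    refine ⟨fun p hp => (hasFDerivAt_integral_segment hC hs hF k hp).differentiableAt.differentiableWithinAt,
      by simp, ?_⟩
    refine (ih (F := fderiv ℝ F) ((contDiffOn_infty_iff_fderiv_of_isOpen hC).1 hF).2
      (k + 1)).congr fun p hp => ?_
    exact (hasFDerivAt_integral_segment hC hs hF k hp).fderiv

/-- Hadamard's lemma. -/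
theorem exists_hadamard {G : Type w} [NormedAddCommGroup G] [NormedSpace ℝ G] [CompleteSpace G]
    {C : Set V} (hC : IsOpen C) {p₀ : V} (hs : StarConvex ℝ p₀ C) {F : V → G}
    (hF : ContDiffOn ℝ ∞ F C) : ∃ g : V → V →L[ℝ] G, ContDiffOn ℝ ∞ g C ∧
      g p₀ = fderiv ℝ F p₀ ∧ ∀ p ∈ C, F p = F p₀ + g p (p - p₀) := by
  have hF' := (contDiffOn_infty_iff_fderiv_of_isOpen hC).1 hF
  -- The witness is the mean of the derivative over the segment from `p₀` to `p`.
  refine ⟨fun p => ∫ t in (0 : ℝ)..1, t ^ 0 • fderiv ℝ F (p₀ + t • (p - p₀)),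
    contDiffOn_infty.2 fun n => contDiffOn_integral_segment.{u, w} hC hs n hF'.2 0, by simp, ?_⟩
  intro p hp
  have hm : ∀ t ∈ uIcc (0 : ℝ) 1, p₀ + t • (p - p₀) ∈ C := fun t ht =>
    segment_mem hs hp (by rwa [uIcc_of_le zero_le_one] at ht)
  have hcont : ContinuousOn (fun t : ℝ => fderiv ℝ F (p₀ + t • (p - p₀))) (uIcc 0 1) :=
    hF'.2.continuousOn.comp (by fun_prop) hm
  have hder : ∀ t ∈ uIcc (0 : ℝ) 1, HasDerivAt (fun t : ℝ => F (p₀ + t • (p - p₀)))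
      (fderiv ℝ F (p₀ + t • (p - p₀)) (p - p₀)) t := by
    intro t ht
    have h1 := (hF'.1.differentiableAt (hC.mem_nhds (hm t ht))).hasFDerivAt
    have h2 : HasDerivAt (fun t : ℝ => p₀ + t • (p - p₀)) (p - p₀) t := by
      simpa using ((hasDerivAt_id t).smul_const (p - p₀)).const_add p₀
    exact h1.comp_hasDerivAt t h2
  have h := integral_eq_sub_of_hasDerivAt hder
    (hcont.clm_apply continuousOn_const).intervalIntegrable
  have h2 : (∫ t in (0 : ℝ)..1, fderiv ℝ F (p₀ + t • (p - p₀))) (p - p₀) =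
      ∫ t in (0 : ℝ)..1, fderiv ℝ F (p₀ + t • (p - p₀)) (p - p₀) :=
    ContinuousLinearMap.intervalIntegral_apply hcont.intervalIntegrable _
  simp only [pow_zero, one_smul]
  rw [h2, h]
  simp

end Hadamard

/-! ### Functions read in a chart -/

section Chart

variable {V : Type*} [NormedAddCommGroup V] [NormedSpace ℝ V] {H : Type*} [TopologicalSpace H]
  {I : ModelWithCorners ℝ V H} [I.Boundaryless] {N : Type*} [TopologicalSpace N] [ChartedSpace H N]
  [IsManifold I ∞ N] {F : Type*} [NormedAddCommGroup F] [NormedSpace ℝ F]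

variable (I) in
/-- The derivative at `y` of a function read in the chart at `p`. -/
def chartD (p : N) (h : N → F) (y : N) : V →L[ℝ] F :=
  fderiv ℝ (h ∘ (extChartAt I p).symm) (extChartAt I p y)

theorem contDiffAt_chart {p y : N} {h : N → F} (hy : y ∈ (extChartAt I p).source)
    (hh : ContMDiffAt I 𝓘(ℝ, F) ∞ h y) :
    ContDiffAt ℝ ∞ (h ∘ (extChartAt I p).symm) (extChartAt I p y) := by
  rw [← contMDiffAt_iff_contDiffAt]
  have h1 : ContMDiffAt 𝓘(ℝ, V) I ∞ (extChartAt I p).symm (extChartAt I p y) :=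
    (contMDiffOn_extChartAt_symm p).contMDiffAt
      ((isOpen_extChartAt_target p).mem_nhds ((extChartAt I p).map_source hy))
  refine ContMDiffAt.comp _ ?_ h1
  rwa [(extChartAt I p).left_inv hy]

theorem contMDiffAt_extChart {p y : N} (hy : y ∈ (extChartAt I p).source) :
    ContMDiffAt I 𝓘(ℝ, V) ∞ (extChartAt I p) y :=
  (contMDiffOn_extChartAt (n := ∞)).contMDiffAt
    ((chartAt H p).open_source.mem_nhds (by rwa [extChartAt_source] at hy))

theorem contMDiffAt_chartD {p y : N} {h : N → F} (hy : y ∈ (extChartAt I p).source)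
    (hh : ContMDiffAt I 𝓘(ℝ, F) ∞ h y) :
    ContMDiffAt I 𝓘(ℝ, V →L[ℝ] F) ∞ (chartD I p h) y := by
  have h1 : ContDiffAt ℝ ∞ (fderiv ℝ (h ∘ (extChartAt I p).symm)) (extChartAt I p y) :=
    (contDiffAt_chart hy hh).fderiv_right (m := ∞) (by simp)
  exact h1.comp_contMDiffAt (contMDiffAt_extChart hy)

/-- `mfderiv` at `y` is read in the chart preferred at `y`, which need not vary continuously with
`y`. In the fixed chart at `p` the derivative is smooth in `y`; the price is the factor given by the
derivative of that chart. -/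
theorem mfderiv_eq_chartD {p y : N} {h : N → F} (hy : y ∈ (extChartAt I p).source)
    (hh : MDifferentiableAt I 𝓘(ℝ, F) h y) :
    mfderiv I 𝓘(ℝ, F) h y = chartD I p h y ∘L mfderiv I 𝓘(ℝ, V) (extChartAt I p) y := by
  have h0 : IsManifold I 1 N := IsManifold.of_le (n := ∞) (by simp)
  have hz := (extChartAt I p).map_source hy
  have h1 : MDifferentiableAt 𝓘(ℝ, V) I (extChartAt I p).symm (extChartAt I p y) :=
    (mdifferentiableOn_extChartAt_symm (I := I) (x := p)).mdifferentiableAt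
      ((isOpen_extChartAt_target p).mem_nhds hz)
  have h2 : MDifferentiableAt 𝓘(ℝ, V) 𝓘(ℝ, F) (h ∘ (extChartAt I p).symm) (extChartAt I p y) := by
    refine MDifferentiableAt.comp _ ?_ h1
    rwa [(extChartAt I p).left_inv hy]
  have h3 : MDifferentiableAt I 𝓘(ℝ, V) (extChartAt I p) y :=
    mdifferentiableAt_extChartAt (by rwa [extChartAt_source] at hy)
  have h4 : h =ᶠ[nhds y] (h ∘ (extChartAt I p).symm) ∘ extChartAt I p := by
    filter_upwards [(isOpen_extChartAt_source p).mem_nhds hy] with u hu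
    rw [Function.comp_apply, Function.comp_apply, (extChartAt I p).left_inv hu]
  rw [h4.mfderiv_eq, mfderiv_comp y h2 h3, mfderiv_eq_fderiv]
  rfl

theorem mfderiv_eq_chartD_self {p : N} {h : N → F} (hh : MDifferentiableAt I 𝓘(ℝ, F) h p) :
    mfderiv I 𝓘(ℝ, F) h p = chartD I p h p := by
  have h0 : IsManifold I 1 N := IsManifold.of_le (n := ∞) (by simp)
  rw [mfderiv_eq_chartD (mem_extChartAt_source p) hh, mfderiv_extChartAt_self]
  ext v; rfl

theorem chartD_congr {p y : N} {h k : N → F} (hy : y ∈ (extChartAt I p).source)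
    (hhk : h =ᶠ[nhds y] k) : chartD I p h y = chartD I p k y := by
  refine Filter.EventuallyEq.fderiv_eq ?_
  have h1 := (continuousAt_extChartAt_symm' (I := I) hy).eventually
    (p := fun u => h u = k u) (by rwa [(extChartAt I p).left_inv hy])
  filter_upwards [h1] with u hu using hu

theorem chartD_mul {𝔸 : Type*} [NormedCommRing 𝔸] [NormedAlgebra ℝ 𝔸] {p y : N} {h k : N → 𝔸}
    (hy : y ∈ (extChartAt I p).source) (hh : ContMDiffAt I 𝓘(ℝ, 𝔸) ∞ h y)
    (hk : ContMDiffAt I 𝓘(ℝ, 𝔸) ∞ k y) (w : V) :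
    chartD I p (fun u => h u * k u) y w = h y * chartD I p k y w + k y * chartD I p h y w := by
  have h1 := (contDiffAt_chart hy hh).differentiableAt (by simp)
  have h2 := (contDiffAt_chart hy hk).differentiableAt (by simp)
  have h3 := congrArg (fun T => T w) (fderiv_mul h1 h2)
  simp only [Function.comp_apply, (extChartAt I p).left_inv hy, add_apply,
    smul_apply, smul_eq_mul] at h3
  exact h3

theorem chartD_add {p y : N} {h k : N → F} (hy : y ∈ (extChartAt I p).source)
    (hh : ContMDiffAt I 𝓘(ℝ, F) ∞ h y) (hk : ContMDiffAt I 𝓘(ℝ, F) ∞ k y) :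
    chartD I p (fun u => h u + k u) y = chartD I p h y + chartD I p k y :=
  fderiv_add ((contDiffAt_chart hy hh).differentiableAt (by simp))
    ((contDiffAt_chart hy hk).differentiableAt (by simp))

theorem chartD_clm {G : Type*} [NormedAddCommGroup G] [NormedSpace ℝ G] (T : F →L[ℝ] G)
    {p y : N} {h : N → F} (hy : y ∈ (extChartAt I p).source)
    (hh : ContMDiffAt I 𝓘(ℝ, F) ∞ h y) :
    chartD I p (fun u => T (h u)) y = T ∘L chartD I p h y :=
  (T.hasFDerivAt.comp _ ((contDiffAt_chart hy hh).differentiableAt (by simp)).hasFDerivAt).fderiv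

/-- If `h` is the composition of the chart with a function `k` on the model space then its
derivative in the chart is the one of `k`. -/
theorem chartD_comp {p y : N} {h : N → F} {k : V → F} (hy : y ∈ (extChartAt I p).source)
    (hhk : ∀ᶠ u in nhds y, h u = k (extChartAt I p u)) :
    chartD I p h y = fderiv ℝ k (extChartAt I p y) := by
  rw [chartD_congr hy hhk]
  refine Filter.EventuallyEq.fderiv_eq ?_
  filter_upwards [(isOpen_extChartAt_target p).mem_nhds ((extChartAt I p).map_source hy)] with u hu
  simp only [Function.comp_apply]
  rw [(extChartAt I p).right_inv hu]

end Chart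

/-! ### Local analysis on the base -/

section Base

open Bundle TopologicalSpace

/-- The real derivative of a vector valued function. -/
def realD {V W : Type*} [NormedAddCommGroup V] [NormedSpace ℂ V]
    [NormedAddCommGroup W] [NormedSpace ℂ W] {N : Type*} [TopologicalSpace N] [ChartedSpace V N]
    (f : N → W) (y : N) : V →L[ℝ] W := mfderiv 𝓘(ℝ, V) 𝓘(ℝ, W) f y

/-- The real derivative of a complex differentiable map is complex linear. -/
theorem realD_I_smul {V W : Type*} [NormedAddCommGroup V] [NormedSpace ℂ V]
    [NormedAddCommGroup W] [NormedSpace ℂ W] {N : Type*} [TopologicalSpace N] [ChartedSpace V N]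
    {f : N → W} {y : N} (hf : MDifferentiableAt 𝓘(ℂ, V) 𝓘(ℂ, W) f y) (u : V) :
    realD f y (Complex.I • u) = Complex.I • realD f y u := by
  have h1 := hf.hasMFDerivAt
  have h2 : HasMFDerivAt 𝓘(ℝ, V) 𝓘(ℝ, W) f y
      ((mfderiv 𝓘(ℂ, V) 𝓘(ℂ, W) f y : V →L[ℂ] W).restrictScalars ℝ) :=
    ⟨h1.1, h1.2.restrictScalars ℝ⟩
  rw [realD, h2.mfderiv]
  exact (mfderiv 𝓘(ℂ, V) 𝓘(ℂ, W) f y : V →L[ℂ] W).map_smul Complex.I u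

variable {E : Type*} [NormedAddCommGroup E] [NormedSpace ℂ E]
  {X : Type*} [TopologicalSpace X] [ChartedSpace E X]
  {L : X → Type*} [∀ x, AddCommGroup (L x)] [∀ x, Module ℂ (L x)] [∀ x, TopologicalSpace (L x)]
  [TopologicalSpace (TotalSpace ℂ L)] [FiberBundle ℂ L] [VectorBundle ℂ ℂ L]
  [FiniteDimensional ℂ E] [T2Space X] [IsManifold 𝓘(ℂ, E) ω X]
  [ContMDiffVectorBundle ω ℂ L 𝓘(ℂ, E)]

attribute [local instance] isManifold_real

variable (E L) in
/-- The common domain of the preferred chart and of the preferred trivialization at a point. -/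
def goodSet (x₀ : X) : Set X := (chartAt E x₀).source ∩ (trivializationAt ℂ L x₀).baseSet

theorem isOpen_goodSet (x₀ : X) : IsOpen (goodSet E L x₀) :=
  (chartAt E x₀).open_source.inter (trivializationAt ℂ L x₀).open_baseSet

theorem mem_goodSet (x₀ : X) : x₀ ∈ goodSet E L x₀ :=
  ⟨mem_chart_source E x₀, mem_baseSet_trivializationAt ℂ L x₀⟩

theorem mem_source_of_goodSet {x₀ y : X} (hy : y ∈ goodSet E L x₀) :
    y ∈ (extChartAt 𝓘(ℝ, E) x₀).source := by
  rw [extChartAt_source]; exact hy.1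

theorem exists_bump {x₀ : X} {W : Set X} (hW : W ∈ nhds x₀) : ∃ χ : X → ℝ,
    ContMDiff 𝓘(ℝ, E) 𝓘(ℝ, ℝ) ∞ χ ∧ (∀ᶠ y in nhds x₀, χ y = 1) ∧ tsupport χ ⊆ W := by
  obtain ⟨f, -, hf⟩ := (SmoothBumpFunction.nhds_basis_tsupport (I := 𝓘(ℝ, E)) x₀).mem_iff.1 hW
  exact ⟨f, f.contMDiff, f.eventuallyEq_one, hf⟩

variable (E L) in
theorem exists_cut (x₀ : X) : ∃ χ : X → ℝ, ContMDiff 𝓘(ℝ, E) 𝓘(ℝ, ℝ) ∞ χ ∧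
    (∀ᶠ y in nhds x₀, χ y = 1) ∧ tsupport χ ⊆ goodSet E L x₀ :=
  exists_bump (E := E) ((isOpen_goodSet (L := L) x₀).mem_nhds (mem_goodSet x₀))

variable (E L) in
/-- A bump function at `x₀` supported in the preferred chart and trivialization. -/
def cut (x₀ : X) : X → ℝ := (exists_cut E L x₀).choose

variable (L) in
theorem cut_smooth (x₀ : X) : ContMDiff 𝓘(ℝ, E) 𝓘(ℝ, ℝ) ∞ (cut E L x₀) :=
  (exists_cut E L x₀).choose_spec.1

variable (E L) in
theorem cut_eventually (x₀ : X) : ∀ᶠ y in nhds x₀, cut E L x₀ y = 1 :=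
  (exists_cut E L x₀).choose_spec.2.1

theorem cut_self (x₀ : X) : cut E L x₀ x₀ = 1 := (cut_eventually E L x₀).self_of_nhds

theorem cut_tsupport (x₀ : X) : tsupport (cut E L x₀) ⊆ goodSet E L x₀ :=
  (exists_cut E L x₀).choose_spec.2.2

theorem cut_eq_zero {x₀ y : X} (hy : y ∉ goodSet E L x₀) : cut E L x₀ y = 0 :=
  image_eq_zero_of_notMem_tsupport fun h => hy (cut_tsupport x₀ h)

theorem contMDiff_bump_smul {V : Type*} [NormedAddCommGroup V] [NormedSpace ℝ V] {H : Type*}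
    [TopologicalSpace H] {I : ModelWithCorners ℝ V H} {N : Type*} [TopologicalSpace N]
    [ChartedSpace H N] {F : Type*} [NormedAddCommGroup F] [NormedSpace ℝ F] {χ : N → ℝ}
    (hχ : ContMDiff I 𝓘(ℝ, ℝ) ∞ χ) {h : N → F}
    (hh : ∀ y ∈ tsupport χ, ContMDiffAt I 𝓘(ℝ, F) ∞ h y) :
    ContMDiff I 𝓘(ℝ, F) ∞ (fun y => χ y • h y) := by
  refine contMDiff_of_tsupport fun y hy => ?_
  exact (hχ y).smul (hh y (closure_mono (Function.support_smul_subset_left χ h) hy))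

variable (L) in
/-- The smooth function `χ h`, where `χ` is the bump function at `x₀`. -/
def cutFun (x₀ : X) (h : X → ℂ)
    (hh : ∀ y ∈ goodSet E L x₀, ContMDiffAt 𝓘(ℝ, E) 𝓘(ℝ, ℂ) ∞ h y) : CFun E X :=
  ⟨fun y => cut E L x₀ y • h y,
    contMDiff_bump_smul (cut_smooth L x₀) fun y hy => hh y (cut_tsupport x₀ hy)⟩

variable (L) in
/-- The preferred local frame at `x₀`. -/
def frame (x₀ y : X) : L y := (trivializationAt ℂ L x₀).symmL ℂ y 1

variable (L) in
/-- The transition function between preferred trivializations. -/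
def transFun (x₀ x₁ y : X) : ℂ := localRep (frame L x₀) x₁ y

/-- The transition function is the coordinate change applied to `1`. Its complex analyticity, and
not only its smoothness, makes `∂̄` independent of the trivialization. -/
theorem contMDiffAt_transFun {x₀ x₁ y : X} (h₀ : y ∈ (trivializationAt ℂ L x₀).baseSet)
    (h₁ : y ∈ (trivializationAt ℂ L x₁).baseSet) :
    ContMDiffAt 𝓘(ℂ, E) 𝓘(ℂ, ℂ) ω (transFun L x₀ x₁) y := by
  have h := contMDiffAt_coordChangeL (n := ω) (IB := 𝓘(ℂ, E)) (e := trivializationAt ℂ L x₀)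
    (e' := trivializationAt ℂ L x₁) h₀ h₁
  have h2 := (ContinuousLinearMap.apply ℂ ℂ (1 : ℂ)).contDiff.contDiffAt.comp_contMDiffAt h
  refine h2.congr_of_eventuallyEq ?_
  filter_upwards [(trivializationAt ℂ L x₀).open_baseSet.mem_nhds h₀,
    (trivializationAt ℂ L x₁).open_baseSet.mem_nhds h₁] with u hu hu'
  have h3 := Trivialization.coordChangeL_apply (R := ℂ) _ _ ⟨hu, hu'⟩ (1 : ℂ)
  rw [← Trivialization.symmL_apply (R := ℂ) _ hu] at h3
  exact h3.symm

theorem localRep_trans (s : ∀ x, L x) {x₀ x₁ y : X} (h₀ : y ∈ (trivializationAt ℂ L x₀).baseSet)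
    (h₁ : y ∈ (trivializationAt ℂ L x₁).baseSet) :
    localRep s x₁ y = transFun L x₀ x₁ y * localRep s x₀ y := by
  have h := Trivialization.coordChangeL_apply (R := ℂ) (trivializationAt ℂ L x₀)
    (trivializationAt ℂ L x₁) ⟨h₀, h₁⟩
  have h1 := h (localRep s x₀ y)
  rw [localRep, Trivialization.symm_apply_apply_mk _ h₀] at h1
  have h2 := h 1
  rw [← Trivialization.symmL_apply (R := ℂ) _ h₀] at h2
  change _ = localRep (frame L x₀) x₁ y at h2
  rw [transFun, ← h2, localRep, ← h1, mul_comm, ← smul_eq_mul, ← map_smul, smul_eq_mul, mul_one]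
  rfl

theorem ContMDiffAt.to_real {W : Type*} [NormedAddCommGroup W] [NormedSpace ℂ W] {f : X → W} {y : X}
    (h : ContMDiffAt 𝓘(ℂ, E) 𝓘(ℂ, W) ω f y) : ContMDiffAt 𝓘(ℝ, E) 𝓘(ℝ, W) ∞ f y := by
  rw [contMDiffAt_iff] at h ⊢
  exact ⟨h.1, (h.2.restrict_scalars ℝ).of_le le_top⟩

theorem contMDiffAt_localRep (s : CSec E L) {x₀ y : X} (hy : y ∈ goodSet E L x₀) :
    ContMDiffAt 𝓘(ℝ, E) 𝓘(ℝ, ℂ) ∞ (localRep s.1 x₀) y := by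
  have hyy := mem_baseSet_trivializationAt ℂ L y
  have h1 : ContMDiffAt 𝓘(ℝ, E) 𝓘(ℝ, ℂ) ∞ (localRep s.1 y) y := (contMDiffAt_section y).1 (s.2 y)
  have h2 := contMDiffAt_mul_complex E
    (ContMDiffAt.to_real (contMDiffAt_transFun (E := E) hyy hy.2)) h1
  refine h2.congr_of_eventuallyEq ?_
  filter_upwards [(trivializationAt ℂ L x₀).open_baseSet.mem_nhds hy.2,
    (trivializationAt ℂ L y).open_baseSet.mem_nhds hyy] with u hu hu'
  exact localRep_trans s.1 hu' hu

theorem symm_eq_smul {x₀ y : X} (hy : y ∈ (trivializationAt ℂ L x₀).baseSet) (c : ℂ) :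
    (trivializationAt ℂ L x₀).symm y c = c • frame L x₀ y := by
  rw [← Trivialization.symmL_apply (R := ℂ) _ hy, frame, ← map_smul, smul_eq_mul, mul_one]

theorem localRep_smul_frame {x₀ y : X} (hy : y ∈ (trivializationAt ℂ L x₀).baseSet) (c : ℂ) :
    (trivializationAt ℂ L x₀ ⟨y, c • frame L x₀ y⟩).2 = c := by
  rw [← symm_eq_smul hy, Trivialization.apply_mk_symm _ hy]

theorem eq_localRep_smul {x₀ y : X} (hy : y ∈ (trivializationAt ℂ L x₀).baseSet) (s : ∀ x, L x) :
    s y = localRep s x₀ y • frame L x₀ y := by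
  rw [← symm_eq_smul hy, localRep, Trivialization.symm_apply_apply_mk _ hy]

theorem frame_ne_zero {x₀ y : X} (hy : y ∈ (trivializationAt ℂ L x₀).baseSet) :
    frame L x₀ y ≠ 0 := by
  intro h
  have h1 := localRep_smul_frame hy (1 : ℂ)
  rw [h, smul_zero, ← smul_zero (0 : ℂ), ← zero_smul ℂ (frame L x₀ y), smul_smul,
    localRep_smul_frame hy] at h1
  simp at h1

theorem smul_frame_inj {x₀ y : X} (hy : y ∈ (trivializationAt ℂ L x₀).baseSet) {c d : ℂ}
    (h : c • frame L x₀ y = d • frame L x₀ y) : c = d := by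
  rw [← localRep_smul_frame hy c, h, localRep_smul_frame hy]

theorem localRep_eq_zero_iff {x₀ y : X} (hy : y ∈ (trivializationAt ℂ L x₀).baseSet)
    (s : ∀ x, L x) : localRep s x₀ y = 0 ↔ s y = 0 := by
  rw [eq_localRep_smul hy s]
  refine ⟨fun h => by rw [h, zero_smul], fun h => ?_⟩
  rw [← zero_smul ℂ (frame L x₀ y)] at h
  exact smul_frame_inj hy h

theorem localRep_of_smul {x₀ y : X} (hy : y ∈ (trivializationAt ℂ L x₀).baseSet)
    {s t : ∀ x, L x} {a : ℂ} (h : s y = a • t y) : localRep s x₀ y = a * localRep t x₀ y := by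
  refine smul_frame_inj hy ?_
  rw [← eq_localRep_smul hy s, h, mul_smul, ← eq_localRep_smul hy t]

theorem localRep_of_add {x₀ y : X} (hy : y ∈ (trivializationAt ℂ L x₀).baseSet)
    {s t r : ∀ x, L x} (h : s y = t y + r y) :
    localRep s x₀ y = localRep t x₀ y + localRep r x₀ y := by
  refine smul_frame_inj hy ?_
  rw [← eq_localRep_smul hy s, h, add_smul, ← eq_localRep_smul hy t, ← eq_localRep_smul hy r]

/-- A section is smooth if its local representations are so. -/
theorem isSmoothSec_of_localRep {s : ∀ x, L x}
    (h : ∀ y, ContMDiffAt 𝓘(ℝ, E) 𝓘(ℝ, ℂ) ∞ (localRep s y) y) : IsSmoothSec E L s := fun y =>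
  (contMDiffAt_section y).2 (h y)

/-- The smooth section `χ h e`, where `χ` is the bump function and `e` the preferred local frame
at `x₀`. -/
def cutSec (x₀ : X) (h : X → ℂ)
    (hh : ∀ y ∈ goodSet E L x₀, ContMDiffAt 𝓘(ℝ, E) 𝓘(ℝ, ℂ) ∞ h y) : CSec E L :=
  ⟨fun y => (cut E L x₀ y • h y) • frame L x₀ y, by
    refine isSmoothSec_of_localRep fun y => ?_
    have hyy := mem_baseSet_trivializationAt ℂ L y
    by_cases hy : y ∈ tsupport (cut E L x₀)
    · have hy' := cut_tsupport x₀ hy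
      have h2 := contMDiffAt_mul_complex E
        (ContMDiffAt.to_real (contMDiffAt_transFun (E := E) hy'.2 hyy))
        ((cutFun L x₀ h hh).2 y)
      refine h2.congr_of_eventuallyEq ?_
      filter_upwards [(trivializationAt ℂ L x₀).open_baseSet.mem_nhds hy'.2,
        (trivializationAt ℂ L y).open_baseSet.mem_nhds hyy] with u hu hu'
      rw [localRep_trans _ hu hu', localRep, localRep_smul_frame hu]
      rfl
    · refine (contMDiffAt_const (c := (0 : ℂ))).congr_of_eventuallyEq ?_
      filter_upwards [(isClosed_tsupport _).isOpen_compl.mem_nhds hy,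
        (trivializationAt ℂ L y).open_baseSet.mem_nhds hyy] with u hu hu'
      rw [localRep_eq_zero_iff hu', image_eq_zero_of_notMem_tsupport hu, zero_smul, zero_smul]⟩

theorem localRep_cutSec {x₀ y : X} {h : X → ℂ}
    {hh : ∀ y ∈ goodSet E L x₀, ContMDiffAt 𝓘(ℝ, E) 𝓘(ℝ, ℂ) ∞ h y} (hy : y ∈ goodSet E L x₀) :
    localRep (cutSec (L := L) x₀ h hh).1 x₀ y = cut E L x₀ y * h y :=
  localRep_smul_frame hy.2 _

/-! ### The `∂̄`-operator -/

theorem mdiff_of_smooth {W : Type*} [NormedAddCommGroup W] [NormedSpace ℂ W] {f : X → W} {y : X}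
    (h : ContMDiffAt 𝓘(ℝ, E) 𝓘(ℝ, W) ∞ f y) : MDifferentiableAt 𝓘(ℝ, E) 𝓘(ℝ, W) f y :=
  h.mdifferentiableAt (by simp)

variable (E) in
/-- The derivative at `y` of the chart at `x₀`. -/
def chartT (x₀ y : X) : E →L[ℝ] E := realD (extChartAt 𝓘(ℝ, E) x₀) y

theorem chartT_I_smul {x₀ y : X} (hy : y ∈ (chartAt E x₀).source) (u : E) :
    chartT E x₀ y (Complex.I • u) = Complex.I • chartT E x₀ y u := by
  have h0 : IsManifold 𝓘(ℂ, E) 1 X := IsManifold.of_le (n := ω) le_top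
  exact realD_I_smul (mdifferentiableAt_extChartAt (I := 𝓘(ℂ, E)) hy) u

theorem chartT_self (x₀ : X) : chartT E x₀ x₀ = ContinuousLinearMap.id ℝ E := by
  have h0 : IsManifold 𝓘(ℝ, E) 1 X := IsManifold.of_le (n := ∞) (by simp)
  exact mfderiv_extChartAt_self

theorem chartT_surjective {x₀ y : X} (hy : y ∈ (chartAt E x₀).source) (w : E) :
    ∃ u, chartT E x₀ y u = w := by
  have h0 : IsManifold 𝓘(ℝ, E) 1 X := IsManifold.of_le (n := ∞) (by simp)
  obtain ⟨T, hT⟩ := isInvertible_mfderiv_extChartAt (I := 𝓘(ℝ, E)) (x := x₀) (y := y)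
    (by rwa [extChartAt_source])
  let T : E ≃L[ℝ] E := T
  refine ⟨T.symm w, ?_⟩
  change (mfderiv 𝓘(ℝ, E) 𝓘(ℝ, E) (extChartAt 𝓘(ℝ, E) x₀) y : E →L[ℝ] E) _ = _
  have h1 : (mfderiv 𝓘(ℝ, E) 𝓘(ℝ, E) (extChartAt 𝓘(ℝ, E) x₀) y : E →L[ℝ] E) =
    (T : E →L[ℝ] E) := hT.symm
  rw [h1]
  exact T.apply_symm_apply w

variable (E) in
/-- The derivative at `y` of the local representation of a section in the chart and in the
trivialization at `x₀`. -/
def secD (s : CSec E L) (x₀ y : X) : E →L[ℝ] ℂ := chartD 𝓘(ℝ, E) x₀ (localRep s.1 x₀) y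

theorem dloc_eq_secD (s : CSec E L) (x : X) : dloc s x = secD E s x x :=
  mfderiv_eq_chartD_self (mdiff_of_smooth (contMDiffAt_localRep s (mem_goodSet x)))

theorem dfun_eq_chartD (f : CFun E X) {x₀ y : X} (hy : y ∈ (chartAt E x₀).source) :
    dfun f y = chartD 𝓘(ℝ, E) x₀ f.1 y ∘L chartT E x₀ y :=
  mfderiv_eq_chartD (by rwa [extChartAt_source]) (mdiff_of_smooth (f.2 y))

theorem dfun_eq_chartD_self (f : CFun E X) (x : X) : dfun f x = chartD 𝓘(ℝ, E) x f.1 x :=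
  mfderiv_eq_chartD_self (mdiff_of_smooth (f.2 x))

/-- The `∂̄`-operator may be computed in any preferred trivialization. -/
theorem dbar_eq (s : CSec E L) {x₀ y : X} (hy : y ∈ goodSet E L x₀) (u : E) :
    dbar s y u = ((1 / 2 : ℂ) * (secD E s x₀ y (chartT E x₀ y u) +
      Complex.I * secD E s x₀ y (Complex.I • chartT E x₀ y u))) • frame L x₀ y := by
  have hyy := mem_baseSet_trivializationAt ℂ L y
  have hg := contMDiffAt_transFun (E := E) hy.2 hyy
  have hg1 : MDifferentiableAt 𝓘(ℂ, E) 𝓘(ℂ, ℂ) (transFun L x₀ y) y := hg.mdifferentiableAt (by simp)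
  have hg2 := mdiff_of_smooth (ContMDiffAt.to_real hg)
  have hl := mdiff_of_smooth (contMDiffAt_localRep s hy)
  have hs : ∀ w, secD E s x₀ y (chartT E x₀ y w) = realD (localRep s.1 x₀) y w := by
    intro w
    have := mfderiv_eq_chartD (I := 𝓘(ℝ, E)) (mem_source_of_goodSet hy) hl
    exact (congrArg (fun T : E →L[ℝ] ℂ => T w) this).symm
  have hD : ∀ w, dloc s y w = transFun L x₀ y y * realD (localRep s.1 x₀) y w +
      localRep s.1 x₀ y * realD (transFun L x₀ y) y w := by
    intro w
    have h1 : localRep s.1 y =ᶠ[nhds y] fun u => transFun L x₀ y u * localRep s.1 x₀ u := by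
      filter_upwards [(trivializationAt ℂ L x₀).open_baseSet.mem_nhds hy.2,
        (trivializationAt ℂ L y).open_baseSet.mem_nhds hyy] with u hu hu'
      exact localRep_trans s.1 hu hu'
    have h2 := (hg2.hasMFDerivAt.mul hl.hasMFDerivAt).mfderiv
    have h3 := h1.mfderiv_eq (I := 𝓘(ℝ, E)) (I' := 𝓘(ℝ, ℂ))
    exact (congrArg (fun T : E →L[ℝ] ℂ => T w) (h3.trans h2)).trans rfl
  have hf : frame L x₀ y = transFun L x₀ y y • frame L y y := eq_localRep_smul hyy (frame L x₀)
  -- By the Leibniz rule the change of trivialization adds a multiple of the differential of the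
  -- transition function. This differential is complex linear, so the extra term is cancelled by its
  -- image under `i · (i u)`.
  rw [dbar, symm_eq_smul hyy, hf, smul_smul, ← chartT_I_smul hy.1, hs, hs, hD, hD,
    realD_I_smul hg1]
  congr 1
  rw [smul_eq_mul]
  linear_combination (1 / 2 : ℂ) * localRep s.1 x₀ y * realD (transFun L x₀ y) y u * Complex.I_mul_I

theorem dbar_self (s : CSec E L) (x : X) (u : E) :
    dbar s x u = ((1 / 2 : ℂ) * (dloc s x u + Complex.I * dloc s x (Complex.I • u))) •
      frame L x x := by
  rw [dbar, symm_eq_smul (mem_baseSet_trivializationAt ℂ L x)]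

/-- A section satisfies `∂̄ s = 0` at `x` iff its differential is complex linear. -/
theorem dbar_eq_zero_iff (s : CSec E L) (x : X) :
    (∀ u, dbar s x u = 0) ↔ ∀ u, dloc s x (Complex.I • u) = Complex.I * dloc s x u := by
  have hI := Complex.I_mul_I
  constructor
  · intro h u
    have h1 := h u
    rw [dbar_self, ← zero_smul ℂ (frame L x x)] at h1
    have h2 := smul_frame_inj (mem_baseSet_trivializationAt ℂ L x) h1
    linear_combination (-2 * Complex.I) * h2 + dloc s x (Complex.I • u) * hI
  · intro h u
    rw [dbar_self, h u, ← mul_assoc, hI]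
    simp

end Base

/-! ### Hadamard's lemma for derivations -/

/-- A derivation vanishes at a point on the functions with vanishing differential there. -/
theorem derivation_apply_eq_zero {𝕜 A N V : Type*} [NormedField 𝕜] [NormedAlgebra ℝ 𝕜]
    [CompleteSpace 𝕜] [CommRing A] [Algebra 𝕜 A] [NormedAddCommGroup V] [NormedSpace ℝ V]
    [FiniteDimensional ℝ V] (ev : N → A →ₐ[𝕜] 𝕜)
    (hev : ∀ a b, (∀ n, ev n a = ev n b) → a = b)
    {C : Set V} (hC : IsOpen C) {n₀ : N} {Ψ : N → V} (hs : StarConvex ℝ (Ψ n₀) C) {κ : N → 𝕜}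
    (hκ : κ n₀ = 1) (hκC : ∀ n, κ n ≠ 0 → Ψ n ∈ C)
    (hA : ∀ h : V → 𝕜, ContDiffOn ℝ ∞ h C → ∃ b : A, ∀ n, ev n b = κ n * h (Ψ n))
    {F : V → 𝕜} (hF : ContDiffOn ℝ ∞ F C) (hF0 : fderiv ℝ F (Ψ n₀) = 0) {a : A}
    (ha : ∀ n, κ n ≠ 0 → ev n a = F (Ψ n)) (ξ : Derivation 𝕜 A A) : ev n₀ (ξ a) = 0 := by
  obtain ⟨g, hg, hg0, hgF⟩ := exists_hadamard hC hs hF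
  let b := Module.finBasis ℝ V
  have hcoord : ∀ k, ContDiff ℝ ∞ fun p : V => algebraMap ℝ 𝕜 (b.coord k (p - Ψ n₀)) := fun k =>
    (algebraMapCLM ℝ 𝕜).contDiff.comp
      ((LinearMap.toContinuousLinearMap (b.coord k)).contDiff.comp (contDiff_id.sub contDiff_const))
  choose f hf using fun k => hA _ (hcoord k).contDiffOn
  choose q hq using fun k => hA (fun p => g p (b k)) (hg.clm_apply contDiffOn_const)
  obtain ⟨κ', hκ'⟩ := hA (fun _ => 1) contDiffOn_const
  -- Hadamard's lemma as an identity in `A`: the `f k` are the coordinates, which vanish at `n₀`,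
  -- and the `q k` are the mean partial derivatives, which vanish there because `F` has zero
  -- differential. Applying `ξ`, the Leibniz rule kills every product at `n₀`, while the left side
  -- yields `ξ a`.
  have h1 : κ' * κ' * (a - algebraMap 𝕜 A (F (Ψ n₀))) = ∑ k, f k * q k := by
    refine hev _ _ fun n => ?_
    simp only [map_mul, map_sub, map_sum, AlgHom.commutes, hf, hq, hκ', Algebra.algebraMap_self,
      RingHom.id_apply, mul_one]
    by_cases hn : κ n = 0
    · simp [hn]
    · have h2 : Ψ n - Ψ n₀ = ∑ k, b.coord k (Ψ n - Ψ n₀) • b k := (b.sum_repr _).symm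
      have h3 : g (Ψ n) (Ψ n - Ψ n₀) =
          ∑ k, algebraMap ℝ 𝕜 (b.coord k (Ψ n - Ψ n₀)) * g (Ψ n) (b k) := by
        conv_lhs => rw [h2]
        rw [map_sum]
        refine Finset.sum_congr rfl fun k _ => ?_
        rw [map_smul, Algebra.smul_def]
      rw [ha n hn, hgF _ (hκC n hn), add_sub_cancel_left, h3, Finset.mul_sum]
      exact Finset.sum_congr rfl fun k _ => by
        simp only [map_sub]; rw [mul_mul_mul_comm]
  have h2 := congrArg (fun c => ev n₀ (ξ c)) h1
  have h3 : ∀ k, ev n₀ (f k) = 0 := fun k => by rw [hf]; simp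
  have h4 : ∀ k, ev n₀ (q k) = 0 := fun k => by rw [hq, hg0, hF0]; simp
  have h5 : ev n₀ κ' = 1 := by rw [hκ', hκ, one_mul]
  have h6 : ev n₀ a = F (Ψ n₀) := ha n₀ (by rw [hκ]; exact one_ne_zero)
  simpa [h3, h4, h5, h6] using h2

/-! ### Complex linear parts -/

section LinPart

variable {V : Type*} [NormedAddCommGroup V] [NormedSpace ℂ V]

/-- The complex linear part of a real linear functional with complex values. -/
def linPart (D : V →L[ℝ] ℂ) : V →L[ℂ] ℂ where
  toFun u := (1 / 2 : ℂ) * (D u - Complex.I * D (Complex.I • u))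
  map_add' u w := by simp only [smul_add, map_add]; ring
  map_smul' c u := by
    have h : ∀ (c : ℂ) (w : V), D (c • w) = c.re * D w + c.im * D (Complex.I • w) := by
      intro c w
      conv_lhs => rw [← Complex.re_add_im c, add_smul, mul_smul, map_add]
      simp only [Complex.coe_smul, map_smul, Complex.real_smul]
    have h2 : ∀ w, D (Complex.I • Complex.I • w) = -D w := fun w => by
      rw [smul_smul, Complex.I_mul_I, neg_one_smul, map_neg]
    rw [smul_comm Complex.I c u, h c u, h c (Complex.I • u), h2, RingHom.id_apply, smul_eq_mul]
    conv_rhs => rw [← Complex.re_add_im c]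
    linear_combination (1 / 2 : ℂ) * c.im * D (Complex.I • u) * Complex.I_mul_I
  cont := by fun_prop

theorem linPart_apply (D : V →L[ℝ] ℂ) (u : V) :
    linPart D u = (1 / 2 : ℂ) * (D u - Complex.I * D (Complex.I • u)) := rfl

theorem linPart_of_linear {D : V →L[ℝ] ℂ} (h : ∀ u, D (Complex.I • u) = Complex.I * D u) (u : V) :
    linPart D u = D u := by
  rw [linPart_apply, h]
  linear_combination (-(1 / 2 : ℂ) * D u) * Complex.I_mul_I

theorem linPart_of_anti {D : V →L[ℝ] ℂ} (h : ∀ u, D (Complex.I • u) = -(Complex.I * D u)) :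
    linPart D = 0 := by
  ext u
  rw [linPart_apply, h]
  change _ = (0 : ℂ)
  linear_combination ((1 / 2 : ℂ) * D u) * Complex.I_mul_I

/-- The difference of a functional and its complex linear part is antilinear. -/
theorem sub_linPart_I (D : V →L[ℝ] ℂ) (u : V) : D (Complex.I • u) - linPart D (Complex.I • u) =
    -(Complex.I * (D u - linPart D u)) := by
  rw [linPart_apply, linPart_apply, smul_smul, Complex.I_mul_I, neg_one_smul, map_neg]
  linear_combination (1 / 2 : ℂ) * D (Complex.I • u) * Complex.I_mul_I

end LinPart

/-! ### Derivations on the base -/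

section BaseDer

open Bundle TopologicalSpace

variable {E : Type*} [NormedAddCommGroup E] [NormedSpace ℂ E]
  {X : Type*} [TopologicalSpace X] [ChartedSpace E X]
  {L : X → Type*} [∀ x, AddCommGroup (L x)] [∀ x, Module ℂ (L x)] [∀ x, TopologicalSpace (L x)]
  [TopologicalSpace (TotalSpace ℂ L)] [FiberBundle ℂ L] [VectorBundle ℂ ℂ L]

/-- Evaluation of smooth functions at a point. -/
def evC (x : X) : CFun E X →ₐ[ℂ] ℂ where
  toFun f := f.1 x
  map_one' := rfl
  map_mul' _ _ := rfl
  map_zero' := rfl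
  map_add' _ _ := rfl
  commutes' _ := rfl

theorem CFun.ext {f g : CFun E X} (h : ∀ x, evC x f = evC x g) : f = g := Subtype.ext (funext h)

/-- Evaluation of smooth sections at a point. -/
def evL (x : X) : CSec E L →ₗ[ℂ] L x where
  toFun s := s.1 x
  map_add' _ _ := rfl
  map_smul' _ _ := rfl

theorem evL_ext {s t : CSec E L} (h : ∀ x, evL x s = evL x t) : s = t := Subtype.ext (funext h)

@[simp] theorem evL_smul (f : CFun E X) (s : CSec E L) (x : X) :
    evL x (f • s) = evC x f • evL x s := rfl

/-- The local representation of a smooth section. -/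
def loc (s : CSec E L) (x₀ y : X) : ℂ := localRep s.1 x₀ y

variable [FiniteDimensional ℂ E] [T2Space X] [IsManifold 𝓘(ℂ, E) ω X]
  [ContMDiffVectorBundle ω ℂ L 𝓘(ℂ, E)]

attribute [local instance] isManifold_real

theorem smooth_fun (f : CFun E X) : ContMDiff 𝓘(ℝ, E) 𝓘(ℝ, ℂ) ∞ fun x => evC x f := f.2

theorem smooth_loc (s : CSec E L) {x₀ y : X} (hy : y ∈ goodSet E L x₀) :
    ContMDiffAt 𝓘(ℝ, E) 𝓘(ℝ, ℂ) ∞ (loc s x₀) y := contMDiffAt_localRep s hy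

section
variable {x₀ y : X} (hy : y ∈ (trivializationAt ℂ L x₀).baseSet)
include hy

theorem evL_eq (s : CSec E L) : evL y s = loc s x₀ y • frame L x₀ y := eq_localRep_smul hy s.1
theorem loc_add (s t : CSec E L) : loc (s + t) x₀ y = loc s x₀ y + loc t x₀ y :=
  localRep_of_add hy rfl
theorem loc_fsmul (f : CFun E X) (s : CSec E L) : loc (f • s) x₀ y = evC y f * loc s x₀ y :=
  localRep_of_smul hy rfl
theorem loc_smul (c : ℂ) (s : CSec E L) : loc (c • s) x₀ y = c * loc s x₀ y :=
  localRep_of_smul hy rfl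
theorem loc_sub (s t : CSec E L) : loc (s - t) x₀ y = loc s x₀ y - loc t x₀ y := by
  refine smul_frame_inj hy ?_
  rw [← evL_eq hy, sub_smul, ← evL_eq hy, ← evL_eq hy, map_sub]
theorem loc_eq_zero_iff (s : CSec E L) : loc s x₀ y = 0 ↔ evL y s = 0 :=
  localRep_eq_zero_iff hy s.1

end

theorem chartD_const_mul (c : ℂ) {p y : X} {h : X → ℂ} (hy : y ∈ (extChartAt 𝓘(ℝ, E) p).source)
    (hh : ContMDiffAt 𝓘(ℝ, E) 𝓘(ℝ, ℂ) ∞ h y) (u : E) :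
    chartD 𝓘(ℝ, E) p (fun z => c * h z) y u = c * chartD 𝓘(ℝ, E) p h y u :=
  congrArg (fun T : E →L[ℝ] ℂ => T u) (chartD_clm (ContinuousLinearMap.mul ℝ ℂ c) hy hh)

theorem mem_nhds_base {x₀ y : X} (hy : y ∈ goodSet E L x₀) :
    ∀ᶠ z in nhds y, z ∈ goodSet E L x₀ := (isOpen_goodSet x₀).mem_nhds hy

section
variable {x₀ y : X} (hy : y ∈ goodSet E L x₀)
include hy

theorem secD_fsmul (f : CFun E X) (s : CSec E L) (u : E) : secD E (f • s) x₀ y u =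
    evC y f * secD E s x₀ y u + loc s x₀ y * chartD 𝓘(ℝ, E) x₀ (fun z => evC z f) y u := by
  have hs := mem_source_of_goodSet hy
  have h1 := chartD_mul hs (smooth_fun f y) (smooth_loc s hy) u
  refine (congrArg (fun T : E →L[ℝ] ℂ => T u) (chartD_congr hs ?_)).trans h1
  filter_upwards [mem_nhds_base hy] with z hz using loc_fsmul hz.2 f s

theorem secD_smul (c : ℂ) (s : CSec E L) (u : E) :
    secD E (c • s) x₀ y u = c * secD E s x₀ y u := by
  have hs := mem_source_of_goodSet hy
  refine (congrArg (fun T : E →L[ℝ] ℂ => T u) (chartD_congr hs ?_)).trans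
    (chartD_const_mul c hs (smooth_loc s hy) u)
  filter_upwards [mem_nhds_base hy] with z hz using loc_smul hz.2 c s

theorem secD_add (s t : CSec E L) (u : E) :
    secD E (s + t) x₀ y u = secD E s x₀ y u + secD E t x₀ y u := by
  have hs := mem_source_of_goodSet hy
  refine (congrArg (fun T : E →L[ℝ] ℂ => T u) ((chartD_congr hs ?_).trans
    (chartD_add hs (smooth_loc s hy) (smooth_loc t hy))))
  filter_upwards [mem_nhds_base hy] with z hz using loc_add hz.2 s t

theorem secD_sub (s t : CSec E L) (u : E) :
    secD E (s - t) x₀ y u = secD E s x₀ y u - secD E t x₀ y u := by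
  rw [sub_eq_add_neg, ← neg_one_smul ℂ t, secD_add hy, secD_smul hy]; ring

end

theorem dloc_sub (s t : CSec E L) (x : X) (u : E) : dloc (s - t) x u = dloc s x u - dloc t x u := by
  simp only [dloc_eq_secD]; exact secD_sub (mem_goodSet x) s t u
theorem dloc_smul (c : ℂ) (t : CSec E L) (x : X) (u : E) : dloc (c • t) x u = c * dloc t x u := by
  simp only [dloc_eq_secD]; exact secD_smul (mem_goodSet x) c t u

theorem evC_cutFun (x₀ y : X) (h : X → ℂ)
    (hh : ∀ y ∈ goodSet E L x₀, ContMDiffAt 𝓘(ℝ, E) 𝓘(ℝ, ℂ) ∞ h y) :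
    evC y (cutFun L x₀ h hh) = cut E L x₀ y * h y := Complex.real_smul

theorem evL_cutSec (x₀ y : X) (h : X → ℂ)
    (hh : ∀ y ∈ goodSet E L x₀, ContMDiffAt 𝓘(ℝ, E) 𝓘(ℝ, ℂ) ∞ h y) :
    evL y (cutSec (L := L) x₀ h hh) = (cut E L x₀ y * h y) • frame L x₀ y :=
  congrArg (fun c : ℂ => c • frame L x₀ y) Complex.real_smul

/-- Two functions which agree after multiplication by the bump function. -/
theorem cut_mul_congr {x₀ y : X} {a b : ℂ} (h : y ∈ goodSet E L x₀ → a = b) :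
    (cut E L x₀ y : ℂ) * a = cut E L x₀ y * b := by
  by_cases hy : y ∈ goodSet E L x₀
  · rw [h hy]
  · rw [cut_eq_zero hy]; simp

variable (L) in
/-- The function `χ ∂_u f`. -/
def pdFun (x₀ : X) (u : E) (f : CFun E X) : CFun E X :=
  cutFun L x₀ (fun y => chartD 𝓘(ℝ, E) x₀ (fun z => evC z f) y u) fun _ hy =>
    (ContinuousLinearMap.apply ℝ ℂ u).contDiff.contDiffAt.comp_contMDiffAt
      (contMDiffAt_chartD (mem_source_of_goodSet hy) (smooth_fun f).contMDiffAt)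

theorem evC_pdFun (x₀ : X) (u : E) (f : CFun E X) (y : X) :
    evC y (pdFun L x₀ u f) = cut E L x₀ y * chartD 𝓘(ℝ, E) x₀ (fun z => evC z f) y u :=
  Complex.real_smul

variable (L) in
/-- The coordinate vector field `χ ∂_u` at `x₀`. -/
def pd (x₀ : X) (u : E) : CVec E X :=
  Derivation.mk'
    { toFun := pdFun L x₀ u
      map_add' f g := CFun.ext fun y => by
        rw [map_add, evC_pdFun, evC_pdFun, evC_pdFun, ← mul_add]
        refine cut_mul_congr fun hy => ?_
        exact congrArg (fun T : E →L[ℝ] ℂ => T u)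
          (chartD_add (mem_source_of_goodSet hy) (smooth_fun f y) (smooth_fun g y))
      map_smul' c f := CFun.ext fun y => by
        rw [RingHom.id_apply, map_smul, evC_pdFun, evC_pdFun, smul_eq_mul, mul_left_comm]
        exact cut_mul_congr fun hy =>
          chartD_const_mul c (mem_source_of_goodSet hy) (smooth_fun f y) u }
    fun f g => CFun.ext fun y => by
      refine (evC_pdFun x₀ u (f * g) y).trans ?_
      rw [map_add, smul_eq_mul, smul_eq_mul, map_mul, map_mul]
      change _ = evC y f * evC y (pdFun L x₀ u g) + evC y g * evC y (pdFun L x₀ u f)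
      rw [evC_pdFun, evC_pdFun, mul_left_comm, mul_left_comm (evC y g), ← mul_add]
      exact cut_mul_congr fun hy =>
        chartD_mul (mem_source_of_goodSet hy) (smooth_fun f y) (smooth_fun g y) u

theorem evC_pd (x₀ : X) (u : E) (f : CFun E X) (y : X) :
    evC y (pd L x₀ u f) = cut E L x₀ y * chartD 𝓘(ℝ, E) x₀ (fun z => evC z f) y u :=
  evC_pdFun x₀ u f y

variable (L) in
/-- The vector field `χ ∂̄_u` of type `(0,1)`. -/
def pd01 (x₀ : X) (u : E) : CVec E X :=
  (1 / 2 : ℂ) • (pd L x₀ u + Complex.I • pd L x₀ (Complex.I • u))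

variable (L) in
/-- The vector field `χ ∂_u` of type `(1,0)`. -/
def pd10 (x₀ : X) (u : E) : CVec E X :=
  (1 / 2 : ℂ) • (pd L x₀ u - Complex.I • pd L x₀ (Complex.I • u))

theorem evC_pd01 (x₀ : X) (u : E) (f : CFun E X) (y : X) :
    evC y (pd01 L x₀ u f) =
      cut E L x₀ y * ((1 / 2 : ℂ) * (chartD 𝓘(ℝ, E) x₀ (fun z => evC z f) y u +
      Complex.I * chartD 𝓘(ℝ, E) x₀ (fun z => evC z f) y (Complex.I • u))) := by
  simp only [pd01, Derivation.smul_apply, Derivation.add_apply, map_smul, map_add, evC_pd,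
    smul_eq_mul]
  ring

theorem evC_pd10 (x₀ : X) (u : E) (f : CFun E X) (y : X) :
    evC y (pd10 L x₀ u f) =
      cut E L x₀ y * ((1 / 2 : ℂ) * (chartD 𝓘(ℝ, E) x₀ (fun z => evC z f) y u -
      Complex.I * chartD 𝓘(ℝ, E) x₀ (fun z => evC z f) y (Complex.I • u))) := by
  simp only [pd10, Derivation.smul_apply, Derivation.sub_apply, map_smul, map_sub, evC_pd,
    smul_eq_mul]
  ring

theorem dfun_apply_eq (f : CFun E X) {x₀ y : X} (hy : y ∈ (chartAt E x₀).source) (u : E) :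
    dfun f y u = chartD 𝓘(ℝ, E) x₀ (fun z => evC z f) y (chartT E x₀ y u) :=
  congrArg (fun T : E →L[ℝ] ℂ => T u) (dfun_eq_chartD f hy)

theorem chartD_I_smul_of {x₀ y : X} (hy : y ∈ (chartAt E x₀).source) (f : CFun E X) {c : ℂ}
    (h : ∀ v, dfun f y (Complex.I • v) = c * dfun f y v) (u : E) :
    chartD 𝓘(ℝ, E) x₀ (fun z => evC z f) y (Complex.I • u) =
      c * chartD 𝓘(ℝ, E) x₀ (fun z => evC z f) y u := by
  obtain ⟨w, rfl⟩ := chartT_surjective hy u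
  have h1 := h w
  rwa [dfun_apply_eq f hy, dfun_apply_eq f hy, chartT_I_smul hy] at h1

theorem pd10_mem (x₀ : X) (u : E) : pd10 L x₀ u ∈ T10 E X := by
  intro f y hf
  change evC y (pd10 L x₀ u f) = 0
  rw [evC_pd10, ← mul_zero (cut E L x₀ y : ℂ)]
  refine cut_mul_congr fun hy => ?_
  rw [chartD_I_smul_of hy.1 f (c := -Complex.I) (fun v => by rw [hf v]; ring)]
  linear_combination (1 / 2 : ℂ) * chartD 𝓘(ℝ, E) x₀ (fun z => evC z f) y u * Complex.I_mul_I

/-- A complex vector field vanishes at a point on the functions with vanishing differential. -/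
theorem cvec_apply_eq_zero (ξ : CVec E X) {f : CFun E X} {x : X} (h : dfun f x = 0) :
    evC x (ξ f) = 0 := by
  have : FiniteDimensional ℝ E := FiniteDimensional.complexToReal E
  set ψ := extChartAt 𝓘(ℝ, E) x with hψ
  have hx : x ∈ ψ.source := mem_extChartAt_source x
  -- Hadamard's lemma needs a star-convex domain, so the chart is restricted to a ball.
  obtain ⟨r, hr, hrC⟩ := Metric.isOpen_iff.1 (isOpen_extChartAt_target (I := 𝓘(ℝ, E)) x) (ψ x)
    (ψ.map_source hx)
  have hW : ψ.source ∩ ψ ⁻¹' Metric.ball (ψ x) r ∈ nhds x :=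
    Filter.inter_mem (extChartAt_source_mem_nhds x)
      ((continuousAt_extChartAt x).preimage_mem_nhds (Metric.ball_mem_nhds _ hr))
  obtain ⟨χ, hχ, hχ1, hχs⟩ := exists_bump (E := E) hW
  have hsup : ∀ y, (χ y : ℂ) ≠ 0 → y ∈ ψ.source ∩ ψ ⁻¹' Metric.ball (ψ x) r := fun y hy =>
    hχs (subset_tsupport χ fun h0 => hy (by rw [h0]; simp))
  refine derivation_apply_eq_zero (N := X) evC (fun _ _ => CFun.ext) Metric.isOpen_ball
    (n₀ := x) (Ψ := ψ) (κ := fun y => (χ y : ℂ))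
    (((convex_ball _ _).starConvex (Metric.mem_ball_self hr)))
    (by rw [hχ1.self_of_nhds]; simp) (fun y hy => (hsup y hy).2) ?_
    (F := fun z => evC (ψ.symm z) f) ?_ ?_ ?_ ξ
  · intro k hk
    refine ⟨⟨fun y => χ y • k (ψ y), contMDiff_bump_smul hχ fun y hy => ?_⟩,
      fun n => Complex.real_smul⟩
    exact ((hk.contDiffAt (Metric.isOpen_ball.mem_nhds (hχs hy).2)).comp_contMDiffAt
      (contMDiffAt_extChart (hχs hy).1))
  · intro z hz
    have h1 := contDiffAt_chart (ψ.map_target (hrC hz)) (smooth_fun f (ψ.symm z))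
    rw [← hψ, ψ.right_inv (hrC hz)] at h1
    exact h1.contDiffWithinAt
  · rw [dfun_eq_chartD_self] at h
    exact h
  · intro n hn
    rw [ψ.left_inv (hsup n hn).1]

/-! ### The `∂̄`-derivations of the line bundle -/

variable (L) in
/-- The local trivialization of sections at `x₀`, multiplied by the bump function. -/
def locFun (x₀ : X) : CSec E L →ₗ[CFun E X] CFun E X where
  toFun s := cutFun L x₀ (loc s x₀) fun _ hy => smooth_loc s hy
  map_add' s t := CFun.ext fun y => by
    rw [map_add, evC_cutFun, evC_cutFun, evC_cutFun, ← mul_add]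
    exact cut_mul_congr fun hy => loc_add hy.2 s t
  map_smul' f s := CFun.ext fun y => by
    rw [RingHom.id_apply, smul_eq_mul, map_mul, evC_cutFun, evC_cutFun, mul_left_comm]
    exact cut_mul_congr fun hy => loc_fsmul hy.2 f s

theorem evC_locFun (x₀ y : X) (s : CSec E L) :
    evC y (locFun L x₀ s) = cut E L x₀ y * loc s x₀ y := Complex.real_smul

/-- Two vectors which agree after multiplication by the bump function. -/
theorem cut_smul_congr {x₀ y : X} {a b : L y} (h : y ∈ goodSet E L x₀ → a = b) :
    (cut E L x₀ y : ℂ) • a = (cut E L x₀ y : ℂ) • b := by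
  by_cases hy : y ∈ goodSet E L x₀
  · rw [h hy]
  · rw [cut_eq_zero hy]; simp

/-- Both sides are the bump function times the product of the two local representations, since the
rank is one. This identity replaces division by a local frame: applying a derivation to it turns
statements on sections into statements on functions. -/
theorem locFun_smul (x₀ : X) (s t : CSec E L) : locFun L x₀ s • t = locFun L x₀ t • s := by
  refine evL_ext fun y => ?_
  rw [evL_smul, evL_smul, evC_locFun, evC_locFun, mul_smul, mul_smul]
  refine cut_smul_congr fun hy => ?_
  rw [evL_eq hy.2 s, evL_eq hy.2 t, smul_smul, smul_smul, mul_comm]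

theorem dfun_locFun (s : CSec E L) (x : X) : dfun (locFun L x s) x = dloc s x := by
  refine (dfun_eq_chartD_self (locFun L x s) x).trans ?_
  rw [dloc_eq_secD]
  refine chartD_congr (mem_extChartAt_source x) ?_
  filter_upwards [cut_eventually E L x] with y hy
  change evC y (locFun L x s) = loc s x y
  rw [evC_locFun, hy]; simp

/-- A smooth section which is nonzero at `x`. -/
theorem exists_sec_ne_zero (x : X) : ∃ s : CSec E L, evC x (locFun L x s) = 1 := by
  refine ⟨cutSec x (fun _ => 1) fun _ _ => contMDiffAt_const, ?_⟩
  rw [evC_locFun, loc, localRep_cutSec (mem_goodSet x), cut_self]; simp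

theorem evC_locFun_eq_zero_iff (x : X) (s : CSec E L) : evC x (locFun L x s) = 0 ↔ evL x s = 0 := by
  rw [evC_locFun, cut_self, Complex.ofReal_one, one_mul,
    loc_eq_zero_iff (mem_baseSet_trivializationAt ℂ L x)]

/-- A derivation of `L` vanishes at a point on the sections with vanishing `1`-jet. -/
theorem gauge_apply_eq_zero (Δ : Gauge ℂ (CFun E X) (CSec E L)) {s : CSec E L} {x : X}
    (h0 : evL x s = 0) {S : CVec E X} (hS : IsSymbol Δ.1 S)
    (h1 : evC x (S (locFun L x s)) = 0) : evL x (Δ.1 s) = 0 := by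
  obtain ⟨t, ht⟩ := exists_sec_ne_zero (E := E) (L := L) x
  -- Expand `Δ` on both sides by its symbol. At `x` all terms vanish by assumption except `Δ s`,
  -- whose coefficient is `1`.
  have h2 := congrArg (fun r => evL x (Δ.1 r)) (locFun_smul x s t)
  have h3 := (evC_locFun_eq_zero_iff x s).2 h0
  simp only [hS _ _, map_add, evL_smul, h0, h1, h3, ht] at h2
  simpa using h2.symm

theorem gauge_apply_eq_zero_of_jet (Δ : Gauge ℂ (CFun E X) (CSec E L)) {s : CSec E L} {x : X}
    (h0 : evL x s = 0) (h1 : dloc s x = 0) : evL x (Δ.1 s) = 0 := by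
  obtain ⟨S, hS⟩ := Δ.2
  exact gauge_apply_eq_zero Δ h0 hS (cvec_apply_eq_zero S (by rw [dfun_locFun, h1]))

variable (E L) in
/-- The functional computing `∂̄_u` of a section in the trivialization at `x₀`. -/
def barD (s : CSec E L) (x₀ : X) (u : E) (y : X) : ℂ :=
  (1 / 2 : ℂ) * (secD E s x₀ y u + Complex.I * secD E s x₀ y (Complex.I • u))

theorem smooth_barD (s : CSec E L) (x₀ : X) (u : E) {y : X} (hy : y ∈ goodSet E L x₀) :
    ContMDiffAt 𝓘(ℝ, E) 𝓘(ℝ, ℂ) ∞ (barD E L s x₀ u) y := by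
  have h1 : ∀ w : E, ContMDiffAt 𝓘(ℝ, E) 𝓘(ℝ, ℂ) ∞ (fun y => secD E s x₀ y w) y := fun w =>
    (ContinuousLinearMap.apply ℝ ℂ w).contDiff.contDiffAt.comp_contMDiffAt
      (contMDiffAt_chartD (mem_source_of_goodSet hy) (smooth_loc s hy))
  exact contMDiffAt_mul_complex E contMDiffAt_const
    ((h1 u).add (contMDiffAt_mul_complex E contMDiffAt_const (h1 _)))

variable (L) in
/-- The section `χ ∂̄_u s`. -/
def barSec (x₀ : X) (u : E) (s : CSec E L) : CSec E L :=
  cutSec x₀ (barD E L s x₀ u) fun _ hy => smooth_barD s x₀ u hy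

theorem evL_barSec (x₀ : X) (u : E) (s : CSec E L) (y : X) :
    evL y (barSec L x₀ u s) = (cut E L x₀ y : ℂ) • barD E L s x₀ u y • frame L x₀ y := by
  rw [smul_smul]; exact evL_cutSec _ _ _ fun _ hy => smooth_barD s x₀ u hy

variable (L) in
/-- The operator `χ ∂̄_u`. -/
def barLin (x₀ : X) (u : E) : CSec E L →ₗ[ℂ] CSec E L where
  toFun := barSec L x₀ u
  map_add' s t := evL_ext fun y => by
    rw [map_add, evL_barSec, evL_barSec, evL_barSec, ← smul_add]
    refine cut_smul_congr fun hy => ?_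
    simp only [barD, secD_add hy, ← add_smul]
    congr 1; ring
  map_smul' c s := evL_ext fun y => by
    rw [map_smul, evL_barSec, evL_barSec, RingHom.id_apply, smul_comm c]
    refine cut_smul_congr fun hy => ?_
    simp only [barD, secD_smul hy, smul_smul]
    congr 1; ring

theorem evL_barLin (x₀ : X) (u : E) (s : CSec E L) (y : X) :
    evL y (barLin L x₀ u s) = (cut E L x₀ y : ℂ) • barD E L s x₀ u y • frame L x₀ y :=
  evL_barSec x₀ u s y

theorem barLin_symbol (x₀ : X) (u : E) : IsSymbol (barLin L x₀ u) (pd01 L x₀ u) := fun f s =>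
  evL_ext fun y => by
    rw [map_add, evL_smul, evL_smul, evL_barLin, evL_barLin, evC_pd01, mul_smul,
      smul_comm (evC y f), ← smul_add]
    refine cut_smul_congr fun hy => ?_
    simp only [barD, secD_fsmul hy, evL_eq hy.2 s, smul_smul, ← add_smul]
    congr 1; ring

variable (L) in
/-- The derivation `χ ∂̄_u` of the line bundle. -/
def dbarOp (x₀ : X) (u : E) : Gauge ℂ (CFun E X) (CSec E L) :=
  ⟨barLin L x₀ u, pd01 L x₀ u, barLin_symbol x₀ u⟩

theorem dbar_eq_barD (s : CSec E L) {x₀ y : X} (hy : y ∈ goodSet E L x₀) (u : E) :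
    dbar s y u = barD E L s x₀ (chartT E x₀ y u) y • frame L x₀ y := dbar_eq s hy u

theorem dbarOp_self (x : X) (u : E) (s : CSec E L) : evL x ((dbarOp L x u).1 s) = dbar s x u := by
  rw [dbar_eq_barD s (mem_goodSet x), chartT_self]
  refine (evL_barLin x u s x).trans ?_
  rw [cut_self]; simp

/-- In the chart at `x₀` the required vector field is `u` times the bump function, and outside
`goodSet` it is zero. Hence `dbarOp` is among the derivations on which `DbarClosed` is tested. -/
theorem exists_isDbar (x₀ : X) (u : E) : ∃ V, IsDbar (dbarOp L x₀ u) V := by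
  have h : ∀ y, ∃ w : E, ∀ s : CSec E L, evL y ((dbarOp L x₀ u).1 s) = dbar s y w := by
    intro y
    by_cases hy : y ∈ goodSet E L x₀
    · obtain ⟨w, hw⟩ := chartT_surjective hy.1 (cut E L x₀ y • u)
      refine ⟨w, fun s => ?_⟩
      rw [dbar_eq_barD s hy, hw]
      refine (evL_barLin x₀ u s y).trans ?_
      have e : ∀ w, secD E s x₀ y (cut E L x₀ y • w) = cut E L x₀ y * secD E s x₀ y w :=
        fun w => by rw [map_smul, Complex.real_smul]
      rw [barD, barD, smul_comm Complex.I (cut E L x₀ y) u, e, e, smul_smul]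
      congr 1; ring
    · refine ⟨0, fun s => ?_⟩
      refine (evL_barLin x₀ u s y).trans ?_
      rw [cut_eq_zero hy, dbar_self]; simp
  choose V hV using h
  exact ⟨V, fun s y => hV y s⟩

end BaseDer

/-! ### Locally holomorphic sections -/

section Hol

open Bundle TopologicalSpace

variable {E : Type*} [NormedAddCommGroup E] [NormedSpace ℂ E]
  {X : Type*} [TopologicalSpace X] [ChartedSpace E X]
  {L : X → Type*} [∀ x, AddCommGroup (L x)] [∀ x, Module ℂ (L x)] [∀ x, TopologicalSpace (L x)]
  [TopologicalSpace (TotalSpace ℂ L)] [FiberBundle ℂ L] [VectorBundle ℂ ℂ L]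

/-- The section satisfies `∂̄ s = 0` at the point `x`. -/
def HolAt (x : X) (s : CSec E L) : Prop := ∀ u, dbar s x u = 0

/-- The section is holomorphic near the point `x`. -/
def HolNear (x : X) (s : CSec E L) : Prop := ∀ᶠ y in nhds x, HolAt y s

theorem HolNear.holAt {x : X} {s : CSec E L} (h : HolNear x s) : HolAt x s := h.self_of_nhds

theorem HolNear.eventually {x : X} {s : CSec E L} (h : HolNear x s) :
    ∀ᶠ y in nhds x, HolNear y s := eventually_eventually_nhds.2 h

variable [FiniteDimensional ℂ E] [T2Space X] [IsManifold 𝓘(ℂ, E) ω X]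
  [ContMDiffVectorBundle ω ℂ L 𝓘(ℂ, E)]

attribute [local instance] isManifold_real

theorem holAt_iff (x : X) (s : CSec E L) :
    HolAt x s ↔ ∀ u, dloc s x (Complex.I • u) = Complex.I * dloc s x u := dbar_eq_zero_iff s x

theorem HolAt.smul {x : X} {s : CSec E L} (h : HolAt x s) (c : ℂ) : HolAt x (c • s) := by
  rw [holAt_iff] at h ⊢
  intro u
  rw [dloc_smul, dloc_smul, h]; ring

theorem HolAt.sub {x : X} {s t : CSec E L} (h : HolAt x s) (h' : HolAt x t) : HolAt x (s - t) := by
  rw [holAt_iff] at h h' ⊢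
  intro u
  rw [dloc_sub, dloc_sub, h, h']; ring

theorem HolNear.smul {x : X} {s : CSec E L} (h : HolNear x s) (c : ℂ) : HolNear x (c • s) :=
  Filter.Eventually.mono h fun _ h => h.smul c

variable (E L) in
/-- The set where the bump function at `x₀` is locally one. -/
def core (x₀ : X) : Set X := interior {y | cut E L x₀ y = 1}

variable (E L) in
theorem isOpen_core (x₀ : X) : IsOpen (core E L x₀) := isOpen_interior

variable (E L) in
theorem mem_core (x₀ : X) : x₀ ∈ core E L x₀ :=
  mem_interior_iff_mem_nhds.2 (cut_eventually E L x₀)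

theorem core_cut {x₀ y : X} (hy : y ∈ core E L x₀) : cut E L x₀ y = 1 :=
  interior_subset (s := {y | cut E L x₀ y = 1}) hy

theorem core_good {x₀ y : X} (hy : y ∈ core E L x₀) : y ∈ goodSet E L x₀ := by
  by_contra h
  have := core_cut hy
  rw [cut_eq_zero h] at this
  exact zero_ne_one this

variable (E) in
/-- The chart at `x₀`, centered at `x₀`. -/
def centered (x₀ y : X) : E := extChartAt 𝓘(ℝ, E) x₀ y - extChartAt 𝓘(ℝ, E) x₀ x₀

theorem smooth_affine (x₀ : X) (c : ℂ) (β : E →L[ℝ] ℂ) {y : X} (hy : y ∈ goodSet E L x₀) :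
    ContMDiffAt 𝓘(ℝ, E) 𝓘(ℝ, ℂ) ∞ (fun y => c + β (centered E x₀ y)) y := by
  have h : ContDiff ℝ ∞ fun z : E => c + β (z - extChartAt 𝓘(ℝ, E) x₀ x₀) := by fun_prop
  exact h.contDiffAt.comp_contMDiffAt (contMDiffAt_extChart (mem_source_of_goodSet hy))

theorem chartD_affine {x₀ y : X} (c : ℂ) (β : E →L[ℝ] ℂ) (hy : y ∈ goodSet E L x₀) {h : X → ℂ}
    (hh : ∀ᶠ z in nhds y, h z = c + β (centered E x₀ z)) : chartD 𝓘(ℝ, E) x₀ h y = β := by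
  rw [chartD_comp (k := fun z : E => c + β (z - extChartAt 𝓘(ℝ, E) x₀ x₀))
    (mem_source_of_goodSet hy) hh]
  have h1 := ((β.hasFDerivAt.comp (extChartAt 𝓘(ℝ, E) x₀ y) ((hasFDerivAt_id _).sub_const
    (extChartAt 𝓘(ℝ, E) x₀ x₀))).const_add c).fderiv
  exact h1

/-- Local section with affine local representation. -/
def affSec (x₀ : X) (c : ℂ) (β : E →L[ℝ] ℂ) : CSec E L :=
  cutSec x₀ (fun y => c + β (centered E x₀ y)) fun _ hy => smooth_affine x₀ c β hy

theorem evL_affSec (x₀ : X) (c : ℂ) (β : E →L[ℝ] ℂ) (y : X) : evL y (affSec (L := L) x₀ c β) =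
    (cut E L x₀ y * (c + β (centered E x₀ y))) • frame L x₀ y :=
  evL_cutSec _ _ _ fun _ hy => smooth_affine x₀ c β hy

/-- The local section with affine holomorphic local representation in the chart and the
trivialization at `x₀`. -/
def holSec (x₀ : X) : (ℂ × (E →L[ℂ] ℂ)) →ₗ[ℂ] CSec E L where
  toFun p := affSec x₀ p.1 (p.2.restrictScalars ℝ)
  map_add' p q := evL_ext fun y => by
    rw [map_add, evL_affSec, evL_affSec, evL_affSec, ← add_smul]
    congr 1
    change _ * (p.1 + q.1 + (p.2 (centered E x₀ y) + q.2 (centered E x₀ y))) =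
      _ * (p.1 + p.2 (centered E x₀ y)) + _ * (q.1 + q.2 (centered E x₀ y))
    ring
  map_smul' c p := evL_ext fun y => by
    rw [RingHom.id_apply, map_smul, evL_affSec, evL_affSec, smul_smul]
    congr 1
    change _ * (c * p.1 + c * p.2 (centered E x₀ y)) = c * (_ * (p.1 + p.2 (centered E x₀ y)))
    ring

theorem loc_affSec {x₀ y : X} (hy : y ∈ core E L x₀) (c : ℂ) (β : E →L[ℝ] ℂ) :
    loc (affSec (L := L) x₀ c β) x₀ y = c + β (centered E x₀ y) := by
  refine smul_frame_inj (core_good hy).2 ?_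
  rw [← evL_eq (core_good hy).2, evL_affSec, core_cut hy, Complex.ofReal_one, one_mul]

theorem loc_holSec {x₀ y : X} (hy : y ∈ core E L x₀) (p : ℂ × (E →L[ℂ] ℂ)) :
    loc (holSec (L := L) x₀ p) x₀ y = p.1 + p.2 (centered E x₀ y) := loc_affSec hy _ _

theorem secD_holSec {x₀ y : X} (hy : y ∈ core E L x₀) (p : ℂ × (E →L[ℂ] ℂ)) :
    secD E (holSec (L := L) x₀ p) x₀ y = p.2.restrictScalars ℝ := by
  refine chartD_affine p.1 (p.2.restrictScalars ℝ) (core_good hy) ?_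
  filter_upwards [(isOpen_core E L x₀).mem_nhds hy] with z hz using loc_holSec hz p

theorem holAt_holSec {x₀ y : X} (hy : y ∈ core E L x₀) (p : ℂ × (E →L[ℂ] ℂ)) :
    HolAt y (holSec (L := L) x₀ p) := by
  intro u
  rw [dbar_eq_barD _ (core_good hy), barD, secD_holSec hy]
  change ((1 / 2 : ℂ) * (p.2 _ + Complex.I * p.2 (Complex.I • _))) • _ = _
  rw [map_smul, smul_eq_mul, ← mul_assoc Complex.I, Complex.I_mul_I]
  simp

theorem holNear_holSec {x₀ y : X} (hy : y ∈ core E L x₀) (p : ℂ × (E →L[ℂ] ℂ)) :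
    HolNear y (holSec (L := L) x₀ p) := by
  filter_upwards [(isOpen_core E L x₀).mem_nhds hy] with z hz using holAt_holSec hz p

theorem loc_holSec_self (x : X) (p : ℂ × (E →L[ℂ] ℂ)) : loc (holSec (L := L) x p) x x = p.1 := by
  rw [loc_holSec (mem_core E L x), centered, sub_self, map_zero, add_zero]

theorem dloc_holSec_self (x : X) (p : ℂ × (E →L[ℂ] ℂ)) :
    dloc (holSec (L := L) x p) x = p.2.restrictScalars ℝ := by
  rw [dloc_eq_secD, secD_holSec (mem_core E L x)]

variable (E L) in
/-- The holomorphic part of the `1`-jet of a section. -/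
def holPart (x : X) (s : CSec E L) : CSec E L := holSec x (loc s x x, linPart (dloc s x))

theorem holNear_holPart (x : X) (s : CSec E L) : HolNear x (holPart E L x s) :=
  holNear_holSec (mem_core E L x) _

theorem evL_holPart (x : X) (s : CSec E L) : evL x (holPart E L x s) = evL x s := by
  have h := mem_baseSet_trivializationAt ℂ L x
  rw [evL_eq h, evL_eq h s, holPart, loc_holSec_self]

theorem dloc_holPart (x : X) (s : CSec E L) (u : E) :
    dloc (holPart E L x s) x u = linPart (dloc s x) u := by
  rw [holPart, dloc_holSec_self]; rfl

theorem dloc_holPart_of_hol {x : X} {s : CSec E L} (h : HolAt x s) :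
    dloc (holPart E L x s) x = dloc s x := by
  ext u
  rw [dloc_holPart, linPart_of_linear ((holAt_iff x s).1 h)]

/-- The section `s` vanishes at `x`, with differential of type `(0,1)`. -/
def AntiJet (x : X) (s : CSec E L) : Prop :=
  evL x s = 0 ∧ ∀ u, dloc s x (Complex.I • u) = -(Complex.I * dloc s x u)

/-- What remains of the 1-jet after removing its complex linear part is antilinear, and a
bi-derivation of type `(2,0)` ignores it. At a given point every section may thus be replaced by one
that is holomorphic nearby. -/
theorem antiJet_sub_holPart (x : X) (s : CSec E L) : AntiJet x (s - holPart E L x s) := by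
  refine ⟨by rw [map_sub, evL_holPart, sub_self], fun u => ?_⟩
  rw [dloc_sub, dloc_sub, dloc_holPart, dloc_holPart]
  exact sub_linPart_I _ u

/-! ### Antiholomorphic functions -/

/-- The function is antiholomorphic near `x`. -/
def AntiHolNear (x : X) (f : CFun E X) : Prop :=
  ∀ᶠ y in nhds x, ∀ u, dfun f y (Complex.I • u) = -(Complex.I * dfun f y u)

variable (L) in
/-- Local function which is real affine in the chart at `x₀`. -/
def affFun (x₀ : X) (c : ℂ) (β : E →L[ℝ] ℂ) : CFun E X :=
  cutFun L x₀ (fun y => c + β (centered E x₀ y)) fun _ hy => smooth_affine x₀ c β hy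

theorem evC_affFun {x₀ y : X} (hy : y ∈ core E L x₀) (c : ℂ) (β : E →L[ℝ] ℂ) :
    evC y (affFun L x₀ c β) = c + β (centered E x₀ y) := by
  refine (evC_cutFun (L := L) x₀ y (fun y => c + β (centered E x₀ y))
    fun _ hy => smooth_affine x₀ c β hy).trans ?_
  rw [core_cut hy, Complex.ofReal_one, one_mul]

theorem chartD_affFun {x₀ y : X} (hy : y ∈ core E L x₀) (c : ℂ) (β : E →L[ℝ] ℂ) :
    chartD 𝓘(ℝ, E) x₀ (fun z => evC z (affFun L x₀ c β)) y = β := by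
  refine chartD_affine c β (core_good hy) ?_
  filter_upwards [(isOpen_core E L x₀).mem_nhds hy] with z hz using evC_affFun hz c β

theorem dfun_affFun {x₀ y : X} (hy : y ∈ core E L x₀) (c : ℂ) (β : E →L[ℝ] ℂ) (u : E) :
    dfun (affFun L x₀ c β) y u = β (chartT E x₀ y u) := by
  rw [dfun_apply_eq _ (core_good hy).1, chartD_affFun hy]

theorem dfun_affFun_self (x : X) (c : ℂ) (β : E →L[ℝ] ℂ) : dfun (affFun L x c β) x = β := by
  ext u
  rw [dfun_affFun (mem_core E L x), chartT_self]; rfl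

theorem antiHolNear_affFun {x₀ y : X} (hy : y ∈ core E L x₀) (c : ℂ) {β : E →L[ℝ] ℂ}
    (hβ : ∀ u, β (Complex.I • u) = -(Complex.I * β u)) : AntiHolNear y (affFun L x₀ c β) := by
  filter_upwards [(isOpen_core E L x₀).mem_nhds hy] with z hz u
  rw [dfun_affFun hz, dfun_affFun hz, chartT_I_smul (core_good hz).1, hβ]

theorem dloc_fsmul (f : CFun E X) (s : CSec E L) (x : X) (u : E) :
    dloc (f • s) x u = evC x f * dloc s x u + loc s x x * dfun f x u := by
  rw [dloc_eq_secD, dloc_eq_secD, secD_fsmul (mem_goodSet x), dfun_eq_chartD_self]; rfl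

/-- A jet of type `(0,1)` is the jet of an antiholomorphic multiple of a section. -/
theorem AntiJet.exists {x : X} {s : CSec E L} (h : AntiJet x s) : ∃ (f : CFun E X) (t : CSec E L),
    AntiHolNear x f ∧ evC x f = 0 ∧ dloc (s - f • t) x = 0 := by
  -- The factor is the affine function whose linear part is the given antilinear differential, and
  -- the section is the local frame.
  refine ⟨affFun L x 0 (dloc s x), holSec x (1, 0), antiHolNear_affFun (mem_core E L x) 0 h.2, ?_, ?_⟩
  · rw [evC_affFun (mem_core E L x), centered, sub_self, map_zero, add_zero]
  · ext u
    rw [dloc_sub, dloc_fsmul, evC_affFun (mem_core E L x), centered, sub_self, map_zero,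
      loc_holSec_self, dfun_affFun_self]
    simp

/-! ### Bi-derivations -/

theorem gauge_congr (Δ : Gauge ℂ (CFun E X) (CSec E L)) {s t : CSec E L} {x : X}
    (h0 : evL x s = evL x t) (h1 : dloc s x = dloc t x) : evL x (Δ.1 s) = evL x (Δ.1 t) := by
  rw [← sub_eq_zero, ← map_sub, ← map_sub]
  refine gauge_apply_eq_zero_of_jet Δ (by rw [map_sub, h0, sub_self]) ?_
  ext u
  rw [dloc_sub, h1, sub_self]; rfl

theorem dloc_congr {s t : CSec E L} {x : X} (h : ∀ᶠ y in nhds x, evL y s = evL y t) :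
    dloc s x = dloc t x := by
  rw [dloc_eq_secD, dloc_eq_secD]
  refine chartD_congr (mem_extChartAt_source x) ?_
  filter_upwards [h, mem_nhds_base (mem_goodSet (L := L) (E := E) x)] with y hy hb
  refine smul_frame_inj hb.2 ?_
  exact (evL_eq hb.2 s).symm.trans (hy.trans (evL_eq hb.2 t))

/-- Derivations are local operators. -/
theorem gauge_congr_of_eventually (Δ : Gauge ℂ (CFun E X) (CSec E L)) {s t : CSec E L} {x : X}
    (h : ∀ᶠ y in nhds x, evL y s = evL y t) : evL x (Δ.1 s) = evL x (Δ.1 t) :=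
  gauge_congr Δ h.self_of_nhds (dloc_congr h)

theorem HolAt.of_jet {s t : CSec E L} {x : X} (h : HolAt x s) (h1 : dloc s x = dloc t x) :
    HolAt x t := by
  rw [holAt_iff] at h ⊢
  rwa [← h1]

variable {J : BiDer ℂ (CFun E X) (CSec E L)}

theorem Is20.left (hJ : Is20 J) {x : X} {s : CSec E L} (h : AntiJet x s) (t : CSec E L) :
    evL x (J.bracket s t) = 0 := hJ s t x h.1 h.2

theorem Is20.right (hJ : Is20 J) {x : X} {s : CSec E L} (h : AntiJet x s) (t : CSec E L) :
    evL x (J.bracket t s) = 0 := by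
  rw [J.bracket_skew, map_neg, hJ.left h, neg_zero]

theorem bracket_sub_left (s s' t : CSec E L) :
    J.bracket (s - s') t = J.bracket s t - J.bracket s' t := by
  simp [BiDer.bracket]

theorem Is20.holPart_left (hJ : Is20 J) (x : X) (s t : CSec E L) :
    evL x (J.bracket (holPart E L x s) t) = evL x (J.bracket s t) := by
  rw [eq_comm, ← sub_eq_zero, ← map_sub, ← bracket_sub_left]
  exact hJ.left (antiJet_sub_holPart x s) t

/-- A bi-derivation of type `(2,0)` is linear over antiholomorphic functions. -/
theorem Is20.anti_smul (hJ : Is20 J) {x : X} {f : CFun E X} (hf : AntiHolNear x f)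
    (s t : CSec E L) : ∀ᶠ y in nhds x, evL y (J.bracket (f • s) t) = evL y (f • J.bracket s t) := by
  filter_upwards [hf] with y hy
  -- At `y` this difference vanishes and its differential is `s(y) df`, which is antilinear.
  have h1 : AntiJet y (f • s - evC y f • s) := by
    refine ⟨by simp, fun u => ?_⟩
    rw [dloc_sub, dloc_sub, dloc_fsmul, dloc_fsmul, dloc_smul, dloc_smul, hy]; ring
  have h2 := hJ.left h1 t
  rw [bracket_sub_left, map_sub, sub_eq_zero] at h2
  rw [h2, evL_smul]
  simp [BiDer.bracket]

variable (J) in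
/-- The bi-derivation preserves local holomorphic sections. -/
def PreservesHol : Prop := ∀ (x : X) (s t : CSec E L), HolNear x s → HolNear x t →
  HolAt x (J.bracket s t)

/-- The Schouten bracket `[Δ, J]` is a derivation in the first entry. -/
theorem schoutenGauge_eq (Δ : Gauge ℂ (CFun E X) (CSec E L)) (s t : CSec E L) :
    J.schoutenGauge Δ s t = (J.br (Δ.1 t) - gcomm Δ (J.br t)).1 s := by
  have h1 : J.bracket s t = -(J.br t).1 s := J.bracket_skew s t
  have h2 : J.bracket (Δ.1 s) t = -(J.br t).1 (Δ.1 s) := J.bracket_skew _ t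
  rw [BiDer.schoutenGauge, h1, h2]
  change _ = (J.br (Δ.1 t)).1 s - (Δ.1 ((J.br t).1 s) - (J.br t).1 (Δ.1 s))
  rw [map_neg, BiDer.bracket]; abel

theorem schoutenGauge_skew (Δ : Gauge ℂ (CFun E X) (CSec E L)) (s t : CSec E L) :
    J.schoutenGauge Δ s t = -J.schoutenGauge Δ t s := by
  rw [BiDer.schoutenGauge, BiDer.schoutenGauge, J.bracket_skew s t, map_neg]; abel

theorem evL_isDbar {Δ : Gauge ℂ (CFun E X) (CSec E L)} {V : X → E} (h : IsDbar Δ V) (s : CSec E L)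
    (x : X) : evL x (Δ.1 s) = dbar s x (V x) := h s x

theorem IsDbar.eventually_zero {Δ : Gauge ℂ (CFun E X) (CSec E L)} {V : X → E} (h : IsDbar Δ V)
    {s : CSec E L} {x : X} (hs : HolNear x s) :
    ∀ᶠ y in nhds x, evL y (Δ.1 s) = evL y (0 : CSec E L) := by
  filter_upwards [hs] with y hy
  rw [evL_isDbar h, hy, map_zero]

theorem IsDbar.bracket_zero {Δ : Gauge ℂ (CFun E X) (CSec E L)} {V : X → E} (h : IsDbar Δ V)
    {s t : CSec E L} {x : X} (hs : HolNear x s) : evL x (J.bracket (Δ.1 s) t) = 0 := by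
  rw [J.bracket_skew, map_neg, BiDer.bracket, gauge_congr_of_eventually (J.br t)
    (h.eventually_zero hs), map_zero, map_zero, neg_zero]

/-- At `x` the bracket `[Δ, J](s, t)` depends only on the 1-jets of `s` and `t`, so sections with
`∂̄ = 0` at `x` may be replaced by sections holomorphic near `x`. For these `Δ s` and `Δ t` vanish
near `x`, and only `Δ J(s, t)` is left, which is zero by assumption. -/
theorem PreservesHol.dbarClosed (hJ : PreservesHol J) : DbarClosed J := by
  have key : ∀ (Δ : Gauge ℂ (CFun E X) (CSec E L)) (x : X) (s t : CSec E L), HolAt x s →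
      evL x (J.schoutenGauge Δ s t) = evL x (J.schoutenGauge Δ (holPart E L x s) t) := by
    intro Δ x s t hs
    rw [schoutenGauge_eq, schoutenGauge_eq]
    exact gauge_congr _ (evL_holPart x s).symm (dloc_holPart_of_hol hs).symm
  intro Δ V hV s t x hs ht
  change evL x (J.schoutenGauge Δ s t) = 0
  rw [key Δ x s t hs, schoutenGauge_skew, map_neg, key Δ x t _ ht]
  have h1 := holNear_holPart x s
  have h2 := holNear_holPart x t
  rw [BiDer.schoutenGauge, map_sub, map_sub, hV.bracket_zero h1, hV.bracket_zero h2,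
    evL_isDbar hV, hJ x _ _ h2 h1]
  simp

/-- For sections holomorphic near `x`, the bracket `[χ ∂̄_u, J](s, t)` reduces at `x` to `∂̄_u J(s,
t)`. -/
theorem DbarClosed.preservesHol (hJ : DbarClosed J) : PreservesHol J := by
  intro x s t hs ht u
  obtain ⟨V, hV⟩ := exists_isDbar (L := L) x u
  have h : evL x (J.schoutenGauge (dbarOp L x u) s t) = 0 := hJ _ V hV s t x hs.holAt ht.holAt
  rw [BiDer.schoutenGauge, map_sub, map_sub, hV.bracket_zero hs, hV.bracket_zero ht,
    dbarOp_self] at h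
  simpa using h

/-- The Jacobiator of a bi-derivation. -/
def BiDer.jacobiator {K A P : Type*} [Field K] [CommRing A] [Algebra K A] [AddCommGroup P]
    [Module K P] [Module A P] [IsScalarTower K A P] (B : BiDer K A P) (p q r : P) : P :=
  B.bracket p (B.bracket q r) + B.bracket q (B.bracket r p) + B.bracket r (B.bracket p q)

theorem BiDer.jacobiator_cyc {K A P : Type*} [Field K] [CommRing A] [Algebra K A] [AddCommGroup P]
    [Module K P] [Module A P] [IsScalarTower K A P] (B : BiDer K A P) (p q r : P) :
    B.jacobiator p q r = B.jacobiator q r p := by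
  simp only [jacobiator]; abel

theorem BiDer.bracket_neg_right {K A P : Type*} [Field K] [CommRing A] [Algebra K A]
    [AddCommGroup P] [Module K P] [Module A P] [IsScalarTower K A P] (B : BiDer K A P) (p q : P) :
    B.bracket p (-q) = -B.bracket p q := by simp [bracket]

/-- The Jacobiator is a derivation in its first entry, so at a point it depends only on the 1-jet
there; by cyclicity the same holds for each entry. -/
theorem BiDer.jacobiator_eq {K A P : Type*} [Field K] [CommRing A] [Algebra K A] [AddCommGroup P]
    [Module K P] [Module A P] [IsScalarTower K A P] (B : BiDer K A P) (p q r : P) :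
    B.jacobiator p q r = (gcomm (B.br q) (B.br r) - B.br (B.bracket q r)).1 p := by
  rw [jacobiator, B.bracket_skew p (B.bracket q r), B.bracket_skew p q, B.bracket_neg_right]
  change _ = (B.br q).1 ((B.br r).1 p) - (B.br r).1 ((B.br q).1 p) - (B.br (B.bracket q r)).1 p
  simp only [bracket]; abel

theorem BiDer.schoutenSelf_eq {K A P : Type*} [Field K] [CommRing A] [Algebra K A] [AddCommGroup P]
    [Module K P] [Module A P] [IsScalarTower K A P] (B : BiDer K A P) (p q r : P) :
    B.schoutenSelf p q r = (2 : ℤ) • B.jacobiator p q r := by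
  rw [schoutenSelf, gerst, jacobiator, B.bracket_skew (B.bracket p q) r,
    B.bracket_skew (B.bracket p r) q, B.bracket_skew (B.bracket q r) p, B.bracket_skew p r,
    B.bracket_neg_right]
  module

theorem schoutenSelf_eq_zero_iff : (∀ s t u, J.schoutenSelf s t u = 0) ↔ J.IsJacobi := by
  have h2 : ∀ r : CSec E L, (2 : ℤ) • r = (2 : ℂ) • r := fun r => by module
  refine forall_congr' fun s => forall_congr' fun t => forall_congr' fun u => ?_
  rw [J.schoutenSelf_eq, h2, smul_eq_zero_iff_right two_ne_zero]; rfl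

/-- For a bi-derivation of type `(2,0)`, it suffices to check the Jacobi identity on local
holomorphic sections. -/
theorem Is20.isJacobi (hJ : Is20 J)
    (h : ∀ x (s t u : CSec E L), HolNear x s → HolNear x t → HolNear x u →
      evL x (J.jacobiator s t u) = 0) : J.IsJacobi := by
  have key : ∀ x (s t u : CSec E L),
      evL x (J.jacobiator s t u) = evL x (J.jacobiator (holPart E L x s) t u) := by
    intro x s t u
    have ha := antiJet_sub_holPart x s
    obtain ⟨f, r, hf, hf0, hfd⟩ := ha.exists
    -- The antilinear remainder has the 1-jet of `f • r` with `f` antiholomorphic and `f(x) = 0`.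
    -- Brackets of type `(2,0)` are linear over such `f`, so `f` can be pulled out of both nested
    -- brackets and every term carries the factor `f(x)`.
    have h1 : evL x (J.jacobiator (s - holPart E L x s) t u) = evL x (J.jacobiator (f • r) t u) := by
      rw [J.jacobiator_eq, J.jacobiator_eq]
      refine gauge_congr _ (by rw [ha.1, evL_smul, hf0, zero_smul]) ?_
      ext w
      have := congrArg (fun T : E →L[ℝ] ℂ => T w) hfd
      rw [← sub_eq_zero, ← dloc_sub]; exact this
    have h2 : evL x (J.jacobiator (f • r) t u) = 0 := by
      have a1 := hJ.anti_smul hf r u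
      have a2 := hJ.anti_smul hf r t
      have e1 : evL x (J.bracket (f • r) (J.bracket t u)) = 0 := by
        rw [(hJ.anti_smul hf r (J.bracket t u)).self_of_nhds, evL_smul, hf0, zero_smul]
      have e2 : evL x (J.bracket t (J.bracket u (f • r))) = 0 := by
        rw [J.bracket_skew u, J.bracket_neg_right, map_neg, BiDer.bracket,
          gauge_congr_of_eventually (J.br t) a1]
        change -evL x (J.bracket t _) = 0
        rw [J.bracket_skew t, map_neg, (hJ.anti_smul hf _ t).self_of_nhds, evL_smul, hf0]; simp
      have e3 : evL x (J.bracket u (J.bracket (f • r) t)) = 0 := by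
        rw [BiDer.bracket, gauge_congr_of_eventually (J.br u) a2]
        change evL x (J.bracket u _) = 0
        rw [J.bracket_skew u, map_neg, (hJ.anti_smul hf _ u).self_of_nhds, evL_smul, hf0]; simp
      rw [BiDer.jacobiator, map_add, map_add, e1, e2, e3]; simp
    rw [h2, J.jacobiator_eq, map_sub, map_sub, ← J.jacobiator_eq, ← J.jacobiator_eq,
      sub_eq_zero] at h1
    exact h1
  intro s t u
  refine evL_ext fun x => ?_
  change evL x (J.jacobiator s t u) = _
  -- Rotating the entries replaces all three by their holomorphic parts.
  rw [key, J.jacobiator_cyc, key, J.jacobiator_cyc, key, map_zero]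
  exact h x _ _ _ (holNear_holPart x u) (holNear_holPart x s) (holNear_holPart x t)

end Hol

/-! ### The slit dual bundle -/

section Slit

open Bundle TopologicalSpace

variable {E : Type*} [NormedAddCommGroup E] [NormedSpace ℂ E]
  {X : Type*} [TopologicalSpace X] [ChartedSpace E X]
  {L : X → Type*} [∀ x, AddCommGroup (L x)] [∀ x, Module ℂ (L x)] [∀ x, TopologicalSpace (L x)]
  [TopologicalSpace (TotalSpace ℂ L)] [FiberBundle ℂ L] [VectorBundle ℂ ℂ L]

/-- Evaluation of smooth functions on `ℝℙ(L*)`. -/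
def evH (v : slitDual L) : HatFun E L →ₐ[ℝ] ℝ where
  toFun f := f.1 (toHat v)
  map_one' := rfl
  map_mul' _ _ := rfl
  map_zero' := rfl
  map_add' _ _ := rfl
  commutes' _ := rfl

/-- Evaluation of the homogeneous function corresponding to a section of `ℓ`. -/
def tl (v : slitDual L) : HatSec E L →ₗ[ℝ] ℝ where
  toFun s := tilde s v
  map_add' _ _ := rfl
  map_smul' _ _ := rfl

@[simp] theorem tl_smul (v : slitDual L) (a : HatFun E L) (s : HatSec E L) :
    tl v (a • s) = evH v a * tl v s := rfl

theorem tl_ext {s t : HatSec E L} (h : ∀ v, tl v s = tl v t) : s = t := tilde_inj h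

theorem evH_ext {a b : HatFun E L} (h : ∀ v, evH v a = evH v b) : a = b := by
  refine Subtype.ext (funext fun p => ?_)
  rw [← toHat_hatRep p]; exact h (hatRep p)

theorem real_smul_ne {v : slitDual L} {c : ℝ} (hc : c ≠ 0) : c • v.1.2 ≠ 0 := by
  intro h
  refine v.2 (ContinuousLinearMap.ext fun u => ?_)
  have h1 : c • v.1.2 u = 0 := congrArg (fun T : CDual L v.1.1 => T u) h
  exact (smul_eq_zero.1 h1).resolve_left hc

/-- Multiplication by a real number. -/
def sc (c : ℝ) (hc : c ≠ 0) (v : slitDual L) : slitDual L := ⟨⟨v.1.1, c • v.1.2⟩, real_smul_ne hc⟩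

theorem tl_sc {c : ℝ} (hc : c ≠ 0) (v : slitDual L) (s : HatSec E L) :
    tl (sc c hc v) s = c * tl v s := tilde_hom s v c _

theorem toHat_sc {c : ℝ} (hc : c ≠ 0) (v : slitDual L) : toHat (sc c hc v) = toHat v := by
  refine Sigma.ext rfl (heq_of_eq ?_)
  exact (Projectivization.mk_eq_mk_iff' ℝ _ _ _ _).2 ⟨c, rfl⟩

theorem evH_sc {c : ℝ} (hc : c ≠ 0) (v : slitDual L) (a : HatFun E L) :
    evH (sc c hc v) a = evH v a := congrArg a.1 (toHat_sc hc v)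

theorem exists_fun_of {F : slitDual L → ℝ} (hF : ContMDiff (tildeModel E) 𝓘(ℝ, ℝ) ∞ F)
    (hom : ∀ c hc v, F (sc c hc v) = F v) : ∃ f : HatFun E L, ∀ v, evH v f = F v :=
  exists_hatFun F hF fun v c h => hom c (smul_ne h) v

theorem exists_sec_of {F : slitDual L → ℝ} (hF : ContMDiff (tildeModel E) 𝓘(ℝ, ℝ) ∞ F)
    (hom : ∀ c hc v, F (sc c hc v) = c * F v) : ∃ s : HatSec E L, ∀ v, tl v s = F v :=
  exists_hatSec F hF fun v c h => hom c (smul_ne h) v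

theorem smooth_tl (s : HatSec E L) :
    ContMDiff (tildeModel E) 𝓘(ℝ, ℝ) ∞ fun v : slitDual L => tl v s := s.2

theorem smooth_evH (a : HatFun E L) :
    ContMDiff (tildeModel E) 𝓘(ℝ, ℝ) ∞ fun v : slitDual L => evH v a := a.2

/-- The fiber coordinate on the dual bundle defined by the preferred frame at `x₀`. -/
def om (x₀ : X) (v : slitDual L) : ℂ := v.1.2 (frame L x₀ v.1.1)

theorem om_sc (x₀ : X) {c : ℝ} (hc : c ≠ 0) (v : slitDual L) :
    om x₀ (sc c hc v) = c * om x₀ v := Complex.real_smul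

theorem cTilde_sc {c : ℝ} (hc : c ≠ 0) (v : slitDual L) (s : CSec E L) :
    cTilde s (sc c hc v) = c * cTilde s v := Complex.real_smul

variable [FiniteDimensional ℂ E] [T2Space X] [IsManifold 𝓘(ℂ, E) ω X]
  [ContMDiffVectorBundle ω ℂ L 𝓘(ℂ, E)]

attribute [local instance] isManifold_real

theorem om_ne_zero {x₀ : X} {v : slitDual L}
    (hv : v.1.1 ∈ (trivializationAt ℂ L x₀).baseSet) : om x₀ v ≠ 0 := by
  classical
  intro h
  refine v.2 (ContinuousLinearMap.ext fun u => ?_)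
  let s : ∀ x, L x := Function.update 0 v.1.1 u
  have h1 := eq_localRep_smul hv s
  have h2 : s v.1.1 = u := Function.update_self _ _ _
  rw [h2] at h1
  rw [h1, map_smul]
  change _ • om x₀ v = _
  rw [h, smul_zero]; rfl

theorem exists_point {x₀ x : X} (hx : x ∈ (trivializationAt ℂ L x₀).baseSet) {c : ℂ} (hc : c ≠ 0) :
    ∃ v : slitDual L, v.1.1 = x ∧ om x₀ v = c := by
  let l := (trivializationAt ℂ L x₀).continuousLinearEquivAt ℂ x hx
  have hl : l (frame L x₀ x) = 1 := by
    have := localRep_smul_frame hx (1 : ℂ)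
    rwa [one_smul] at this
  let φ : CDual L x := c • (l : L x →L[ℂ] ℂ)
  have h1 : φ (frame L x₀ x) = c := by
    change c * l (frame L x₀ x) = c
    rw [hl, mul_one]
  exact ⟨⟨⟨x, φ⟩, fun h => hc (by
    rw [← h1]; exact congrArg (fun T : CDual L x => T (frame L x₀ x)) h)⟩, rfl, h1⟩

theorem isManifold_slit : IsManifold (tildeModel E) ∞ (slitDual L) := by
  have h0 : IsManifold (𝓘(ℂ, E).prod 𝓘(ℂ, ℂ →L[ℂ] ℂ)) ω (DualTot L) := inferInstance
  have h1 : IsManifold (tildeModel E) ∞ (DualTot L) := by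
    refine isManifold_of_contDiffOn _ _ _ fun e e' he he' => ?_
    have h := HasGroupoid.compatible
      (G := contDiffGroupoid ω (𝓘(ℂ, E).prod 𝓘(ℂ, ℂ →L[ℂ] ℂ))) he he'
    exact ((mem_groupoid_of_pregroupoid.1 h).1.restrict_scalars ℝ).of_le le_top
  infer_instance

attribute [local instance] isManifold_slit

theorem mem_slitChart_source {v₀ v : slitDual L} :
    v ∈ (extChartAt (tildeModel E) v₀).source ↔ v.1.1 ∈ goodSet E L v₀.1.1 := by
  rw [extChartAt_source, Opens.chartAt_eq, OpenPartialHomeomorph.subtypeRestr_source]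
  change v.1 ∈ (chartAt (ModelProd E (ℂ →L[ℂ] ℂ)) v₀.1).source ↔ _
  rw [FiberBundle.chartedSpace_chartAt]
  simp only [OpenPartialHomeomorph.trans_source, Set.mem_inter_iff, Set.mem_preimage,
    OpenPartialHomeomorph.prod_source, Set.mem_prod, Trivialization.mem_source, Trivialization.coe_coe]
  rw [hom_trivializationAt_baseSet]
  simp only [Set.mem_inter_iff]
  exact ⟨fun h => ⟨h.2.1, h.1.1⟩, fun h => ⟨⟨h.2, by simp⟩, h.1, by simp⟩⟩

/-- The model fiber is `ℂ →L[ℂ] ℂ`, so the fiber coordinate `z` occurs as `z • id`; evaluation at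
`1` recovers it in later computations. -/
theorem slitChart_apply {v₀ v : slitDual L} (hv : v.1.1 ∈ goodSet E L v₀.1.1) :
    extChartAt (tildeModel E) v₀ v = (extChartAt 𝓘(ℝ, E) v₀.1.1 v.1.1,
      om v₀.1.1 v • ContinuousLinearMap.id ℂ ℂ) := by
  have h1 : extChartAt (tildeModel E) v₀ v = (extChartAt 𝓘(ℝ, E) v₀.1.1 v.1.1,
      ContinuousLinearMap.inCoordinates ℂ L ℂ (Trivial X ℂ) v₀.1.1 v.1.1 v₀.1.1 v.1.1 v.1.2) :=
    hom_chart v₀.1 v.1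
  rw [h1]
  congr 1
  ext
  rw [ContinuousLinearMap.inCoordinates_eq hv.2 (by simp)]
  have h2 : frame L v₀.1.1 v.1.1 = (trivializationAt ℂ L v₀.1.1).symm v.1.1 1 :=
    Trivialization.symmL_apply (R := ℂ) _ hv.2 1
  simp [om, h2]

theorem smooth_proj : ContMDiff (tildeModel E) 𝓘(ℝ, E) ∞ (fun v : slitDual L => v.1.1) :=
  (contMDiff_proj (CDual L)).comp contMDiff_subtype_val

theorem continuous_proj : Continuous fun v : slitDual L => v.1.1 :=
  (FiberBundle.continuous_proj (ℂ →L[ℂ] ℂ) (CDual L)).comp continuous_subtype_val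

variable (E L) in
theorem eventually_good {x₀ : X} {v : slitDual L} (hv : v.1.1 ∈ goodSet E L x₀) :
    ∀ᶠ u in nhds v, u.1.1 ∈ goodSet E L x₀ :=
  continuous_proj.continuousAt.preimage_mem_nhds ((isOpen_goodSet x₀).mem_nhds hv)

theorem smooth_om {v₀ v : slitDual L} (hv : v.1.1 ∈ goodSet E L v₀.1.1) :
    ContMDiffAt (tildeModel E) 𝓘(ℝ, ℂ) ∞ (om v₀.1.1) v := by
  have h1 := contMDiffAt_extChart (mem_slitChart_source.2 hv)
  have h2 : ContDiff ℝ ∞ fun p : TildeT E => p.2 1 :=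
    ((ContinuousLinearMap.apply ℂ ℂ (1 : ℂ)).restrictScalars ℝ).contDiff.comp contDiff_snd
  refine (h2.contDiffAt.comp_contMDiffAt h1).congr_of_eventuallyEq ?_
  filter_upwards [eventually_good E L hv] with u hu
  rw [Function.comp_apply, slitChart_apply hu]
  simp

theorem cTilde_eq (s : CSec E L) {x₀ : X} {v : slitDual L} (hv : v.1.1 ∈ goodSet E L x₀) :
    cTilde s v = loc s x₀ v.1.1 * om x₀ v := by
  change v.1.2 (evL v.1.1 s) = _
  rw [evL_eq hv.2, map_smul]; rfl

theorem contMDiffAt_mul_slit {f g : slitDual L → ℂ} {v : slitDual L}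
    (hf : ContMDiffAt (tildeModel E) 𝓘(ℝ, ℂ) ∞ f v)
    (hg : ContMDiffAt (tildeModel E) 𝓘(ℝ, ℂ) ∞ g v) :
    ContMDiffAt (tildeModel E) 𝓘(ℝ, ℂ) ∞ (fun x => f x * g x) v :=
  (contDiff_mul (𝕜 := ℝ) (𝔸 := ℂ)).contDiffAt.comp_contMDiffAt (hf.prodMk_space hg)

theorem smooth_cTilde (s : CSec E L) : ContMDiff (tildeModel E) 𝓘(ℝ, ℂ) ∞ (cTilde s) := by
  intro v
  have hv := mem_goodSet (E := E) (L := L) v.1.1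
  refine (contMDiffAt_mul_slit ((smooth_loc s hv).comp v (smooth_proj v))
    (smooth_om hv)).congr_of_eventuallyEq ?_
  filter_upwards [eventually_good E L hv] with u hu using cTilde_eq s hu

theorem exists_re (s : CSec E L) : ∃ t : HatSec E L, ∀ v, tl v t = (cTilde s v).re :=
  exists_sec_of (Complex.reCLM.contDiff.comp_contMDiff (smooth_cTilde s)) fun c hc v => by
    rw [cTilde_sc]; simp

/-- The real section of `ℓ` corresponding to the real part of the homogeneous function defined by
a section of `L`. -/
def re : CSec E L →ₗ[ℝ] HatSec E L where
  toFun s := (exists_re s).choose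
  map_add' s t := tl_ext fun v => by
    rw [map_add, (exists_re s).choose_spec, (exists_re t).choose_spec,
      (exists_re (s + t)).choose_spec, ← Complex.add_re]
    congr 1; exact map_add v.1.2 _ _
  map_smul' c s := tl_ext fun v => by
    rw [RingHom.id_apply, map_smul, (exists_re s).choose_spec, (exists_re (c • s)).choose_spec,
      smul_eq_mul, ← Complex.re_ofReal_mul]
    congr 1; exact map_smul v.1.2 (c : ℂ) _

theorem tl_re (v : slitDual L) (s : CSec E L) : tl v (re s) = (cTilde s v).re :=
  (exists_re s).choose_spec v

/-! ### Differentials on the slit dual bundle -/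

variable (E) in
/-- The derivative at `v` of the chart at `v₀`. -/
def slitT (v₀ v : slitDual L) : TildeT E →L[ℝ] TildeT E :=
  mfderiv (tildeModel E) 𝓘(ℝ, TildeT E) (extChartAt (tildeModel E) v₀) v

/-- The derivative of the homogeneous function of a section of `ℓ` in the chart at `v₀`. -/
def tlD (v₀ v : slitDual L) (s : HatSec E L) : TildeT E →L[ℝ] ℝ :=
  chartD (tildeModel E) v₀ (fun u => tl u s) v

theorem dTilde_eq (s : HatSec E L) {v₀ v : slitDual L} (hv : v.1.1 ∈ goodSet E L v₀.1.1) :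
    dTilde s v = tlD v₀ v s ∘L slitT E v₀ v :=
  mfderiv_eq_chartD (mem_slitChart_source.2 hv) ((smooth_tl s v).mdifferentiableAt (by simp))

theorem dTilde_self (s : HatSec E L) (v : slitDual L) : dTilde s v = tlD v v s :=
  mfderiv_eq_chartD_self ((smooth_tl s v).mdifferentiableAt (by simp))

section
variable {v₀ v : slitDual L} (hv : v.1.1 ∈ goodSet E L v₀.1.1)
include hv

theorem tlD_add (s t : HatSec E L) : tlD v₀ v (s + t) = tlD v₀ v s + tlD v₀ v t :=
  chartD_add (mem_slitChart_source.2 hv) (smooth_tl s v) (smooth_tl t v)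

theorem tlD_fsmul (a : HatFun E L) (s : HatSec E L) : tlD v₀ v (a • s) =
    evH v a • tlD v₀ v s + tl v s • chartD (tildeModel E) v₀ (fun u => evH u a) v := by
  refine ContinuousLinearMap.ext fun w => ?_
  exact chartD_mul (mem_slitChart_source.2 hv) (smooth_evH a v) (smooth_tl s v) w

theorem tlD_smul (c : ℝ) (s : HatSec E L) : tlD v₀ v (c • s) = c • tlD v₀ v s := by
  refine ContinuousLinearMap.ext fun w => ?_
  exact congrArg (fun T : TildeT E →L[ℝ] ℝ => T w) (chartD_clm (ContinuousLinearMap.mul ℝ ℝ c)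
    (mem_slitChart_source.2 hv) (smooth_tl s v))

theorem smooth_tlD (s : HatSec E L) :
    ContMDiffAt (tildeModel E) 𝓘(ℝ, TildeT E →L[ℝ] ℝ) ∞ (fun v => tlD v₀ v s) v :=
  contMDiffAt_chartD (mem_slitChart_source.2 hv) (smooth_tl s v)

theorem slitChart_sc {c : ℝ} (hc : c ≠ 0) : extChartAt (tildeModel E) v₀ (sc c hc v) =
    ((extChartAt (tildeModel E) v₀ v).1, c • (extChartAt (tildeModel E) v₀ v).2) := by
  have hv' : (sc c hc v).1.1 ∈ goodSet E L v₀.1.1 := hv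
  rw [slitChart_apply hv, slitChart_apply hv', om_sc]
  refine Prod.ext rfl ?_
  change (c * om v₀.1.1 v) • _ = c • om v₀.1.1 v • _
  rw [mul_smul]; rfl

theorem slitChart_symm_sc {c : ℝ} (hc : c ≠ 0) {p : TildeT E}
    (hp : p ∈ (extChartAt (tildeModel E) v₀).target) :
    (extChartAt (tildeModel E) v₀).symm (p.1, c • p.2) =
      sc c hc ((extChartAt (tildeModel E) v₀).symm p) := by
  set u := (extChartAt (tildeModel E) v₀).symm p with hu
  have h1 : u ∈ (extChartAt (tildeModel E) v₀).source := (extChartAt _ v₀).map_target hp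
  have h2 := slitChart_sc (mem_slitChart_source.1 h1) hc
  have h3 : sc c hc u ∈ (extChartAt (tildeModel E) v₀).source :=
    mem_slitChart_source.2 (mem_slitChart_source.1 h1)
  rw [hu, (extChartAt _ v₀).right_inv hp, ← hu] at h2
  rw [← (extChartAt _ v₀).left_inv h3, h2]

/-- In the chart, real scaling of the fiber is a linear map; the identity is the derivative of `s̃(c
v) = c s̃(v)`. -/
theorem tlD_sc {c : ℝ} (hc : c ≠ 0) (s : HatSec E L) (w : TildeT E) :
    tlD v₀ (sc c hc v) s (w.1, c • w.2) = c * tlD v₀ v s w := by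
  have hs := mem_slitChart_source.2 hv
  have hv' : sc c hc v ∈ (extChartAt (tildeModel E) v₀).source := mem_slitChart_source.2 hv
  set G : TildeT E → ℝ := (fun u => tl u s) ∘ (extChartAt (tildeModel E) v₀).symm with hG
  let m : TildeT E →L[ℝ] TildeT E :=
    (ContinuousLinearMap.id ℝ E).prodMap (c • ContinuousLinearMap.id ℝ (ℂ →L[ℂ] ℂ))
  have h1 : HasFDerivAt G (tlD v₀ (sc c hc v) s) (m (extChartAt (tildeModel E) v₀ v)) := by
    have h := ((contDiffAt_chart hv' (smooth_tl s (sc c hc v))).differentiableAt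
      (by simp)).hasFDerivAt
    rw [show m (extChartAt (tildeModel E) v₀ v) = extChartAt (tildeModel E) v₀ (sc c hc v) from
      (slitChart_sc hv hc).symm]
    exact h
  have h2 := h1.comp _ (m.hasFDerivAt (x := extChartAt (tildeModel E) v₀ v))
  have h3 : G ∘ m =ᶠ[nhds (extChartAt (tildeModel E) v₀ v)] fun p => c * G p := by
    filter_upwards [(isOpen_extChartAt_target v₀).mem_nhds ((extChartAt _ v₀).map_source hs)]
      with p hp
    have h4 := slitChart_symm_sc hv hc hp
    exact (congrArg (fun u => tl u s) h4).trans (tl_sc hc _ s)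
  have h5 : HasFDerivAt (fun p => c * G p) (c • tlD v₀ v s) (extChartAt (tildeModel E) v₀ v) :=
    ((contDiffAt_chart hs (smooth_tl s v)).differentiableAt (by simp)).hasFDerivAt.const_mul c
  exact congrArg (fun T : TildeT E →L[ℝ] ℝ => T w) (h2.unique (h5.congr_of_eventuallyEq h3))

end

theorem dTilde_add (s t : HatSec E L) (v : slitDual L) :
    dTilde (s + t) v = dTilde s v + dTilde t v := by
  simp only [dTilde_self]; exact tlD_add (mem_goodSet v.1.1) s t

theorem dTilde_smul (c : ℝ) (s : HatSec E L) (v : slitDual L) :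
    dTilde (c • s) v = c • dTilde s v := by
  simp only [dTilde_self]; exact tlD_smul (mem_goodSet v.1.1) c s

variable (E) in
/-- The differential at `v` as a linear map. -/
def dT (v : slitDual L) : HatSec E L →ₗ[ℝ] (TildeT E →L[ℝ] ℝ) where
  toFun s := dTilde s v
  map_add' s t := dTilde_add s t v
  map_smul' c s := dTilde_smul c s v

/-- The differential of the complex homogeneous function of a section of `L` in a chart. -/
theorem chartD_cTilde (s : CSec E L) {v₀ v : slitDual L} (hv : v.1.1 ∈ goodSet E L v₀.1.1)
    (w : TildeT E) : chartD (tildeModel E) v₀ (cTilde s) v w =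
      w.2 1 * loc s v₀.1.1 v.1.1 + om v₀.1.1 v * secD E s v₀.1.1 v.1.1 w.1 := by
  have hs := mem_slitChart_source.2 hv
  have hb := mem_source_of_goodSet hv
  let G : E → ℂ := loc s v₀.1.1 ∘ (extChartAt 𝓘(ℝ, E) v₀.1.1).symm
  have h1 : ∀ᶠ u in nhds v, cTilde s u = (fun p : TildeT E => p.2 1 * G p.1)
      (extChartAt (tildeModel E) v₀ u) := by
    filter_upwards [eventually_good E L hv] with u hu
    rw [cTilde_eq s hu, slitChart_apply hu]
    simp only [G, Function.comp_apply]
    rw [(extChartAt 𝓘(ℝ, E) v₀.1.1).left_inv (mem_source_of_goodSet hu), mul_comm]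
    simp
  rw [chartD_comp (k := fun p : TildeT E => p.2 1 * G p.1) hs h1, slitChart_apply hv]
  have hG : HasFDerivAt G (secD E s v₀.1.1 v.1.1) (extChartAt 𝓘(ℝ, E) v₀.1.1 v.1.1) :=
    ((contDiffAt_chart hb (smooth_loc s hv)).differentiableAt (by simp)).hasFDerivAt
  let ev : (ℂ →L[ℂ] ℂ) →L[ℝ] ℂ := (ContinuousLinearMap.apply ℂ ℂ (1 : ℂ)).restrictScalars ℝ
  set p₀ : TildeT E := (extChartAt 𝓘(ℝ, E) v₀.1.1 v.1.1,
    om v₀.1.1 v • ContinuousLinearMap.id ℂ ℂ) with hp₀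
  have h2 : HasFDerivAt (fun p : TildeT E => ev p.2) (ev ∘L ContinuousLinearMap.snd ℝ _ _) p₀ :=
    ev.hasFDerivAt.comp p₀ hasFDerivAt_snd
  have h3 : HasFDerivAt (fun p : TildeT E => G p.1)
    (secD E s v₀.1.1 v.1.1 ∘L ContinuousLinearMap.fst ℝ _ _) p₀ :=
    HasFDerivAt.comp (g := G) (f := fun p : TildeT E => p.1) p₀ hG hasFDerivAt_fst
  have h4 := (h2.mul h3).fderiv
  have hG0 : G p₀.1 = loc s v₀.1.1 v.1.1 := by
    simp only [hp₀, G, Function.comp_apply, (extChartAt 𝓘(ℝ, E) v₀.1.1).left_inv hb]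
  have hev : ev p₀.2 = om v₀.1.1 v := by simp [ev, hp₀]
  refine (congrArg (fun T : TildeT E →L[ℝ] ℂ => T w) h4).trans ?_
  change ev p₀.2 * secD E s v₀.1.1 v.1.1 w.1 + G p₀.1 * w.2 1 = _
  rw [hG0, hev]; ring

theorem dcTilde_apply (s : CSec E L) (v : slitDual L) (w : TildeT E) :
    dcTilde s v w = w.2 1 * loc s v.1.1 v.1.1 + om v.1.1 v * dloc s v.1.1 w.1 := by
  rw [dloc_eq_secD, ← chartD_cTilde s (mem_goodSet v.1.1)]
  exact congrArg (fun T : TildeT E →L[ℝ] ℂ => T w)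
    (mfderiv_eq_chartD_self ((smooth_cTilde s v).mdifferentiableAt (by simp)))

theorem tlD_re (s : CSec E L) {v₀ v : slitDual L} (hv : v.1.1 ∈ goodSet E L v₀.1.1)
    (w : TildeT E) : tlD v₀ v (re s) w =
      (w.2 1 * loc s v₀.1.1 v.1.1 + om v₀.1.1 v * secD E s v₀.1.1 v.1.1 w.1).re := by
  rw [← chartD_cTilde s hv]
  have h1 := chartD_clm Complex.reCLM (mem_slitChart_source.2 hv) (smooth_cTilde s v)
  refine congrArg (fun T : TildeT E →L[ℝ] ℝ => T w) (Eq.trans ?_ h1)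
  refine chartD_congr (mem_slitChart_source.2 hv) (Filter.Eventually.of_forall fun u => ?_)
  exact tl_re u s

theorem dTilde_re (s : CSec E L) (v : slitDual L) (w : TildeT E) :
    dTilde (re s) v w = (dcTilde s v w).re := by
  rw [dTilde_self, tlD_re s (mem_goodSet v.1.1), dcTilde_apply, dloc_eq_secD]

/-- The homogeneous function of a section with `∂̄ s = 0` at `x` has complex linear differential. -/
theorem HolAt.dcTilde_I {s : CSec E L} {v : slitDual L} (h : HolAt v.1.1 s) (w : TildeT E) :
    dcTilde s v (Complex.I • w) = Complex.I * dcTilde s v w := by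
  rw [dcTilde_apply, dcTilde_apply]
  change Complex.I * w.2 1 * _ + _ * dloc s _ (Complex.I • w.1) = _
  rw [(holAt_iff _ s).1 h]; ring

theorem dcTilde_smul (c : ℂ) (s : CSec E L) (v : slitDual L) (w : TildeT E) :
    dcTilde (c • s) v w = c * dcTilde s v w := by
  rw [dcTilde_apply, dcTilde_apply, dloc_smul,
    loc_smul (mem_baseSet_trivializationAt ℂ L v.1.1)]; ring

/-- This is the formula behind `ĵ`: on real parts of holomorphic functions, multiplying the vector
by `i` is the same as multiplying the section by `i`. -/
theorem HolAt.dTilde_I {s : CSec E L} {v : slitDual L} (h : HolAt v.1.1 s) (w : TildeT E) :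
    dTilde (re s) v (Complex.I • w) = dTilde (re (Complex.I • s)) v w := by
  rw [dTilde_re, dTilde_re, h.dcTilde_I, dcTilde_smul]

end Slit

section HatDer

open Bundle TopologicalSpace

variable {E : Type*} [NormedAddCommGroup E] [NormedSpace ℂ E]
  {X : Type*} [TopologicalSpace X] [ChartedSpace E X]
  {L : X → Type*} [∀ x, AddCommGroup (L x)] [∀ x, Module ℂ (L x)] [∀ x, TopologicalSpace (L x)]
  [TopologicalSpace (TotalSpace ℂ L)] [FiberBundle ℂ L] [VectorBundle ℂ ℂ L]
  [FiniteDimensional ℂ E] [T2Space X] [IsManifold 𝓘(ℂ, E) ω X]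
  [ContMDiffVectorBundle ω ℂ L 𝓘(ℂ, E)]

attribute [local instance] isManifold_real isManifold_slit

/-! ### Derivations of the smooth functions on `ℝℙ(L*)` -/

/-- A smooth function on `ℂ` with support in a cone around the positive real axis. -/
def coneBump (ζ : ℂ) : ℝ := Real.smoothTransition (2 * (ζ.re ^ 2 / Complex.normSq ζ) - 1)

theorem coneBump_one : coneBump 1 = 1 := by
  refine Real.smoothTransition.one_of_one_le ?_
  norm_num

/-- The function depends only on the squared cosine of the argument of `ζ`. Invariance holds for
negative `c` too, as is needed for functions on the real projective bundle. -/
theorem coneBump_real_mul {c : ℝ} (hc : c ≠ 0) (ζ : ℂ) : coneBump (c * ζ) = coneBump ζ := by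
  have h : (c * ζ : ℂ).re ^ 2 / Complex.normSq (c * ζ) = ζ.re ^ 2 / Complex.normSq ζ := by
    rw [Complex.re_ofReal_mul, Complex.normSq_mul, Complex.normSq_ofReal, mul_pow, ← sq,
      mul_div_mul_left _ _ (pow_ne_zero 2 hc)]
  rw [coneBump, h, coneBump]

theorem contDiff_normSq : ContDiff ℝ ∞ fun z : ℂ => Complex.normSq z := by
  have : (fun z : ℂ => Complex.normSq z) = fun z => z.re * z.re + z.im * z.im := by
    ext z; exact Complex.normSq_apply z
  rw [this]
  exact (Complex.reCLM.contDiff.mul Complex.reCLM.contDiff).add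
    (Complex.imCLM.contDiff.mul Complex.imCLM.contDiff)

theorem contDiffAt_cone_ratio {ζ : ℂ} (hζ : ζ ≠ 0) :
    ContDiffAt ℝ ∞ (fun ζ : ℂ => 2 * (ζ.re ^ 2 / Complex.normSq ζ) - 1) ζ :=
  (contDiffAt_const.mul ((Complex.reCLM.contDiff.contDiffAt.pow 2).div contDiff_normSq.contDiffAt
    (Complex.normSq_pos.2 hζ).ne')).sub contDiffAt_const

theorem contDiffAt_coneBump {ζ : ℂ} (hζ : ζ ≠ 0) : ContDiffAt ℝ ∞ coneBump ζ :=
  Real.smoothTransition.contDiff.contDiffAt.comp ζ (contDiffAt_cone_ratio hζ)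

theorem coneBump_eventually_zero {ζ : ℂ} (hζ : ζ ≠ 0) (h : ζ.re = 0) :
    ∀ᶠ η in nhds ζ, coneBump η = 0 := by
  have h1 := (contDiffAt_cone_ratio hζ).continuousAt
  have h2 := h1.eventually_lt (continuousAt_const (y := (0 : ℝ))) (by simp [h])
  filter_upwards [h2] with η hη
  exact Real.smoothTransition.zero_of_nonpos hη.le

theorem re_ne_zero_of_coneBump {ζ : ℂ} (h : coneBump ζ ≠ 0) : ζ.re ≠ 0 := by
  intro h0
  exact h (Real.smoothTransition.zero_of_nonpos (by simp [h0]))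

theorem mem_slitChart_target {v₀ : slitDual L} {z : E} {c : ℂ}
    (hz : z ∈ (extChartAt 𝓘(ℝ, E) v₀.1.1).target)
    (hg : (extChartAt 𝓘(ℝ, E) v₀.1.1).symm z ∈ goodSet E L v₀.1.1) (hc : c ≠ 0) :
    ((z, c • ContinuousLinearMap.id ℂ ℂ) : TildeT E) ∈ (extChartAt (tildeModel E) v₀).target := by
  obtain ⟨v, hv, hvc⟩ := exists_point hg.2 hc
  have h1 : v.1.1 ∈ goodSet E L v₀.1.1 := by rw [hv]; exact hg
  have h2 := slitChart_apply h1
  rw [hvc, hv, (extChartAt 𝓘(ℝ, E) v₀.1.1).right_inv hz] at h2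
  rw [← h2]
  exact (extChartAt _ v₀).map_source (mem_slitChart_source.2 h1)

/-- Smooth functions on `ℝℙ(L*)` are handled as functions of degree zero on `L* ∖ 0`, without charts
of the quotient. Near the line of `v₀` they depend on the base coordinates and on the slope of the
fiber coordinate relative to its value at `v₀`, and Hadamard's lemma is applied in these
coordinates. -/
theorem derivation_hat_eq_zero (ξ : Derivation ℝ (HatFun E L) (HatFun E L)) {a : HatFun E L}
    {v₀ : slitDual L} (h : chartD (tildeModel E) v₀ (fun u => evH u a) v₀ = 0) :
    evH v₀ (ξ a) = 0 := by
  have : FiniteDimensional ℝ E := FiniteDimensional.complexToReal E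
  set x₀ := v₀.1.1 with hx₀
  set ψ := extChartAt 𝓘(ℝ, E) x₀ with hψ
  set ω₀ := om x₀ v₀ with hω₀
  have hω : ω₀ ≠ 0 := om_ne_zero (mem_baseSet_trivializationAt ℂ L x₀)
  have hx : x₀ ∈ ψ.source := mem_extChartAt_source x₀
  have hN : ψ.target ∩ ψ.symm ⁻¹' goodSet E L x₀ ∈ nhds (ψ x₀) := by
    refine Filter.inter_mem (extChartAt_target_mem_nhds x₀) ?_
    refine (continuousAt_extChartAt_symm x₀).preimage_mem_nhds ?_
    rw [extChartAt_to_inv]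
    exact (isOpen_goodSet x₀).mem_nhds (mem_goodSet x₀)
  obtain ⟨r, hr, hrC⟩ := Metric.mem_nhds_iff.1 hN
  have hW : goodSet E L x₀ ∩ ψ ⁻¹' Metric.ball (ψ x₀) r ∈ nhds x₀ :=
    Filter.inter_mem ((isOpen_goodSet x₀).mem_nhds (mem_goodSet x₀))
      ((continuousAt_extChartAt x₀).preimage_mem_nhds (Metric.ball_mem_nhds _ hr))
  obtain ⟨χ, hχ, hχ1, hχs⟩ := exists_bump (E := E) hW
  let ζ : slitDual L → ℂ := fun v => om x₀ v / ω₀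
  have hζ0 : ∀ v : slitDual L, v.1.1 ∈ goodSet E L x₀ → ζ v ≠ 0 := fun v hv =>
    div_ne_zero (om_ne_zero hv.2) hω
  have hζs : ∀ v : slitDual L, v.1.1 ∈ goodSet E L x₀ →
      ContMDiffAt (tildeModel E) 𝓘(ℝ, ℂ) ∞ ζ v := fun v hv => by
    have h1 := contMDiffAt_mul_slit (E := E) (smooth_om (v₀ := v₀) hv)
      (contMDiffAt_const (c := ω₀⁻¹))
    exact h1
  have hζsc : ∀ (c : ℝ) (hc : c ≠ 0) v, ζ (sc c hc v) = c * ζ v := fun c hc v => by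
    simp only [ζ, om_sc]; ring
  let Ψ : slitDual L → E × ℝ := fun v => (ψ v.1.1, (ζ v).im / (ζ v).re)
  let κ : slitDual L → ℝ := fun v => χ v.1.1 * coneBump (ζ v)
  let C : Set (E × ℝ) := Metric.ball (ψ x₀) r ×ˢ Set.univ
  -- A section of the coordinates `Ψ`: on each real line it selects the representative whose fiber
  -- coordinate, divided by `ω₀`, has real part `1`.
  let m : E × ℝ → TildeT E := fun p =>
    (p.1, (ω₀ * (1 + p.2 * Complex.I)) • ContinuousLinearMap.id ℂ ℂ)
  have hm : ContDiff ℝ ∞ m := by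
    have h1 : ContDiff ℝ ∞ fun p : E × ℝ => ω₀ * (1 + (p.2 : ℂ) * Complex.I) :=
      contDiff_const.mul (contDiff_const.add
        ((Complex.ofRealCLM.contDiff.comp contDiff_snd).mul contDiff_const))
    let T : ℂ →L[ℝ] (ℂ →L[ℂ] ℂ) := ((ContinuousLinearMap.toSpanSingleton ℂ
      (ContinuousLinearMap.id ℂ ℂ)).restrictScalars ℝ)
    exact contDiff_fst.prodMk (T.contDiff.comp h1)
  have hcne : ∀ t : ℝ, ω₀ * (1 + t * Complex.I) ≠ 0 := fun t => by
    refine mul_ne_zero hω fun h0 => ?_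
    have := congrArg Complex.re h0
    simp at this
  have hmT : ∀ p ∈ C, m p ∈ (extChartAt (tildeModel E) v₀).target := fun p hp =>
    mem_slitChart_target (hrC hp.1).1 (hrC hp.1).2 (hcne p.2)
  have hsup : ∀ v, κ v ≠ 0 → v.1.1 ∈ goodSet E L x₀ ∧ ψ v.1.1 ∈ Metric.ball (ψ x₀) r ∧
      (ζ v).re ≠ 0 := fun v hv => by
    have h1 := hχs (subset_tsupport χ (left_ne_zero_of_mul hv))
    exact ⟨h1.1, h1.2, re_ne_zero_of_coneBump (right_ne_zero_of_mul hv)⟩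
  have hζv : ζ v₀ = 1 := div_self hω
  have hmΨ : m (Ψ v₀) = extChartAt (tildeModel E) v₀ v₀ := by
    rw [slitChart_apply (mem_goodSet _)]
    simp only [m, Ψ, hζv]
    simp [← hx₀, ← hω₀]
    rfl
  have hF : ∀ p ∈ C, ContDiffAt ℝ ∞ ((fun u => evH u a) ∘ (extChartAt (tildeModel E) v₀).symm)
      (m p) := by
    intro p hp
    have h1 := contDiffAt_chart ((extChartAt (tildeModel E) v₀).map_target (hmT p hp))
      (smooth_evH a ((extChartAt (tildeModel E) v₀).symm (m p)))
    rwa [(extChartAt (tildeModel E) v₀).right_inv (hmT p hp)] at h1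
  have hmem : Ψ v₀ ∈ C := ⟨Metric.mem_ball_self hr, Set.mem_univ _⟩
  refine derivation_apply_eq_zero (N := slitDual L) evH (fun _ _ => evH_ext)
    (C := C) (Metric.isOpen_ball.prod isOpen_univ) (n₀ := v₀) (Ψ := Ψ) (κ := κ)
    (((convex_ball _ _).prod convex_univ).starConvex hmem) ?_ (fun v hv => ⟨(hsup v hv).2.1, trivial⟩)
    ?_ (F := fun p => evH ((extChartAt (tildeModel E) v₀).symm (m p)) a) ?_ ?_ ?_ ξ
  · simp only [κ, hζv, coneBump_one, hχ1.self_of_nhds, ← hx₀, mul_one]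
  · intro k hk
    refine exists_fun_of (F := fun v => κ v * k (Ψ v)) ?_ ?_
    · intro v
      by_cases hv : v.1.1 ∈ tsupport χ
      · have hv1 := hχs hv
        -- The slope is not defined where `Re ζ = 0`, but the cone factor of `κ` vanishes near such
        -- points.
        by_cases h0 : (ζ v).re = 0
        · refine (contMDiffAt_const (c := (0 : ℝ))).congr_of_eventuallyEq ?_
          filter_upwards [(hζs v hv1.1).continuousAt.eventually
            (coneBump_eventually_zero (hζ0 v hv1.1) h0)] with u hu
          simp only [κ, hu, mul_zero, zero_mul]
        · have h1 : ContMDiffAt (tildeModel E) 𝓘(ℝ, ℝ) ∞ κ v :=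
            ((hχ v.1.1).comp v (smooth_proj v)).mul
              ((contDiffAt_coneBump (hζ0 v hv1.1)).comp_contMDiffAt (hζs v hv1.1))
          have h2 : ContDiffAt ℝ ∞ (fun c : ℂ => c.im / c.re) (ζ v) :=
            Complex.imCLM.contDiff.contDiffAt.div Complex.reCLM.contDiff.contDiffAt h0
          have h3 : ContMDiffAt (tildeModel E) 𝓘(ℝ, E × ℝ) ∞ Ψ v :=
            ((contMDiffAt_extChart (mem_source_of_goodSet hv1.1)).comp v
              (smooth_proj v)).prodMk_space (h2.comp_contMDiffAt (hζs v hv1.1))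
          exact h1.mul ((hk.contDiffAt ((Metric.isOpen_ball.prod isOpen_univ).mem_nhds
            (show Ψ v ∈ C from ⟨hv1.2, trivial⟩))).comp_contMDiffAt h3)
      · refine (contMDiffAt_const (c := (0 : ℝ))).congr_of_eventuallyEq ?_
        filter_upwards [continuous_proj.continuousAt.preimage_mem_nhds
          ((isClosed_tsupport χ).isOpen_compl.mem_nhds hv)] with u hu
        simp only [κ, image_eq_zero_of_notMem_tsupport hu, zero_mul]
    · intro c hc v
      have h1 : Ψ (sc c hc v) = Ψ v := by
        simp only [Ψ, hζsc, Complex.re_ofReal_mul, Complex.im_ofReal_mul]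
        rw [mul_div_mul_left _ _ hc]; rfl
      have h2 : κ (sc c hc v) = κ v := by
        simp only [κ, hζsc, coneBump_real_mul hc]; rfl
      rw [h1, h2]
  · intro p hp
    exact ((hF p hp).comp p hm.contDiffAt).contDiffWithinAt
  · have h1 : HasFDerivAt ((fun u => evH u a) ∘ (extChartAt (tildeModel E) v₀).symm)
        (0 : TildeT E →L[ℝ] ℝ) (m (Ψ v₀)) := by
      have h2 := ((hF _ hmem).differentiableAt (by simp)).hasFDerivAt
      rw [hmΨ] at h2 ⊢
      rw [← h]; exact h2
    have h2 := h1.comp (Ψ v₀) ((hm.differentiable (by simp)) (Ψ v₀)).hasFDerivAt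
    rw [ContinuousLinearMap.zero_comp] at h2
    exact h2.fderiv
  · intro v hv
    obtain ⟨h1, h2, h3⟩ := hsup v hv
    have hc : (ζ v).re⁻¹ ≠ 0 := inv_ne_zero h3
    -- The representative selected by `m` is `v` divided by `Re ζ`, and a function of degree zero
    -- has the same value at both.
    have h4 : m (Ψ v) = extChartAt (tildeModel E) v₀ (sc _ hc v) := by
      rw [slitChart_apply (v := sc _ hc v) h1, om_sc]
      refine Prod.ext rfl ?_
      change (_ : ℂ) • _ = (_ : ℂ) • _
      congr 1
      have h5 : om x₀ v = ζ v * ω₀ := (div_mul_cancel₀ _ hω).symm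
      have h6 : ((ζ v).re : ℂ) ≠ 0 := Complex.ofReal_ne_zero.2 h3
      rw [← hx₀, h5]
      conv_rhs => rw [← Complex.re_add_im (ζ v)]
      simp only [Ψ, Complex.ofReal_div, Complex.ofReal_inv, Complex.add_re, Complex.ofReal_re,
        Complex.re_ofReal_mul, Complex.I_re, mul_zero, add_zero]
      field_simp
    have h7 := (extChartAt (tildeModel E) v₀).left_inv
      (mem_slitChart_source.2 (show (sc _ hc v).1.1 ∈ _ from h1))
    rw [h4, h7, evH_sc]

/-! ### Derivations of `ℓ` -/

/-- Euler's identity. -/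
theorem euler (v : slitDual L) (s : HatSec E L) :
    dTilde s v (0, om v.1.1 v • ContinuousLinearMap.id ℂ ℂ) = tl v s := by
  have hv := mem_goodSet (E := E) (L := L) v.1.1
  have hs := mem_slitChart_source.2 hv
  rw [dTilde_self]
  set p := extChartAt (tildeModel E) v v with hp
  have hp2 : p.2 = om v.1.1 v • ContinuousLinearMap.id ℂ ℂ := by rw [hp, slitChart_apply hv]
  have h1 : HasFDerivAt ((fun u => tl u s) ∘ (extChartAt (tildeModel E) v).symm) (tlD v v s) p :=
    ((contDiffAt_chart hs (smooth_tl s v)).differentiableAt (by simp)).hasFDerivAt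
  -- The ray through `v`, along which `s̃(c v) = c s̃(v)` is differentiated at `c = 1`.
  have h2 : HasDerivAt (fun c : ℝ => ((p.1, c • p.2) : TildeT E)) (0, p.2) 1 := by
    have h3 : HasDerivAt (fun c : ℝ => c • p.2) p.2 1 := by
      simpa using (hasDerivAt_id (1 : ℝ)).smul_const p.2
    exact (hasDerivAt_const (1 : ℝ) p.1).prodMk h3
  have h1' : HasFDerivAt ((fun u => tl u s) ∘ (extChartAt (tildeModel E) v).symm) (tlD v v s)
      ((p.1, (1 : ℝ) • p.2) : TildeT E) := by rw [one_smul]; exact h1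
  have h3 := h1'.comp_hasDerivAt (1 : ℝ) h2
  have h4 : HasDerivAt (fun c : ℝ => c * tl v s) (tl v s) 1 := by
    simpa using (hasDerivAt_id (1 : ℝ)).mul_const (tl v s)
  have h5 : ((fun u => tl u s) ∘ (extChartAt (tildeModel E) v).symm) ∘
      (fun c : ℝ => ((p.1, c • p.2) : TildeT E)) =ᶠ[nhds 1] fun c : ℝ => c * tl v s := by
    filter_upwards [isOpen_ne.mem_nhds (one_ne_zero (α := ℝ))] with c hc
    have h6 := slitChart_symm_sc hv hc ((extChartAt (tildeModel E) v).map_source hs)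
    rw [(extChartAt (tildeModel E) v).left_inv hs] at h6
    exact (congrArg (fun u => tl u s) h6).trans (tl_sc hc v s)
  rw [← hp2]
  exact h3.unique (h4.congr_of_eventuallyEq h5)

/-- By Euler's identity the value is contained in the differential. Hence `dTilde s v` encodes the
full 1-jet of a section of `ℓ`. -/
theorem tl_eq_zero_of_dTilde {v : slitDual L} {s : HatSec E L} (h : dTilde s v = 0) :
    tl v s = 0 := by
  rw [← euler, h]; rfl

/-- A functional `ℓ → A` trivializing `ℓ` near `v₀`. -/
theorem exists_triv (v₀ : slitDual L) : ∃ γ : HatSec E L →ₗ[HatFun E L] HatFun E L,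
    (∀ s t, γ s • t = γ t • s) ∧ (∃ e, evH v₀ (γ e) = 1) ∧
    ∃ G : slitDual L → ℝ, ContMDiff (tildeModel E) 𝓘(ℝ, ℝ) ∞ G ∧ G v₀ ≠ 0 ∧
      ∀ v s, evH v (γ s) = G v * tl v s := by
  -- `G` has degree `-1`, so its product with the homogeneous function of a section has degree zero
  -- and descends.
  obtain ⟨s₀, G, hG, hGh, hs, hG0⟩ := exists_local (E := E) v₀
  have ex : ∀ s : HatSec E L, ∃ f : HatFun E L, ∀ v, evH v f = G v * tl v s := fun s => by
    refine exists_fun_of (hG.mul (smooth_tl s)) fun c hc v => ?_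
    have h1 : G (sc c hc v) = c⁻¹ * G v := hGh v c (real_smul_ne hc)
    change G (sc c hc v) * tl (sc c hc v) s = G v * tl v s
    rw [h1, tl_sc]
    field_simp
  choose f hf using ex
  refine ⟨⟨⟨f, fun s t => evH_ext fun v => by simp [hf, mul_add]⟩, fun a s => evH_ext fun v => by
    simp [hf]; ring⟩, fun s t => tl_ext fun v => ?_, ⟨(G v₀ * tl v₀ s₀)⁻¹ • s₀, ?_⟩, G, hG, hG0,
    fun v s => hf s v⟩
  · change tl v (f s • t) = tl v (f t • s)
    simp [hf]; ring
  · change evH v₀ (f _) = 1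
    rw [hf, map_smul, smul_eq_mul]
    have : tl v₀ s₀ ≠ 0 := hs
    field_simp

theorem hat_gauge_eq_zero (Δ : Gauge ℝ (HatFun E L) (HatSec E L)) {s : HatSec E L}
    {v : slitDual L} (h : dTilde s v = 0) : tl v (Δ.1 s) = 0 := by
  obtain ⟨γ, hγ, ⟨e, he⟩, G, hG, -, hγG⟩ := exists_triv (E := E) v
  obtain ⟨S, hS⟩ := Δ.2
  have h0 := tl_eq_zero_of_dTilde h
  have h1 : evH v (S (γ s)) = 0 := by
    refine derivation_hat_eq_zero S ?_
    have h2 : (fun u => evH u (γ s)) = fun u => G u * tl u s := funext fun u => hγG u s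
    rw [h2]
    refine ContinuousLinearMap.ext fun w => ?_
    rw [chartD_mul (mem_slitChart_source.2 (mem_goodSet _)) (hG v) (smooth_tl s v), h0]
    rw [dTilde_self] at h
    change G v * tlD v v s w + _ = 0
    rw [h]; simp
  have h2 := congrArg (fun r => tl v (Δ.1 r)) (hγ s e)
  have h3 : evH v (γ s) = 0 := by rw [hγG, h0, mul_zero]
  simp only [hS _ _, map_add, tl_smul, h0, h1, h3, he] at h2
  simpa using h2.symm

theorem dTilde_sub (s t : HatSec E L) (v : slitDual L) (w : TildeT E) :
    dTilde (s - t) v w = dTilde s v w - dTilde t v w := by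
  have h : s - t = s + (-1 : ℝ) • t := by module
  rw [h, dTilde_add, dTilde_smul]
  change dTilde s v w + (-1) * dTilde t v w = _
  ring

theorem hat_gauge_congr (Δ : Gauge ℝ (HatFun E L) (HatSec E L)) {s t : HatSec E L}
    {v : slitDual L} (h : dTilde s v = dTilde t v) : tl v (Δ.1 s) = tl v (Δ.1 t) := by
  rw [← sub_eq_zero, ← map_sub, ← map_sub]
  refine hat_gauge_eq_zero Δ (ContinuousLinearMap.ext fun w => ?_)
  rw [dTilde_sub, h]
  exact sub_self (dTilde t v w)

end HatDer

/-! ### Recognizing derivations by a second order identity. -/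

section Criterion

variable {K A P : Type*} [Field K] [CommRing A] [Algebra K A] [AddCommGroup P] [Module K P]
  [Module A P] [IsScalarTower K A P] [IsLineModule A P]

theorem smul_left_inj_line {a b : A} (h : ∀ p : P, a • p = b • p) : a = b :=
  sub_eq_zero.1 (IsLineModule.faithful (P := P) _ fun p => by rw [sub_smul, h, sub_self])

/-- An operator of order at most one on a line bundle is a derivation. -/
theorem mem_gauge_of_second_order (D : P →ₗ[K] P)
    (hD : ∀ (a b : A) p, D (a • b • p) = a • D (b • p) + b • D (a • p) - (a * b) • D p) :
    D ∈ Gauge K A P := by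
  -- The assumption on `D` says that the commutator of `D` with multiplication by `a` is `A`-linear;
  -- on a line bundle it is then multiplication by a function, the value of the symbol at `a`.
  have h1 : ∀ a : A, ∃ c : A, ∀ p, D (a • p) - a • D p = c • p := fun a =>
    IsLineModule.endo (A := A) (P := P)
      { toFun := fun p => D (a • p) - a • D p
        map_add' := fun p q => by simp only [smul_add, map_add]; abel
        map_smul' := fun b p => by
          rw [hD, RingHom.id_apply, smul_sub, mul_smul, smul_comm a b (D p)]; abel }
  choose c hc using h1
  let cl : A →ₗ[K] A :=
    { toFun := c
      map_add' := fun a b => smul_left_inj_line (P := P) fun p => by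
        rw [add_smul, ← hc, ← hc, ← hc, add_smul, add_smul, map_add]; abel
      map_smul' := fun k a => smul_left_inj_line (P := P) fun p => by
        rw [RingHom.id_apply, smul_assoc, ← hc, ← hc, smul_assoc, smul_assoc, map_smul, smul_sub] }
  refine ⟨Derivation.mk' cl fun a b => smul_left_inj_line (P := P) fun p => ?_, fun a p => ?_⟩
  · change c (a * b) • p = (a • c b + b • c a) • p
    rw [add_smul, smul_assoc, smul_assoc, ← hc, ← hc, ← hc, mul_smul, hD, smul_sub, smul_sub,
      mul_smul, smul_comm b a (D p)]
    abel
  · change _ = c a • p + _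
    rw [← hc]; abel

end Criterion

/-! ### Jet frames of `ℓ` made of real parts of holomorphic sections. -/

section Frame

open Bundle TopologicalSpace

variable {E : Type*} [NormedAddCommGroup E] [NormedSpace ℂ E]
  {X : Type*} [TopologicalSpace X] [ChartedSpace E X]
  {L : X → Type*} [∀ x, AddCommGroup (L x)] [∀ x, Module ℂ (L x)] [∀ x, TopologicalSpace (L x)]
  [TopologicalSpace (TotalSpace ℂ L)] [FiberBundle ℂ L] [VectorBundle ℂ ℂ L]
  [FiniteDimensional ℂ E] [T2Space X] [IsManifold 𝓘(ℂ, E) ω X]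
  [ContMDiffVectorBundle ω ℂ L 𝓘(ℂ, E)]

attribute [local instance] isManifold_real isManifold_slit

/-- Both the smoothness of `F` and its homogeneity can be read off locally, where `F` is the
quotient of a section by a function of degree zero. -/
theorem exists_sec_of_locally {F : slitDual L → ℝ}
    (h : ∀ v₀, ∃ (κ : HatFun E L) (t : HatSec E L), evH v₀ κ ≠ 0 ∧
      ∀ v, evH v κ ≠ 0 → evH v κ * F v = tl v t) : ∃ s : HatSec E L, ∀ v, tl v s = F v := by
  refine exists_sec_of (fun v => ?_) fun c hc v => ?_
  · obtain ⟨κ, t, h0, h1⟩ := h v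
    refine ((smooth_tl t v).div₀ (smooth_evH κ v) h0).congr_of_eventuallyEq ?_
    filter_upwards [(smooth_evH κ).continuous.continuousAt.eventually_ne h0] with u hu
    change _ = tl u t / evH u κ
    rw [← h1 u hu]; field_simp
  · obtain ⟨κ, t, h0, h1⟩ := h v
    have h2 := h1 (sc c hc v) (by rwa [evH_sc])
    rw [evH_sc, tl_sc, ← h1 v h0] at h2
    refine mul_left_cancel₀ h0 ?_
    rw [h2]; ring

/-- A real covector is the differential of the real part of a holomorphic section. -/
theorem exists_dTilde_re (v : slitDual L) (α : TildeT E →L[ℝ] ℝ) :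
    ∃ s : CSec E L, HolNear v.1.1 s ∧ dTilde (re s) v = α := by
  -- The complex linear functional with real part `α`; taking the `(1,0)`-part halves the real part,
  -- whence the factor `2`.
  let A : TildeT E →L[ℂ] ℂ := (2 : ℂ) • linPart (complexify α)
  have hA : ∀ w, (A w).re = α w := fun w => by
    have : A w = (2 : ℂ) * linPart (complexify α) w := rfl
    rw [this, linPart_apply]
    simp [complexify]
  have h0 := om_ne_zero (mem_baseSet_trivializationAt ℂ L v.1.1)
  -- In the coordinates at `v` the differential of `s̃` is `w ↦ w₂ s + ω ds(w₁)`, with `ω` the fiber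
  -- coordinate of `v`. The value and the derivative of `s` are chosen so that this equals `A`.
  refine ⟨holSec v.1.1 (A (0, ContinuousLinearMap.id ℂ ℂ),
    (om v.1.1 v)⁻¹ • A ∘L ContinuousLinearMap.inl ℂ E (ℂ →L[ℂ] ℂ)),
    holNear_holSec (mem_core E L _) _, ContinuousLinearMap.ext fun w => ?_⟩
  rw [dTilde_re, dcTilde_apply, loc_holSec_self, dloc_holSec_self, ← hA]
  congr 1
  change w.2 1 * _ + _ * ((om v.1.1 v)⁻¹ * A (w.1, 0)) = _
  rw [mul_inv_cancel_left₀ h0, ← smul_eq_mul, ← map_smul, ← map_add]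
  congr 1
  refine Prod.ext ?_ ?_
  · change w.2 1 • (0 : E) + w.1 = w.1
    rw [smul_zero, zero_add]
  · refine ContinuousLinearMap.ext_ring ?_
    change w.2 1 * 1 + 0 = w.2 1
    ring

/-- The reduction principle of the proof: a derivation sees only the differential at the point, and
each differential is that of `re s` for some `s` holomorphic nearby. -/
theorem hat_gauge_ext {Δ Θ : Gauge ℝ (HatFun E L) (HatSec E L)}
    (h : ∀ (v : slitDual L) (s : CSec E L), HolNear v.1.1 s → tl v (Δ.1 (re s)) = tl v (Θ.1 (re s))) :
    Δ = Θ := by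
  refine Subtype.ext (LinearMap.ext fun t => tl_ext fun v => ?_)
  obtain ⟨s, hs, hst⟩ := exists_dTilde_re v (dTilde t v)
  rw [← hat_gauge_congr Δ hst, ← hat_gauge_congr Θ hst, h v s hs]

/-- A frame of the jet bundle of `ℓ` near a point, made of jets of real parts of holomorphic
sections. -/
structure JetFrame (v₀ : slitDual L) where
  ι : Type
  fintype : Fintype ι
  sec : ι → CSec E L
  κ : HatFun E L
  c : ι → HatSec E L →ₗ[ℝ] HatFun E L
  W : ι → TildeT E
  κ_self : evH v₀ κ = 1
  hol : ∀ v, evH v κ ≠ 0 → ∀ i, HolNear v.1.1 (sec i)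
  eq : ∀ s v w, evH v κ * dTilde s v w = ∑ i, evH v (c i s) * dTilde (re (sec i)) v w
  order : ∀ i (a b : HatFun E L) s, c i (a • b • s) = a * c i (b • s) + b * c i (a • s) - a * b * c i s
  vec : ∀ i s, evH v₀ (c i s) = dTilde s v₀ (W i)
  indep : ∀ i, ∃ w, dTilde (re (sec i)) v₀ w = 1 ∧ ∀ j, j ≠ i → dTilde (re (sec j)) v₀ w = 0

attribute [instance] JetFrame.fintype

/-- The inverse of the isomorphism sending a tangent vector at `v`, in the chart at `x₀`, to
the values on it of the differentials of affine holomorphic sections. -/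
def frameVec (x₀ : X) (v : slitDual L) : (ℂ × E) →ₗ[ℂ] TildeT E where
  toFun y := ((om x₀ v)⁻¹ • (y.2 - y.1 • centered E x₀ v.1.1), y.1 • ContinuousLinearMap.id ℂ ℂ)
  map_add' y z := by
    refine Prod.ext ?_ ?_
    · change _ • (y.2 + z.2 - (y.1 + z.1) • _) = _ • _ + _ • _
      module
    · change (y.1 + z.1) • _ = _ • _ + _ • _
      module
  map_smul' c y := by
    refine Prod.ext ?_ ?_
    · change _ • (c • y.2 - (c * y.1) • _) = c • _ • _
      module
    · change (c * y.1) • _ = c • _ • _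
      module

theorem smooth_frameVec {v₀ v : slitDual L} (hv : v.1.1 ∈ goodSet E L v₀.1.1) (y : ℂ × E) :
    ContMDiffAt (tildeModel E) 𝓘(ℝ, TildeT E) ∞ (fun v => frameVec (E := E) v₀.1.1 v y) v := by
  have h1 : ContMDiffAt (tildeModel E) 𝓘(ℝ, ℂ) ∞ (fun v : slitDual L => (om v₀.1.1 v)⁻¹) v :=
    (contDiffAt_inv ℝ (om_ne_zero hv.2)).comp_contMDiffAt (smooth_om hv)
  have h2 : ContMDiffAt (tildeModel E) 𝓘(ℝ, E) ∞
      (fun v : slitDual L => extChartAt 𝓘(ℝ, E) v₀.1.1 v.1.1) v :=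
    (contMDiffAt_extChart (mem_source_of_goodSet hv)).comp v (smooth_proj v)
  have h3 : ContDiff ℝ ∞ fun q : ℂ × E =>
      (q.1 • (y.2 - y.1 • (q.2 - extChartAt 𝓘(ℝ, E) v₀.1.1 v₀.1.1)),
        y.1 • ContinuousLinearMap.id ℂ ℂ) := by
    refine ContDiff.prodMk (contDiff_fst.smul (contDiff_const.sub ?_)) contDiff_const
    exact (contDiff_snd.sub contDiff_const).const_smul y.1
  exact h3.contDiffAt.comp_contMDiffAt (h1.prodMk_space h2)

/-- The factor `c⁻¹` compensates the degree one in `tlD_sc`, so the derivative of a section along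
this vector is a function of degree zero. -/
theorem frameVec_sc (x₀ : X) {c : ℝ} (hc : c ≠ 0) (v : slitDual L) (y : ℂ × E) :
    frameVec (E := E) x₀ (sc c hc v) y =
      c⁻¹ • ((frameVec (E := E) x₀ v y).1, c • (frameVec (E := E) x₀ v y).2) := by
  refine Prod.ext ?_ ?_
  · change (om x₀ (sc c hc v))⁻¹ • _ = c⁻¹ • (om x₀ v)⁻¹ • _
    rw [om_sc, mul_inv, mul_smul, ← Complex.ofReal_inv, Complex.coe_smul]; rfl
  · change _ = c⁻¹ • c • (frameVec (E := E) x₀ v y).2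
    rw [inv_smul_smul₀ hc]; rfl

theorem frameVec_surj {x₀ : X} {v : slitDual L} (hv : v.1.1 ∈ goodSet E L x₀) (w : TildeT E) :
    frameVec (E := E) x₀ v (w.2 1, w.2 1 • centered E x₀ v.1.1 + om x₀ v • w.1) = w := by
  refine Prod.ext ?_ ?_
  · change (om x₀ v)⁻¹ • (_ + om x₀ v • w.1 - _) = w.1
    rw [add_sub_cancel_left, inv_smul_smul₀ (om_ne_zero hv.2)]
  · refine ContinuousLinearMap.ext_ring ?_
    change w.2 1 * 1 = w.2 1
    ring

theorem tlD_add_apply {v₀ v : slitDual L} (hv : v.1.1 ∈ goodSet E L v₀.1.1) (s t : HatSec E L)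
    (w : TildeT E) : tlD v₀ v (s + t) w = tlD v₀ v s w + tlD v₀ v t w := by
  rw [tlD_add hv]; rfl

theorem tlD_smul_apply {v₀ v : slitDual L} (hv : v.1.1 ∈ goodSet E L v₀.1.1) (c : ℝ)
    (s : HatSec E L) (w : TildeT E) : tlD v₀ v (c • s) w = c * tlD v₀ v s w := by
  rw [tlD_smul hv]; rfl

theorem tlD_fsmul_apply {v₀ v : slitDual L} (hv : v.1.1 ∈ goodSet E L v₀.1.1) (a : HatFun E L)
    (s : HatSec E L) (w : TildeT E) : tlD v₀ v (a • s) w =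
      evH v a * tlD v₀ v s w + tl v s * chartD (tildeModel E) v₀ (fun u => evH u a) v w := by
  rw [tlD_fsmul hv]; rfl

/-- The two basic real directions in a complex line. -/
def unitC (b : Bool) : ℂ := if b then 1 else Complex.I

theorem sum_unitC (z : ℂ) : ∑ b, ((starRingEnd ℂ (unitC b) * z).re : ℂ) * unitC b = z := by
  simp [unitC]

/-- The values on a tangent vector of the differentials of all affine holomorphic sections are
encoded by a point of `ℂ × E`, and `frameVec` inverts this encoding. A complex basis of `ℂ × E`,
together with its multiples by `i`, gives real coordinates; the frame consists of the corresponding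
dual sections and the coefficients are derivatives along the basis vectors, cut off by a bump
function. -/
theorem nonempty_jetFrame (v₀ : slitDual L) : Nonempty (JetFrame (E := E) v₀) := by
  classical
  set x₀ := v₀.1.1 with hx₀
  obtain ⟨χ, hχ, hχ1, hχs⟩ := exists_bump (E := E) ((isOpen_core E L x₀).mem_nhds (mem_core E L x₀))
  have hsup : ∀ v : slitDual L, χ v.1.1 ≠ 0 → v.1.1 ∈ core E L x₀ := fun v hv =>
    hχs (subset_tsupport χ hv)
  let e := Module.finBasis ℂ (ℂ × E)
  let ι := Fin (Module.finrank ℂ (ℂ × E)) × Bool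
  let y : ι → ℂ × E := fun i => unitC i.2 • e i.1
  let q : ι → (ℂ × E) →L[ℂ] ℂ := fun i =>
    (starRingEnd ℂ (unitC i.2) • e.coord i.1).toContinuousLinearMap
  -- The vectors `y i` form a real basis of `ℂ × E` and the real parts of the `q i` are its
  -- coordinates.
  have hyq : ∀ z, ∑ i, (q i z).re • y i = z := fun z => by
    rw [Fintype.sum_prod_type]
    conv_rhs => rw [← e.sum_repr z]
    refine Finset.sum_congr rfl fun k _ => ?_
    have h1 := sum_unitC (e.repr z k)
    conv_rhs => rw [← h1, Finset.sum_smul]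
    refine Finset.sum_congr rfl fun b _ => ?_
    change ((starRingEnd ℂ (unitC b) * e.repr z k).re : ℝ) • unitC b • e k = _
    rw [mul_smul, Complex.coe_smul]
  let p : ι → ℂ × (E →L[ℂ] ℂ) := fun i => (q i (1, 0), q i ∘L ContinuousLinearMap.inr ℂ ℂ E)
  have hfun : ∀ (i : ι) (s : HatSec E L), ∃ f : HatFun E L, ∀ v,
      evH v f = χ v.1.1 * tlD v₀ v s (frameVec x₀ v (y i)) := fun i s => by
    refine exists_fun_of (fun v => ?_) fun c hc v => ?_
    · by_cases hv : v.1.1 ∈ tsupport χ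
      · have hg := core_good (hχs hv)
        exact ((hχ v.1.1).comp v (smooth_proj v)).mul
          ((smooth_tlD hg s).clm_apply (smooth_frameVec hg (y i)))
      · refine (contMDiffAt_const (c := (0 : ℝ))).congr_of_eventuallyEq ?_
        filter_upwards [continuous_proj.continuousAt.preimage_mem_nhds
          ((isClosed_tsupport χ).isOpen_compl.mem_nhds hv)] with u hu
        rw [image_eq_zero_of_notMem_tsupport hu, zero_mul]
    · by_cases hv : χ v.1.1 = 0
      · change χ v.1.1 * _ = _
        rw [hv, zero_mul, zero_mul]
      · change χ v.1.1 * _ = _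
        have h1 := tlD_sc (core_good (hsup v hv)) hc s (frameVec x₀ v (y i))
        rw [frameVec_sc x₀ hc, map_smul, h1, smul_eq_mul, inv_mul_cancel_left₀ hc]
  choose c hc using hfun
  have hfunκ : ∃ f : HatFun E L, ∀ v, evH v f = χ v.1.1 :=
    exists_fun_of (hχ.comp smooth_proj) fun _ _ _ => rfl
  obtain ⟨κ, hκ⟩ := hfunκ
  have off : ∀ v i s, χ v.1.1 = 0 → evH v (c i s) = 0 := fun v i s h => by rw [hc, h, zero_mul]
  let cl : ι → HatSec E L →ₗ[ℝ] HatFun E L := fun i =>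
    { toFun := c i
      map_add' := fun s t => evH_ext fun v => by
        rw [map_add, hc, hc, hc]
        by_cases hv : χ v.1.1 = 0
        · simp [hv]
        · rw [tlD_add_apply (core_good (hsup v hv))]
          ring
      map_smul' := fun r s => evH_ext fun v => by
        rw [RingHom.id_apply, map_smul, hc, hc]
        by_cases hv : χ v.1.1 = 0
        · simp [hv]
        · rw [tlD_smul_apply (core_good (hsup v hv)), smul_eq_mul]
          ring }
  -- At `v₀` the differentials of the frame and the vectors `frameVec x₀ v₀ (y i)` are dual bases;
  -- this is the source of `indep`.
  have hdual : ∀ i j, dTilde (re (holSec (L := L) x₀ (p j))) v₀ (frameVec x₀ v₀ (y i)) =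
      (q j (y i)).re := fun i j => by
    have h1 : v₀.1.1 ∈ core E L x₀ := mem_core E L x₀
    rw [dTilde_self, tlD_re _ (core_good h1), loc_holSec h1, secD_holSec h1]
    congr 1
    have h0 := om_ne_zero (core_good h1).2
    have h3 : (frameVec (E := E) x₀ v₀ (y i)).2 1 = (y i).1 := mul_one _
    have h4 : om x₀ v₀ • (frameVec (E := E) x₀ v₀ (y i)).1 =
        (y i).2 - (y i).1 • centered E x₀ v₀.1.1 := smul_inv_smul₀ h0 _
    rw [h3]
    change (y i).1 * (q j (1, 0) + q j (0, centered E x₀ v₀.1.1)) +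
      om x₀ v₀ * q j (0, (frameVec (E := E) x₀ v₀ (y i)).1) = _
    simp only [← smul_eq_mul, ← map_smul, ← map_add]
    congr 1
    refine Prod.ext ?_ ?_
    · simp
    · change (y i).1 • (0 + centered E x₀ v₀.1.1) + om x₀ v₀ • _ = _
      rw [h4]; simp
  have hqv : ∀ i j, (q j (y i)).re =
      (starRingEnd ℂ (unitC j.2) * (unitC i.2 * if i.1 = j.1 then 1 else 0)).re := fun i j => by
    change (starRingEnd ℂ (unitC j.2) * e.repr (unitC i.2 • e i.1) j.1).re = _
    rw [map_smul, e.repr_self, Finsupp.smul_apply, Finsupp.single_apply, smul_eq_mul]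
  refine ⟨⟨ι, inferInstance, fun i => holSec x₀ (p i), κ, cl,
    fun i => frameVec x₀ v₀ (y i), ?_, ?_, ?_, ?_, ?_,
    fun i => ⟨frameVec x₀ v₀ (y i), ?_, fun j hj => ?_⟩⟩⟩
  · rw [hκ]; exact hχ1.self_of_nhds
  · intro v hv i
    rw [hκ] at hv
    exact holNear_holSec (hsup v hv) _
  · intro s v w
    rw [hκ]
    by_cases hv : χ v.1.1 = 0
    · rw [hv, zero_mul]
      exact (Finset.sum_eq_zero fun i _ => by
        change evH v (c i s) * _ = 0
        rw [off v i s hv, zero_mul]).symm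
    have hg := core_good (hsup v hv)
    set w' := slitT E v₀ v w
    have h2 : ∀ t : HatSec E L, dTilde t v w = tlD v₀ v t w' := fun t => by
      rw [dTilde_eq t hg]; rfl
    have h3 : ∀ i, dTilde (re (holSec (L := L) x₀ (p i))) v w =
        (q i (w'.2 1, w'.2 1 • centered E x₀ v.1.1 + om x₀ v • w'.1)).re := fun i => by
      rw [h2, tlD_re _ hg, loc_holSec (hsup v hv), secD_holSec (hsup v hv)]
      congr 1
      change w'.2 1 * (q i (1, 0) + q i (0, centered E x₀ v.1.1)) + _ * q i (0, w'.1) = _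
      simp only [← smul_eq_mul, ← map_smul, ← map_add]
      congr 1
      refine Prod.ext ?_ ?_
      · simp
      · simp [hx₀]
    have h4 : tlD v₀ v s w' = ∑ i, tlD v₀ v s (frameVec x₀ v (y i)) *
        dTilde (re (holSec (L := L) x₀ (p i))) v w := by
      conv_lhs => rw [← frameVec_surj hg w', ← hyq (w'.2 1, _)]
      have h5 : ∀ z : ι → ℝ, frameVec (E := E) x₀ v (∑ i, z i • y i) =
          ∑ i, z i • frameVec x₀ v (y i) := fun z => by
        have : ∀ i, z i • y i = (z i : ℂ) • y i := fun i => rfl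
        simp only [this, map_sum, map_smul]; rfl
      rw [h5, map_sum]
      refine Finset.sum_congr rfl fun i _ => ?_
      rw [h3, map_smul, smul_eq_mul, mul_comm]
    rw [h2, h4, Finset.mul_sum]
    refine Finset.sum_congr rfl fun i _ => ?_
    change _ = evH v (c i s) * _
    rw [hc, mul_assoc]
  · intro i a b s
    change c i _ = a * c i _ + b * c i _ - a * b * c i s
    refine evH_ext fun v => ?_
    simp only [map_sub, map_add, map_mul, hc]
    by_cases hv : χ v.1.1 = 0
    · simp [hv]
    have hg := core_good (hsup v hv)
    rw [tlD_fsmul_apply hg, tlD_fsmul_apply hg, tlD_fsmul_apply hg, tl_smul]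
    ring
  · intro i s
    change evH v₀ (c i s) = _
    rw [hc, dTilde_self, ← hx₀, hχ1.self_of_nhds, one_mul]
  · rw [hdual, hqv]
    obtain ⟨k, b⟩ := i
    cases b <;> simp [unitC]
  · rw [hdual, hqv]
    obtain ⟨k, b⟩ := i
    obtain ⟨k', b'⟩ := j
    by_cases hk : k = k'
    · subst hk
      have hb : b' ≠ b := fun h => hj (by rw [h])
      cases b <;> cases b' <;> simp_all [unitC]
    · simp [hk]

end Frame

/-! ### Derivations and jets of `ℓ` in a frame. -/

section FrameUse

open Bundle TopologicalSpace

variable {E : Type*} [NormedAddCommGroup E] [NormedSpace ℂ E]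
  {X : Type*} [TopologicalSpace X] [ChartedSpace E X]
  {L : X → Type*} [∀ x, AddCommGroup (L x)] [∀ x, Module ℂ (L x)] [∀ x, TopologicalSpace (L x)]
  [TopologicalSpace (TotalSpace ℂ L)] [FiberBundle ℂ L] [VectorBundle ℂ ℂ L]
  [FiniteDimensional ℂ E] [T2Space X] [IsManifold 𝓘(ℂ, E) ω X]
  [ContMDiffVectorBundle ω ℂ L 𝓘(ℂ, E)]

attribute [local instance] isManifold_real isManifold_slit

/-- By the Leibniz rule the differential satisfies the identity of a first order operator, so any
operator that depends linearly on it does as well. -/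
theorem dTilde_second_order (a b : HatFun E L) (t : HatSec E L) (v : slitDual L) :
    dTilde (a • b • t) v + (evH v a * evH v b) • dTilde t v =
      evH v a • dTilde (b • t) v + evH v b • dTilde (a • t) v := by
  have hg := mem_goodSet (E := E) (L := L) v.1.1
  refine ContinuousLinearMap.ext fun w => ?_
  change dTilde (a • b • t) v w + (evH v a * evH v b) * dTilde t v w =
    evH v a * dTilde (b • t) v w + evH v b * dTilde (a • t) v w
  simp only [dTilde_self]
  rw [tlD_fsmul_apply hg, tlD_fsmul_apply hg, tlD_fsmul_apply hg, tl_smul]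
  ring

/-- An operator which depends linearly on the differential is a derivation. -/
theorem mem_gauge_of_dTilde (D : HatSec E L →ₗ[ℝ] HatSec E L)
    (l : slitDual L → (TildeT E →L[ℝ] ℝ) →ₗ[ℝ] ℝ) (h : ∀ v s, tl v (D s) = l v (dTilde s v)) :
    D ∈ Gauge ℝ (HatFun E L) (HatSec E L) := by
  refine mem_gauge_of_second_order D fun a b p => tl_ext fun v => ?_
  simp only [map_sub, map_add, tl_smul, h, map_mul]
  have h1 := congrArg (l v) (dTilde_second_order a b p v)
  rw [map_add, map_add, map_smul, map_smul, map_smul] at h1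
  exact eq_sub_of_add_eq h1

theorem dTilde_congr {s t : HatSec E L} {v : slitDual L} (h : ∀ᶠ u in nhds v, tl u s = tl u t) :
    dTilde s v = dTilde t v := Filter.EventuallyEq.mfderiv_eq h

theorem hat_gauge_congr_of_eventually (Δ : Gauge ℝ (HatFun E L) (HatSec E L)) {s t : HatSec E L}
    {v : slitDual L} (h : ∀ᶠ u in nhds v, tl u s = tl u t) : tl v (Δ.1 s) = tl v (Δ.1 t) :=
  hat_gauge_congr Δ (dTilde_congr h)

namespace JetFrame

variable {v₀ : slitDual L} (F : JetFrame (E := E) v₀)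

/-- The derivations given by a frame. -/
def op (i : F.ι) (t : HatSec E L) : Gauge ℝ (HatFun E L) (HatSec E L) :=
  ⟨{ toFun := fun s => F.c i s • t
     map_add' := fun s s' => by rw [map_add, add_smul]
     map_smul' := fun r s => by rw [map_smul, RingHom.id_apply, smul_assoc] },
    mem_gauge_of_second_order _ fun a b s => by
      change F.c i (a • b • s) • t = _
      rw [F.order, sub_smul, add_smul, mul_smul, mul_smul, mul_smul (a * b)]; rfl⟩

theorem op_apply (i : F.ι) (s t : HatSec E L) : (F.op i t).1 s = F.c i s • t := rfl

/-- At `v` both sides depend only on differentials, and the two sections to which `Δ` is effectively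
applied have the same differential by the defining property of the frame. -/
theorem gauge_apply (Δ : Gauge ℝ (HatFun E L) (HatSec E L)) (s : HatSec E L) :
    F.κ • Δ.1 s = ∑ i, F.c i s • Δ.1 (re (F.sec i)) := by
  refine tl_ext fun v => ?_
  obtain ⟨γ, hγ⟩ : ∃ u : HatSec E L, u = ∑ i, evH v (F.c i s) • re (F.sec i) := ⟨_, rfl⟩
  have h1 : dTilde (evH v F.κ • s) v = dTilde γ v := by
    refine ContinuousLinearMap.ext fun w => ?_
    have h2 : dTilde γ v = dT E v γ := rfl
    rw [dTilde_smul, h2, hγ, map_sum]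
    change evH v F.κ * dTilde s v w = _
    rw [F.eq, sum_apply]
    refine Finset.sum_congr rfl fun i _ => ?_
    rw [map_smul]; rfl
  have h2 := hat_gauge_congr Δ h1
  rw [hγ, map_smul, map_smul, map_sum, map_sum] at h2
  rw [tl_smul, map_sum]
  refine h2.trans (Finset.sum_congr rfl fun i _ => ?_)
  rw [map_smul, map_smul, tl_smul]; rfl

theorem gauge_eq (Δ : Gauge ℝ (HatFun E L) (HatSec E L)) :
    F.κ • Δ = ∑ i, F.op i (Δ.1 (re (F.sec i))) := by
  refine Subtype.ext (LinearMap.ext fun s => ?_)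
  rw [Submodule.coe_sum, LinearMap.sum_apply]
  exact F.gauge_apply Δ s

/-- `ρ` applied to the frame derivation `F.op i t` is linear in the section `t`, hence is
multiplication by a function; these functions are the coefficients of `ρ`. -/
theorem jet_eq (ρ : Jet ℝ (HatFun E L) (HatSec E L)) :
    ∃ b : F.ι → HatFun E L, F.κ • ρ = ∑ i, b i • j1 (re (F.sec i)) := by
  have h : ∀ i, ∃ b : HatFun E L, ∀ t, ρ (F.op i t) = b • t := fun i =>
    IsLineModule.endo (A := HatFun E L) (P := HatSec E L)
      { toFun := fun t => ρ (F.op i t)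
        map_add' := fun t t' => by
          rw [← map_add]; congr 1; ext s; simp [op_apply]
        map_smul' := fun a t => by
          rw [RingHom.id_apply, ← map_smul]; congr 1; ext s; simp [op_apply, smul_comm a] }
  choose b hb using h
  refine ⟨b, LinearMap.ext fun Θ => ?_⟩
  rw [LinearMap.smul_apply, ← map_smul, F.gauge_eq, map_sum, LinearMap.sum_apply]
  exact Finset.sum_congr rfl fun i _ => hb i _

end JetFrame

/-- A tensorial operator on jets is determined by its values on the jets of real parts of
local holomorphic sections. -/
theorem jet_ext {T : Jet ℝ (HatFun E L) (HatSec E L) →ₗ[HatFun E L] HatSec E L}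
    (h : ∀ (v : slitDual L) (s : CSec E L), HolNear v.1.1 s → tl v (T (j1 (re s))) = 0)
    (ρ : Jet ℝ (HatFun E L) (HatSec E L)) : T ρ = 0 := by
  refine tl_ext fun v => ?_
  obtain ⟨F⟩ := nonempty_jetFrame (E := E) v
  obtain ⟨b, hb⟩ := F.jet_eq ρ
  have h1 := congrArg (fun r => tl v (T r)) hb
  simp only [map_smul, map_sum, tl_smul, F.κ_self, one_mul] at h1
  rw [h1, map_zero]
  refine Finset.sum_eq_zero fun i _ => ?_
  rw [h v _ (F.hol v (by rw [F.κ_self]; exact one_ne_zero) i), mul_zero]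

/-! ### The vector corresponding to a derivation -/

/-- The vector combines the frame vectors `F.W i`, which compute the coefficients at `v`, with the
values of `Δ` on the frame sections. -/
theorem exists_gvec (v : slitDual L) (Δ : Gauge ℝ (HatFun E L) (HatSec E L)) :
    ∃ V : TildeT E, ∀ s, dTilde s v V = tl v (Δ.1 s) := by
  obtain ⟨F⟩ := nonempty_jetFrame (E := E) v
  refine ⟨∑ i, tl v (Δ.1 (re (F.sec i))) • F.W i, fun s => ?_⟩
  have h1 := congrArg (tl v) (F.gauge_apply Δ s)
  rw [tl_smul, F.κ_self, one_mul, map_sum] at h1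
  rw [h1, map_sum]
  refine Finset.sum_congr rfl fun i _ => ?_
  rw [map_smul, tl_smul, F.vec, smul_eq_mul, mul_comm]

theorem vec_ext {v : slitDual L} {V W : TildeT E}
    (h : ∀ s : CSec E L, HolNear v.1.1 s → dTilde (re s) v V = dTilde (re s) v W) : V = W := by
  refine (SeparatingDual.eq_iff_forall_dual_eq (R := ℝ)).2 fun α => ?_
  obtain ⟨s, hs, hα⟩ := exists_dTilde_re v α
  rw [← hα, h s hs]

/-- The value at `v` of the vector field corresponding to a derivation. -/
def gvec (v : slitDual L) (Δ : Gauge ℝ (HatFun E L) (HatSec E L)) : TildeT E :=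
  (exists_gvec v Δ).choose

theorem dTilde_gvec (v : slitDual L) (Δ : Gauge ℝ (HatFun E L) (HatSec E L)) (s : HatSec E L) :
    dTilde s v (gvec v Δ) = tl v (Δ.1 s) := (exists_gvec v Δ).choose_spec s

theorem gvec_eq {v : slitDual L} {Δ : Gauge ℝ (HatFun E L) (HatSec E L)} {V : TildeT E}
    (h : ∀ s, dTilde s v V = tl v (Δ.1 s)) : gvec v Δ = V :=
  vec_ext fun s _ => by rw [dTilde_gvec, h]

theorem exists_gauge (v : slitDual L) (V : TildeT E) :
    ∃ Δ : Gauge ℝ (HatFun E L) (HatSec E L), ∀ s, tl v (Δ.1 s) = dTilde s v V := by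
  obtain ⟨F⟩ := nonempty_jetFrame (E := E) v
  obtain ⟨γ, -, ⟨e, he⟩, G, -, -, hG⟩ := exists_triv (E := E) v
  have h0 : tl v e ≠ 0 := fun h => by
    rw [hG, h, mul_zero] at he; exact zero_ne_one he
  refine ⟨∑ i, F.op i ((dTilde (re (F.sec i)) v V * (tl v e)⁻¹) • e), fun s => ?_⟩
  have h1 := F.eq s v V
  rw [F.κ_self, one_mul] at h1
  rw [Submodule.coe_sum, LinearMap.sum_apply, map_sum, h1]
  refine Finset.sum_congr rfl fun i _ => ?_
  rw [F.op_apply, tl_smul, map_smul, smul_eq_mul, mul_assoc _ (tl v e)⁻¹, inv_mul_cancel₀ h0, mul_one]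

/-! ### The complex structure of the gauge algebroid -/

/-- The point is smoothness of `v ↦ ds̃(i V)`. In a frame of holomorphic sections it is a
combination of the values of `Δ` on the sections `re (i s_j)`. -/
theorem exists_hatEnd_apply (Δ : Gauge ℝ (HatFun E L) (HatSec E L)) :
    ∃ Θ : Gauge ℝ (HatFun E L) (HatSec E L), ∀ v s,
      tl v (Θ.1 s) = dTilde s v (Complex.I • gvec v Δ) := by
  have h : ∀ s : HatSec E L, ∃ t : HatSec E L, ∀ v, tl v t = dTilde s v (Complex.I • gvec v Δ) := by
    intro s
    refine exists_sec_of_locally fun v₀ => ?_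
    obtain ⟨F⟩ := nonempty_jetFrame (E := E) v₀
    refine ⟨F.κ, ∑ i, F.c i s • Δ.1 (re (Complex.I • F.sec i)), ?_, fun v hv => ?_⟩
    · rw [F.κ_self]; exact one_ne_zero
    · rw [F.eq, map_sum]
      refine Finset.sum_congr rfl fun i _ => ?_
      rw [(F.hol v hv i).holAt.dTilde_I, dTilde_gvec, tl_smul]
  choose D hD using h
  let Dl : HatSec E L →ₗ[ℝ] HatSec E L :=
    { toFun := D
      map_add' := fun s t => tl_ext fun v => by
        rw [map_add, hD, hD, hD, dTilde_add]; rfl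
      map_smul' := fun c s => tl_ext fun v => by
        rw [map_smul, hD, hD, dTilde_smul]; rfl }
  refine ⟨⟨Dl, mem_gauge_of_dTilde Dl (fun v =>
    { toFun := fun α => α (Complex.I • gvec v Δ)
      map_add' := fun _ _ => rfl
      map_smul' := fun _ _ => rfl }) fun v s => hD s v⟩, fun v s => hD s v⟩

theorem isHatEnd_iff {φ : Gauge ℝ (HatFun E L) (HatSec E L) →ₗ[HatFun E L]
    Gauge ℝ (HatFun E L) (HatSec E L)} :
    IsHatEnd φ ↔ ∀ Δ v s, tl v ((φ Δ).1 s) = dTilde s v (Complex.I • gvec v Δ) := by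
  refine ⟨fun h Δ v s => ?_, fun h Δ => ⟨fun v => gvec v Δ, fun s v => dTilde_gvec v Δ s,
    fun s v => (h Δ v s).symm⟩⟩
  obtain ⟨V, hV, hV'⟩ := h Δ
  rw [gvec_eq fun s => hV s v]
  exact (hV' s v).symm

variable (E L) in
theorem existsUnique_hatEnd : ∃! φ : Gauge ℝ (HatFun E L) (HatSec E L) →ₗ[HatFun E L]
    Gauge ℝ (HatFun E L) (HatSec E L), IsHatEnd φ := by
  choose φ hφ using exists_hatEnd_apply (E := E) (L := L)
  refine ⟨⟨⟨φ, fun Δ Θ => ?_⟩, fun a Δ => ?_⟩, isHatEnd_iff.2 fun Δ v s => hφ Δ v s, fun ψ hψ => ?_⟩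
  · refine Subtype.ext (LinearMap.ext fun s => tl_ext fun v => ?_)
    have h : gvec v (Δ + Θ) = gvec v Δ + gvec v Θ := gvec_eq fun s => by
      rw [map_add, dTilde_gvec, dTilde_gvec]; exact (map_add (tl v) _ _).symm
    refine (hφ _ v s).trans ?_
    rw [h, smul_add, map_add, ← hφ, ← hφ]; exact (map_add (tl v) _ _).symm
  · refine Subtype.ext (LinearMap.ext fun s => tl_ext fun v => ?_)
    have h : gvec v (a • Δ) = evH v a • gvec v Δ := gvec_eq fun s => by
      rw [map_smul, dTilde_gvec]; rfl
    refine (hφ _ v s).trans ?_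
    rw [h, smul_comm, map_smul, ← hφ]; rfl
  · refine LinearMap.ext fun Δ => Subtype.ext (LinearMap.ext fun s => tl_ext fun v => ?_)
    exact (isHatEnd_iff.1 hψ Δ v s).trans (hφ Δ v s).symm

variable {φ : Gauge ℝ (HatFun E L) (HatSec E L) →ₗ[HatFun E L]
    Gauge ℝ (HatFun E L) (HatSec E L)}

/-- The working description of `ĵ`: on real parts of holomorphic sections it moves `i` into the
section. -/
theorem IsHatEnd.apply_re (h : IsHatEnd φ) (Δ : Gauge ℝ (HatFun E L) (HatSec E L)) {v : slitDual L}
    {s : CSec E L} (hs : HolAt v.1.1 s) : tl v ((φ Δ).1 (re s)) = tl v (Δ.1 (re (Complex.I • s))) := by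
  rw [isHatEnd_iff.1 h, hs.dTilde_I, dTilde_gvec]

variable (E L) in
theorem HolNear.eventually_slit {v : slitDual L} {s : CSec E L} (h : HolNear v.1.1 s) :
    ∀ᶠ u : slitDual L in nhds v, HolNear u.1.1 s :=
  continuous_proj.continuousAt.eventually h.eventually

/-- Under a further derivation `Θ` the equality must hold near `v`; for this reason `s` is
holomorphic near the point and not only at it. -/
theorem IsHatEnd.gauge_apply_re (h : IsHatEnd φ) (Δ Θ : Gauge ℝ (HatFun E L) (HatSec E L))
    {v : slitDual L} {s : CSec E L} (hs : HolNear v.1.1 s) :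
    tl v (Θ.1 ((φ Δ).1 (re s))) = tl v (Θ.1 (Δ.1 (re (Complex.I • s)))) := by
  refine hat_gauge_congr_of_eventually Θ ?_
  filter_upwards [HolNear.eventually_slit E L hs] with u hu using h.apply_re Δ hu.holAt

theorem re_I_I (s : CSec E L) : re (Complex.I • Complex.I • s) = -re s := by
  rw [smul_smul, Complex.I_mul_I, neg_one_smul, map_neg]

theorem IsHatEnd.sq (h : IsHatEnd φ) (Δ : Gauge ℝ (HatFun E L) (HatSec E L)) :
    φ (φ Δ) = -Δ := by
  refine hat_gauge_ext fun v s hs => ?_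
  rw [h.apply_re _ hs.holAt, h.apply_re _ (hs.smul _).holAt, re_I_I, map_neg]; rfl

theorem tl_gcomm (v : slitDual L) (Δ Θ : Gauge ℝ (HatFun E L) (HatSec E L)) (s : HatSec E L) :
    tl v ((gcomm Δ Θ).1 s) = tl v (Δ.1 (Θ.1 s)) - tl v (Θ.1 (Δ.1 s)) := rfl

/-- On `re s` each occurrence of `φ` becomes multiplication of `s` by `i`. The composites `Δ Θ` and
`Θ Δ` then occur with coefficients that cancel because `i² = -1`. -/
theorem IsHatEnd.torsion_eq_zero (h : IsHatEnd φ) (Δ Θ : Gauge ℝ (HatFun E L) (HatSec E L)) :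
    torsion φ Δ Θ = 0 := by
  refine hat_gauge_ext fun v s hs => ?_
  rw [torsion, h.sq]
  change tl v ((gcomm (φ Δ) (φ Θ)).1 (re s)) + -tl v ((gcomm Δ Θ).1 (re s)) -
    tl v ((φ (gcomm (φ Δ) Θ)).1 (re s)) - tl v ((φ (gcomm Δ (φ Θ))).1 (re s)) = 0
  rw [h.apply_re _ hs.holAt, h.apply_re _ hs.holAt]
  simp only [tl_gcomm]
  rw [h.gauge_apply_re _ _ hs, h.gauge_apply_re _ _ hs, h.gauge_apply_re _ _ (hs.smul _),
    h.gauge_apply_re _ _ (hs.smul _), re_I_I]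
  simp only [map_neg]
  ring

end FrameUse

/-! ### Bi-derivations of `ℓ` induced by a bi-derivation of `L`. -/

section Pair

open Bundle TopologicalSpace

variable {E : Type*} [NormedAddCommGroup E] [NormedSpace ℂ E]
  {X : Type*} [TopologicalSpace X] [ChartedSpace E X]
  {L : X → Type*} [∀ x, AddCommGroup (L x)] [∀ x, Module ℂ (L x)] [∀ x, TopologicalSpace (L x)]
  [TopologicalSpace (TotalSpace ℂ L)] [FiberBundle ℂ L] [VectorBundle ℂ ℂ L]
  [FiniteDimensional ℂ E] [T2Space X] [IsManifold 𝓘(ℂ, E) ω X]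
  [ContMDiffVectorBundle ω ℂ L 𝓘(ℂ, E)]

attribute [local instance] isManifold_real isManifold_slit

theorem cTilde_smul (c : ℂ) (s : CSec E L) (v : slitDual L) : cTilde (c • s) v = c * cTilde s v :=
  map_smul v.1.2 c _

theorem BiDer.ext_br {K A P : Type*} [Field K] [CommRing A] [Algebra K A] [AddCommGroup P]
    [Module K P] [Module A P] [IsScalarTower K A P] {B B' : BiDer K A P}
    (h : ∀ p, B.br p = B'.br p) : B = B' := by
  obtain ⟨b, hb⟩ := B
  obtain ⟨b', hb'⟩ := B'
  have : b = b' := LinearMap.ext h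
  subst this; rfl

theorem JetFrame.dT_eq {v₀ : slitDual L} (F : JetFrame (E := E) v₀) (s : HatSec E L)
    (v : slitDual L) :
    evH v F.κ • dTilde s v = ∑ i, evH v (F.c i s) • dTilde (re (F.sec i)) v := by
  refine ContinuousLinearMap.ext fun w => ?_
  rw [sum_apply]
  exact F.eq s v w

/-- A bi-vector gives a bi-derivation as soon as it is smooth. -/
theorem exists_biDer (b : slitDual L → (TildeT E →L[ℝ] ℝ) →ₗ[ℝ] (TildeT E →L[ℝ] ℝ) →ₗ[ℝ] ℝ)
    (alt : ∀ v α, b v α α = 0)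
    (hb : ∀ (v : slitDual L) (s t : CSec E L), HolNear v.1.1 s → HolNear v.1.1 t → ∃ n : HatSec E L,
      ∀ u : slitDual L, HolNear u.1.1 s → HolNear u.1.1 t →
        b u (dTilde (re s) u) (dTilde (re t) u) = tl u n) :
    ∃ B : BiDer ℝ (HatFun E L) (HatSec E L), ∀ s t v,
      tl v (B.bracket s t) = b v (dTilde s v) (dTilde t v) := by
  have h : ∀ s t : HatSec E L, ∃ n : HatSec E L, ∀ v, tl v n = b v (dTilde s v) (dTilde t v) := by
    intro s t
    refine exists_sec_of_locally fun v₀ => ?_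
    obtain ⟨F⟩ := nonempty_jetFrame (E := E) v₀
    have h0 : evH v₀ F.κ ≠ 0 := by rw [F.κ_self]; exact one_ne_zero
    choose n hn using fun i j => hb v₀ (F.sec i) (F.sec j) (F.hol v₀ h0 i) (F.hol v₀ h0 j)
    -- Each of the two entries is expanded in the frame and contributes one factor `κ`.
    refine ⟨F.κ * F.κ, ∑ i, ∑ j, (F.c i s * F.c j t) • n i j, ?_, fun v hv => ?_⟩
    · rw [map_mul]; exact mul_ne_zero h0 h0
    · have hv' : evH v F.κ ≠ 0 := fun h => hv (by rw [map_mul, h, mul_zero])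
      have h1 : b v (evH v F.κ • dTilde s v) (evH v F.κ • dTilde t v) =
          evH v (F.κ * F.κ) * b v (dTilde s v) (dTilde t v) := by
        rw [LinearMap.map_smul₂, map_smul, map_mul, smul_eq_mul, smul_eq_mul, mul_assoc]
      rw [← h1, F.dT_eq, F.dT_eq, LinearMap.map_sum₂, map_sum]
      refine Finset.sum_congr rfl fun i _ => ?_
      rw [map_sum, map_sum]
      refine Finset.sum_congr rfl fun j _ => ?_
      rw [map_smul, LinearMap.map_smul₂, tl_smul, map_mul,
        hn i j v (F.hol v hv' i) (F.hol v hv' j), smul_eq_mul, smul_eq_mul]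
      ring
  choose n hn using h
  let D : HatSec E L → HatSec E L →ₗ[ℝ] HatSec E L := fun s =>
    { toFun := n s
      map_add' := fun t t' => tl_ext fun v => by
        rw [map_add, hn, hn, hn, dTilde_add, map_add]
      map_smul' := fun c t => tl_ext fun v => by
        rw [map_smul, hn, hn, dTilde_smul, map_smul]; rfl }
  let br : HatSec E L → Gauge ℝ (HatFun E L) (HatSec E L) := fun s =>
    ⟨D s, mem_gauge_of_dTilde (D s) (fun v => b v (dTilde s v)) fun v t => hn s t v⟩
  refine ⟨⟨⟨⟨br, fun s s' => ?_⟩, fun c s => ?_⟩, fun s => ?_⟩, hn⟩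
  · refine Subtype.ext (LinearMap.ext fun t => tl_ext fun v => ?_)
    change tl v (n (s + s') t) = tl v (n s t + n s' t)
    rw [map_add, hn, hn, hn, dTilde_add, map_add]; rfl
  · refine Subtype.ext (LinearMap.ext fun t => tl_ext fun v => ?_)
    change tl v (n (c • s) t) = tl v (c • n s t)
    rw [map_smul, hn, hn, dTilde_smul, map_smul]; rfl
  · refine tl_ext fun v => ?_
    change tl v (n s s) = tl v 0
    rw [hn, alt, map_zero]

/-- The bi-derivation `B` of `ℓ` is determined by `n J` on real parts of holomorphic sections. -/
def Induces (n : ℂ) (J : BiDer ℂ (CFun E X) (CSec E L)) (B : BiDer ℝ (HatFun E L) (HatSec E L)) :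
    Prop :=
  ∀ (v : slitDual L) (s t : CSec E L), HolAt v.1.1 s → HolAt v.1.1 t →
    tl v (B.bracket (re s) (re t)) = tl v (re (n • J.bracket s t))

variable {J : BiDer ℂ (CFun E X) (CSec E L)}

theorem biDer_ext {B B' : BiDer ℝ (HatFun E L) (HatSec E L)}
    (h : ∀ (v : slitDual L) (s t : CSec E L), HolNear v.1.1 s → HolNear v.1.1 t →
      tl v (B.bracket (re s) (re t)) = tl v (B'.bracket (re s) (re t))) : B = B' := by
  refine BiDer.ext_br fun p => hat_gauge_ext fun v t ht => ?_
  obtain ⟨s, hs, hsp⟩ := exists_dTilde_re v (dTilde p v)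
  have h1 : ∀ C : BiDer ℝ (HatFun E L) (HatSec E L),
      tl v ((C.br p).1 (re t)) = -tl v (C.bracket (re t) (re s)) := fun C => by
    have h2 : (C.br p).1 (re t) = -C.bracket (re t) p := C.bracket_skew p (re t)
    rw [h2, map_neg]
    exact congrArg Neg.neg (hat_gauge_congr (C.br (re t)) hsp).symm
  rw [h1, h1, h v t s ht hs]

theorem Induces.unique {n : ℂ} {B B' : BiDer ℝ (HatFun E L) (HatSec E L)} (h : Induces n J B)
    (h' : Induces n J B') : B = B' :=
  biDer_ext fun v s t hs ht => by rw [h v s t hs.holAt ht.holAt, h' v s t hs.holAt ht.holAt]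

theorem CBivector.form_skew (Q : CBivector E L) (v : slitDual L) (α β : TildeT E →L[ℝ] ℂ) :
    Q.form v α β = -Q.form v β α := by
  have h := Q.alt v (α + β)
  rw [LinearMap.map_add₂, map_add, map_add, Q.alt, Q.alt] at h
  linear_combination h

/-- The difference is half of the complex conjugate of a complex linear functional. -/
theorem is01_sub {v : slitDual L} {s : CSec E L} (hs : HolAt v.1.1 s) :
    Is01 (complexify (dTilde (re s) v) + (-(1 / 2) : ℂ) • dcTilde s v) := by
  intro w
  change (dTilde (re s) v (Complex.I • w) : ℂ) + (-(1 / 2) : ℂ) * dcTilde s v (Complex.I • w) =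
    -(Complex.I * ((dTilde (re s) v w : ℂ) + (-(1 / 2) : ℂ) * dcTilde s v w))
  rw [dTilde_re, dTilde_re, hs.dcTilde_I]
  set z := dcTilde s v w
  apply Complex.ext <;> simp <;> ring

theorem CBivector.Is20.form_left {Q : CBivector E L} (hQ : Q.Is20) {v : slitDual L} {s : CSec E L}
    (hs : HolAt v.1.1 s) (β : TildeT E →L[ℝ] ℂ) :
    Q.form v (complexify (dTilde (re s) v)) β = (1 / 2) * Q.form v (dcTilde s v) β := by
  have h := hQ v _ β (is01_sub hs)
  rw [map_add, LinearMap.add_apply, map_smul, LinearMap.smul_apply, smul_eq_mul] at h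
  linear_combination h

/-- Modulo covectors of type `(0,1)` each entry is half of the differential of the complex function,
which gives the factor `1/4`. -/
theorem CBivector.Is20.form_re {Q : CBivector E L} (hQ : Q.Is20) (hJ : Q.Lifts J) {v : slitDual L}
    {s t : CSec E L} (hs : HolAt v.1.1 s) (ht : HolAt v.1.1 t) :
    Q.form v (complexify (dTilde (re s) v)) (complexify (dTilde (re t) v)) =
      (1 / 4) * cTilde (J.bracket s t) v := by
  rw [hQ.form_left hs, Q.form_skew, hQ.form_left ht, Q.form_skew, hJ]
  ring

theorem IsHatPair.induces_left {B' B : BiDer ℝ (HatFun E L) (HatSec E L)} (h : IsHatPair J B' B)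
    (hJ : Is20 J) : Induces (1 / 4) J B' := by
  obtain ⟨Q, hQ, h20, h1, -⟩ := h
  intro v s t hs ht
  refine (h1 _ _ v).trans ?_
  rw [(h20 hJ).form_re hQ hs ht, tl_re, cTilde_smul]

/-- The constant differs from that of `IsHatPair.induces_left` by `-i`, since `Im z = Re (-i z)`. -/
theorem IsHatPair.induces_right {B' B : BiDer ℝ (HatFun E L) (HatSec E L)} (h : IsHatPair J B' B)
    (hJ : Is20 J) : Induces (-Complex.I / 4) J B := by
  obtain ⟨Q, hQ, h20, -, h1⟩ := h
  intro v s t hs ht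
  refine (h1 _ _ v).trans ?_
  rw [(h20 hJ).form_re hQ hs ht, tl_re, cTilde_smul]
  generalize cTilde (J.bracket s t) v = z
  simp
  ring

/-- The local holomorphic section of `L` with differential of the homogeneous function at `v`
given by the `(1,0)`-part of a covector. -/
def covSec (v : slitDual L) : (TildeT E →L[ℝ] ℂ) →ₗ[ℂ] CSec E L :=
  holSec v.1.1 ∘ₗ
    { toFun := fun α => (linPart α (0, ContinuousLinearMap.id ℂ ℂ),
        (om v.1.1 v)⁻¹ • (linPart α ∘L ContinuousLinearMap.inl ℂ E (ℂ →L[ℂ] ℂ)))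
      map_add' := fun α β => by
        refine Prod.ext ?_ (ContinuousLinearMap.ext fun u => ?_)
        · change linPart (α + β) _ = linPart α _ + linPart β _
          simp only [linPart_apply, add_apply]; ring
        · change _ * linPart (α + β) _ = _ * linPart α _ + _ * linPart β _
          simp only [linPart_apply, add_apply]; ring
      map_smul' := fun c α => by
        refine Prod.ext ?_ (ContinuousLinearMap.ext fun u => ?_)
        · change linPart (c • α) _ = c * linPart α _
          simp only [linPart_apply, smul_apply, smul_eq_mul]; ring
        · change _ * linPart (c • α) _ = c * (_ * linPart α _)
          simp only [linPart_apply, smul_apply, smul_eq_mul]; ring }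

/-- Both sides are the affine holomorphic section determined by the `(1,0)`-part of the same jet.
Thus `liftBivector` lifts `J` as soon as `J` does not distinguish a section from its holomorphic
part. -/
theorem covSec_dcTilde (v : slitDual L) (s : CSec E L) :
    covSec v (dcTilde s v) = holPart E L v.1.1 s := by
  refine congrArg (holSec v.1.1) (Prod.ext ?_ (ContinuousLinearMap.ext fun u => ?_))
  · change linPart (dcTilde s v) (0, ContinuousLinearMap.id ℂ ℂ) = loc s v.1.1 v.1.1
    rw [linPart_apply, dcTilde_apply, dcTilde_apply]
    change (1 / 2 : ℂ) * (1 * loc s v.1.1 v.1.1 + om v.1.1 v * dloc s v.1.1 0 -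
      Complex.I * (Complex.I * 1 * loc s v.1.1 v.1.1 +
        om v.1.1 v * dloc s v.1.1 (Complex.I • 0))) = _
    rw [smul_zero, map_zero]
    linear_combination (-(1 / 2) * loc s v.1.1 v.1.1) * Complex.I_mul_I
  · change (om v.1.1 v)⁻¹ * linPart (dcTilde s v) (u, 0) = linPart (dloc s v.1.1) u
    rw [linPart_apply, dcTilde_apply, dcTilde_apply, linPart_apply]
    change (om v.1.1 v)⁻¹ * ((1 / 2 : ℂ) * (0 * loc s v.1.1 v.1.1 + om v.1.1 v * dloc s v.1.1 u -
      Complex.I * (Complex.I * 0 * loc s v.1.1 v.1.1 +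
        om v.1.1 v * dloc s v.1.1 (Complex.I • u)))) = _
    have h0 := om_ne_zero (mem_baseSet_trivializationAt ℂ L v.1.1)
    field_simp
    ring

theorem covSec_is01 (v : slitDual L) {α : TildeT E →L[ℝ] ℂ} (hα : Is01 α) : covSec v α = 0 := by
  have h := linPart_of_anti hα
  have h1 : ((linPart α (0, ContinuousLinearMap.id ℂ ℂ),
      (om v.1.1 v)⁻¹ • (linPart α ∘L ContinuousLinearMap.inl ℂ E (ℂ →L[ℂ] ℂ))) :
      ℂ × (E →L[ℂ] ℂ)) = 0 := by
    rw [h]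
    exact Prod.ext rfl (ContinuousLinearMap.ext fun u => mul_zero _)
  exact (congrArg (holSec v.1.1) h1).trans (map_zero _)

theorem bracket_smul_left (c : ℂ) (s t : CSec E L) :
    J.bracket (c • s) t = c • J.bracket s t := by
  simp [BiDer.bracket]

theorem bracket_add_left (s s' t : CSec E L) :
    J.bracket (s + s') t = J.bracket s t + J.bracket s' t := by
  simp [BiDer.bracket]

theorem bracket_smul_right (c : ℂ) (s t : CSec E L) :
    J.bracket s (c • t) = c • J.bracket s t := by
  simp [BiDer.bracket]

theorem bracket_add_right (s t t' : CSec E L) :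
    J.bracket s (t + t') = J.bracket s t + J.bracket s t' := by
  simp [BiDer.bracket]

variable (J) in
/-- The bi-vector of type `(2,0)` defined by a bi-derivation. -/
def liftBivector : CBivector E L where
  form v := LinearMap.mk₂ ℂ (fun α β => cTilde (J.bracket (covSec v α) (covSec v β)) v)
    (fun α α' β => by rw [map_add, bracket_add_left]; exact map_add v.1.2 _ _)
    (fun c α β => by rw [map_smul, bracket_smul_left, cTilde_smul]; rfl)
    (fun α β β' => by rw [map_add, bracket_add_right]; exact map_add v.1.2 _ _)
    (fun c α β => by rw [map_smul, bracket_smul_right, cTilde_smul]; rfl)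
  alt v α := by
    have h : J.bracket (covSec v α) (covSec v α) = 0 := J.skew _
    change cTilde (J.bracket (covSec v α) (covSec v α)) v = 0
    rw [h]; exact map_zero v.1.2

theorem liftBivector_is20 : (liftBivector J).Is20 := fun v α β hα => by
  change cTilde (J.bracket (covSec v α) (covSec v β)) v = 0
  have h : J.bracket (0 : CSec E L) (covSec v β) = 0 := by simp [BiDer.bracket]
  rw [covSec_is01 v hα, h]; exact map_zero v.1.2

theorem liftBivector_lifts (hJ : Is20 J) : (liftBivector J).Lifts J := fun s t v => by
  change cTilde (J.bracket (covSec v (dcTilde s v)) (covSec v (dcTilde t v))) v = _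
  rw [covSec_dcTilde, covSec_dcTilde]
  change v.1.2 (evL v.1.1 _) = v.1.2 (evL v.1.1 _)
  rw [hJ.holPart_left, J.bracket_skew, map_neg, hJ.holPart_left, ← map_neg, ← J.bracket_skew]

/-- The constant `c` treats both parts of the bi-vector at once: the real part for `c = 1` and the
imaginary part for `c = -i`. Smoothness holds because on real parts of holomorphic sections the
value is given by a multiple of the smooth section `J(s, t)`. -/
theorem exists_induced (Q : CBivector E L) (hQ : Q.Is20) (hJ : Q.Lifts J) (c : ℂ) :
    ∃ B : BiDer ℝ (HatFun E L) (HatSec E L), ∀ s t v, tl v (B.bracket s t) =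
      (c * Q.form v (complexify (dTilde s v)) (complexify (dTilde t v))).re := by
  have hadd : ∀ α β : TildeT E →L[ℝ] ℝ, complexify (α + β) = complexify α + complexify β :=
    fun α β => ContinuousLinearMap.ext fun w => Complex.ofReal_add _ _
  have hsmul : ∀ (r : ℝ) (α : TildeT E →L[ℝ] ℝ), complexify (r • α) = (r : ℂ) • complexify α :=
    fun r α => ContinuousLinearMap.ext fun w => Complex.ofReal_mul _ _
  refine exists_biDer (fun v => LinearMap.mk₂ ℝ
    (fun α β => (c * Q.form v (complexify α) (complexify β)).re) ?_ ?_ ?_ ?_) ?_ ?_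
  · intro α α' β
    rw [hadd, map_add, LinearMap.add_apply, mul_add, Complex.add_re]
  · intro r α β
    rw [hsmul, map_smul, LinearMap.smul_apply, smul_eq_mul, smul_eq_mul, mul_left_comm,
      Complex.re_ofReal_mul]
  · intro α β β'
    rw [hadd, map_add, mul_add, Complex.add_re]
  · intro r α β
    rw [hsmul, map_smul, smul_eq_mul, smul_eq_mul, mul_left_comm, Complex.re_ofReal_mul]
  · intro v α
    change (c * Q.form v (complexify α) (complexify α)).re = 0
    rw [Q.alt, mul_zero, Complex.zero_re]
  · intro v s t _ _
    refine ⟨re ((c * (1 / 4)) • J.bracket s t), fun u hs ht => ?_⟩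
    change (c * Q.form u _ _).re = _
    rw [hQ.form_re hJ hs.holAt ht.holAt, tl_re, cTilde_smul, mul_assoc]

theorem existsUnique_hatPair (hJ : Is20 J) : ∃! B : BiDer ℝ (HatFun E L) (HatSec E L) ×
    BiDer ℝ (HatFun E L) (HatSec E L), IsHatPair J B.1 B.2 := by
  have hQ := liftBivector_is20 (J := J)
  have hl := liftBivector_lifts hJ
  obtain ⟨B', hB'⟩ := exists_induced (liftBivector J) hQ hl 1
  obtain ⟨B, hB⟩ := exists_induced (liftBivector J) hQ hl (-Complex.I)
  have h : IsHatPair J B' B := by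
    refine ⟨liftBivector J, hl, fun _ => hQ, fun s t v => ?_, fun s t v => ?_⟩
    · refine (hB' s t v).trans ?_
      rw [one_mul]
    · refine (hB s t v).trans ?_
      simp
  exact ⟨(B', B), h, fun C hC => Prod.ext ((hC.induces_left hJ).unique (h.induces_left hJ))
    ((hC.induces_right hJ).unique (h.induces_right hJ))⟩

end Pair

/-! ### Jacobi Nijenhuis and generalized contact structures -/

section GaugeAlgebra

variable {K A P : Type*} [Field K] [CommRing A] [Algebra K A] [AddCommGroup P] [Module K P]
  [Module A P] [IsScalarTower K A P]

theorem gcomm_add_left (Δ Δ' Θ : Gauge K A P) : gcomm (Δ + Δ') Θ = gcomm Δ Θ + gcomm Δ' Θ := by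
  ext p; simp [gcomm]; abel

theorem gcomm_add_right (Δ Θ Θ' : Gauge K A P) : gcomm Δ (Θ + Θ') = gcomm Δ Θ + gcomm Δ Θ' := by
  ext p; simp [gcomm]; abel

theorem gcomm_skew (Δ Θ : Gauge K A P) : gcomm Δ Θ = -gcomm Θ Δ := by
  ext p; simp [gcomm]

theorem gcomm_apply (Δ Θ : Gauge K A P) (p : P) :
    (gcomm Δ Θ).1 p = Δ.1 (Θ.1 p) - Θ.1 (Δ.1 p) := rfl

theorem gcomm_smul_right {Δ : Gauge K A P} {S : Derivation K A A} (h : IsSymbol Δ.1 S) (a : A)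
    (Θ : Gauge K A P) : gcomm Δ (a • Θ) = S a • Θ + a • gcomm Δ Θ := by
  ext p
  have := h a (Θ.1 p)
  simp [gcomm, this, smul_sub]; abel

theorem gcomm_smul_left {Θ : Gauge K A P} {S : Derivation K A A} (h : IsSymbol Θ.1 S) (a : A)
    (Δ : Gauge K A P) : gcomm (a • Δ) Θ = a • gcomm Δ Θ - S a • Δ := by
  rw [gcomm_skew, gcomm_smul_right h, gcomm_skew Δ Θ, smul_neg]; abel

theorem lieDer_apply (Δ : Gauge K A P) (ρ : Jet K A P) (Θ : Gauge K A P) :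
    lieDer Δ ρ Θ = Δ.1 (ρ Θ) - ρ (gcomm Δ Θ) := rfl

theorem lieDer_add_left (Δ Δ' : Gauge K A P) (ρ : Jet K A P) :
    lieDer (Δ + Δ') ρ = lieDer Δ ρ + lieDer Δ' ρ := by
  ext Θ
  simp only [lieDer_apply, LinearMap.add_apply, gcomm_add_left, map_add, Submodule.coe_add]
  abel

theorem lieDer_neg_right (Δ : Gauge K A P) (ρ : Jet K A P) : lieDer Δ (-ρ) = -lieDer Δ ρ := by
  ext Θ
  simp only [lieDer_apply, LinearMap.neg_apply, map_neg]
  abel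

theorem gcomm_zero_left (Θ : Gauge K A P) : gcomm 0 Θ = 0 := by ext p; simp [gcomm]

theorem gcomm_zero_right (Θ : Gauge K A P) : gcomm Θ 0 = 0 := by ext p; simp [gcomm]

theorem lieDer_zero_left (ρ : Jet K A P) : lieDer 0 ρ = 0 := by
  ext Θ
  rw [lieDer_apply, gcomm_zero_left, map_zero, sub_zero]; rfl

theorem j1_apply (p : P) (Δ : Gauge K A P) : j1 p Δ = Δ.1 p := rfl

theorem adj_apply (φ : Gauge K A P →ₗ[A] Gauge K A P) (ρ : Jet K A P) (Δ : Gauge K A P) :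
    adj φ ρ Δ = ρ (φ Δ) := rfl

variable (K A P) in
/-- The jet module is separated by the jets of sections: tensorial operators vanish as soon as they
vanish on the jets of sections. -/
def JetGenerated : Prop :=
  ∀ T : Jet K A P →ₗ[A] P, (∀ p, T (j1 p) = 0) → ∀ ρ, T ρ = 0

variable [IsLineModule A P]

theorem BiDer.sharp_apply (B : BiDer K A P) (ρ : Jet K A P) (p : P) :
    (B.sharp ρ).1 p = -ρ (B.br p) := rfl

/-- On jets of sections this is the skew-symmetry of the bracket. The sum of the two sides is
tensorial in `ρ`, so it suffices to test it on such jets. -/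
theorem BiDer.form_skew (B : BiDer K A P) (hg : JetGenerated K A P) (ρ σ : Jet K A P) :
    ρ (B.sharp σ) = -σ (B.sharp ρ) := by
  let T : Jet K A P →ₗ[A] P :=
    { toFun := fun ρ => ρ (B.sharp σ) + σ (B.sharp ρ)
      map_add' := fun ρ ρ' => by rw [map_add, map_add, LinearMap.add_apply]; abel
      map_smul' := fun a ρ => by
        rw [map_smul, map_smul, LinearMap.smul_apply, RingHom.id_apply, smul_add] }
  refine eq_neg_of_add_eq_zero_left (hg T (fun p => ?_) ρ)
  change (B.sharp σ).1 p + σ (B.sharp (j1 p)) = 0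
  rw [B.sharp_j1, B.sharp_apply]; abel

end GaugeAlgebra

section RealAlgebra

variable {A P : Type*} [CommRing A] [Algebra ℝ A] [AddCommGroup P] [Module ℝ P]
  [Module A P] [IsScalarTower ℝ A P] [IsLineModule A P]
  (B : BiDer ℝ A P) (φ : Gauge ℝ A P →ₗ[A] Gauge ℝ A P)

theorem SharpComm.apply {B : BiDer ℝ A P} {φ : Gauge ℝ A P →ₗ[A] Gauge ℝ A P} (h : SharpComm B φ)
    (ρ : Jet ℝ A P) : B.sharp (adj φ ρ) = φ (B.sharp ρ) := LinearMap.congr_fun h ρ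

theorem SharpComm.form_skew {B : BiDer ℝ A P} {φ : Gauge ℝ A P →ₗ[A] Gauge ℝ A P}
    (h : SharpComm B φ) (hg : JetGenerated ℝ A P) (ρ σ : Jet ℝ A P) :
    ρ (φ (B.sharp σ)) = -σ (φ (B.sharp ρ)) := by
  rw [← adj_apply, B.form_skew hg, h.apply]

/-- The failure of the compatibility of `B♯` with the brackets. -/
def jacDefect (hg : JetGenerated ℝ A P) (p : P) : Jet ℝ A P →ₗ[A] Jet ℝ A P →ₗ[A] P :=
  have hsk := B.form_skew hg
  have hadd : ∀ ρ σ σ' : Jet ℝ A P, (gcomm (B.sharp ρ) (B.sharp (σ + σ'))).1 p +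
      (B.jetBracket ρ (σ + σ')) (B.br p) = ((gcomm (B.sharp ρ) (B.sharp σ)).1 p +
      (B.jetBracket ρ σ) (B.br p)) + ((gcomm (B.sharp ρ) (B.sharp σ')).1 p +
      (B.jetBracket ρ σ') (B.br p)) := fun ρ σ σ' => by
    simp only [BiDer.jetBracket, BiDer.form, LinearMap.sub_apply, map_add, lieDer_apply, j1_apply,
      LinearMap.add_apply, gcomm_add_left, gcomm_add_right, Submodule.coe_add]
    abel
  -- Neither term is tensorial; the derivatives of `a` in the commutator and in the jet bracket
  -- cancel by the skew-symmetry of the form.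
  have hsmul : ∀ (a : A) (ρ σ : Jet ℝ A P), (gcomm (B.sharp ρ) (B.sharp (a • σ))).1 p +
      (B.jetBracket ρ (a • σ)) (B.br p) = a • ((gcomm (B.sharp ρ) (B.sharp σ)).1 p +
      (B.jetBracket ρ σ) (B.br p)) := fun a ρ σ => by
    obtain ⟨S, hS⟩ := (B.sharp ρ).2
    obtain ⟨R, hR⟩ := (B.br p).2
    have h1 : (B.br p).1 (a • σ (B.sharp ρ)) = _ := hR _ _
    have h2 : (B.sharp ρ).1 (a • σ (B.br p)) = _ := hS _ _
    simp only [BiDer.jetBracket, BiDer.form, LinearMap.sub_apply, map_smul, lieDer_apply, j1_apply,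
      LinearMap.smul_apply, gcomm_smul_left hR, gcomm_smul_right hS, Submodule.coe_add, map_sub,
      Submodule.coe_smul, h1, h2, LinearMap.add_apply]
    rw [B.sharp_apply, hsk ρ σ]
    module
  have hskew : ∀ ρ σ : Jet ℝ A P, (gcomm (B.sharp ρ) (B.sharp σ)).1 p +
      (B.jetBracket ρ σ) (B.br p) = -((gcomm (B.sharp σ) (B.sharp ρ)).1 p +
      (B.jetBracket σ ρ) (B.br p)) := fun ρ σ => by
    rw [BiDer.jetBracket, BiDer.jetBracket, BiDer.form, BiDer.form, hsk ρ σ,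
      gcomm_skew (B.sharp ρ) (B.sharp σ)]
    simp only [LinearMap.sub_apply, map_neg, LinearMap.neg_apply, Submodule.coe_neg]
    abel
  LinearMap.mk₂ A (fun ρ σ => (gcomm (B.sharp ρ) (B.sharp σ)).1 p + (B.jetBracket ρ σ) (B.br p))
    (fun ρ ρ' σ => by rw [hskew, hadd, neg_add, ← hskew, ← hskew])
    (fun a ρ σ => by rw [hskew, hsmul, ← smul_neg, ← hskew])
    hadd hsmul

theorem jacDefect_apply (hg : JetGenerated ℝ A P) (p : P) (ρ σ : Jet ℝ A P) :
    jacDefect B hg p ρ σ = (gcomm (B.sharp ρ) (B.sharp σ) - B.sharp (B.jetBracket ρ σ)).1 p := by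
  change (gcomm (B.sharp ρ) (B.sharp σ)).1 p + (B.jetBracket ρ σ) (B.br p) =
    (gcomm (B.sharp ρ) (B.sharp σ)).1 p - -(B.jetBracket ρ σ) (B.br p)
  abel

theorem jetBracket_j1 (p q : P) : B.jetBracket (j1 p) (j1 q) = j1 (B.bracket p q) := by
  rw [BiDer.jetBracket, B.form_j1, B.sharp_j1, B.sharp_j1, lieDer_j1, lieDer_j1]
  have h : (B.br q).1 p = -B.bracket p q := B.bracket_skew q p
  rw [h, map_neg]
  change j1 (B.bracket p q) - _ - _ = _
  abel

theorem jacDefect_j1 (hg : JetGenerated ℝ A P) (p q r : P) :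
    jacDefect B hg p (j1 q) (j1 r) = B.jacobiator p q r := by
  rw [jacDefect_apply, jetBracket_j1, B.sharp_j1, B.sharp_j1, B.sharp_j1, B.jacobiator_eq]

/-- The defect is tensorial in both jets, and on jets of sections it is the Jacobiator. -/
theorem isJacobi_iff_sharp (hg : JetGenerated ℝ A P) : B.IsJacobi ↔
    ∀ ρ σ, gcomm (B.sharp ρ) (B.sharp σ) = B.sharp (B.jetBracket ρ σ) := by
  constructor
  · intro h ρ σ
    refine sub_eq_zero.1 (Subtype.ext (LinearMap.ext fun p => ?_))
    rw [← jacDefect_apply B hg]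
    refine hg (jacDefect B hg p ρ) (fun r => ?_) σ
    refine hg ((jacDefect B hg p).flip (j1 r)) (fun q => ?_) ρ
    rw [LinearMap.flip_apply, jacDefect_j1]; exact h p q r
  · intro h p q r
    change B.jacobiator p q r = 0
    rw [← jacDefect_j1 B hg, jacDefect_apply, h, sub_self]; rfl

variable {B φ}

/-- The failure of the compatibility condition for a pair with `B♯ φ† = φ B♯`. -/
def compatDefect (hg : JetGenerated ℝ A P) (hc : SharpComm B φ) (Θ : Gauge ℝ A P) :
    Jet ℝ A P →ₗ[A] Jet ℝ A P →ₗ[A] P :=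
  let M : Jet ℝ A P → Gauge ℝ A P := fun σ => gcomm (B.sharp σ) (φ Θ) - φ (gcomm (B.sharp σ) Θ)
  let f : Jet ℝ A P → Jet ℝ A P → P := fun ρ σ =>
    ρ (M σ) - σ (M ρ) - (φ Θ).1 (σ (B.sharp ρ)) + Θ.1 (σ (φ (B.sharp ρ)))
  have hsk := B.form_skew hg
  have hsk' := hc.form_skew hg
  have hM : ∀ ρ σ, M (ρ + σ) = M ρ + M σ := fun ρ σ => by
    simp only [M, map_add, gcomm_add_left]; abel
  have hadd : ∀ ρ σ σ' : Jet ℝ A P, f ρ (σ + σ') = f ρ σ + f ρ σ' := fun ρ σ σ' => by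
    simp only [f, hM, map_add, LinearMap.add_apply]; abel
  have hskew : ∀ ρ σ : Jet ℝ A P, f ρ σ = -f σ ρ := fun ρ σ => by
    simp only [f]
    rw [hsk ρ σ, hsk' ρ σ, map_neg, map_neg]; abel
  have hsmul : ∀ (a : A) (ρ σ : Jet ℝ A P), f ρ (a • σ) = a • f ρ σ := fun a ρ σ => by
    obtain ⟨S, hS⟩ := (φ Θ).2
    obtain ⟨R, hR⟩ := Θ.2
    have h1 : (φ Θ).1 (a • σ (B.sharp ρ)) = _ := hS _ _
    have h2 : Θ.1 (a • σ (φ (B.sharp ρ))) = _ := hR _ _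
    simp only [f, M, map_smul, LinearMap.smul_apply, gcomm_smul_left hR, gcomm_smul_left hS,
      h1, h2, map_sub]
    rw [hsk ρ σ, hsk' ρ σ]
    module
  LinearMap.mk₂ A f
    (fun ρ ρ' σ => by rw [hskew, hadd, neg_add, ← hskew, ← hskew])
    (fun a ρ σ => by rw [hskew, hsmul, ← smul_neg, ← hskew])
    hadd hsmul

theorem compatDefect_apply (hg : JetGenerated ℝ A P) (hc : SharpComm B φ) (Θ : Gauge ℝ A P)
    (ρ σ : Jet ℝ A P) : compatDefect hg hc Θ ρ σ =
      ρ (gcomm (B.sharp σ) (φ Θ) - φ (gcomm (B.sharp σ) Θ)) -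
      σ (gcomm (B.sharp ρ) (φ Θ) - φ (gcomm (B.sharp ρ) Θ)) - (φ Θ).1 (σ (B.sharp ρ)) +
      Θ.1 (σ (φ (B.sharp ρ))) := rfl

theorem deform_sharp (hc : SharpComm B φ) (ρ : Jet ℝ A P) :
    (B.deform φ hc).sharp ρ = B.sharp (adj φ ρ) := by
  ext p
  have h2 : B.sharp (adj φ (j1 p)) = φ (B.br p) := by rw [hc.apply, B.sharp_j1]
  change -(ρ (B.sharp (adj φ (j1 p)))) = -(ρ (φ (B.br p)))
  rw [h2]

/-- Evaluating the compatibility identity on `Θ` and expanding the Lie derivatives gives exactly the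
defect, which has the advantage of being tensorial in the two jets. -/
theorem compatible_iff (hg : JetGenerated ℝ A P) : Compatible B φ ↔
    ∃ hc : SharpComm B φ, ∀ Θ ρ σ, compatDefect hg hc Θ ρ σ = 0 := by
  refine exists_congr fun hc => ⟨fun h Θ ρ σ => ?_, fun h ρ σ => LinearMap.ext fun Θ => ?_⟩
  · have h1 := LinearMap.congr_fun (h ρ σ) Θ
    rw [← sub_eq_zero] at h1
    rw [← h1]
    simp only [compatDefect_apply, BiDer.jetBracket, deform_sharp, BiDer.form, LinearMap.sub_apply,
      LinearMap.add_apply, adj_apply, lieDer_apply, j1_apply, map_sub, hc.apply]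
    abel
  · rw [← sub_eq_zero, ← h Θ ρ σ]
    simp only [compatDefect_apply, BiDer.jetBracket, deform_sharp, BiDer.form, LinearMap.sub_apply,
      LinearMap.add_apply, adj_apply, lieDer_apply, j1_apply, map_sub, hc.apply]
    abel

/-- The off-diagonal block of `I² = -1` is `B^♯ φ^† = φ B^♯`. The integrability condition splits by
components: two derivations give the torsion, two jets give the Jacobi identity and the
compatibility condition, and a mixed pair gives the compatibility condition again together with an
identity that holds for every `φ` without torsion and with `φ² = -1`. -/
theorem isGeneralizedContact_iff (hg : JetGenerated ℝ A P) (hφ : ∀ Δ, φ (φ Δ) = -Δ)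
    (htor : ∀ Δ Θ, torsion φ Δ Θ = 0) :
    IsGeneralizedContact (blockEnd φ B) ↔ IsJacobiNijenhuis B φ := by
  have hsk := B.form_skew hg
  have htor' : ∀ Δ Θ, gcomm (φ Δ) (φ Θ) = gcomm Δ Θ + φ (gcomm (φ Δ) Θ) + φ (gcomm Δ (φ Θ)) :=
    fun Δ Θ => by
      have h := htor Δ Θ
      rw [torsion, hφ] at h
      rw [← sub_eq_zero, ← h]; abel
  have hI : ∀ α, blockEnd φ B α = (φ α.1 + B.sharp α.2, -adj φ α.2) := fun _ => rfl
  constructor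
  · intro h
    have hc : SharpComm B φ := LinearMap.ext fun ρ => by
      have h1 := congrArg Prod.fst (h.almost_complex (0, ρ))
      simp only [hI, map_zero, zero_add, map_neg] at h1
      have h2 : φ (B.sharp ρ) + -B.sharp (adj φ ρ) = 0 := h1.trans (neg_zero)
      exact (eq_of_sub_eq_zero (by rw [sub_eq_add_neg]; exact h2)).symm
    have key : ∀ ρ σ, gcomm (B.sharp ρ) (B.sharp σ) = B.sharp (B.jetBracket ρ σ) ∧
        ∀ Θ, compatDefect hg hc Θ ρ σ = 0 := fun ρ σ => by
      -- On two pure jets, the derivation component says that `B^♯` preserves brackets and the jet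
      -- component is the compatibility condition.
      have h1 := h.integrable (0, ρ) (0, σ)
      have e1 := congrArg Prod.fst h1
      have e2 := fun Θ => LinearMap.congr_fun (congrArg Prod.snd h1) Θ
      simp only [hI, dorfman, map_zero, zero_add, gcomm_zero_left, gcomm_zero_right, Prod.fst_sub,
        Prod.snd_sub, Prod.fst_zero, Prod.snd_zero, lieDer_zero_left] at e1 e2
      constructor
      · rw [← sub_eq_zero, ← e1, BiDer.jetBracket, BiDer.form, ← neg_eq_iff_eq_neg.2 (hsk ρ σ)]
        simp only [map_sub, map_add, map_neg, map_zero]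
        abel
      · intro Θ
        refine Eq.trans ?_ (e2 Θ)
        rw [compatDefect_apply]
        simp only [lieDer_apply, adj_apply, j1_apply, LinearMap.sub_apply, sub_zero, add_zero,
          LinearMap.add_apply, LinearMap.neg_apply, map_sub, map_neg, map_add, zero_sub]
        rw [hc.form_skew hg ρ σ, hsk ρ σ]
        simp only [map_neg]
        abel
    exact ⟨(isJacobi_iff_sharp B hg).2 fun ρ σ => (key ρ σ).1,
      (compatible_iff hg).2 ⟨hc, fun Θ ρ σ => (key ρ σ).2 Θ⟩, htor⟩
  · rintro ⟨hJ, hC, -⟩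
    obtain ⟨hc, hC⟩ := (compatible_iff hg).1 hC
    rw [isJacobi_iff_sharp B hg] at hJ
    refine ⟨fun α => ?_, fun α β => ?_, fun α β => ?_⟩
    · obtain ⟨Δ, ρ⟩ := α
      simp only [hI, map_add, map_neg, hφ, hc.apply]
      refine Prod.ext ?_ (LinearMap.ext fun Θ => ?_)
      · simp
      · simp [adj_apply, hφ]
    · simp only [hI, omniPairing, map_add, LinearMap.neg_apply, adj_apply]
      rw [hsk α.2 β.2]; abel
    · obtain ⟨Δ, ρ⟩ := α
      obtain ⟨Θ, σ⟩ := β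
      -- Derivation component for a jet and a derivation: the compatibility condition tested against
      -- the jet of a section `p`.
      have hY : ∀ (ρ : Jet ℝ A P) (Θ : Gauge ℝ A P), gcomm (B.sharp ρ) (φ Θ) -
          φ (gcomm (B.sharp ρ) Θ) - B.sharp (lieDer Θ (adj φ ρ)) + B.sharp (lieDer (φ Θ) ρ) = 0 := by
        intro ρ Θ
        refine Subtype.ext (LinearMap.ext fun p => ?_)
        have h1 := hC Θ ρ (j1 p)
        rw [compatDefect_apply, ← hc.apply] at h1
        simp only [j1_apply, B.sharp_j1, BiDer.sharp_apply, adj_apply] at h1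
        rw [← neg_eq_zero] at h1
        refine Eq.trans ?_ h1
        simp only [Submodule.coe_add, Submodule.coe_sub, LinearMap.add_apply, LinearMap.sub_apply,
          BiDer.sharp_apply, lieDer_apply, adj_apply, map_neg, map_sub]
        rw [gcomm_skew (B.br p), gcomm_skew (B.br p)]
        simp only [map_neg]
        abel
      -- Jet component for a derivation and a jet: it involves only `φ` and follows from the
      -- vanishing torsion and `φ² = -1`.
      have hZ : ∀ (σ : Jet ℝ A P) (Δ : Gauge ℝ A P), adj φ (lieDer (φ Δ) σ) -
          adj φ (lieDer Δ (adj φ σ)) - lieDer (φ Δ) (adj φ σ) - lieDer Δ σ = 0 := by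
        intro σ Δ
        refine LinearMap.ext fun Ψ => ?_
        simp only [LinearMap.sub_apply, adj_apply, lieDer_apply, hφ, htor', map_add, map_neg]
        change _ = (0 : P)
        abel
      -- Jet component for two jets: the compatibility condition once more.
      have hW : lieDer (B.sharp σ) (adj φ ρ) - lieDer (B.sharp ρ) (adj φ σ) -
          j1 (adj φ ρ (B.sharp σ)) + adj φ (lieDer (B.sharp ρ) σ) - adj φ (lieDer (B.sharp σ) ρ) +
          adj φ (j1 (ρ (B.sharp σ))) = 0 := by
        refine LinearMap.ext fun Ψ => ?_
        refine Eq.trans ?_ (hC Ψ ρ σ)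
        rw [compatDefect_apply]
        simp only [lieDer_apply, adj_apply, j1_apply, LinearMap.sub_apply, LinearMap.add_apply, map_sub]
        rw [hc.form_skew hg ρ σ, hsk ρ σ]
        simp only [map_neg]
        abel
      have hX : gcomm (B.sharp ρ) (B.sharp σ) - B.sharp (lieDer (B.sharp ρ) σ) +
          B.sharp (lieDer (B.sharp σ) ρ) - B.sharp (j1 (ρ (B.sharp σ))) = 0 := by
        rw [hJ, BiDer.jetBracket, BiDer.form, hsk ρ σ]
        simp only [map_sub, map_neg]
        abel
      have hj : adj φ ρ (φ Θ) = -ρ Θ := by rw [adj_apply, hφ, map_neg]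
      refine Prod.ext ?_ ?_
      · have e1 := hY ρ Θ
        have e2 := hY σ Δ
        rw [gcomm_skew (B.sharp σ), gcomm_skew (B.sharp σ)] at e2
        have e := congrArg₂ (· + ·) hX (congrArg₂ (· - ·) e1 e2)
        refine Eq.trans ?_ (e.trans (by simp))
        simp only [hI, dorfman, Prod.fst_sub, gcomm_add_left, gcomm_add_right, htor', map_add,
          lieDer_add_left, lieDer_neg_right, map_sub, map_neg, LinearMap.neg_apply, adj_apply]
        abel
      · have e1 := hZ ρ Θ
        have e2 := hZ σ Δ
        have e := congrArg₂ (· + ·) hW (congrArg₂ (· - ·) e2 e1)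
        refine Eq.trans ?_ (e.trans (by simp))
        simp only [hI, dorfman, Prod.snd_sub, map_add,
          lieDer_add_left, lieDer_neg_right, map_sub, map_neg, LinearMap.neg_apply, adj_apply, hj]
        abel

end RealAlgebra

/-! ### The equivalence of the three conditions. -/

section Equivalence

open Bundle TopologicalSpace

variable {E : Type*} [NormedAddCommGroup E] [NormedSpace ℂ E]
  {X : Type*} [TopologicalSpace X] [ChartedSpace E X]
  {L : X → Type*} [∀ x, AddCommGroup (L x)] [∀ x, Module ℂ (L x)] [∀ x, TopologicalSpace (L x)]
  [TopologicalSpace (TotalSpace ℂ L)] [FiberBundle ℂ L] [VectorBundle ℂ ℂ L]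
  [FiniteDimensional ℂ E] [T2Space X] [IsManifold 𝓘(ℂ, E) ω X]
  [ContMDiffVectorBundle ω ℂ L 𝓘(ℂ, E)]

attribute [local instance] isManifold_real isManifold_slit

variable {J : BiDer ℂ (CFun E X) (CSec E L)} {n : ℂ}
  {B B' : BiDer ℝ (HatFun E L) (HatSec E L)}
  {φ : Gauge ℝ (HatFun E L) (HatSec E L) →ₗ[HatFun E L] Gauge ℝ (HatFun E L) (HatSec E L)}

variable (E L) in
theorem jetGenerated_hat : JetGenerated ℝ (HatFun E L) (HatSec E L) := fun T h =>
  jet_ext fun v s _ => by rw [h, map_zero]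

theorem jet_gauge_ext {T : Jet ℝ (HatFun E L) (HatSec E L) →ₗ[HatFun E L]
      Gauge ℝ (HatFun E L) (HatSec E L)}
    (h : ∀ (v : slitDual L) (s t : CSec E L), HolNear v.1.1 s → HolNear v.1.1 t →
      tl v ((T (j1 (re s))).1 (re t)) = 0) : T = 0 := by
  refine LinearMap.ext fun ρ => Subtype.ext (LinearMap.ext fun p => ?_)
  let ev : Gauge ℝ (HatFun E L) (HatSec E L) →ₗ[HatFun E L] HatSec E L := j1 p
  refine jet_ext (T := ev ∘ₗ T) (fun v s hs => ?_) ρ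
  obtain ⟨t, ht, htp⟩ := exists_dTilde_re v (dTilde p v)
  exact (hat_gauge_congr (T (j1 (re s))) htp).symm.trans (h v s t hs ht)

theorem jet_bilin_ext {T : Jet ℝ (HatFun E L) (HatSec E L) →ₗ[HatFun E L]
      Jet ℝ (HatFun E L) (HatSec E L) →ₗ[HatFun E L] HatSec E L}
    (h : ∀ (v : slitDual L) (s t : CSec E L), HolNear v.1.1 s → HolNear v.1.1 t →
      tl v (T (j1 (re s)) (j1 (re t))) = 0) (ρ σ : Jet ℝ (HatFun E L) (HatSec E L)) : T ρ σ = 0 := by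
  refine tl_ext fun v => ?_
  obtain ⟨F⟩ := nonempty_jetFrame (E := E) v
  have hF : evH v F.κ ≠ 0 := by rw [F.κ_self]; exact one_ne_zero
  obtain ⟨b, hb⟩ := F.jet_eq ρ
  obtain ⟨c, hc⟩ := F.jet_eq σ
  have h1 : tl v (T (F.κ • ρ) (F.κ • σ)) = tl v (T ρ σ) := by
    rw [LinearMap.map_smul₂, (T ρ).map_smul, tl_smul, tl_smul, F.κ_self, one_mul, one_mul]
  rw [← h1, hb, hc, LinearMap.map_sum₂, map_sum, map_zero]
  refine Finset.sum_eq_zero fun i _ => ?_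
  rw [map_sum, map_sum]
  refine Finset.sum_eq_zero fun j _ => ?_
  rw [LinearMap.map_smul₂, (T _).map_smul, tl_smul, tl_smul, h v _ _ (F.hol v hF i) (F.hol v hF j),
    mul_zero, mul_zero]

theorem evL_eq_zero_of_cTilde {v : slitDual L} {s : CSec E L} (h : cTilde s v = 0) :
    evL v.1.1 s = 0 := by
  have hb := mem_baseSet_trivializationAt ℂ L v.1.1
  rw [cTilde_eq s (mem_goodSet v.1.1)] at h
  rw [← loc_eq_zero_iff hb]
  exact (mul_eq_zero.1 h).resolve_right (om_ne_zero hb)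

/-- The real parts for `s` and for `i s` are the real part and minus the imaginary part of one
complex number. -/
theorem evL_eq_zero_of_re {v : slitDual L} {s : CSec E L} (h : tl v (re s) = 0)
    (h' : tl v (re (Complex.I • s)) = 0) : evL v.1.1 s = 0 := by
  refine evL_eq_zero_of_cTilde ?_
  rw [tl_re] at h
  rw [tl_re, cTilde_smul] at h'
  apply Complex.ext
  · exact h
  · simpa using h'

theorem exists_over (x : X) : ∃ v : slitDual L, v.1.1 = x := by
  obtain ⟨v, hv, -⟩ := exists_point (mem_baseSet_trivializationAt ℂ L x) one_ne_zero
  exact ⟨v, hv⟩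

theorem Induces.eventually (hB : Induces n J B) {v : slitDual L} {s t : CSec E L}
    (hs : HolNear v.1.1 s) (ht : HolNear v.1.1 t) :
    ∀ᶠ u in nhds v, tl u (B.bracket (re s) (re t)) = tl u (re (n • J.bracket s t)) := by
  filter_upwards [HolNear.eventually_slit E L hs, HolNear.eventually_slit E L ht] with u h1 h2
  exact hB u s t h1.holAt h2.holAt

/-- On real parts of holomorphic sections the two sides become `n J(i s, t)` and `n J(s, i t)`,
equal by complex bilinearity. -/
theorem Induces.sharpComm (hB : Induces n J B) (hφ : IsHatEnd φ) : SharpComm B φ := by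
  refine sub_eq_zero.1 (jet_gauge_ext fun v s t hs ht => ?_)
  have h1 : (B.sharp (adj φ (j1 (re s)))).1 (re t) = -(φ (B.br (re t))).1 (re s) := rfl
  have h2 : (B.br (re t)).1 (re (Complex.I • s)) = -B.bracket (re (Complex.I • s)) (re t) :=
    B.bracket_skew _ _
  rw [LinearMap.sub_apply, Submodule.coe_sub, LinearMap.sub_apply, map_sub, LinearMap.comp_apply,
    LinearMap.comp_apply, h1, B.sharp_j1, map_neg, hφ.apply_re _ hs.holAt, hφ.apply_re _ ht.holAt,
    h2, map_neg, neg_neg]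
  change _ - tl v (B.bracket (re s) (re (Complex.I • t))) = 0
  rw [hB v _ _ (hs.holAt.smul _) ht.holAt, hB v _ _ hs.holAt (ht.holAt.smul _), bracket_smul_left,
    bracket_smul_right, sub_self]

theorem Induces.deform (hB : Induces n J B) (hφ : IsHatEnd φ) (hc : SharpComm B φ) :
    Induces (Complex.I * n) J (B.deform φ hc) := by
  intro v s t hs ht
  have h1 : (B.deform φ hc).bracket (re s) (re t) = (φ (B.br (re s))).1 (re t) := by
    change (B.sharp (adj φ (j1 (re s)))).1 (re t) = _
    rw [hc.apply, B.sharp_j1]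
  rw [h1, hφ.apply_re _ ht]
  refine (hB v _ _ hs (ht.smul _)).trans ?_
  rw [bracket_smul_right, smul_smul, mul_comm]

/-- The terms in which `φ Θ` meets `re s` or `re t` cancel by moving `i` into the sections. What is
left is the failure of `φ` to act as `i` on the section `n J(s, t)`, and by `IsHatEnd.holAt` this
vanishes for all `Θ` only if that section is holomorphic at the point. -/
theorem Induces.compatDefect (hB : Induces n J B) (hφ : IsHatEnd φ) (hc : SharpComm B φ)
    (Θ : Gauge ℝ (HatFun E L) (HatSec E L)) {v : slitDual L} {s t : CSec E L}
    (hs : HolNear v.1.1 s) (ht : HolNear v.1.1 t) :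
    tl v (compatDefect (jetGenerated_hat E L) hc Θ (j1 (re s)) (j1 (re t))) =
      tl v ((φ Θ).1 (re (n • J.bracket s t))) - tl v (Θ.1 (re (Complex.I • n • J.bracket s t))) := by
  rw [compatDefect_apply, B.sharp_j1, B.sharp_j1]
  simp only [map_sub, map_add, j1_apply]
  rw [hφ.apply_re _ hs.holAt, hφ.apply_re _ ht.holAt]
  simp only [tl_gcomm]
  have e1 : ∀ q, tl v ((B.br q).1 ((φ Θ).1 (re s))) = tl v ((B.br q).1 (Θ.1 (re (Complex.I • s)))) :=
    fun q => hφ.gauge_apply_re Θ (B.br q) hs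
  have e2 : ∀ q, tl v ((B.br q).1 ((φ Θ).1 (re t))) = tl v ((B.br q).1 (Θ.1 (re (Complex.I • t)))) :=
    fun q => hφ.gauge_apply_re Θ (B.br q) ht
  have e3 : tl v (Θ.1 ((φ (B.br (re s))).1 (re t))) =
      tl v (Θ.1 ((B.br (re s)).1 (re (Complex.I • t)))) := hφ.gauge_apply_re _ _ ht
  have e4 : tl v ((φ Θ).1 ((B.br (re s)).1 (re t))) = tl v ((φ Θ).1 (re (n • J.bracket s t))) :=
    hat_gauge_congr_of_eventually _ (hB.eventually hs ht)
  have e5 : (B.br (re t)).1 (re s) = -(B.br (re s)).1 (re t) := B.bracket_skew _ _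
  have e6 : tl v (Θ.1 ((B.br (re t)).1 (re (Complex.I • s)))) =
      -tl v (Θ.1 (re (Complex.I • n • J.bracket s t))) := by
    have h1 : n • J.bracket t (Complex.I • s) = -(Complex.I • n • J.bracket s t) := by
      rw [bracket_smul_right, J.bracket_skew t s, smul_neg, smul_neg, smul_comm]
    have h2 := hat_gauge_congr_of_eventually Θ (hB.eventually ht (hs.smul Complex.I))
    rw [h1] at h2
    refine h2.trans ?_
    rw [map_neg, map_neg, map_neg]
  rw [e1, e2, e3, e4, e5, e6, map_neg, map_neg, e4]
  ring

/-- A section with complex linear differential is characterized by the complex structure. -/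
theorem IsHatEnd.holAt (hφ : IsHatEnd φ) {v : slitDual L} {s : CSec E L}
    (h : ∀ Θ : Gauge ℝ (HatFun E L) (HatSec E L),
      tl v ((φ Θ).1 (re s)) = tl v (Θ.1 (re (Complex.I • s)))) : HolAt v.1.1 s := by
  have key : ∀ V : TildeT E, (dcTilde s v (Complex.I • V)).re = (Complex.I * dcTilde s v V).re := by
    intro V
    obtain ⟨Θ, hΘ⟩ := exists_gauge v V
    have h1 := h Θ
    rw [isHatEnd_iff.1 hφ, hΘ, gvec_eq fun s => (hΘ s).symm, dTilde_re, dTilde_re, dcTilde_smul] at h1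
    exact h1
  have hD : ∀ V : TildeT E, dcTilde s v (Complex.I • V) = Complex.I * dcTilde s v V := fun V => by
    apply Complex.ext
    · exact key V
    · have h1 := key (Complex.I • V)
      have h2 : Complex.I • Complex.I • V = -V := by
        rw [smul_smul, Complex.I_mul_I]; exact neg_one_smul ℂ V
      rw [h2, map_neg] at h1
      simp only [Complex.neg_re, Complex.mul_re, Complex.I_re, Complex.I_im, Complex.mul_im] at h1 ⊢
      linarith
  rw [holAt_iff]
  intro u
  have h1 := hD (u, 0)
  rw [dcTilde_apply, dcTilde_apply] at h1
  change Complex.I * 0 * _ + _ * dloc s v.1.1 (Complex.I • u) =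
    Complex.I * (0 * _ + _ * dloc s v.1.1 u) at h1
  refine mul_left_cancel₀ (om_ne_zero (mem_baseSet_trivializationAt ℂ L v.1.1)) ?_
  linear_combination h1

theorem Induces.compatible (hB : Induces n J B) (hφ : IsHatEnd φ) (hJ : PreservesHol J) :
    Compatible B φ := by
  refine (compatible_iff (jetGenerated_hat E L)).2 ⟨hB.sharpComm hφ, fun Θ =>
    jet_bilin_ext fun v s t hs ht => ?_⟩
  rw [hB.compatDefect hφ _ Θ hs ht, hφ.apply_re _ ((hJ _ _ _ hs ht).smul n), sub_self]

theorem Induces.preservesHol (hB : Induces n J B) (hn : n ≠ 0) (hφ : IsHatEnd φ)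
    (h : Compatible B φ) : PreservesHol J := by
  obtain ⟨hc, h⟩ := (compatible_iff (jetGenerated_hat E L)).1 h
  intro x s t hs ht
  obtain ⟨v, rfl⟩ := exists_over (L := L) x
  have h1 : HolAt v.1.1 (n • J.bracket s t) := hφ.holAt fun Θ => by
    rw [← sub_eq_zero, ← hB.compatDefect hφ hc Θ hs ht, h, map_zero]
  have h2 := h1.smul n⁻¹
  rwa [inv_smul_smul₀ hn] at h2

/-- The formula for `B` is used for both nested brackets, hence the square of `n`. The outer use
requires the inner bracket to be holomorphic. -/
theorem Induces.jacobiator (hB : Induces n J B) (hJ : PreservesHol J) {v : slitDual L}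
    {s t r : CSec E L} (hs : HolNear v.1.1 s) (ht : HolNear v.1.1 t) (hr : HolNear v.1.1 r) :
    tl v (B.jacobiator (re s) (re t) (re r)) = tl v (re (n • n • J.jacobiator s t r)) := by
  have key : ∀ {s t r : CSec E L}, HolNear v.1.1 s → HolNear v.1.1 t → HolNear v.1.1 r →
      tl v (B.bracket (re s) (B.bracket (re t) (re r))) =
        tl v (re (n • n • J.bracket s (J.bracket t r))) := fun {s t r} hs ht hr => by
    have h1 := hat_gauge_congr_of_eventually (B.br (re s)) (hB.eventually ht hr)
    refine h1.trans ((hB v _ _ hs.holAt ((hJ _ _ _ ht hr).smul n)).trans ?_)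
    rw [bracket_smul_right]
  rw [BiDer.jacobiator, BiDer.jacobiator, map_add, map_add, key hs ht hr, key ht hr hs, key hr hs ht]
  simp only [smul_add, map_add]

theorem biDer_isJacobi (h : ∀ (v : slitDual L) (s t r : CSec E L), HolNear v.1.1 s →
    HolNear v.1.1 t → HolNear v.1.1 r → tl v (B.jacobiator (re s) (re t) (re r)) = 0) :
    B.IsJacobi := by
  intro p q r
  refine tl_ext fun v => ?_
  have key : ∀ {p p' : HatSec E L} (q r : HatSec E L), dTilde p v = dTilde p' v →
      tl v (B.jacobiator p q r) = tl v (B.jacobiator p' q r) := fun q r h => by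
    rw [B.jacobiator_eq, B.jacobiator_eq]
    exact hat_gauge_congr _ h
  obtain ⟨a, ha, hap⟩ := exists_dTilde_re v (dTilde p v)
  obtain ⟨b, hb, hbq⟩ := exists_dTilde_re v (dTilde q v)
  obtain ⟨c, hc, hcr⟩ := exists_dTilde_re v (dTilde r v)
  change tl v (B.jacobiator p q r) = _
  rw [← key q r hap, B.jacobiator_cyc, ← key r _ hbq, B.jacobiator_cyc, ← key _ _ hcr,
    B.jacobiator_cyc, h v a b c ha hb hc, map_zero]

theorem Induces.isJacobi (hB : Induces n J B) (hJ : PreservesHol J) (h : J.IsJacobi) :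
    B.IsJacobi := by
  refine biDer_isJacobi fun v s t r hs ht hr => ?_
  have h1 : J.jacobiator s t r = 0 := h s t r
  rw [hB.jacobiator hJ hs ht hr, h1, smul_zero, smul_zero, map_zero, map_zero]

theorem Induces.isJacobi_of (hB : Induces n J B) (hn : n ≠ 0) (hJ : PreservesHol J) (h20 : Is20 J)
    (h : B.IsJacobi) : J.IsJacobi := by
  refine h20.isJacobi fun x s t r hs ht hr => ?_
  obtain ⟨v, rfl⟩ := exists_over (L := L) x
  have h1 : ∀ s, HolNear v.1.1 s → tl v (re (n • n • J.jacobiator s t r)) = 0 := fun s hs => by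
    rw [← hB.jacobiator hJ hs ht hr]
    have : B.jacobiator (re s) (re t) (re r) = 0 := h _ _ _
    rw [this, map_zero]
  -- Replacing `s` by `i s` provides the imaginary part of the Jacobiator.
  have h2 : J.jacobiator (Complex.I • s) t r = Complex.I • J.jacobiator s t r := by
    rw [J.jacobiator_eq, J.jacobiator_eq, map_smul]
  have h3 := h1 _ (hs.smul Complex.I)
  rw [h2, smul_comm n Complex.I, smul_comm n Complex.I] at h3
  have h4 := evL_eq_zero_of_re (h1 s hs) h3
  rw [map_smul, map_smul, smul_eq_zero_iff_right hn, smul_eq_zero_iff_right hn] at h4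
  exact h4

/-- A covector of type `(0,1)` is `b + i b'` with `b' = b ∘ i` and `-b = b' ∘ i`. The relation
applied to `b` and to `b'` kills the real and the imaginary part of `Q(α, b + i b')`; general first
entries follow by complex linearity. -/
theorem CBivector.is20_of (Q : CBivector E L) (h : ∀ v (α β : TildeT E →L[ℝ] ℝ) (β' : TildeT E →L[ℝ] ℝ),
    (∀ u, β' u = β (Complex.I • u)) →
    (Q.form v (complexify α) (complexify β)).re = (Q.form v (complexify α) (complexify β')).im) :
    Q.Is20 := by
  have key : ∀ v (α : TildeT E →L[ℝ] ℝ) (β : TildeT E →L[ℝ] ℂ), Is01 β →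
      Q.form v (complexify α) β = 0 := by
    intro v α β hβ
    let b : TildeT E →L[ℝ] ℝ := Complex.reCLM ∘L β
    let b' : TildeT E →L[ℝ] ℝ := Complex.imCLM ∘L β
    have h1 : ∀ u, b' u = b (Complex.I • u) := fun u => by
      change (β u).im = (β (Complex.I • u)).re
      rw [hβ]; simp
    have h2 : ∀ u, (-b) u = b' (Complex.I • u) := fun u => by
      change -(β u).re = (β (Complex.I • u)).im
      rw [hβ]; simp
    have e1 := h v α b b' h1
    have e2 := h v α b' (-b) h2
    have h3 : complexify (-b) = (-1 : ℂ) • complexify b := ContinuousLinearMap.ext fun u => by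
      change ((-(b u) : ℝ) : ℂ) = -1 * (b u : ℂ)
      push_cast; ring
    have h4 : β = complexify b + Complex.I • complexify b' := ContinuousLinearMap.ext fun u => by
      change β u = ((β u).re : ℂ) + Complex.I * ((β u).im : ℂ)
      rw [mul_comm, Complex.re_add_im]
    rw [h3, map_smul, smul_eq_mul, neg_one_mul, Complex.neg_im] at e2
    rw [h4, map_add, map_smul, smul_eq_mul]
    apply Complex.ext
    · simp [e1]
    · simp [e2]
  intro v α β hα
  have h5 : β = complexify (Complex.reCLM ∘L β) + Complex.I • complexify (Complex.imCLM ∘L β) :=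
    ContinuousLinearMap.ext fun u => by
      change β u = ((β u).re : ℂ) + Complex.I * ((β u).im : ℂ)
      rw [mul_comm, Complex.re_add_im]
  rw [Q.form_skew, h5, LinearMap.map_add₂, LinearMap.map_smul₂, key v _ α hα, key v _ α hα]
  simp

/-- `Ĵ' = Ĵ_ĵ` says that the real part of the lift at `(α, β)` is its imaginary part at `(α, β ∘
i)`, for real covectors. So the lift has type `(2,0)`, and so does `J`, because a jet of type
`(0,1)` has a homogeneous function with differential of type `(0,1)`. -/
theorem IsHatPair.is20 (h : IsHatPair J B' B) (hφ : IsHatEnd φ) (hd : IsDeform B' B φ) : Is20 J := by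
  obtain ⟨Q, hQ, -, h1, h2⟩ := h
  obtain ⟨hc, rfl⟩ := hd
  have hQ20 : Q.Is20 := by
    refine Q.is20_of fun v α β β' hβ => ?_
    obtain ⟨a, -, rfl⟩ := exists_dTilde_re v α
    obtain ⟨b, -, rfl⟩ := exists_dTilde_re v β
    obtain ⟨b', -, rfl⟩ := exists_dTilde_re v β'
    have e1 : tilde ((B.deform φ hc).bracket (re a) (re b)) v =
        dTilde (re b) v (Complex.I • gvec v (B.br (re a))) := by
      rw [← isHatEnd_iff.1 hφ, ← B.sharp_j1, ← hc.apply]; rfl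
    rw [← h1, ← h2, e1, ← hβ, dTilde_gvec]; rfl
  intro s t x hs hds
  obtain ⟨v, rfl⟩ := exists_over (L := L) x
  refine evL_eq_zero_of_cTilde (v := v) ?_
  rw [← hQ]
  refine hQ20 v _ _ fun w => ?_
  have h0 : loc s v.1.1 v.1.1 = 0 :=
    (loc_eq_zero_iff (mem_baseSet_trivializationAt ℂ L v.1.1) s).2 hs
  rw [dcTilde_apply, dcTilde_apply, h0]
  change _ + _ * dloc s v.1.1 (Complex.I • w.1) = _
  rw [hds]; ring

theorem isHolomorphicJacobi_iff : IsHolomorphicJacobi J ↔ Is20 J ∧ PreservesHol J ∧ J.IsJacobi :=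
  ⟨fun h => ⟨h.type20, h.dbar_closed.preservesHol, schoutenSelf_eq_zero_iff.1 h.jacobi⟩,
    fun h => ⟨h.1, h.2.1.dbarClosed, schoutenSelf_eq_zero_iff.2 h.2.2⟩⟩

theorem isHolomorphicJacobi_iff_jacobiNijenhuis (hφ : IsHatEnd φ) (h : IsHatPair J B' B) :
    IsHolomorphicJacobi J ↔ IsJacobiNijenhuis B φ ∧ IsDeform B' B φ := by
  have hn : -Complex.I / 4 ≠ 0 := by simp
  rw [isHolomorphicJacobi_iff]
  constructor
  · rintro ⟨h20, hp, hJ⟩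
    have hB := h.induces_right h20
    have hc := hB.sharpComm hφ
    refine ⟨⟨hB.isJacobi hp hJ, hB.compatible hφ hp, hφ.torsion_eq_zero⟩, hc, ?_⟩
    refine (h.induces_left h20).unique ?_
    -- The deformation multiplies the constant by `i`, and `i · (-i / 4) = 1/4` is the constant of
    -- `Ĵ'`; both are then determined by the same values.
    have h1 := hB.deform hφ hc
    rwa [show Complex.I * (-Complex.I / 4) = 1 / 4 by
      linear_combination (-(1 / 4) : ℂ) * Complex.I_mul_I] at h1
  · rintro ⟨hN, hd⟩
    have h20 := h.is20 hφ hd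
    have hB := h.induces_right h20
    have hp := hB.preservesHol hn hφ hN.compatible
    exact ⟨h20, hp, hB.isJacobi_of hn hp h20 hN.jacobi⟩

theorem isHolomorphicJacobi_iff_generalizedContact (hφ : IsHatEnd φ) (h : IsHatPair J B' B) :
    IsHolomorphicJacobi J ↔ IsGeneralizedContact (blockEnd φ B) ∧ IsDeform B' B φ := by
  rw [isHolomorphicJacobi_iff_jacobiNijenhuis hφ h,
    isGeneralizedContact_iff (jetGenerated_hat E L) hφ.sq hφ.torsion_eq_zero]

end Equivalence

/-! ### Contact structures and nondegenerate Jacobi brackets -/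

/-- A line bundle over a space `M`, given by its functions `A` and its sections `P`, with evaluation
at points and local trivializations. -/
structure LineSpace (K A P M : Type*) [Field K] [CommRing A] [Algebra K A] [AddCommGroup P]
    [Module K P] [Module A P] where
  ev : M → A →ₐ[K] K
  val : M → P →ₗ[K] K
  val_smul : ∀ m a p, val m (a • p) = ev m a * val m p
  triv : M → P →ₗ[A] A
  triv_symm : ∀ m s t, triv m s • t = triv m t • s
  frame : M → P
  triv_frame : ∀ m, ev m (triv m (frame m)) = 1
  fun_ext : ∀ a : A, (∀ m, ev m a = 0) → a = 0
  sec_ext : ∀ p : P, (∀ m, val m p = 0) → p = 0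

namespace LineSpace

variable {K A P M : Type*} [Field K] [CommRing A] [Algebra K A] [AddCommGroup P]
  [Module K P] [Module A P] (Λ : LineSpace K A P M)

/-- Near `m` the functional `triv m` is proportional to the coordinate with respect to `frame m`;
this is the division-free form of that statement. -/
theorem triv_val (m m' : M) (p : P) :
    Λ.ev m' (Λ.triv m p) * Λ.val m' (Λ.frame m) = Λ.ev m' (Λ.triv m (Λ.frame m)) * Λ.val m' p := by
  rw [← Λ.val_smul, Λ.triv_symm, Λ.val_smul]

theorem val_eq_zero_of_triv {m m' : M} (h : Λ.ev m' (Λ.triv m (Λ.frame m)) ≠ 0) {p : P}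
    (hp : Λ.ev m' (Λ.triv m p) = 0) : Λ.val m' p = 0 := by
  have h1 := Λ.triv_val m m' p
  rw [hp, zero_mul] at h1
  exact (mul_eq_zero.1 h1.symm).resolve_left h

theorem triv_eq_zero_of_val {m : M} {p : P} (hp : Λ.val m p = 0) (hf : Λ.val m (Λ.frame m) ≠ 0) :
    Λ.ev m (Λ.triv m p) = 0 := by
  have h1 := Λ.triv_val m m p
  rw [hp, mul_zero] at h1
  exact (mul_eq_zero.1 h1).resolve_right hf

theorem symbol_unique {Δ : P →ₗ[K] P} {S S' : Derivation K A A} (hf : ∀ m, Λ.val m (Λ.frame m) ≠ 0)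
    (h : IsSymbol Δ S) (h' : IsSymbol Δ S') : S = S' := by
  ext a
  refine sub_eq_zero.1 (Λ.fun_ext _ fun m => ?_)
  have h1 := (h a (Λ.frame m)).symm.trans (h' a (Λ.frame m))
  have h2 := congrArg (Λ.val m) (add_right_cancel h1)
  rw [Λ.val_smul, Λ.val_smul] at h2
  rw [map_sub, mul_right_cancel₀ (hf m) h2, sub_self]

end LineSpace

section Derivations

variable {K A : Type*} [Field K] [CommRing A] [Algebra K A]

theorem lie_smul_der (ξ ζ : Derivation K A A) (a : A) : ⁅ξ, a • ζ⁆ = ξ a • ζ + a • ⁅ξ, ζ⁆ := by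
  ext b
  simp [Derivation.commutator_apply]
  ring

theorem smul_lie_der (ξ ζ : Derivation K A A) (a : A) : ⁅a • ξ, ζ⁆ = a • ⁅ξ, ζ⁆ - ζ a • ξ := by
  ext b
  simp [Derivation.commutator_apply]
  ring

end Derivations

section ContactAbstract

variable {K A P M : Type*} [Field K] [CommRing A] [Algebra K A] [AddCommGroup P]
  [Module K P] [Module A P] [IsScalarTower K A P]

/-- The symbol of `{p, -}`. -/
def BiDer.sym (B : BiDer K A P) (p : P) : Derivation K A A := (B.br p).2.choose

theorem BiDer.isSymbol_sym (B : BiDer K A P) (p : P) : IsSymbol (B.br p).1 (B.sym p) :=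
  (B.br p).2.choose_spec

theorem BiDer.bracket_smul (B : BiDer K A P) (p q : P) (a : A) :
    B.bracket p (a • q) = B.sym p a • q + a • B.bracket p q := B.isSymbol_sym p a q

theorem IsSymbol.comm {Δ Θ : Gauge K A P} {S R : Derivation K A A} (h : IsSymbol Δ.1 S)
    (h' : IsSymbol Θ.1 R) : IsSymbol (gcomm Δ Θ).1 ⁅S, R⁆ := by
  intro a p
  have h1 := h a; have h2 := h' a
  rw [gcomm_apply, gcomm_apply, h1, h2, map_add, map_add, h1, h2, h, h', Derivation.commutator_apply,
    sub_smul, smul_sub]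
  abel

/-- The data of the line bundle `P` which enter in the comparison of contact structures along
an involutive tangent distribution `T` and nondegenerate Jacobi brackets: `good m` are the sections
whose jets at `m` have type `(1,0)`, and `hol m` are the functions whose differentials at `m` have
type `(1,0)`. -/
structure ContactModel (K A P M : Type*) [Field K] [CommRing A] [Algebra K A] [AddCommGroup P]
    [Module K P] [Module A P] [IsScalarTower K A P] extends LineSpace K A P M where
  T : Submodule A (Derivation K A A)
  lie_mem : ∀ ξ ∈ T, ∀ ζ ∈ T, ⁅ξ, ζ⁆ ∈ T
  good : M → Submodule K P
  hol : M → Set A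
  triv_mem : ∀ m, ∀ s ∈ good m, triv m s ∈ hol m
  smul_mem : ∀ m, ∀ a ∈ hol m, ∀ s ∈ good m, a • s ∈ good m
  frame_mem : ∀ m, frame m ∈ good m
  val_frame : ∀ m, val m (frame m) ≠ 0
  glue : ∀ Q : M → P → Prop, (∀ m q q', Q m q → Q m q' → val m q = val m q') →
    (∀ m₀, ∃ κ t, ev m₀ κ ≠ 0 ∧ ∀ m, ev m κ ≠ 0 → ∃ q, Q m q ∧ val m t = ev m κ * val m q) →
    ∃ p, ∀ m q, Q m q → val m p = val m q
  eq_zero_of_hol : ∀ m, ∀ ξ ∈ T, (∀ a ∈ hol m, ev m (ξ a) = 0) → ∀ a, ev m (ξ a) = 0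
  exists_frame : ∀ m₀, ∃ (ι : Type) (_ : Fintype ι) (p : ι → P) (κ : A), ev m₀ κ ≠ 0 ∧
    (∀ m, ev m κ ≠ 0 → (∀ i, p i ∈ good m) ∧ ev m (triv m₀ (frame m₀)) ≠ 0 ∧
      ∀ Δ : Gauge K A P, (∀ i, val m (Δ.1 (p i)) = 0) → ∀ s ∈ good m, val m (Δ.1 s) = 0) ∧
    ∀ x : ι → K, val m₀ (∑ i, x i • p i) = 0 →
      (∀ ζ ∈ T, ev m₀ (ζ (triv m₀ (∑ i, x i • p i))) = 0) → x = 0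
  factor : ∀ m, ∀ ξ ∈ T, (∀ a, ev m (ξ a) = 0) → ∃ (ι : Type) (_ : Fintype ι) (χ : A) (a : ι → A)
    (η : ι → Derivation K A A), ev m χ ≠ 0 ∧ (∀ i, ev m (a i) = 0) ∧ χ • ξ = ∑ i, a i • η i

namespace ContactModel

variable (𝓜 : ContactModel K A P M) {B : BiDer K A P} {θ : Derivation K A A →ₗ[A] P}

/-- The form `θ` is a contact form for the model. -/
def IsContact (θ : Derivation K A A →ₗ[A] P) : Prop :=
  IsContactForm (fun m a => 𝓜.ev m a = 0) (fun m p => 𝓜.val m p = 0) (𝓜.T : Set _) θ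

/-- The jet of type `(1,0)` of the section vanishes. -/
def JetZero (m : M) (p : P) : Prop :=
  𝓜.val m p = 0 ∧ ∀ ζ ∈ 𝓜.T, 𝓜.ev m (ζ (𝓜.triv m p)) = 0

theorem contactField_unique (hθ : 𝓜.IsContact θ) {ξ ξ' : Derivation K A A}
    (h : IsContactField (𝓜.T : Set _) θ ξ) (h' : IsContactField (𝓜.T : Set _) θ ξ')
    (he : θ ξ = θ ξ') : ξ = ξ' := by
  ext a
  refine sub_eq_zero.1 (𝓜.fun_ext _ fun m => ?_)
  refine hθ.nondeg m (ξ - ξ') (𝓜.T.sub_mem h.1 h'.1) (by rw [map_sub, he, sub_self])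
    (fun ζ hζ hζ0 => ?_) a
  rw [sub_lie, map_sub, h.2 ζ hζ hζ0, h'.2 ζ hζ hζ0, sub_self, map_zero]

/-- The bracket induced by a contact structure is a nondegenerate Jacobi bracket. -/
theorem IsContact.jacobi_nondeg (hθ : 𝓜.IsContact θ) (hB : B.InducedBy (𝓜.T : Set _) θ) :
    B.IsJacobi ∧ ∀ m p, (∀ q, 𝓜.val m (B.bracket p q) = 0) → 𝓜.JetZero m p := by
  choose X hX using fun p => hB p p
  have hXc : ∀ p, IsContactField (𝓜.T : Set _) θ (X p) := fun p => (hX p).choose_spec.1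
  have hXp : ∀ p, θ (X p) = p := fun p => (hX p).choose_spec.2.2.1
  have hXB : ∀ p q, B.bracket p q = θ ⁅X p, X q⁆ := fun p q => by
    obtain ⟨ξ, ζ, h1, h2, h3, h4, h5⟩ := hB p q
    rw [h5, 𝓜.contactField_unique hθ h1 (hXc p) (h3.trans (hXp p).symm),
      𝓜.contactField_unique hθ h2 (hXc q) (h4.trans (hXp q).symm)]
  -- Subtracting `X (θ ζ)` from `ζ` gives an element of `ker θ`, on which the contact condition
  -- applies.
  have key : ∀ p, ∀ ζ ∈ 𝓜.T, θ ⁅X p, ζ⁆ = B.bracket p (θ ζ) := fun p ζ hζ => by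
    have h := (hXc p).2 (ζ - X (θ ζ)) (𝓜.T.sub_mem hζ (hXc _).1) (by rw [map_sub, hXp, sub_self])
    rw [lie_sub, map_sub] at h
    rw [hXB, ← sub_eq_zero, h]
  -- Contact fields are closed under the commutator, and a contact field is determined by its value
  -- under `θ`. The Jacobi identity for `B` is then that of vector fields.
  have hlie : ∀ p q, X (B.bracket p q) = ⁅X p, X q⁆ := fun p q => by
    refine 𝓜.contactField_unique hθ (hXc _) ⟨𝓜.lie_mem _ (hXc p).1 _ (hXc q).1, fun ζ hζ h0 => ?_⟩
      ((hXp _).trans (hXB p q))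
    rw [lie_lie, map_sub,
      (hXc p).2 _ (𝓜.lie_mem _ (hXc q).1 _ hζ) ((hXc q).2 ζ hζ h0),
      (hXc q).2 _ (𝓜.lie_mem _ (hXc p).1 _ hζ) ((hXc p).2 ζ hζ h0), sub_self]
  constructor
  · intro p q r
    have h : ∀ p q r, B.bracket p (B.bracket q r) = θ ⁅X p, ⁅X q, X r⁆⁆ := fun p q r => by
      rw [hXB p, hlie]
    rw [h, h, h, ← map_add, ← map_add, lie_jacobi, map_zero]
  · intro m p hp
    have hsm : ∀ (a : A) (q : P), B.bracket p (a • q) = X p a • q + a • B.bracket p q := fun a q => by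
      have h1 := key p (a • X q) (𝓜.T.smul_mem a (hXc q).1)
      rw [lie_smul_der, map_add, map_smul, map_smul, map_smul, hXp, ← hXB] at h1
      exact h1.symm
    -- Comparing `{p, e}` with `{p, a e}` for a frame `e`: if `{p, -}` vanishes at `m`, so does the
    -- contact field of `p`.
    have h0 : ∀ a, 𝓜.ev m (X p a) = 0 := fun a => by
      have h1 := hp (a • 𝓜.frame m)
      rw [hsm, map_add, 𝓜.val_smul, 𝓜.val_smul, hp, mul_zero, add_zero] at h1
      exact (mul_eq_zero.1 h1).resolve_right (𝓜.val_frame m)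
    -- As the contact field vanishes at `m`, near `m` it is a combination of vector fields with
    -- coefficients vanishing at `m`. Applying `θ` shows that `p` vanishes at `m`.
    obtain ⟨ι, _, χ, a, η, hχ, ha, he⟩ := 𝓜.factor m (X p) (hXc p).1 h0
    have hχp : χ • p = ∑ i, a i • θ (η i) := by
      have h1 := congrArg θ he
      rw [map_smul, hXp, map_sum] at h1
      rw [h1]
      exact Finset.sum_congr rfl fun i _ => map_smul _ _ _
    have hp0 : 𝓜.val m p = 0 := by
      have h1 := congrArg (𝓜.val m) hχp
      rw [𝓜.val_smul, map_sum, Finset.sum_eq_zero fun i _ => by rw [𝓜.val_smul, ha, zero_mul]] at h1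
      exact (mul_eq_zero.1 h1).resolve_left hχ
    have ht0 := 𝓜.triv_eq_zero_of_val hp0 (𝓜.val_frame m)
    refine ⟨hp0, fun ζ hζ => ?_⟩
    -- At `m` only the terms with `ζ (a i)` survive in the bracket with `ζ`. Up to sign, their sum
    -- is also the derivative of `p` along `ζ`, and it is zero because `{p, θ ζ}` vanishes at `m`.
    have h1 := congrArg (fun ξ => 𝓜.ev m (𝓜.triv m (θ ⁅ξ, ζ⁆))) he
    simp only [sum_lie, smul_lie_der, map_sub, map_smul, map_sum, hXp, smul_eq_mul, map_mul, ha,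
      zero_mul, ht0, mul_zero, zero_sub, sub_zero] at h1
    rw [key p ζ hζ, 𝓜.triv_eq_zero_of_val (hp _) (𝓜.val_frame m), mul_zero] at h1
    have h2 := congrArg (fun r => 𝓜.ev m (ζ (𝓜.triv m r))) hχp
    simp only [map_smul, map_sum, smul_eq_mul, Derivation.leibniz, map_add, map_mul, ha, zero_mul,
      ht0, zero_add, add_zero] at h2
    have h3 : 𝓜.ev m χ * 𝓜.ev m (ζ (𝓜.triv m p)) = 0 := by
      rw [h2, ← neg_eq_zero, ← Finset.sum_neg_distrib, h1]
      refine Finset.sum_congr rfl fun i _ => ?_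
      ring
    exact (mul_eq_zero.1 h3).resolve_left hχ

/-- Nondegenerate Jacobi brackets of type `(2,0)`. -/
structure NondegJacobi (B : BiDer K A P) : Prop where
  jacobi : B.IsJacobi
  sym_mem : ∀ p, B.sym p ∈ 𝓜.T
  nondeg : ∀ m, ∀ q ∈ 𝓜.good m, (∀ s ∈ 𝓜.good m, 𝓜.val m (B.bracket q s) = 0) → 𝓜.JetZero m q
  exists_good : ∀ m p, ∃ q ∈ 𝓜.good m, 𝓜.val m q = 𝓜.val m p ∧
    ∀ s, 𝓜.val m (B.bracket q s) = 𝓜.val m (B.bracket p s)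

theorem sym_add (𝓜 : ContactModel K A P M) (B : BiDer K A P) (p q : P) : B.sym (p + q) = B.sym p + B.sym q := by
  refine 𝓜.symbol_unique (Δ := (B.br (p + q)).1) 𝓜.val_frame (B.isSymbol_sym _) fun a s => ?_
  have h1 := B.isSymbol_sym p a s
  have h2 := B.isSymbol_sym q a s
  rw [map_add, Submodule.coe_add, LinearMap.add_apply, h1, h2, LinearMap.add_apply,
    Derivation.add_apply, add_smul, smul_add]
  abel

theorem sym_smul (𝓜 : ContactModel K A P M) (B : BiDer K A P) (c : K) (p : P) : B.sym (c • p) = c • B.sym p := by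
  refine 𝓜.symbol_unique (Δ := (B.br (c • p)).1) 𝓜.val_frame (B.isSymbol_sym _) fun a s => ?_
  have h1 := B.isSymbol_sym p a s
  rw [B.br.map_smul]
  change c • (B.br p).1 (a • s) = (c • B.sym p a) • s + a • c • (B.br p).1 s
  rw [h1, smul_add, smul_assoc, smul_comm a c]

/-- The symbol of `{p, -}` as a linear map. -/
def symL (𝓜 : ContactModel K A P M) (B : BiDer K A P) : P →ₗ[K] Derivation K A A where
  toFun := B.sym
  map_add' := 𝓜.sym_add B
  map_smul' := 𝓜.sym_smul B

/-- The section `q` represents the vector field `ξ` at the point `m`. -/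
def Rep (B : BiDer K A P) (ξ : Derivation K A A) (m : M) (q : P) : Prop :=
  q ∈ 𝓜.good m ∧ ∀ a ∈ 𝓜.hol m, 𝓜.ev m (B.sym q a) = 𝓜.ev m (ξ a)

theorem sym_eq {m : M} {p q : P} (h : ∀ s, 𝓜.val m (B.bracket q s) = 𝓜.val m (B.bracket p s))
    (a : A) : 𝓜.ev m (B.sym q a) = 𝓜.ev m (B.sym p a) := by
  have h1 := h (a • 𝓜.frame m)
  rw [B.bracket_smul, B.bracket_smul, map_add, map_add, 𝓜.val_smul, 𝓜.val_smul, 𝓜.val_smul,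
    𝓜.val_smul, h] at h1
  exact mul_right_cancel₀ (𝓜.val_frame m) (add_right_cancel h1)

theorem Rep.add {ξ ξ' : Derivation K A A} {m : M} {q q' : P} (h : 𝓜.Rep B ξ m q)
    (h' : 𝓜.Rep B ξ' m q') : 𝓜.Rep B (ξ + ξ') m (q + q') :=
  ⟨Submodule.add_mem _ h.1 h'.1, fun a ha => by
    rw [𝓜.sym_add, Derivation.add_apply, Derivation.add_apply, map_add, map_add, h.2 a ha,
      h'.2 a ha]⟩

theorem Rep.smul {ξ : Derivation K A A} {m : M} {q : P} (h : 𝓜.Rep B ξ m q) (b : A) :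
    𝓜.Rep B (b • ξ) m (𝓜.ev m b • q) :=
  ⟨Submodule.smul_mem _ _ h.1, fun a ha => by
    rw [𝓜.sym_smul, Derivation.smul_apply, Derivation.smul_apply, map_smul, smul_eq_mul,
      smul_eq_mul, map_mul, h.2 a ha]⟩

/-- If the symbol of `{r, -}` vanishes on `hol m`, then `{r, s}` at `m` is proportional to the value
of the good section `s`. For `s = r` the bracket is zero, so either `r` vanishes at `m` or all
brackets `{r, s}` do; in the second case nondegeneracy applies. -/
theorem Rep.val_eq_zero (hB : 𝓜.NondegJacobi B) {m : M} {r : P} (h : 𝓜.Rep B 0 m r) :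
    𝓜.val m r = 0 := by
  have key : ∀ s ∈ 𝓜.good m, 𝓜.val m (B.bracket r s) =
      𝓜.ev m (𝓜.triv m s) * 𝓜.val m (B.bracket r (𝓜.frame m)) := fun s hs => by
    have h1 := congrArg (fun t => 𝓜.val m (B.bracket r t)) (𝓜.triv_symm m s (𝓜.frame m))
    simp only [B.bracket_smul, map_add, 𝓜.val_smul, 𝓜.triv_frame, one_mul,
      h.2 _ (𝓜.triv_mem m s hs), h.2 _ (𝓜.triv_mem m _ (𝓜.frame_mem m)), Derivation.zero_apply,
      map_zero, zero_mul, zero_add] at h1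
    exact h1.symm
  have h0 := key r h.1
  rw [show B.bracket r r = 0 from B.skew r, map_zero] at h0
  rcases mul_eq_zero.1 h0.symm with h1 | h1
  · exact 𝓜.val_eq_zero_of_triv (by rw [𝓜.triv_frame]; exact one_ne_zero) h1
  · exact (hB.nondeg m r h.1 fun s hs => by rw [key s hs, h1, mul_zero]).1

theorem Rep.val_unique (hB : 𝓜.NondegJacobi B) {ξ : Derivation K A A} {m : M} {q q' : P}
    (h : 𝓜.Rep B ξ m q) (h' : 𝓜.Rep B ξ m q') : 𝓜.val m q = 𝓜.val m q' := by
  have h1 : 𝓜.Rep B 0 m (q + (-1 : K) • q') :=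
    ⟨Submodule.add_mem _ h.1 (Submodule.smul_mem _ _ h'.1), fun a ha => by
      rw [𝓜.sym_add, 𝓜.sym_smul, Derivation.add_apply, Derivation.smul_apply, map_add, map_smul,
        h.2 a ha, h'.2 a ha]
      simp⟩
  have h2 := h1.val_eq_zero 𝓜 hB
  rw [map_add, map_smul, neg_one_smul, ← sub_eq_add_neg, sub_eq_zero] at h2
  exact h2

/-- Near each point the vector fields are represented by combinations of a frame of sections,
with coefficients depending on the vector field. -/
theorem exists_local_rep (hB : 𝓜.NondegJacobi B) (m₀ : M) :
    ∃ (ι : Type) (_ : Fintype ι) (p : ι → P) (κ d : A), 𝓜.ev m₀ κ ≠ 0 ∧ 𝓜.ev m₀ d ≠ 0 ∧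
      (∀ m, 𝓜.ev m κ ≠ 0 → ∀ i, p i ∈ 𝓜.good m) ∧ ∀ ξ : Derivation K A A, ∃ x : ι → A,
        ∀ m, 𝓜.ev m κ ≠ 0 → 𝓜.Rep B (d • ξ) m (∑ i, 𝓜.ev m (x i) • p i) := by
  classical
  obtain ⟨ι, _, p, κ, hκ, hp, hi⟩ := 𝓜.exists_frame m₀
  set e := 𝓜.frame m₀
  set g := 𝓜.triv m₀ e
  -- The Gram matrix of the bracket in a frame of good jets.
  let N : Matrix ι ι A := fun i j => 𝓜.triv m₀ (B.bracket (p i) (p j))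
  have hval : ∀ m (x : ι → K) j, 𝓜.ev m (𝓜.triv m₀ (B.bracket (∑ i, x i • p i) (p j))) =
      ∑ i, x i * 𝓜.ev m (N i j) := fun m x j => by
    have : B.bracket (∑ i, x i • p i) (p j) = ∑ i, x i • B.bracket (p i) (p j) := by
      change (B.br _).1 _ = _
      rw [map_sum]
      simp only [map_smul]
      rw [Submodule.coe_sum, LinearMap.sum_apply]
      rfl
    rw [this, map_sum, map_sum]
    refine Finset.sum_congr rfl fun i _ => ?_
    rw [← algebraMap_smul A (x i), map_smul, smul_eq_mul, map_mul, AlgHom.commutes]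
    rfl
  -- A vector in the left kernel would give a good section with vanishing brackets, hence with zero
  -- jet, against the independence of the frame.
  have hdet : 𝓜.ev m₀ N.det ≠ 0 := fun h0 => by
    rw [AlgHom.map_det] at h0
    obtain ⟨x, hx, hx0⟩ := Matrix.exists_vecMul_eq_zero_iff.2 h0
    refine hx (hi x ?_ ?_)
    all_goals
      have hg : (∑ i, x i • p i) ∈ 𝓜.good m₀ :=
        Submodule.sum_mem _ fun i _ => Submodule.smul_mem _ _ ((hp m₀ hκ).1 i)
      have := hB.nondeg m₀ _ hg fun s hs => by
        refine (hp m₀ hκ).2.2 (B.br _) (fun j => ?_) s hs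
        refine 𝓜.val_eq_zero_of_triv (hp m₀ hκ).2.1 ?_
        exact (hval m₀ x j).trans (congrFun hx0 j)
    · exact this.1
    · exact this.2
  refine ⟨ι, inferInstance, p, κ, N.det * g, hκ, by
    rw [map_mul]; exact mul_ne_zero hdet (hp m₀ hκ).2.1, fun m hm => (hp m hm).1, fun ξ =>
    ⟨fun i => ∑ j, g * ξ (𝓜.triv m₀ (p j)) * N.adjugate j i, fun m hm => ?_⟩⟩
  obtain ⟨hgood, hg0, hspan⟩ := hp m hm
  -- Cramer's rule for the equations `{q, p k} = ξ (triv (p k)) e`, without dividing by the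
  -- determinant.
  set x : ι → A := fun i => ∑ j, g * ξ (𝓜.triv m₀ (p j)) * N.adjugate j i
  set q := ∑ i, 𝓜.ev m (x i) • p i
  refine ⟨Submodule.sum_mem _ fun i _ => Submodule.smul_mem _ _ (hgood i), fun a ha => ?_⟩
  have hxN : ∀ k, ∑ i, x i * N i k = g * ξ (𝓜.triv m₀ (p k)) * N.det := fun k => by
    have h1 := congrFun (congrArg (Matrix.vecMul fun j => g * ξ (𝓜.triv m₀ (p j)))
      (Matrix.adjugate_mul N)) k
    rw [← Matrix.vecMul_vecMul, Matrix.vecMul_smul, Matrix.vecMul_one, Pi.smul_apply,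
      smul_eq_mul, mul_comm] at h1
    exact h1
  -- A derivation with symbol `g • ξ`. The section `q` is chosen so that `{q, -}` and `N.det • D`
  -- agree on the frame, hence on good sections; comparing them on `a • frame m` and on `frame m`
  -- gives the symbols.
  let D : Gauge K A P := ⟨
    { toFun := fun s => ξ (𝓜.triv m₀ s) • e
      map_add' := fun s t => by rw [map_add, map_add, add_smul]
      map_smul' := fun c s => by
        rw [← algebraMap_smul A c s, map_smul, algebraMap_smul, Derivation.map_smul, RingHom.id_apply,
          smul_assoc] }, g • ξ, fun a s => by
      change ξ (𝓜.triv m₀ (a • s)) • e = (g * ξ a) • s + a • ξ (𝓜.triv m₀ s) • e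
      rw [map_smul, smul_eq_mul, Derivation.leibniz, add_smul, smul_assoc, smul_eq_mul, mul_smul,
        smul_comm _ (ξ a), 𝓜.triv_symm, mul_comm g, mul_smul, add_comm]⟩
  have hDs : ∀ a s, D.1 (a • s) = (g * ξ a) • s + a • D.1 s := fun a s => by
    change ξ (𝓜.triv m₀ (a • s)) • e = (g * ξ a) • s + a • ξ (𝓜.triv m₀ s) • e
    rw [map_smul, smul_eq_mul, Derivation.leibniz, add_smul, smul_assoc, smul_eq_mul, mul_smul,
      smul_comm _ (ξ a), 𝓜.triv_symm, mul_comm g, mul_smul, add_comm]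
  have hkill : ∀ k, 𝓜.val m ((B.br q - N.det • D).1 (p k)) = 0 := fun k => by
    change 𝓜.val m (B.bracket q (p k) - N.det • ξ (𝓜.triv m₀ (p k)) • e) = 0
    have h1 := 𝓜.triv_val m₀ m (B.bracket q (p k))
    have h2 : 𝓜.ev m (𝓜.triv m₀ (B.bracket q (p k))) =
        𝓜.ev m (g * ξ (𝓜.triv m₀ (p k)) * N.det) := by
      rw [← hxN, map_sum, hval]
      simp only [map_mul]
    rw [h2] at h1
    rw [map_sub, sub_eq_zero, 𝓜.val_smul, 𝓜.val_smul]
    refine mul_left_cancel₀ hg0 (h1.symm.trans ?_)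
    simp only [map_mul]
    ring
  have h1 := hspan _ hkill _ (𝓜.smul_mem m a ha _ (𝓜.frame_mem m))
  have h2 := hspan _ hkill _ (𝓜.frame_mem m)
  change 𝓜.val m (B.bracket q _ - N.det • D.1 _) = 0 at h1 h2
  rw [B.bracket_smul, hDs, smul_add, map_sub, map_add, map_add, 𝓜.val_smul, 𝓜.val_smul,
    𝓜.val_smul, 𝓜.val_smul, 𝓜.val_smul, 𝓜.val_smul] at h1
  rw [map_sub, 𝓜.val_smul] at h2
  have h3 : (𝓜.ev m (B.sym q a) - 𝓜.ev m (N.det * g * ξ a)) * 𝓜.val m (𝓜.frame m) = 0 := by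
    simp only [map_mul] at h1 ⊢
    linear_combination h1 - 𝓜.ev m a * h2
  exact sub_eq_zero.1 ((mul_eq_zero.1 h3).resolve_right (𝓜.val_frame m))

/-- The form determined by a nondegenerate Jacobi bracket. -/
theorem exists_form (hB : 𝓜.NondegJacobi B) : ∃ θ : Derivation K A A →ₗ[A] P,
    (∀ ξ m q, 𝓜.Rep B ξ m q → 𝓜.val m (θ ξ) = 𝓜.val m q) ∧ ∀ ξ m, ∃ q, 𝓜.Rep B ξ m q := by
  have hex : ∀ ξ m, ∃ q, 𝓜.Rep B ξ m q := fun ξ m => by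
    obtain ⟨ι, _, p, κ, d, hκ, hd, -, hx⟩ := 𝓜.exists_local_rep hB m
    obtain ⟨x, hx⟩ := hx ξ
    have h1 := (hx m hκ).smul 𝓜 (algebraMap K A (𝓜.ev m d)⁻¹)
    refine ⟨_, h1.1, fun a ha => (h1.2 a ha).trans ?_⟩
    rw [Derivation.smul_apply, Derivation.smul_apply, smul_eq_mul, smul_eq_mul, map_mul, map_mul,
      AlgHom.commutes]
    exact inv_mul_cancel_left₀ hd _
  have hgl : ∀ ξ, ∃ p, ∀ m q, 𝓜.Rep B ξ m q → 𝓜.val m p = 𝓜.val m q := fun ξ => by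
    refine 𝓜.glue (𝓜.Rep B ξ) (fun m q q' h h' => h.val_unique 𝓜 hB h') fun m₀ => ?_
    obtain ⟨ι, _, p, κ, d, hκ, hd, -, hx⟩ := 𝓜.exists_local_rep hB m₀
    obtain ⟨x, hx⟩ := hx ξ
    refine ⟨κ * d, κ • ∑ i, x i • p i, by rw [map_mul]; exact mul_ne_zero hκ hd, fun m hm => ?_⟩
    rw [map_mul] at hm
    obtain ⟨q, hq⟩ := hex ξ m
    refine ⟨q, hq, ?_⟩
    rw [map_mul, mul_assoc, 𝓜.val_smul]
    congr 1
    -- The smooth local combination represents `d • ξ`, and the value of a representing section is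
    -- unique; hence it differs from the value for `ξ` by the factor `d`.
    have h1 := (hx m (left_ne_zero_of_mul hm)).val_unique 𝓜 hB (hq.smul 𝓜 d)
    rw [map_smul, smul_eq_mul] at h1
    rw [← h1, map_sum, map_sum]
    refine Finset.sum_congr rfl fun i _ => ?_
    rw [𝓜.val_smul, map_smul, smul_eq_mul]
  choose θ hθ using hgl
  refine ⟨{ toFun := θ, map_add' := fun ξ ζ => ?_, map_smul' := fun a ξ => ?_ }, hθ, hex⟩
  · refine sub_eq_zero.1 (𝓜.sec_ext _ fun m => ?_)
    obtain ⟨q, hq⟩ := hex ξ m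
    obtain ⟨q', hq'⟩ := hex ζ m
    rw [map_sub, map_add, hθ _ m _ (hq.add 𝓜 hq'), hθ _ m _ hq, hθ _ m _ hq', map_add, sub_self]
  · refine sub_eq_zero.1 (𝓜.sec_ext _ fun m => ?_)
    obtain ⟨q, hq⟩ := hex ξ m
    rw [map_sub, RingHom.id_apply, 𝓜.val_smul, hθ _ m _ (hq.smul 𝓜 a), hθ _ m _ hq, map_smul,
      smul_eq_mul, sub_self]

theorem sym_bracket (𝓜 : ContactModel K A P M) (hB : B.IsJacobi) (p q : P) : B.sym (B.bracket p q) = ⁅B.sym p, B.sym q⁆ := by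
  have h1 : gcomm (B.br p) (B.br q) = B.br (B.bracket p q) := by
    refine Subtype.ext (LinearMap.ext fun r => ?_)
    rw [gcomm_apply]
    have h2 := hB p q r
    rw [B.bracket_skew r p, B.bracket_skew r] at h2
    have h3 : B.bracket q (-B.bracket p r) = -B.bracket q (B.bracket p r) :=
      map_neg (B.br q).1 _
    rw [h3] at h2
    change B.bracket p (B.bracket q r) - B.bracket q (B.bracket p r) = B.bracket (B.bracket p q) r
    rw [← sub_eq_zero, ← h2]
    abel
  refine 𝓜.symbol_unique 𝓜.val_frame (B.isSymbol_sym _) ?_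
  rw [← h1]
  exact (B.isSymbol_sym p).comm (B.isSymbol_sym q)

/-- A nondegenerate Jacobi bracket is induced by a contact structure. -/
theorem exists_contact (hB : 𝓜.NondegJacobi B) : ∃ θ : Derivation K A A →ₗ[A] P,
    𝓜.IsContact θ ∧ B.InducedBy (𝓜.T : Set _) θ ∧
    (∀ ξ m, (∀ a ∈ 𝓜.hol m, 𝓜.ev m (ξ a) = 0) → 𝓜.val m (θ ξ) = 0) ∧ (∀ p, θ (B.sym p) = p) ∧
    ∀ m₀, ∃ (ι : Type) (_ : Fintype ι) (p : ι → P) (f : A), 𝓜.ev m₀ f ≠ 0 ∧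
      (∀ m, 𝓜.ev m f ≠ 0 → ∀ i, p i ∈ 𝓜.good m) ∧
      ∀ ζ ∈ 𝓜.T, ∃ x : ι → A, f • ζ = ∑ i, x i • B.sym (p i) := by
  obtain ⟨θ, hθ, hex⟩ := 𝓜.exists_form hB
  have hsym : ∀ p, θ (B.sym p) = p := fun p => by
    refine sub_eq_zero.1 (𝓜.sec_ext _ fun m => ?_)
    obtain ⟨q, hq, h1, h2⟩ := hB.exists_good m p
    rw [map_sub, hθ _ m q ⟨hq, fun a _ => 𝓜.sym_eq h2 a⟩, h1, sub_self]
  have hspan : ∀ m₀, ∃ (ι : Type) (_ : Fintype ι) (p : ι → P) (f : A), 𝓜.ev m₀ f ≠ 0 ∧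
      (∀ m, 𝓜.ev m f ≠ 0 → ∀ i, p i ∈ 𝓜.good m) ∧
      ∀ ζ ∈ 𝓜.T, ∃ x : ι → A, f • ζ = ∑ i, x i • B.sym (p i) := fun m₀ => by
    obtain ⟨ι, _, p, κ, d, hκ, hd, hg, hx⟩ := 𝓜.exists_local_rep hB m₀
    refine ⟨ι, inferInstance, p, κ * d, by rw [map_mul]; exact mul_ne_zero hκ hd,
      fun m hm => hg m (left_ne_zero_of_mul (by rwa [map_mul] at hm)), fun ζ hζ => ?_⟩
    obtain ⟨x, hx⟩ := hx ζ
    refine ⟨fun i => κ * x i, ?_⟩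
    have h1 : ∀ m, 𝓜.ev m κ ≠ 0 → ∀ a, 𝓜.ev m ((d • ζ - ∑ i, x i • B.sym (p i)) a) = 0 :=
      fun m hm => by
        refine 𝓜.eq_zero_of_hol m _ (𝓜.T.sub_mem (𝓜.T.smul_mem _ hζ)
          (𝓜.T.sum_mem fun i _ => 𝓜.T.smul_mem _ (hB.sym_mem _))) fun a ha => ?_
        have h2 := (hx m hm).2 a ha
        have h3 : B.sym (∑ i, 𝓜.ev m (x i) • p i) = ∑ i, 𝓜.ev m (x i) • B.sym (p i) := by
          have := map_sum (𝓜.symL B) (fun i => 𝓜.ev m (x i) • p i) Finset.univ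
          simp only [map_smul] at this
          exact this
        rw [h3] at h2
        rw [Derivation.sub_apply, map_sub, ← h2, sub_eq_zero, ← Derivation.coeFnAddMonoidHom_apply,
          ← Derivation.coeFnAddMonoidHom_apply, map_sum, map_sum, Finset.sum_apply,
          Finset.sum_apply, map_sum, map_sum]
        refine Finset.sum_congr rfl fun i _ => ?_
        change 𝓜.ev m (𝓜.ev m (x i) • B.sym (p i) a) = 𝓜.ev m (x i * B.sym (p i) a)
        rw [map_smul, map_mul, smul_eq_mul]
    have h2 : κ • (d • ζ - ∑ i, x i • B.sym (p i)) = 0 := by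
      ext a
      refine 𝓜.fun_ext _ fun m => ?_
      rw [Derivation.smul_apply, smul_eq_mul, map_mul]
      by_cases hm : 𝓜.ev m κ = 0
      · rw [hm, zero_mul]
      · rw [h1 m hm, mul_zero]
    rw [smul_sub, sub_eq_zero, smul_smul, Finset.smul_sum] at h2
    rw [h2]
    exact Finset.sum_congr rfl fun i _ => smul_smul _ _ _
  -- By `hspan` the symbols generate `T` locally. For `ζ = B.sym q` the identity is `sym_bracket`,
  -- and both sides obey the same Leibniz rule in `ζ`.
  have key : ∀ p, ∀ ζ ∈ 𝓜.T, θ ⁅B.sym p, ζ⁆ = B.bracket p (θ ζ) := fun p ζ hζ => by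
    refine sub_eq_zero.1 (𝓜.sec_ext _ fun m => ?_)
    obtain ⟨ι, _, q, f, hf, -, hx⟩ := hspan m
    obtain ⟨x, hx⟩ := hx ζ hζ
    have h1 : θ ⁅B.sym p, f • ζ⁆ = B.bracket p (θ (f • ζ)) := by
      rw [hx, lie_sum, map_sum, map_sum]
      change _ = (B.br p).1 _
      rw [map_sum]
      refine Finset.sum_congr rfl fun i _ => ?_
      rw [lie_smul_der, map_add, map_smul, map_smul, map_smul, hsym, ← 𝓜.sym_bracket hB.jacobi,
        hsym]
      exact (B.bracket_smul _ _ _).symm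
    rw [lie_smul_der, map_add, map_smul, map_smul, map_smul, B.bracket_smul] at h1
    have h2 := congrArg (𝓜.val m) (add_left_cancel h1)
    rw [𝓜.val_smul, 𝓜.val_smul] at h2
    rw [map_sub, mul_left_cancel₀ hf h2, sub_self]
  have hcf : ∀ p, IsContactField (𝓜.T : Set _) θ (B.sym p) := fun p =>
    ⟨hB.sym_mem p, fun ζ hζ h0 => by rw [key p ζ hζ, h0]; exact map_zero (B.br p).1⟩
  refine ⟨θ, ⟨fun p => ⟨_, hB.sym_mem p, hsym p⟩, fun m ξ hξ h0 h a => ?_⟩, fun p q =>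
    ⟨_, _, hcf p, hcf q, hsym p, hsym q, by rw [key p _ (hB.sym_mem q), hsym]⟩, fun ξ m h0 => ?_,
    hsym, hspan⟩
  -- The test vector `B.sym (a • e) - a • B.sym e` lies in `ker θ`, and `θ` of its bracket with `ξ`
  -- is `-ξ(a) e`.
  · set e := 𝓜.frame m
    have h1 := h (B.sym (a • e) - a • B.sym e)
      (𝓜.T.sub_mem (hB.sym_mem _) (𝓜.T.smul_mem _ (hB.sym_mem _)))
      (by rw [map_sub, map_smul, hsym, hsym, sub_self])
    have h2 : ∀ p, θ ⁅ξ, B.sym p⁆ = 0 := fun p => by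
      rw [← lie_skew, map_neg, key p ξ hξ, h0]
      exact neg_eq_zero.2 (map_zero (B.br p).1)
    change 𝓜.val m _ = 0 at h1
    rw [lie_sub, lie_smul_der, map_sub, map_add, map_smul, map_smul, h2, h2, hsym, smul_zero,
      zero_sub, add_zero, map_neg, neg_eq_zero, 𝓜.val_smul] at h1
    exact (mul_eq_zero.1 h1).resolve_right (𝓜.val_frame m)
  · rw [hθ ξ m 0 ⟨Submodule.zero_mem _, fun a ha => ?_⟩, map_zero]
    rw [h0 a ha]
    have := map_zero (𝓜.symL B)
    change B.sym 0 = 0 at this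
    rw [this, Derivation.zero_apply, map_zero]

end ContactModel

end ContactAbstract

open Filter

/-! ### Contact structures on `ℓ` as nondegenerate Jacobi brackets. -/

section HatModel


open Bundle TopologicalSpace

variable {E : Type*} [NormedAddCommGroup E] [NormedSpace ℂ E]
  {X : Type*} [TopologicalSpace X] [ChartedSpace E X]
  {L : X → Type*} [∀ x, AddCommGroup (L x)] [∀ x, Module ℂ (L x)] [∀ x, TopologicalSpace (L x)]
  [TopologicalSpace (TotalSpace ℂ L)] [FiberBundle ℂ L] [VectorBundle ℂ ℂ L]
  [FiniteDimensional ℂ E] [T2Space X] [IsManifold 𝓘(ℂ, E) ω X]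
  [ContMDiffVectorBundle ω ℂ L 𝓘(ℂ, E)]

attribute [local instance] isManifold_real isManifold_slit


variable (E L) in
theorem triv_spec (v₀ : slitDual L) : ∃ (γ : HatSec E L →ₗ[HatFun E L] HatFun E L) (e : HatSec E L),
    (∀ s t, γ s • t = γ t • s) ∧ evH v₀ (γ e) = 1 ∧ (∀ s, tl v₀ s = 0 → evH v₀ (γ s) = 0) ∧
    tl v₀ e ≠ 0 := by
  obtain ⟨γ, h1, ⟨e, he⟩, G, -, -, hG⟩ := exists_triv (E := E) v₀
  refine ⟨γ, e, h1, he, fun s hs => by rw [hG, hs, mul_zero], fun h0 => ?_⟩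
  rw [hG, h0, mul_zero] at he
  exact zero_ne_one he

variable (E) in
/-- A local trivialization of the sections of `ℓ`, multiplied by a bump function. -/
def hatTriv (v : slitDual L) : HatSec E L →ₗ[HatFun E L] HatFun E L := (triv_spec E L v).choose

variable (E) in
/-- A local frame of `ℓ`. -/
def hatFrame (v : slitDual L) : HatSec E L := (triv_spec E L v).choose_spec.choose

theorem hatTriv_symm (v : slitDual L) (s t : HatSec E L) : hatTriv E v s • t = hatTriv E v t • s :=
  (triv_spec E L v).choose_spec.choose_spec.1 s t

theorem hatTriv_frame (v : slitDual L) : evH v (hatTriv E v (hatFrame E v)) = 1 :=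
  (triv_spec E L v).choose_spec.choose_spec.2.1

theorem hatTriv_eq_zero {v : slitDual L} {s : HatSec E L} (h : tl v s = 0) :
    evH v (hatTriv E v s) = 0 :=
  (triv_spec E L v).choose_spec.choose_spec.2.2.1 s h

theorem tl_hatFrame (v : slitDual L) : tl v (hatFrame E v) ≠ 0 :=
  (triv_spec E L v).choose_spec.choose_spec.2.2.2

/-- The derivation `s ↦ ξ (γ s) • e` for a local trivialization `γ` and a local frame `e`. -/
def trivGauge {K A P : Type*} [Field K] [CommRing A] [Algebra K A] [AddCommGroup P] [Module K P]
    [Module A P] [IsScalarTower K A P] (γ : P →ₗ[A] A) (hγ : ∀ s t, γ s • t = γ t • s) (e : P)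
    (ξ : Derivation K A A) : Gauge K A P :=
  ⟨{ toFun := fun s => ξ (γ s) • e
     map_add' := fun s t => by rw [map_add, map_add, add_smul]
     map_smul' := fun c s => by
      rw [← algebraMap_smul A c s, map_smul, algebraMap_smul, Derivation.map_smul,
        RingHom.id_apply, smul_assoc] }, γ e • ξ, fun a s => by
    change ξ (γ (a • s)) • e = (γ e * ξ a) • s + a • ξ (γ s) • e
    rw [map_smul, smul_eq_mul, Derivation.leibniz, add_smul, smul_assoc, smul_eq_mul, mul_smul,
      smul_comm _ (ξ a), hγ, mul_comm (γ e), mul_smul, add_comm]⟩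

/-- Each tangent vector at `v` is the value of a derivation of `ℓ`; expanding that derivation on the
symmetric identity for `p` and the frame shows that it kills `p` at `v`. -/
theorem hat_jet_eq_zero {v : slitDual L} {p : HatSec E L} (h0 : tl v p = 0)
    (h : ∀ ζ : Derivation ℝ (HatFun E L) (HatFun E L), evH v (ζ (hatTriv E v p)) = 0) :
    dTilde p v = 0 := by
  refine ContinuousLinearMap.ext fun V => ?_
  obtain ⟨Δ, hΔ⟩ := exists_gauge v V
  obtain ⟨ξ, hξ⟩ := Δ.2
  rw [← hΔ]
  have h1 := congrArg (fun s => tl v (Δ.1 s)) (hatTriv_symm v p (hatFrame E v))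
  have e1 := hξ (hatTriv E v p) (hatFrame E v)
  have e2 := hξ (hatTriv E v (hatFrame E v)) p
  simp only [e1, e2, map_add, tl_smul, h, hatTriv_eq_zero h0, h0, hatTriv_frame] at h1
  change tl v (Δ.1 p) = 0
  linarith

theorem hat_derivation_eq_zero {v : slitDual L} {p : HatSec E L} (h : dTilde p v = 0)
    (ζ : Derivation ℝ (HatFun E L) (HatFun E L)) : evH v (ζ (hatTriv E v p)) = 0 := by
  have h1 : tl v (ζ (hatTriv E v p) • hatFrame E v) = 0 :=
    hat_gauge_eq_zero (trivGauge (hatTriv E v) (hatTriv_symm v) (hatFrame E v) ζ) h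
  rw [tl_smul] at h1
  exact (mul_eq_zero.1 h1).resolve_right (tl_hatFrame v)

/-- Expand in a jet frame the derivation `s ↦ ξ (γ s) e`, with `γ` the local trivialization and `e`
the frame of `ℓ`. Its coefficients are values of `ξ`, so they vanish at `v`. -/
theorem hat_factor (v : slitDual L) (ξ : Derivation ℝ (HatFun E L) (HatFun E L))
    (h : ∀ a, evH v (ξ a) = 0) : ∃ (ι : Type) (_ : Fintype ι) (χ : HatFun E L)
    (a : ι → HatFun E L) (η : ι → Derivation ℝ (HatFun E L) (HatFun E L)), evH v χ ≠ 0 ∧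
      (∀ i, evH v (a i) = 0) ∧ χ • ξ = ∑ i, a i • η i := by
  obtain ⟨F⟩ := nonempty_jetFrame (E := E) v
  set γ := hatTriv E v
  set e := hatFrame E v
  have hγ : ∀ b : HatFun E L, γ (b • e) = b * γ e := fun b => γ.map_smul b e
  -- The symbols of the first order operators `F.c i`, obtained from their commutators with
  -- functions and tested on `e`.
  let η : F.ι → Derivation ℝ (HatFun E L) (HatFun E L) := fun i => Derivation.mk'
    { toFun := fun b => (F.c i (b • e) - b * F.c i e) * γ e
      map_add' := fun b b' => by rw [add_smul, map_add]; ring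
      map_smul' := fun r b => by
        rw [smul_assoc, map_smul, RingHom.id_apply, smul_mul_assoc, ← smul_sub, smul_mul_assoc] }
    fun b b' => by
      change (F.c i ((b * b') • e) - b * b' * F.c i e) * γ e =
        b * ((F.c i (b' • e) - b' * F.c i e) * γ e) + b' * ((F.c i (b • e) - b * F.c i e) * γ e)
      rw [mul_smul, F.order]
      ring
  refine ⟨F.ι, inferInstance, F.κ * (γ e * γ e), fun i => ξ (γ (re (F.sec i))), η, ?_,
    fun i => h _, ?_⟩
  · rw [map_mul, map_mul, hatTriv_frame, F.κ_self]
    norm_num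
  · ext b
    let Δ := trivGauge γ (hatTriv_symm v) e ξ
    have h1 := congrArg γ (F.gauge_apply Δ (b • e))
    have h2 := congrArg γ (F.gauge_apply Δ e)
    change γ (F.κ • ξ (γ (b • e)) • e) = γ (∑ i, F.c i (b • e) • ξ (γ (re (F.sec i))) • e) at h1
    change γ (F.κ • ξ (γ e) • e) = γ (∑ i, F.c i e • ξ (γ (re (F.sec i))) • e) at h2
    simp only [map_sum, smul_smul, hγ, Derivation.leibniz, smul_eq_mul] at h1 h2
    have h3 : (∑ i, ξ (γ (re (F.sec i))) • η i) b =
        ∑ i, ξ (γ (re (F.sec i))) * ((F.c i (b • e) - b * F.c i e) * γ e) := by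
      rw [← Derivation.coeFnAddMonoidHom_apply, map_sum, Finset.sum_apply]
      rfl
    rw [h3, Derivation.smul_apply, smul_eq_mul]
    have h4 : F.κ * (γ e * γ e) * ξ b =
        F.κ * (b * ξ (γ e) + γ e * ξ b) * γ e - b * (F.κ * ξ (γ e) * γ e) := by ring
    rw [h4, h1, h2, Finset.mul_sum, ← Finset.sum_sub_distrib]
    exact Finset.sum_congr rfl fun i _ => by ring

variable (E L) in
/-- The line bundle `ℓ` as a contact model. -/
def hatModel : ContactModel ℝ (HatFun E L) (HatSec E L) (slitDual L) where
  ev := evH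
  val := tl
  val_smul _ _ _ := tl_smul _ _ _
  triv := hatTriv E
  triv_symm := hatTriv_symm
  frame := hatFrame E
  triv_frame := hatTriv_frame
  fun_ext a h := evH_ext fun v => (h v).trans (map_zero (evH v)).symm
  sec_ext p h := tl_ext fun v => (h v).trans (map_zero (tl v)).symm
  T := ⊤
  lie_mem _ _ _ _ := trivial
  good _ := ⊤
  hol _ := Set.univ
  triv_mem _ _ _ := trivial
  smul_mem _ _ _ _ _ := trivial
  frame_mem _ := trivial
  val_frame := tl_hatFrame
  glue Q hQ h := by
    classical
    obtain ⟨p, hp⟩ := exists_sec_of_locally (E := E)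
      (F := fun v => if h : ∃ q, Q v q then tl v h.choose else 0) fun v₀ => by
        obtain ⟨κ, t, h1, h2⟩ := h v₀
        refine ⟨κ, t, h1, fun v hv => ?_⟩
        obtain ⟨q, hq, hqt⟩ := h2 v hv
        have hex : ∃ q, Q v q := ⟨q, hq⟩
        rw [dif_pos hex, hqt, hQ v _ q hex.choose_spec hq]
    refine ⟨p, fun v q hq => ?_⟩
    have hex : ∃ q, Q v q := ⟨q, hq⟩
    rw [hp, dif_pos hex, hQ v _ q hex.choose_spec hq]
  eq_zero_of_hol _ _ _ h a := h a trivial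
  exists_frame v₀ := by
    obtain ⟨F⟩ := nonempty_jetFrame (E := E) v₀
    refine ⟨F.ι, inferInstance, fun i => re (F.sec i), F.κ * hatTriv E v₀ (hatFrame E v₀), ?_,
      fun v hv => ⟨fun _ => trivial, ?_, fun Δ h s _ => ?_⟩, fun x h0 h => ?_⟩
    · rw [map_mul, F.κ_self, hatTriv_frame, one_mul]
      exact one_ne_zero
    · rw [map_mul] at hv
      exact right_ne_zero_of_mul hv
    · rw [map_mul] at hv
      have h1 := congrArg (tl v) (F.gauge_apply Δ s)
      rw [tl_smul, map_sum, Finset.sum_eq_zero fun i _ => by rw [tl_smul, h i, mul_zero]] at h1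
      exact (mul_eq_zero.1 h1).resolve_left (left_ne_zero_of_mul hv)
    · have h1 := hat_jet_eq_zero h0 fun ζ => h ζ trivial
      funext i
      obtain ⟨w, hw, hw'⟩ := F.indep i
      have h2 : dT E v₀ (∑ j, x j • re (F.sec j)) w = x i := by
        rw [map_sum, sum_apply, Finset.sum_eq_single i]
        · rw [map_smul]
          exact (congrArg (x i * ·) hw).trans (mul_one _)
        · intro j _ hj
          rw [map_smul]
          exact (congrArg (x j * ·) (hw' j hj)).trans (mul_zero _)
        · exact fun h => (h (Finset.mem_univ i)).elim
      rw [← h2]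
      exact congrArg (fun T : TildeT E →L[ℝ] ℝ => T w) h1
  factor v ξ _ h := hat_factor v ξ h

theorem val_eq_zero_iff (v : slitDual L) (s : HatSec E L) : s.1 (toHat v) = 0 ↔ tl v s = 0 := by
  constructor
  · intro h
    change s.1 (toHat v) _ = 0
    rw [h]
    rfl
  · intro h
    refine LinearMap.ext fun u => ?_
    obtain ⟨c, hc⟩ := Submodule.mem_span_singleton.1 u.2
    have : u = c • ⟨v.1.2, Submodule.mem_span_singleton_self (R := ℝ) v.1.2⟩ := Subtype.ext hc.symm
    rw [this, map_smul]
    change c • tl v s = 0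
    rw [h, smul_zero]

/-- The model uses the points of `L* ∖ 0` instead of those of `ℝℙ(L*)`; vanishing at a point is the
same condition because the projection is surjective. -/
theorem fromContact_iff {B : BiDer ℝ (HatFun E L) (HatSec E L)} : FromContact B ↔
    ∃ θ, (hatModel E L).IsContact θ ∧ B.InducedBy ((hatModel E L).T : Set _) θ := by
  have h1 : ((hatModel E L).T : Set (Derivation ℝ (HatFun E L) (HatFun E L))) = Set.univ := rfl
  have key : ∀ θ : Derivation ℝ (HatFun E L) (HatFun E L) →ₗ[HatFun E L] HatSec E L,
      IsContactForm (fun (p : Hat L) (f : HatFun E L) => f.1 p = 0)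
        (fun (p : Hat L) (s : HatSec E L) => s.1 p = 0) Set.univ θ ↔
      (hatModel E L).IsContact θ := fun θ => by
    rw [ContactModel.IsContact, h1]
    constructor
    · exact fun h => ⟨h.surj, fun v ξ hξ h0 hn a => h.nondeg (toHat v) ξ hξ h0
        (fun ζ hζ hζ0 => (val_eq_zero_iff v _).2 (hn ζ hζ hζ0)) a⟩
    · refine fun h => ⟨h.surj, fun p ξ hξ h0 hn a => ?_⟩
      obtain ⟨v, rfl⟩ : ∃ v, toHat v = p := ⟨_, toHat_hatRep p⟩
      exact h.nondeg v ξ hξ h0 (fun ζ hζ hζ0 => (val_eq_zero_iff v _).1 (hn ζ hζ hζ0)) a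
  rw [h1]
  exact exists_congr fun θ => and_congr_left fun _ => key θ

/-- A bi-derivation of `ℓ` comes from a contact structure if and only if it is a nondegenerate
Jacobi bracket. -/
theorem fromContact_iff_nondeg {B : BiDer ℝ (HatFun E L) (HatSec E L)} : FromContact B ↔
    B.IsJacobi ∧ ∀ v p, (∀ q, tl v (B.bracket p q) = 0) → dTilde p v = 0 := by
  rw [fromContact_iff]
  constructor
  · rintro ⟨θ, hθ, hB⟩
    obtain ⟨h1, h2⟩ := ContactModel.IsContact.jacobi_nondeg _ hθ hB
    exact ⟨h1, fun v p h => hat_jet_eq_zero (h2 v p h).1 fun ζ => (h2 v p h).2 ζ trivial⟩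
  · rintro ⟨h1, h2⟩
    obtain ⟨θ, hθ, hB, -⟩ := (hatModel E L).exists_contact (B := B)
      ⟨h1, fun _ => trivial, fun v q _ h => by
        have h3 := h2 v q fun s => h s trivial
        exact ⟨tl_eq_zero_of_dTilde h3, fun ζ _ => hat_derivation_eq_zero h3 ζ⟩,
        fun _ p => ⟨p, trivial, rfl, fun _ => rfl⟩⟩
    exact ⟨θ, hθ, hB⟩

end HatModel

open Filter

/-! ### The bundle `L` with vector fields of type `(1,0)` as a contact model. -/

section ComplexModel


open Bundle TopologicalSpace

variable {E : Type*} [NormedAddCommGroup E] [NormedSpace ℂ E]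
  {X : Type*} [TopologicalSpace X] [ChartedSpace E X]
  {L : X → Type*} [∀ x, AddCommGroup (L x)] [∀ x, Module ℂ (L x)] [∀ x, TopologicalSpace (L x)]
  [TopologicalSpace (TotalSpace ℂ L)] [FiberBundle ℂ L] [VectorBundle ℂ ℂ L]
  [FiniteDimensional ℂ E] [T2Space X] [IsManifold 𝓘(ℂ, E) ω X]
  [ContMDiffVectorBundle ω ℂ L 𝓘(ℂ, E)]

attribute [local instance] isManifold_real isManifold_slit


theorem exists_csec_of_locally {F : ∀ x, L x}
    (h : ∀ x₀, ∃ (κ : CFun E X) (t : CSec E L), evC x₀ κ ≠ 0 ∧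
      ∀ y, evC y κ ≠ 0 → evC y κ • F y = evL y t) : ∃ s : CSec E L, ∀ y, evL y s = F y := by
  refine ⟨⟨F, isSmoothSec_of_localRep fun x => ?_⟩, fun y => rfl⟩
  obtain ⟨κ, t, h0, h1⟩ := h x
  have h2 : ContMDiffAt 𝓘(ℝ, E) 𝓘(ℝ, ℂ) ∞ (fun y => (evC y κ)⁻¹) x :=
    ContDiffAt.comp_contMDiffAt (g := fun z : ℂ => z⁻¹) (f := fun y => evC y κ)
      (contDiffAt_inv ℝ h0) (smooth_fun κ x)
  refine (contMDiffAt_mul_complex E h2 (smooth_loc t (mem_goodSet x))).congr_of_eventuallyEq ?_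
  filter_upwards [(smooth_fun κ).continuous.continuousAt.eventually_ne h0,
    mem_nhds_base (mem_goodSet (L := L) (E := E) x)] with y hy hb
  refine smul_frame_inj hb.2 ((eq_localRep_smul hb.2 F).symm.trans ?_)
  rw [mul_smul, ← evL_eq hb.2, ← h1 y hy, smul_smul, inv_mul_cancel₀ hy, one_smul]

theorem exists_bumpC {x : X} {W : Set X} (hW : W ∈ nhds x) : ∃ κ : CFun E X,
    (∀ᶠ y in nhds x, evC y κ = 1) ∧ ∀ y, evC y κ ≠ 0 → y ∈ W := by
  obtain ⟨χ, h1, h2, h3⟩ := exists_bump (E := E) hW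
  refine ⟨⟨fun y => (χ y : ℂ), fun y => Complex.ofRealCLM.contDiff.contDiffAt.comp_contMDiffAt
    (h1 y)⟩, ?_, fun y hy => h3 (subset_tsupport _ fun h0 => hy ?_)⟩
  · filter_upwards [h2] with y hy
    change (χ y : ℂ) = 1
    rw [hy, Complex.ofReal_one]
  · change (χ y : ℂ) = 0
    rw [h0, Complex.ofReal_zero]

theorem dfun_add (f g : CFun E X) (x : X) (u : E) : dfun (f + g) x u = dfun f x u + dfun g x u := by
  rw [dfun_eq_chartD_self, dfun_eq_chartD_self, dfun_eq_chartD_self]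
  have h := chartD_add (mem_extChartAt_source (I := 𝓘(ℝ, E)) x) (smooth_fun f x) (smooth_fun g x)
  exact congrArg (fun T : E →L[ℝ] ℂ => T u) h

theorem dfun_smul (c : ℂ) (f : CFun E X) (x : X) (u : E) : dfun (c • f) x u = c * dfun f x u := by
  rw [dfun_eq_chartD_self, dfun_eq_chartD_self]
  exact chartD_const_mul c (mem_extChartAt_source (I := 𝓘(ℝ, E)) x) (smooth_fun f x) u

theorem dfun_sub (f g : CFun E X) (x : X) (u : E) : dfun (f - g) x u = dfun f x u - dfun g x u := by
  have h : f - g = f + (-1 : ℂ) • g := by rw [neg_one_smul, sub_eq_add_neg]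
  rw [h, dfun_add, dfun_smul]
  ring

theorem dfun_sum {ι : Type*} [Fintype ι] (f : ι → CFun E X) (x : X) (u : E) :
    dfun (∑ i, f i) x u = ∑ i, dfun (f i) x u := by
  have h := map_sum ({ toFun := fun f => dfun f x u
                       map_add' := fun f g => dfun_add f g x u
                       map_smul' := fun c f => dfun_smul c f x u } : CFun E X →ₗ[ℂ] ℂ) f Finset.univ
  exact h

theorem cvec_congr (ξ : CVec E X) {f g : CFun E X} {x : X} (h : dfun f x = dfun g x) :
    evC x (ξ f) = evC x (ξ g) := by
  have h1 := cvec_apply_eq_zero ξ (f := f - g) (x := x)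
    (ContinuousLinearMap.ext fun u => by rw [dfun_sub, h, sub_self]; rfl)
  rwa [map_sub, map_sub, sub_eq_zero] at h1

theorem dfun_congr {f g : CFun E X} {x : X} (h : ∀ᶠ y in nhds x, evC y f = evC y g) :
    dfun f x = dfun g x := Filter.EventuallyEq.mfderiv_eq h

theorem cvec_eq_zero_of_const (ξ : CVec E X) {f : CFun E X} {x : X} {c : ℂ}
    (h : ∀ᶠ y in nhds x, evC y f = c) : evC x (ξ f) = 0 := by
  rw [cvec_congr ξ (g := algebraMap ℂ _ c) (dfun_congr (by simpa using h)),
    Derivation.map_algebraMap, map_zero]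

variable (E X) in
/-- The module of vector fields of type `(1,0)`. -/
def t10 : Submodule (CFun E X) (CVec E X) where
  carrier := T10 E X
  zero_mem' _ _ _ := rfl
  add_mem' {ξ ζ} h h' f x hf := by
    have h1 : evC x (ξ f) = 0 := h f x hf
    have h2 : evC x (ζ f) = 0 := h' f x hf
    change evC x (ξ f + ζ f) = 0
    rw [map_add, h1, h2, add_zero]
  smul_mem' a ξ h f x hf := by
    have h1 : evC x (ξ f) = 0 := h f x hf
    change evC x (a * ξ f) = 0
    rw [map_mul, h1, mul_zero]

theorem t10_apply {ξ : CVec E X} (h : ξ ∈ t10 E X) {f : CFun E X} {x : X}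
    (hf : ∀ v, dfun f x (Complex.I • v) = -(Complex.I * dfun f x v)) : evC x (ξ f) = 0 := h f x hf

include L in
-- A commutator sees only the differential at `x`, so a function with antilinear differential there
-- may be replaced by an antiholomorphic one. Both vector fields annihilate it near `x`.
theorem t10_lie_mem {ξ ζ : CVec E X} (hξ : ξ ∈ t10 E X) (hζ : ζ ∈ t10 E X) :
    ⁅ξ, ζ⁆ ∈ t10 E X := by
  intro f x hf
  change evC x (⁅ξ, ζ⁆ f) = 0
  rw [cvec_congr ⁅ξ, ζ⁆ (g := affFun L x 0 (dfun f x)) (dfun_affFun_self x 0 _).symm,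
    Derivation.commutator_apply, map_sub]
  have h := antiHolNear_affFun (L := L) (mem_core E L x) 0 hf
  rw [cvec_eq_zero_of_const (c := 0) ξ, cvec_eq_zero_of_const (c := 0) ζ, sub_zero]
  · filter_upwards [h] with y hy using t10_apply hξ hy
  · filter_upwards [h] with y hy using t10_apply hζ hy

/-- The bracket of `χ ∂̄_u` with a vector field of type `(1,0)` has type `(1,0)` where `χ = 1`. -/
theorem pd01_lie_apply {ζ : CVec E X} (hζ : ζ ∈ t10 E X) {x y : X} (hy : y ∈ core E L x) (u : E)
    {f : CFun E X} (hf : ∀ v, dfun f y (Complex.I • v) = -(Complex.I * dfun f y v)) :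
    evC y (⁅pd01 L x u, ζ⁆ f) = 0 := by
  set β := chartD 𝓘(ℝ, E) x (fun z => evC z f) y
  have hc : y ∈ (chartAt E x).source := (core_good hy).1
  have hβ : ∀ v, β (Complex.I • v) = -(Complex.I * β v) := fun v =>
    (chartD_I_smul_of hc f (c := -Complex.I) (fun v => by rw [hf]; ring) v).trans (by ring)
  rw [cvec_congr _ (g := affFun L x 0 β) (ContinuousLinearMap.ext fun v => by
      rw [dfun_affFun hy, dfun_apply_eq f hc]), Derivation.commutator_apply, map_sub]
  -- On the affine antiholomorphic replacement, `ζ` gives zero near `y` and `∂̄_u` gives a constant,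
  -- since the chart derivative of an affine function does not vary; both are killed by the other
  -- field.
  rw [cvec_eq_zero_of_const (c := 0) (pd01 L x u),
    cvec_eq_zero_of_const (c := (1 / 2 : ℂ) * (β u + Complex.I * β (Complex.I • u))) ζ, sub_zero]
  · filter_upwards [(isOpen_core E L x).mem_nhds hy] with z hz
    rw [evC_pd01, chartD_affFun hz, core_cut hz, Complex.ofReal_one, one_mul]
  · filter_upwards [antiHolNear_affFun (L := L) hy 0 hβ] with z hz using t10_apply hζ hz

variable (L) in
include L in
-- Subtracting from `a` a holomorphic affine function with the same complex linear part leaves an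
-- antilinear differential, on which `ξ` vanishes.
theorem t10_eq_zero {ξ : CVec E X} (hξ : ξ ∈ t10 E X) {x : X}
    (h : ∀ a : CFun E X, (∀ v, dfun a x (Complex.I • v) = Complex.I * dfun a x v) →
      evC x (ξ a) = 0) (a : CFun E X) : evC x (ξ a) = 0 := by
  set b := affFun L x 0 ((linPart (dfun a x)).restrictScalars ℝ)
  have hb : ∀ v, dfun b x v = linPart (dfun a x) v := fun v => by rw [dfun_affFun_self]; rfl
  have h1 := h b fun v => by rw [hb, hb, map_smul, smul_eq_mul]
  have h2 := t10_apply hξ (f := a - b) (x := x) fun v => by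
    rw [dfun_sub, dfun_sub, hb, hb, sub_linPart_I]
  rwa [map_sub, map_sub, h1, sub_zero] at h2

variable (L) in
-- This is `ξ = ∑ ξ(z_i) ∂_i` in the holomorphic coordinates `z_i`: the antilinear part of `da` does
-- not contribute.
theorem t10_expand {ξ : CVec E X} (hξ : ξ ∈ t10 E X) {x y : X} (hy : y ∈ core E L x)
    {ι : Type*} [Fintype ι] (b : Module.Basis ι ℂ E) (a : CFun E X) : evC y (ξ a) =
      ∑ i, evC y (ξ (affFun L x 0 ((b.coord i).toContinuousLinearMap.restrictScalars ℝ))) *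
        evC y (pd10 L x (b i) a) := by
  set z := fun i => affFun L x 0 ((b.coord i).toContinuousLinearMap.restrictScalars ℝ)
  set D := chartD 𝓘(ℝ, E) x (fun z => evC z a) y
  have hc : y ∈ (chartAt E x).source := (core_good hy).1
  have hd : ∀ i, evC y (pd10 L x (b i) a) = linPart D (b i) := fun i => by
    rw [evC_pd10, core_cut hy, Complex.ofReal_one, one_mul]
    rfl
  have hz : ∀ u, dfun (∑ i, linPart D (b i) • z i) y u = linPart D (chartT E x y u) := fun u => by
    rw [dfun_sum]
    conv_rhs => rw [← b.sum_repr (chartT E x y u), map_sum]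
    refine Finset.sum_congr rfl fun i _ => ?_
    rw [dfun_smul, dfun_affFun hy, map_smul, smul_eq_mul, mul_comm]
    rfl
  have h1 := t10_apply hξ (f := a - ∑ i, linPart D (b i) • z i) (x := y) fun v => by
    rw [dfun_sub, dfun_sub, hz, hz, dfun_apply_eq a hc, dfun_apply_eq a hc, chartT_I_smul hc,
      sub_linPart_I]
  rw [map_sub, map_sub, sub_eq_zero, map_sum, map_sum] at h1
  rw [h1]
  refine Finset.sum_congr rfl fun i _ => ?_
  rw [Derivation.map_smul, map_smul, hd, smul_eq_mul, mul_comm]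

/-- A derivation of `L` vanishes at a point on the sections whose `1`-jet vanishes there. -/
theorem gauge_apply_eq_zero_of_secD (Δ : Gauge ℂ (CFun E X) (CSec E L)) {s : CSec E L} {x y : X}
    (hy : y ∈ core E L x) (h0 : loc s x y = 0) (h1 : secD E s x y = 0) : evL y (Δ.1 s) = 0 := by
  obtain ⟨S, hS⟩ := Δ.2
  have hg := core_good hy
  set e : CSec E L := holSec x (1, 0)
  have e1 := hS (locFun L x s) e
  have e2 := hS (locFun L x e) s
  have h2 := congrArg (fun r => evL y (Δ.1 r)) (locFun_smul x s e)
  have h3 : evC y (locFun L x e) = 1 := by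
    rw [evC_locFun, core_cut hy, loc_holSec hy]
    simp
  have h4 : evC y (locFun L x s) = 0 := by rw [evC_locFun, h0, mul_zero]
  have h5 : evC y (S (locFun L x s)) = 0 := by
    refine cvec_apply_eq_zero S ((dfun_eq_chartD _ hg.1).trans ?_)
    have : chartD 𝓘(ℝ, E) x (locFun L x s).1 y = 0 := by
      rw [← h1]
      refine chartD_congr (mem_source_of_goodSet hg) ?_
      filter_upwards [(isOpen_core E L x).mem_nhds hy] with z hz
      change evC z (locFun L x s) = loc s x z
      rw [evC_locFun, core_cut hz, Complex.ofReal_one, one_mul]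
    rw [this]
    rfl
  have h6 : evL y s = 0 := (loc_eq_zero_iff hg.2 s).1 h0
  simp only [e1, e2, map_add, evL_smul, h3, h4, h5, h6, zero_smul, one_smul, smul_zero,
    zero_add] at h2
  exact h2.symm

/-- At every point of the core, not only at `x`, affine holomorphic sections realize all jets of
type `(1,0)`. This makes a basis of them a frame for `exists_frame`. -/
theorem exists_holSec_jet {x y : X} (hy : y ∈ core E L x) {s : CSec E L} (hs : HolAt y s) :
    ∃ p : ℂ × (E →L[ℂ] ℂ), loc (s - holSec x p) x y = 0 ∧ secD E (s - holSec x p) x y = 0 := by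
  have hg := core_good hy
  set D := secD E s x y
  have hD : ∀ u, D (Complex.I • u) = Complex.I * D u := fun u => by
    obtain ⟨w, rfl⟩ := chartT_surjective hg.1 u
    have h1 := (dbar_eq s hg w).symm.trans (hs w)
    have h2 := (smul_eq_zero.1 h1).resolve_right (frame_ne_zero hg.2)
    linear_combination (-2 * Complex.I) * h2 +
      (D (Complex.I • chartT E x y w)) * Complex.I_mul_I
  refine ⟨(loc s x y - linPart D (centered E x y), linPart D), ?_, ?_⟩
  · rw [loc_sub hg.2, loc_holSec hy]
    ring
  · refine ContinuousLinearMap.ext fun u => ?_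
    rw [secD_sub hg, secD_holSec hy]
    change D u - linPart D u = 0
    rw [linPart_of_linear hD, sub_self]

/-- The value of a section at `x` in the preferred trivialization at `x`. -/
def locVal (x : X) : CSec E L →ₗ[ℂ] ℂ where
  toFun s := loc s x x
  map_add' s t := loc_add (mem_baseSet_trivializationAt ℂ L x) s t
  map_smul' c s := loc_smul (mem_baseSet_trivializationAt ℂ L x) c s

theorem locVal_eq_zero_iff (x : X) (s : CSec E L) : locVal x s = 0 ↔ evL x s = 0 :=
  loc_eq_zero_iff (mem_baseSet_trivializationAt ℂ L x) s

variable (E L) in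
/-- The space of sections which are holomorphic to first order at `x`. -/
def holSub (x : X) : Submodule ℂ (CSec E L) where
  carrier := {s | HolAt x s}
  zero_mem' := by
    rw [Set.mem_ofPred_eq, ← sub_self (0 : CSec E L), ← map_zero (holSec (E := E) (L := L) x)]
    exact (holAt_holSec (mem_core E L x) _).sub (holAt_holSec (mem_core E L x) _)
  add_mem' {s t} hs ht := by
    have h : s + t = s - (-1 : ℂ) • t := by rw [neg_one_smul, sub_neg_eq_add]
    rw [Set.mem_ofPred_eq, h]
    exact hs.sub (ht.smul _)
  smul_mem' c s hs := hs.smul c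

variable (E L) in
/-- The line bundle `L` with the vector fields of type `(1,0)` as a contact model. -/
def complexModel : ContactModel ℂ (CFun E X) (CSec E L) X where
  ev := evC
  val := locVal
  val_smul x a p := loc_fsmul (mem_baseSet_trivializationAt ℂ L x) a p
  triv := locFun L
  triv_symm := locFun_smul
  frame x := holSec x (1, 0)
  triv_frame x := by
    rw [evC_locFun, cut_self, loc_holSec_self, Complex.ofReal_one, one_mul]
  fun_ext a h := CFun.ext fun x => (h x).trans (map_zero (evC x)).symm
  sec_ext p h := evL_ext fun x => ((locVal_eq_zero_iff x p).1 (h x)).trans (map_zero (evL x)).symm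
  T := t10 E X
  lie_mem _ h _ h' := t10_lie_mem (L := L) h h'
  good := holSub E L
  hol x := {a | ∀ v, dfun a x (Complex.I • v) = Complex.I * dfun a x v}
  triv_mem x s hs := by
    have h := (holAt_iff x s).1 hs
    intro v
    rw [dfun_locFun, h]
  smul_mem x a ha s hs := by
    have h := (holAt_iff x s).1 hs
    refine (holAt_iff x _).2 fun v => ?_
    rw [dloc_fsmul, dloc_fsmul, h, ha v]
    ring
  frame_mem x := holAt_holSec (mem_core E L x) _
  val_frame x := by
    change loc _ x x ≠ 0
    rw [loc_holSec_self]
    exact one_ne_zero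
  glue Q hQ h := by
    classical
    have hQ' : ∀ x q q', Q x q → Q x q' → evL x q = evL x q' := fun x q q' h h' => by
      rw [← sub_eq_zero, ← map_sub, ← locVal_eq_zero_iff, map_sub, hQ x q q' h h', sub_self]
    obtain ⟨p, hp⟩ := exists_csec_of_locally (E := E)
      (F := fun x => if h : ∃ q, Q x q then evL x h.choose else 0) fun x₀ => by
        obtain ⟨κ, t, h1, h2⟩ := h x₀
        refine ⟨κ, t, h1, fun x hx => ?_⟩
        obtain ⟨q, hq, hqt⟩ := h2 x hx
        have hex : ∃ q, Q x q := ⟨q, hq⟩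
        have hb := mem_baseSet_trivializationAt ℂ L x
        rw [dif_pos hex, hQ' x _ q hex.choose_spec hq, evL_eq hb, evL_eq hb t, smul_smul]
        congr 1
        exact hqt.symm
    refine ⟨p, fun x q hq => ?_⟩
    have hex : ∃ q, Q x q := ⟨q, hq⟩
    have h1 := hp x
    rw [dif_pos hex, hQ' x _ q hex.choose_spec hq] at h1
    rw [← sub_eq_zero, ← map_sub, locVal_eq_zero_iff, map_sub, h1, sub_self]
  eq_zero_of_hol x ξ hξ h := t10_eq_zero L hξ h
  exists_frame x₀ := by
    obtain ⟨κ, hκ, hκc⟩ := exists_bumpC (E := E) ((isOpen_core E L x₀).mem_nhds (mem_core E L x₀))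
    let b := Module.finBasis ℂ (ℂ × (E →L[ℂ] ℂ))
    refine ⟨Fin (Module.finrank ℂ (ℂ × (E →L[ℂ] ℂ))), inferInstance, fun i => holSec x₀ (b i), κ, ?_,
      fun y hy => ⟨fun i => holAt_holSec (hκc y hy) _, ?_, fun Δ h s hs => ?_⟩, fun x h0 h => ?_⟩
    · rw [hκ.self_of_nhds]
      exact one_ne_zero
    · rw [evC_locFun, core_cut (hκc y hy), loc_holSec (hκc y hy)]
      simp
    · obtain ⟨p, h1, h2⟩ := exists_holSec_jet (hκc y hy) hs
      have h3 := gauge_apply_eq_zero_of_secD Δ (hκc y hy) h1 h2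
      rw [← locVal_eq_zero_iff, map_sub, map_sub, sub_eq_zero] at h3
      rw [h3, ← b.sum_repr p, map_sum, map_sum, map_sum]
      refine Finset.sum_eq_zero fun i _ => ?_
      rw [map_smul, map_smul, map_smul, h i, smul_zero]
    · have h1 : ∑ i, x i • holSec (L := L) x₀ (b i) = holSec x₀ (∑ i, x i • b i) := by
        rw [map_sum]
        exact Finset.sum_congr rfl fun i _ => (map_smul _ _ _).symm
      rw [h1] at h0 h
      have h2 : (∑ i, x i • b i).1 = 0 := by
        rw [← loc_holSec_self (L := L) x₀]
        exact h0
      have h3 : (∑ i, x i • b i).2 = 0 := by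
        refine ContinuousLinearMap.ext fun u => ?_
        have h4 := h _ (pd10_mem (L := L) x₀ u)
        have h5 : ∀ v, chartD 𝓘(ℝ, E) x₀
            (fun z => evC z (locFun L x₀ (holSec x₀ (∑ i, x i • b i)))) x₀ v =
              (∑ i, x i • b i).2 v := fun v => by
          have h6 := dfun_locFun (holSec (L := L) x₀ (∑ i, x i • b i)) x₀
          rw [dfun_eq_chartD_self, dloc_holSec_self] at h6
          exact congrArg (fun T : E →L[ℝ] ℂ => T v) h6
        rw [evC_pd10, cut_self, h5, h5, map_smul, smul_eq_mul, ← mul_assoc Complex.I,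
          Complex.I_mul_I] at h4
        change _ = (0 : ℂ)
        rw [← h4]
        push_cast
        ring
      exact funext (Fintype.linearIndependent_iff.1 b.linearIndependent x (Prod.ext h2 h3))
  factor x ξ hξ h := by
    obtain ⟨κ, hκ, hκc⟩ := exists_bumpC (E := E) ((isOpen_core E L x).mem_nhds (mem_core E L x))
    let b := Module.finBasis ℂ E
    refine ⟨Fin (Module.finrank ℂ E), inferInstance, κ, fun i => κ * ξ (affFun L x 0
      ((b.coord i).toContinuousLinearMap.restrictScalars ℝ)), fun i => pd10 L x (b i), ?_,
      fun i => by rw [map_mul, h, mul_zero], ?_⟩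
    · rw [hκ.self_of_nhds]
      exact one_ne_zero
    · refine Derivation.ext fun a => CFun.ext fun y => ?_
      rw [← Derivation.coeFnAddMonoidHom_apply (∑ i, _), map_sum, Finset.sum_apply, map_sum]
      change evC y (κ * ξ a) = ∑ i, evC y (κ * ξ _ * pd10 L x (b i) a)
      rw [map_mul]
      by_cases hy : evC y κ = 0
      · rw [hy, zero_mul]
        exact (Finset.sum_eq_zero fun i _ => by rw [map_mul, map_mul, hy, zero_mul, zero_mul]).symm
      · rw [t10_expand L hξ (hκc y hy) b, Finset.mul_sum]
        refine Finset.sum_congr rfl fun i _ => ?_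
        rw [map_mul, map_mul, mul_assoc]

end ComplexModel

section

variable {K A P M : Type*} [Field K] [CommRing A] [Algebra K A] [AddCommGroup P]
  [Module K P] [Module A P] [IsScalarTower K A P] (𝓜 : ContactModel K A P M)
  {θ : Derivation K A A →ₗ[A] P}

/-- If the derivation `Δ` with symbol `η` preserves the contact form, locally preserves the tangent
distribution, and locally annihilates `θ X` for a contact vector field `X`, then `[η, X]` is locally
zero along the distribution. -/
theorem ContactModel.IsContact.lie_eq_zero (hθ : 𝓜.IsContact θ) {Δ : Gauge K A P}
    {η X : Derivation K A A} (hΔ : ∀ ζ ∈ 𝓜.T, Δ.1 (θ ζ) = θ ⁅η, ζ⁆)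
    (hX : IsContactField (𝓜.T : Set _) θ X) {χ : A} (hχ : ∀ ζ ∈ 𝓜.T, χ • ⁅η, ζ⁆ ∈ 𝓜.T)
    (h0 : χ • Δ.1 (θ X) = 0) : (χ * χ) • ⁅η, X⁆ = 0 := by
  have hT : (χ * χ) • ⁅η, X⁆ ∈ 𝓜.T := by
    rw [mul_smul]
    exact 𝓜.T.smul_mem _ (hχ X hX.1)
  have hθ0 : θ ((χ * χ) • ⁅η, X⁆) = 0 := by
    rw [map_smul, mul_smul, ← hΔ X hX.1, h0, smul_zero]
  refine Derivation.ext fun a => 𝓜.fun_ext _ fun m =>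
    hθ.nondeg m _ hT hθ0 (fun ζ hζ hζ0 => ?_) a
  have hz : ∀ D : P →ₗ[K] P, ∀ p : P, p = 0 → D p = 0 := fun D p h => by rw [h, map_zero]
  have h1 : θ ⁅X, χ • ⁅η, ζ⁆⁆ = 0 := hX.2 _ (hχ ζ hζ) (by
    rw [map_smul, ← hΔ ζ hζ, hz Δ.1 _ hζ0, smul_zero])
  rw [lie_smul_der, map_add, map_smul, map_smul, ← hΔ ζ hζ, hz Δ.1 _ hζ0, smul_zero,
    zero_add] at h1
  have h2 : θ ⁅η, ⁅X, ζ⁆⁆ = 0 := by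
    rw [← hΔ _ (𝓜.lie_mem _ hX.1 _ hζ)]
    exact hz Δ.1 _ (hX.2 ζ hζ hζ0)
  -- The square matters here: the derivative of `χ * χ` along `ζ` still contains a factor `χ`, which
  -- annihilates `Δ (θ X)`.
  have h3 : θ ⁅(χ * χ) • ⁅η, X⁆, ζ⁆ = 0 := by
    rw [smul_lie_der, map_sub, map_smul, map_smul, ← hΔ X hX.1, lie_lie, map_sub, h2, zero_sub,
      smul_neg, mul_smul, h1, smul_zero, neg_zero, Derivation.leibniz, smul_eq_mul, zero_sub,
      ← two_mul, mul_comm χ, ← mul_assoc, mul_smul, h0, smul_zero, neg_zero]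
  change 𝓜.val m _ = 0
  rw [h3, map_zero]

end

/-! ### Complex contact structures as nondegenerate holomorphic Jacobi brackets. -/

section ComplexContact


open Bundle TopologicalSpace

variable {E : Type*} [NormedAddCommGroup E] [NormedSpace ℂ E]
  {X : Type*} [TopologicalSpace X] [ChartedSpace E X]
  {L : X → Type*} [∀ x, AddCommGroup (L x)] [∀ x, Module ℂ (L x)] [∀ x, TopologicalSpace (L x)]
  [TopologicalSpace (TotalSpace ℂ L)] [FiberBundle ℂ L] [VectorBundle ℂ ℂ L]
  [FiniteDimensional ℂ E] [T2Space X] [IsManifold 𝓘(ℂ, E) ω X]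
  [ContMDiffVectorBundle ω ℂ L 𝓘(ℂ, E)]

attribute [local instance] isManifold_real isManifold_slit


variable {J : BiDer ℂ (CFun E X) (CSec E L)}

/-- The bracket is nondegenerate on jets of type `(1,0)`. -/
def Nondeg (J : BiDer ℂ (CFun E X) (CSec E L)) : Prop :=
  ∀ x s, (∀ t, evL x (J.bracket s t) = 0) → AntiJet x s

theorem antiJet_of_jetZero {x : X} {s : CSec E L} (h : (complexModel E L).JetZero x s) :
    AntiJet x s := by
  refine ⟨(locVal_eq_zero_iff x s).1 h.1, fun u => ?_⟩
  have h1 := h.2 _ (pd10_mem (L := L) x u)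
  change evC x (pd10 L x u (locFun L x s)) = 0 at h1
  have h2 : ∀ v, chartD 𝓘(ℝ, E) x (fun z => evC z (locFun L x s)) x v = dloc s x v := fun v => by
    rw [← dfun_locFun, dfun_eq_chartD_self]
    rfl
  rw [evC_pd10, cut_self, Complex.ofReal_one, one_mul, h2, h2] at h1
  linear_combination (2 * Complex.I) * h1 + (dloc s x (Complex.I • u)) * Complex.I_mul_I

theorem jetZero_of_antiJet {x : X} {s : CSec E L} (h : AntiJet x s) :
    (complexModel E L).JetZero x s :=
  ⟨(locVal_eq_zero_iff x s).2 h.1, fun ζ hζ => t10_apply hζ fun v => by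
    change dfun (locFun L x s) x _ = -(_ * dfun (locFun L x s) x v)
    rw [dfun_locFun, h.2]⟩

theorem Is20.holPart_right (hJ : Is20 J) (x : X) (s t : CSec E L) :
    evL x (J.bracket s (holPart E L x t)) = evL x (J.bracket s t) := by
  rw [J.bracket_skew s, J.bracket_skew s t, map_neg, map_neg, hJ.holPart_left]

/-- If `df` is antilinear at `x`, then `f e - f(x) e` has a jet of type `(0,1)` there, so its
bracket with `p` vanishes; this bracket is the symbol applied to `f`, times the frame `e`. -/
theorem Is20.sym_mem (hJ : Is20 J) (p : CSec E L) : J.sym p ∈ t10 E X := by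
  intro f x hf
  set e : CSec E L := holSec x (1, 0)
  have h1 : AntiJet x (f • e - evC x f • e) := by
    refine ⟨by rw [map_sub, evL_smul, map_smul, sub_self], fun u => ?_⟩
    rw [dloc_sub, dloc_sub, dloc_fsmul, dloc_fsmul, dloc_smul, dloc_smul, hf]
    ring
  have h2 := hJ.right h1 p
  have h3 : J.bracket p (f • e - evC x f • e) =
      J.bracket p (f • e) - evC x f • J.bracket p e := by
    change (J.br p).1 _ = _
    rw [map_sub, LinearMap.map_smul (J.br p).1 (evC x f) e]
    rfl
  rw [h3, J.bracket_smul, map_sub, map_add, evL_smul, evL_smul, map_smul, add_sub_cancel_right] at h2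
  refine (smul_eq_zero.1 h2).resolve_right fun h0 => ?_
  have h4 := (locVal_eq_zero_iff x e).2 h0
  change loc e x x = 0 at h4
  rw [loc_holSec_self] at h4
  exact one_ne_zero h4

theorem nondegJacobi (hJ : Is20 J) (hjac : J.IsJacobi) (hnd : Nondeg J) :
    (complexModel E L).NondegJacobi J where
  jacobi := hjac
  sym_mem p := hJ.sym_mem p
  nondeg x q _ h := jetZero_of_antiJet (hnd x q fun t => by
    rw [← hJ.holPart_right, ← locVal_eq_zero_iff]
    exact h _ (holNear_holPart x t).holAt)
  exists_good x p := by
    refine ⟨holPart E L x p, (holNear_holPart x p).holAt, ?_, fun s => ?_⟩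
    · change locVal x _ = locVal x _
      rw [← sub_eq_zero, ← map_sub, locVal_eq_zero_iff, map_sub, evL_holPart, sub_self]
    · change locVal x _ = locVal x _
      rw [← sub_eq_zero, ← map_sub, locVal_eq_zero_iff, map_sub, hJ.holPart_left, sub_self]

theorem isContactForm_iff {θ : CVec E X →ₗ[CFun E X] CSec E L} :
    IsContactForm (fun (x : X) (f : CFun E X) => f.1 x = 0)
      (fun (x : X) (s : CSec E L) => s.1 x = 0) (T10 E X) θ ↔ (complexModel E L).IsContact θ := by
  have key : ∀ x (s : CSec E L), (complexModel E L).val x s = 0 ↔ s.1 x = 0 := locVal_eq_zero_iff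
  constructor
  · exact fun h => ⟨h.surj, fun x ξ hξ h0 hn a => h.nondeg x ξ hξ h0
      (fun ζ hζ hζ0 => (key x _).1 (hn ζ hζ hζ0)) a⟩
  · exact fun h => ⟨h.surj, fun x ξ hξ h0 hn a => h.nondeg x ξ hξ h0
      (fun ζ hζ hζ0 => (key x _).2 (hn ζ hζ hζ0)) a⟩

/-- The vector fields `[ξ, X]`, for `ξ` of type `(0,1)` and `X` the symbol of `{p, -}` with `p`
holomorphic near `x`, are of type `(0,1)` at `x`. -/
theorem DbarClosed.lie_sym (hJ : DbarClosed J) {Δ : Gauge ℂ (CFun E X) (CSec E L)} {V : X → E}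
    (hΔ : IsDbar Δ V) {ξ : CVec E X} (hξ : IsSymbol Δ.1 ξ) {x : X} {p : CSec E L}
    (hp : HolNear x p) {a : CFun E X}
    (ha : ∀ v, dfun a x (Complex.I • v) = Complex.I * dfun a x v) :
    evC x (⁅ξ, J.sym p⁆ a) = 0 := by
  have h1 : ∀ s, HolAt x s → evL x ((gcomm Δ (J.br p)).1 s) = 0 := fun s hs => by
    have h2 : evL x (J.schoutenGauge Δ p s) = 0 := hJ Δ V hΔ p s x hp.holAt hs
    have h3 : evL x (J.bracket (Δ.1 p) s) = 0 := hΔ.bracket_zero hp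
    rw [BiDer.schoutenGauge, map_sub, map_sub, h3, J.bracket_skew (Δ.1 s), map_neg, zero_sub,
      neg_neg] at h2
    rw [gcomm_apply, map_sub]
    exact h2
  set e : CSec E L := holSec x (1, 0)
  have he : HolAt x e := holAt_holSec (mem_core E L x) _
  have h2 := h1 (a • e) ((complexModel E L).smul_mem x a ha e he)
  rw [hξ.comm (J.isSymbol_sym p), map_add, evL_smul, evL_smul, h1 e he, smul_zero, add_zero] at h2
  refine (smul_eq_zero.1 h2).resolve_right fun h0 => ?_
  exact (complexModel E L).val_frame x ((locVal_eq_zero_iff x e).2 h0)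

/-- The form comes from the abstract model; its holomorphy has to be checked only on local
generators of `T^{1,0} X`. These are the symbols `X_p` with `p` holomorphic: there `∂̄ (θ X_p) = ∂̄
p = 0`, and `[ξ, X_p]` has no `(1,0)`-part, so `θ` kills it. -/
theorem fromComplexContact_of_nondeg (hJ : Is20 J) (hJp : PreservesHol J) (hjac : J.IsJacobi)
    (hnd : Nondeg J) : FromComplexContact J := by
  obtain ⟨θ, h1, h2, h3, h4, h5⟩ := (complexModel E L).exists_contact (nondegJacobi hJ hjac hnd)
  refine ⟨θ, fun ξ hξ => ?_, fun Δ V ξ hΔ hξ ζ hζ => ?_, isContactForm_iff.2 h1, h2⟩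
  · exact (complexModel E L).sec_ext _ fun x => h3 ξ x fun a ha => hξ a x ha
  · refine evL_ext fun x => ?_
    obtain ⟨ι, _, p, f, hf, hp, hx⟩ := h5 x
    obtain ⟨y, hy⟩ := hx ζ hζ
    have hpn : ∀ i, HolNear x (p i) := fun i => by
      filter_upwards [(smooth_fun f).continuous.continuousAt.eventually_ne hf] with z hz
      exact hp z hz i
    have h6 : evL x (Δ.1 (θ (f • ζ))) = evL x (θ ⁅ξ, f • ζ⁆) := by
      have hs : ⁅ξ, ∑ i, y i • J.sym (p i)⁆ = ∑ i, ⁅ξ, y i • J.sym (p i)⁆ := lie_sum _ _ _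
      rw [hy, hs, map_sum, map_sum, map_sum, map_sum, map_sum]
      refine Finset.sum_congr rfl fun i _ => ?_
      have h7 : evL x (θ ⁅ξ, J.sym (p i)⁆) = 0 := (locVal_eq_zero_iff x _).1
        (h3 _ x fun a ha => (hJp.dbarClosed).lie_sym hΔ hξ (hpn i) ha)
      have h8 : evL x (Δ.1 (p i)) = 0 := (evL_isDbar hΔ _ _).trans ((hpn i).holAt _)
      rw [lie_smul_der, map_add, θ.map_smul, θ.map_smul, θ.map_smul, h4, hξ, map_add, map_add, evL_smul,
        evL_smul, evL_smul, h7, h8]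
    rw [lie_smul_der, map_add, θ.map_smul, θ.map_smul, θ.map_smul, hξ, map_add, map_add, evL_smul,
      evL_smul, evL_smul] at h6
    exact smul_right_injective _ hf (add_left_cancel h6)

/-- Besides the abstract result, holomorphic sections have to be preserved. If `s` is holomorphic
near `x`, then the bracket of `∂̄_u` with its contact field vanishes near `x`; the Leibniz rule for
`∂̄_u` on `θ [ξ, ζ]` then gives zero. -/
theorem FromComplexContact.nondeg (h : FromComplexContact J) :
    PreservesHol J ∧ J.IsJacobi ∧ Nondeg J := by
  obtain ⟨θ, -, hbar, hθ, hB⟩ := h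
  have hθ' := isContactForm_iff.1 hθ
  obtain ⟨h1, h2⟩ := ContactModel.IsContact.jacobi_nondeg _ hθ' hB
  refine ⟨fun x s t hs ht u => ?_, h1, fun x s h => antiJet_of_jetZero (h2 x s fun q =>
    (locVal_eq_zero_iff x _).2 (h q))⟩
  obtain ⟨ξ, ζ, hξ, hζ, rfl, rfl, he⟩ := hB s t
  rw [he, ← dbarOp_self]
  obtain ⟨V, hV⟩ := exists_isDbar (L := L) x u
  set Δ := dbarOp L x u
  have hΔ : ∀ ζ ∈ t10 E X, Δ.1 (θ ζ) = θ ⁅pd01 L x u, ζ⁆ := fun ζ hζ => 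
    hbar Δ V _ hV (barLin_symbol x u) ζ hζ
  -- The bump function lives where `χ ∂̄_u` is the honest `∂̄_u` and where it annihilates both
  -- sections.
  obtain ⟨χ, hχ, hχW⟩ := exists_bumpC (E := E) (Filter.inter_mem
    ((isOpen_core E L x).mem_nhds (mem_core E L x)) (Filter.inter_mem (hV.eventually_zero hs)
      (hV.eventually_zero ht)))
  have hT : ∀ ζ ∈ t10 E X, χ • ⁅pd01 L x u, ζ⁆ ∈ t10 E X := fun ζ hζ f y hf => by
    change evC y (χ * ⁅pd01 L x u, ζ⁆ f) = 0
    rw [map_mul]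
    by_cases hy : evC y χ = 0
    · rw [hy, zero_mul]
    · rw [pd01_lie_apply hζ (hχW y hy).1 u hf, mul_zero]
  have h0 : χ • Δ.1 (θ ξ) = 0 := evL_ext fun y => by
    rw [evL_smul, map_zero]
    by_cases hy : evC y χ = 0
    · rw [hy, zero_smul]
    · rw [(hχW y hy).2.1, map_zero, smul_zero]
  have h0' : χ • Δ.1 (θ ζ) = 0 := evL_ext fun y => by
    rw [evL_smul, map_zero]
    by_cases hy : evC y χ = 0
    · rw [hy, zero_smul]
    · rw [(hχW y hy).2.2, map_zero, smul_zero]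
  have hχ1 : evC x χ = 1 := hχ.self_of_nhds
  have key : ∀ ξ ζ : CVec E X, IsContactField ((complexModel E L).T : Set _) θ ξ →
      χ • Δ.1 (θ ξ) = 0 → evL x (θ ⁅⁅pd01 L x u, ξ⁆, ζ⁆) = 0 := fun ξ ζ hξ h0 => by
    have h3 := hθ'.lie_eq_zero _ hΔ hξ hT h0
    have h4 : θ ⁅(χ * χ) • ⁅pd01 L x u, ξ⁆, ζ⁆ = 0 := by rw [h3, zero_lie, map_zero]
    rw [smul_lie_der, map_sub, map_smul, map_smul, ← hΔ ξ hξ.1, Derivation.leibniz, smul_eq_mul,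
      ← two_mul, mul_comm χ (ζ χ), ← mul_assoc, mul_smul (2 * ζ χ), h0, smul_zero, sub_zero] at h4
    have h5 := congrArg (evL x) h4
    rwa [evL_smul, map_mul, hχ1, one_mul, one_smul, map_zero] at h5
  rw [hΔ _ ((complexModel E L).lie_mem _ hξ.1 _ hζ.1), leibniz_lie, map_add, map_add,
    key ξ ζ hξ h0, ← lie_skew, map_neg, map_neg, key ζ ξ hζ h0', neg_zero, add_zero]

theorem fromComplexContact_iff (hJ : Is20 J) : FromComplexContact J ↔
    PreservesHol J ∧ J.IsJacobi ∧ Nondeg J :=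
  ⟨fun h => h.nondeg, fun h => fromComplexContact_of_nondeg hJ h.1 h.2.1 h.2.2⟩

end ComplexContact

/-! ### Contact structures on `ℓ` and complex contact structures on `X`. -/

section HatContact


open Bundle TopologicalSpace

variable {E : Type*} [NormedAddCommGroup E] [NormedSpace ℂ E]
  {X : Type*} [TopologicalSpace X] [ChartedSpace E X]
  {L : X → Type*} [∀ x, AddCommGroup (L x)] [∀ x, Module ℂ (L x)] [∀ x, TopologicalSpace (L x)]
  [TopologicalSpace (TotalSpace ℂ L)] [FiberBundle ℂ L] [VectorBundle ℂ ℂ L]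
  [FiniteDimensional ℂ E] [T2Space X] [IsManifold 𝓘(ℂ, E) ω X]
  [ContMDiffVectorBundle ω ℂ L 𝓘(ℂ, E)]

attribute [local instance] isManifold_real isManifold_slit


variable {J : BiDer ℂ (CFun E X) (CSec E L)} {B : BiDer ℝ (HatFun E L) (HatSec E L)} {n : ℂ}

theorem hat_bracket_congr (B : BiDer ℝ (HatFun E L) (HatSec E L)) {v : slitDual L}
    {p p' q q' : HatSec E L} (hp : dTilde p v = dTilde p' v) (hq : dTilde q v = dTilde q' v) :
    tl v (B.bracket p q) = tl v (B.bracket p' q') := by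
  have h1 : tl v (B.bracket p q) = tl v (B.bracket p q') := hat_gauge_congr (B.br p) hq
  have h2 : tl v (B.bracket q' p) = tl v (B.bracket q' p') := hat_gauge_congr (B.br q') hp
  rw [h1, B.bracket_skew, B.bracket_skew p', map_neg, map_neg, h2]

/-- The differential of a holomorphic section is complex linear, so it vanishes if its real part
does, and also if it is antilinear. -/
theorem dTilde_eq_zero_iff {v : slitDual L} {s : CSec E L} (hs : HolAt v.1.1 s) :
    dTilde (re s) v = 0 ↔ AntiJet v.1.1 s := by
  constructor
  · intro h
    have h1 : ∀ w, dcTilde s v w = 0 := fun w => by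
      have e1 := dTilde_re s v w
      have e2 := dTilde_re s v (Complex.I • w)
      rw [h] at e1 e2
      rw [hs.dcTilde_I, Complex.I_mul_re] at e2
      exact Complex.ext e1.symm (neg_eq_zero.1 e2.symm)
    refine ⟨(locVal_eq_zero_iff v.1.1 s).1 ?_, fun u => ?_⟩
    · have h2 := (dcTilde_apply s v (0, ContinuousLinearMap.id ℂ ℂ)).symm.trans (h1 _)
      rw [map_zero, mul_zero, add_zero] at h2
      exact (one_mul _).symm.trans h2
    · have h3 : ∀ u, dloc s v.1.1 u = 0 := fun u => by
        have h2 := (dcTilde_apply s v (u, 0)).symm.trans (h1 _)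
        rw [zero_apply, zero_mul, zero_add] at h2
        exact (mul_eq_zero.1 h2).resolve_left
          (om_ne_zero (mem_baseSet_trivializationAt ℂ L v.1.1))
      rw [h3, h3, mul_zero, neg_zero]
  · intro h
    refine ContinuousLinearMap.ext fun w => ?_
    have h1 : dloc s v.1.1 w.1 = 0 := by
      have e1 := (holAt_iff _ s).1 hs w.1
      rw [h.2] at e1
      have e2 : (2 * Complex.I) * dloc s v.1.1 w.1 = 0 := by linear_combination -e1
      exact (mul_eq_zero.1 e2).resolve_left (mul_ne_zero two_ne_zero Complex.I_ne_zero)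
    have h2 : loc s v.1.1 v.1.1 = 0 := (locVal_eq_zero_iff v.1.1 s).2 h.1
    rw [dTilde_re, dcTilde_apply, h1, h2, mul_zero, mul_zero, add_zero]
    rfl

/-- Nondegeneracy of a bi-derivation of `ℓ`. -/
def HatNondeg (B : BiDer ℝ (HatFun E L) (HatSec E L)) : Prop :=
  ∀ v p, (∀ q, tl v (B.bracket p q) = 0) → dTilde p v = 0

/-- Testing against `re t` and `re (i t)` recovers the real and imaginary parts of `n J(s, t)`, for
`t` holomorphic at the point; type `(2,0)` removes this restriction. -/
theorem Induces.hatNondeg (hB : Induces n J B) (hn : n ≠ 0) (h20 : Is20 J) (h : Nondeg J) :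
    HatNondeg B := by
  intro v p hp
  obtain ⟨s, hs, hsp⟩ := exists_dTilde_re v (dTilde p v)
  rw [← hsp, dTilde_eq_zero_iff hs.holAt]
  have h1 : ∀ t, HolAt v.1.1 t → tl v (re (n • J.bracket s t)) = 0 := fun t ht => by
    rw [← hB v s t hs.holAt ht, hat_bracket_congr B hsp rfl, hp]
  refine h _ s fun t => ?_
  rw [← h20.holPart_right]
  have ht := (holNear_holPart v.1.1 t).holAt
  have h2 : evL v.1.1 (n • J.bracket s (holPart E L v.1.1 t)) = 0 := evL_eq_zero_of_re (h1 _ ht) (by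
    rw [smul_comm, ← bracket_smul_right]
    exact h1 _ (ht.smul _))
  rw [map_smul] at h2
  exact (smul_eq_zero.1 h2).resolve_left hn

theorem Induces.nondeg (hB : Induces n J B) (h20 : Is20 J) (h : HatNondeg B) : Nondeg J := by
  intro x s hs
  obtain ⟨v, rfl⟩ := exists_over (L := L) x
  have hs' := (holNear_holPart v.1.1 s).holAt
  have h1 : AntiJet v.1.1 (holPart E L v.1.1 s) := by
    rw [← dTilde_eq_zero_iff hs']
    refine h v _ fun q => ?_
    obtain ⟨t, ht, htq⟩ := exists_dTilde_re v (dTilde q v)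
    rw [hat_bracket_congr B rfl htq.symm, hB v _ t hs' ht.holAt, tl_re, cTilde_smul]
    have h2 : evL v.1.1 (J.bracket (holPart E L v.1.1 s) t) = 0 := by rw [h20.holPart_left, hs]
    have h3 : cTilde (J.bracket (holPart E L v.1.1 s) t) v = 0 :=
      (congrArg v.1.2 h2).trans (map_zero v.1.2)
    rw [h3, mul_zero, Complex.zero_re]
  have h2 := antiJet_sub_holPart v.1.1 s
  refine ⟨by rw [← evL_holPart, h1.1], fun u => ?_⟩
  have h3 := h2.2 u
  rw [dloc_sub, dloc_sub, h1.2] at h3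
  linear_combination h3

theorem tl_bracket_neg_right (B : BiDer ℝ (HatFun E L) (HatSec E L)) (v : slitDual L)
    (p : HatSec E L) (s : CSec E L) :
    tl v (B.bracket p (re (-s))) = -tl v (B.bracket p (re s)) := by
  rw [map_neg, B.bracket_neg_right, map_neg]

theorem tl_bracket_add_right (B : BiDer ℝ (HatFun E L) (HatSec E L)) (v : slitDual L)
    (p q r : HatSec E L) :
    tl v (B.bracket p (q + r)) = tl v (B.bracket p q) + tl v (B.bracket p r) := by
  have h : B.bracket p (q + r) = B.bracket p q + B.bracket p r := map_add (B.br p).1 q r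
  rw [h, map_add]

theorem I_smul_I_smul (s : CSec E L) : Complex.I • Complex.I • s = -s := by
  rw [smul_smul, Complex.I_mul_I, neg_one_smul]

theorem Induces.tl_I_I (hB : Induces n J B) {v : slitDual L} {s t : CSec E L}
    (hs : HolAt v.1.1 s) (ht : HolAt v.1.1 t) :
    tl v (B.bracket (re (Complex.I • s)) (re (Complex.I • t))) = -tl v (B.bracket (re s) (re t)) := by
  rw [hB v _ _ (hs.smul _) (ht.smul _), hB v s t hs ht, bracket_smul_left, bracket_smul_right,
    smul_comm n, smul_comm n, re_I_I, map_neg]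

/-- A section which is orthogonal to holomorphic sections, for the complex antilinear part of a
nondegenerate bracket, is holomorphic. -/
theorem Induces.holAt (hB : Induces n J B) (h : HatNondeg B) {v : slitDual L} {κ : CSec E L}
    (hκ : ∀ s, HolNear v.1.1 s → tl v (B.bracket (re s) (re κ)) +
      tl v (B.bracket (re (Complex.I • s)) (re (Complex.I • κ))) = 0) : HolAt v.1.1 κ := by
  set κ₁ := holPart E L v.1.1 κ
  set κ₂ := κ - κ₁
  have hκ₁ : HolAt v.1.1 κ₁ := (holNear_holPart v.1.1 κ).holAt
  have hκ₂ : AntiJet v.1.1 κ₂ := antiJet_sub_holPart v.1.1 κ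
  have hloc : loc κ₂ v.1.1 v.1.1 = 0 := (locVal_eq_zero_iff v.1.1 κ₂).2 hκ₂.1
  have hd : ∀ w, dcTilde κ₂ v w = om v.1.1 v * dloc κ₂ v.1.1 w.1 := fun w => by
    rw [dcTilde_apply, hloc, mul_zero, zero_add]
  -- A holomorphic section with the same real differential as the antilinear remainder `κ₂`. Since
  -- `κ₂` is antilinear, `i κ₂` corresponds to `-i r`: on the holomorphic part `κ₁` the two terms of
  -- the assumption cancel, while on the remainder they add up to twice the pairing with `re r`.
  obtain ⟨r, hr, hrd⟩ := exists_dTilde_re v (dTilde (re κ₂) v)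
  have hrI : dTilde (re (Complex.I • κ₂)) v = dTilde (re (-(Complex.I • r))) v := by
    refine ContinuousLinearMap.ext fun w => ?_
    rw [← neg_smul, ← mul_neg_one, mul_smul, ← hr.holAt.smul (-1) |>.dTilde_I, dTilde_re, dTilde_re,
      dcTilde_smul, dcTilde_smul, hd]
    have h1 := congrArg (fun T : TildeT E →L[ℝ] ℝ => T (Complex.I • w)) hrd
    change dTilde (re r) v _ = dTilde (re κ₂) v _ at h1
    rw [dTilde_re, dTilde_re, hd] at h1
    change _ = (_ * dloc κ₂ v.1.1 (Complex.I • w.1)).re at h1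
    rw [hκ₂.2] at h1
    rw [neg_one_mul, Complex.neg_re, h1, ← Complex.neg_re]
    congr 1
    ring
  have hr0 : dTilde (re r) v = 0 := by
    refine h v _ fun q => ?_
    obtain ⟨s, hs, hsq⟩ := exists_dTilde_re v (dTilde q v)
    have h1 := hκ s hs
    have h2 : κ = κ₁ + κ₂ := (add_sub_cancel κ₁ κ).symm
    have e1 : re κ = re κ₁ + re κ₂ := by rw [← map_add, ← h2]
    have e2 : re (Complex.I • κ) = re (Complex.I • κ₁) + re (Complex.I • κ₂) := by
      rw [← map_add, ← smul_add, ← h2]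
    rw [e1, e2, tl_bracket_add_right, tl_bracket_add_right, hB.tl_I_I hs.holAt hκ₁,
      hat_bracket_congr B rfl hrd.symm, hat_bracket_congr B (p := re (Complex.I • s)) rfl hrI,
      tl_bracket_neg_right, hB.tl_I_I hs.holAt hr.holAt] at h1
    rw [B.bracket_skew, map_neg, hat_bracket_congr B hsq.symm rfl]
    linarith
  have h3 : ∀ u, dloc κ₂ v.1.1 u = 0 := fun u => by
    have h0 : dTilde (re κ₂) v = 0 := hrd.symm.trans hr0
    have e1 := dTilde_re κ₂ v (u, 0)
    have e2 := dTilde_re κ₂ v (Complex.I • u, 0)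
    rw [h0, hd] at e1 e2
    rw [hκ₂.2] at e2
    have e3 : om v.1.1 v * dloc κ₂ v.1.1 u = 0 := by
      refine Complex.ext e1.symm ?_
      have e4 : om v.1.1 v * -(Complex.I * dloc κ₂ v.1.1 u) =
          -(Complex.I * (om v.1.1 v * dloc κ₂ v.1.1 u)) := by ring
      rw [e4, Complex.neg_re, Complex.I_mul_re, neg_neg] at e2
      exact e2.symm
    exact (mul_eq_zero.1 e3).resolve_left (om_ne_zero (mem_baseSet_trivializationAt ℂ L v.1.1))
  refine hκ₁.of_jet (ContinuousLinearMap.ext fun u => ?_)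
  have h4 := h3 u
  rw [dloc_sub, sub_eq_zero] at h4
  exact h4.symm

/-- Compatibility with `ĵ` is not assumed here. The Jacobi identity of `B` on holomorphic entries,
with two of the three multiplied by `i` in all possible ways, isolates the part of the pairing with
`κ = n J(μ, ν)` that would vanish for holomorphic `κ`; by nondegeneracy its vanishing forces `κ` to
be holomorphic. -/
theorem Induces.preservesHol_of_nondeg (hB : Induces n J B) (hn : n ≠ 0) (hjac : B.IsJacobi)
    (h : HatNondeg B) : PreservesHol J := by
  intro x μ ν hμ hν
  obtain ⟨v, rfl⟩ := exists_over (L := L) x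
  have key : HolAt v.1.1 (n • J.bracket μ ν) := by
    refine hB.holAt h fun s hs => ?_
    have jac : ∀ a b c : CSec E L, HolNear v.1.1 a → HolNear v.1.1 b → HolNear v.1.1 c →
        tl v (B.bracket (re a) (re (n • J.bracket b c))) +
        tl v (B.bracket (re b) (re (n • J.bracket c a))) +
        tl v (B.bracket (re c) (re (n • J.bracket a b))) = 0 := fun a b c ha hb hc => by
      have h1 : ∀ a b c : CSec E L, HolNear v.1.1 b → HolNear v.1.1 c →
          tl v (B.bracket (re a) (B.bracket (re b) (re c))) =
            tl v (B.bracket (re a) (re (n • J.bracket b c))) := fun a b c hb hc =>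
        hat_gauge_congr_of_eventually (B.br (re a)) (hB.eventually hb hc)
      rw [← h1 a b c hb hc, ← h1 b c a hc ha, ← h1 c a b ha hb, ← map_add, ← map_add, hjac,
        map_zero]
    have j1 := jac s μ ν hs hμ hν
    have j2 := jac (Complex.I • s) (Complex.I • μ) ν (hs.smul _) (hμ.smul _) hν
    have j3 := jac (Complex.I • s) μ (Complex.I • ν) (hs.smul _) hμ (hν.smul _)
    have j4 := jac s (Complex.I • μ) (Complex.I • ν) hs (hμ.smul _) (hν.smul _)
    simp only [bracket_smul_left, bracket_smul_right, I_smul_I_smul, smul_comm n Complex.I,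
      smul_neg, tl_bracket_neg_right] at j2 j3 j4
    -- In `j1 + j2 + j3 - j4` all pairings with `μ` and `ν` cancel, and twice the wanted sum
    -- remains.
    linarith
  have h1 := key.smul n⁻¹
  rwa [inv_smul_smul₀ hn] at h1

/-- A bi-derivation of `ℓ` induced by `J` comes from a contact structure if and only if `J` comes
from a complex contact structure. -/
theorem Induces.fromContact_iff (hB : Induces n J B) (hn : n ≠ 0) (h20 : Is20 J) :
    FromContact B ↔ FromComplexContact J := by
  rw [fromContact_iff_nondeg, fromComplexContact_iff h20]
  constructor
  · rintro ⟨hjac, h⟩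
    have hJ := hB.preservesHol_of_nondeg hn hjac h
    exact ⟨hJ, hB.isJacobi_of hn hJ h20 hjac, hB.nondeg h20 h⟩
  · rintro ⟨hJ, hjac, h⟩
    exact ⟨hB.isJacobi hJ hjac, hB.hatNondeg hn h20 h⟩

/-- Both bi-derivations are induced by nonzero multiples of `J`, so each is contact exactly when `J`
comes from a complex contact structure. -/
theorem IsHatPair.fromContact {B' B : BiDer ℝ (HatFun E L) (HatSec E L)} (h : IsHatPair J B' B)
    (h20 : Is20 J) : (FromContact B ↔ FromComplexContact J) ∧ (FromContact B → FromContact B') := by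
  have h1 := (h.induces_right h20).fromContact_iff (by simp) h20
  exact ⟨h1, fun hB => ((h.induces_left h20).fromContact_iff (by norm_num) h20).2 (h1.1 hB)⟩

end HatContact

end HJ

end

theorem theorem3
    {E : Type*} [NormedAddCommGroup E] [NormedSpace ℂ E] [FiniteDimensional ℂ E]
    {X : Type*} [TopologicalSpace X] [T2Space X] [SecondCountableTopology X]
    [ChartedSpace E X] [IsManifold 𝓘(ℂ, E) ω X]
    {L : X → Type*} [∀ x, AddCommGroup (L x)] [∀ x, Module ℂ (L x)]
    [∀ x, TopologicalSpace (L x)] [TopologicalSpace (Bundle.TotalSpace ℂ L)] [FiberBundle ℂ L]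
    [VectorBundle ℂ ℂ L] [ContMDiffVectorBundle ω ℂ L 𝓘(ℂ, E)] :
    -- the endomorphism `ĵ` of the gauge algebroid of `ℓ` is well-defined
    (∃! j : HJ.Gauge ℝ (HJ.HatFun E L) (HJ.HatSec E L) →ₗ[HJ.HatFun E L]
        HJ.Gauge ℝ (HJ.HatFun E L) (HJ.HatSec E L), HJ.IsHatEnd j) ∧
    ∀ J : HJ.BiDer ℂ (HJ.CFun E X) (HJ.CSec E L),
      -- the pair `(Ĵ', Ĵ)` is well-defined
      (HJ.Is20 J → ∃! B : HJ.BiDer ℝ (HJ.HatFun E L) (HJ.HatSec E L) ×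
        HJ.BiDer ℝ (HJ.HatFun E L) (HJ.HatSec E L), HJ.IsHatPair J B.1 B.2) ∧
      -- the equivalences, where `j`, `J₁`, `J₂` are `ĵ`, `Ĵ'`, `Ĵ`
      ∀ (j : HJ.Gauge ℝ (HJ.HatFun E L) (HJ.HatSec E L) →ₗ[HJ.HatFun E L]
          HJ.Gauge ℝ (HJ.HatFun E L) (HJ.HatSec E L))
        (J₁ J₂ : HJ.BiDer ℝ (HJ.HatFun E L) (HJ.HatSec E L)),
        HJ.IsHatEnd j → HJ.IsHatPair J J₁ J₂ →
        (HJ.IsHolomorphicJacobi J ↔ HJ.IsJacobiNijenhuis J₂ j ∧ HJ.IsDeform J₁ J₂ j) ∧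
        (HJ.IsHolomorphicJacobi J ↔
          HJ.IsGeneralizedContact (HJ.blockEnd j J₂) ∧ HJ.IsDeform J₁ J₂ j) ∧
        (HJ.Is20 J → (HJ.FromContact J₂ ↔ HJ.FromComplexContact J) ∧
          (HJ.FromContact J₂ → HJ.FromContact J₁)) := by
  refine ⟨HJ.existsUnique_hatEnd E L, fun J => ⟨HJ.existsUnique_hatPair, fun j J₁ J₂ hj hJ => ?_⟩⟩
  exact ⟨HJ.isHolomorphicJacobi_iff_jacobiNijenhuis hj hJ,
    HJ.isHolomorphicJacobi_iff_generalizedContact hj hJ, hJ.fromContact⟩
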